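/- Conventions. All manifolds with corners are compact and Hausdorff; $C^\infty$ means smooth up to the boundary. A boundary hyperface of $M$ is the closure of a connected component of the set of boundary points of depth one. A boundary defining function of a hyperface $F$ is a smooth $\rho_F\ge 0$ with $\{\rho_F=0\}=F$ and $d\rho_F\neq 0$ along $F$. Let $M$ be a manifold with corners with a distinguished set $\mathcal F_1(M)$ of boundary hyperfaces, called singular, each of which has a boundary defining function. A \emph{Lie structure} on $(M,\mathcal F_1(M))$ is a $C^\infty(M)$-submodule $\mathcal V\subset\Gamma(TM)$ that is closed under the Lie bracket, finitely generated and projective, consists of vector fields tangent to all singular hyperfaces, and satisfies $\{V(p):V\in\mathcal V\}=T_pM$ for every $p$ outside $S=\bigcup_{F\in\mathcal F_1(M)}F$. Thus $\mathcal V=\Gamma(\mathcal A)$ for a vector bundle $\mathcal A\to M$ with anchor $\varrho:\mathcal A\to TM$, an isomorphism over $M\setminus S$. If $\mathcal F_1(M)$ consists of all boundary hyperfaces, $(M,\mathcal A,\mathcal V)$ is a Lie manifold. Let $C^\infty(M,\Omega^1(\mathcal A))$ be the space of smooth complex sections of the bundle of one-densities of $\mathcal A$. On $M\setminus S$ such sections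 are ordinary one-densities, and $\int_M$ is the integral of these over $M\setminus S$. $(M,\mathcal A,\mathcal V)$ is \emph{renormalizable} if for every choice of boundary defining functions, with $\rho=\prod_{F\in\mathcal F_1(M)}\rho_F$, there is a linear functional $\mathrm{Tr}:C^\infty(M,\Omega^1(\mathcal A))\to\mathbb C$ such that 1. for each $f$ that vanishes to all orders at $S$ the integral $\int_M f$ exists and equals $\mathrm{Tr}(f)$; 2. there is a minimal $k\in\mathbb R\cup\{-\infty\}$ such that for all $f\in C^\infty(M,\Omega^1(\mathcal A))$ the integral $G(f)(z)=\int_M\rho^z f$ exists and is holomorphic in $z$ for $\operatorname{Re} z>k-1$, and each $G(f)$ extends meromorphically to $\mathbb C$; 3. $\mathrm{Tr}(f)$ is the regularized value at $z=0$ (the constant term of the Laurent expansion) of the meromorphic extension of $G(f)$. $(M,\mathcal A,\mathcal V)$ is a \emph{Lie manifold with boundary} $(Y,\mathcal B,\mathcal W)$ if $\mathcal V$ is a Lie structure on $(M,\mathcal F_1(M))$ and $Y\subset M$ is a compact embedded submanifold with corners of codimension one such that: every boundary hyperface of $M$ is singular or contained in $Y$; $\partial Y=Y\cap S$; $T_pM=\varrho(\mathcal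 A_p)+T_pY$ for all $p\in\partial Y$; and $(Y,\mathcal B,\mathcal W)$ is a Lie manifold, where $\Gamma(\mathcal B)=\mathcal W=\{V|_Y: V\in\mathcal V,\ V|_Y\text{ tangent to }Y\}$. \textbf{Lemma.} Let $(M,\mathcal A,\mathcal V)$ be a Lie manifold with boundary $(Y,\mathcal B,\mathcal W)$. If $(M,\mathcal A,\mathcal V)$ is renormalizable, then the Lie manifold $(Y,\mathcal B,\mathcal W)$ is renormalizable as well. In particular the renormalized integral of $f\in C^\infty(Y,\Omega^1(\mathcal B))$ is defined as the regularized value at $z=0$ of the meromorphic continuation of $\int_Y\rho^z f$, where $\rho$ is the product of boundary defining functions of the boundary hyperfaces of $Y$. -/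

import Mathlib

open Set Filter Topology MeasureTheory Manifold
open scoped ContDiff

noncomputable section

namespace LieMfd

/-! ### Manifolds with corners, vector fields, boundary hyperfaces

An `n`-dimensional smooth manifold with corners is a smooth manifold modelled on the quadrant
`[0, ∞)ⁿ`. Smooth functions and smooth vector fields are Mathlib's. -/

/-- The model with corners `[0, ∞)ⁿ ⊆ ℝⁿ`. -/
abbrev Q (n : ℕ) :
    ModelWithCorners ℝ (EuclideanSpace ℝ (Fin n)) (EuclideanQuadrant n) :=
  modelWithCornersEuclideanQuadrant n

/-- The ring `C^∞(M)` of smooth real functions. -/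
abbrev Fn (n : ℕ) (M : Type*) [TopologicalSpace M] [ChartedSpace (EuclideanQuadrant n) M] :=
  C^∞⟮Q n, M; 𝓘(ℝ, ℝ), ℝ⟯

/-- The space `Γ(TM)` of smooth vector fields. -/
abbrev VF (n : ℕ) (M : Type*) [TopologicalSpace M] [ChartedSpace (EuclideanQuadrant n) M]
    [IsManifold (Q n) ∞ M] :=
  Cₛ^∞⟮Q n; EuclideanSpace ℝ (Fin n), (TangentSpace (Q n) : M → Type _)⟯

section

variable {n : ℕ} {M : Type*} [TopologicalSpace M] [ChartedSpace (EuclideanQuadrant n) M]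

/-- The number of vanishing coordinates of `p` in a chart around `p`. -/
def depth (n : ℕ) {M : Type*} [TopologicalSpace M] [ChartedSpace (EuclideanQuadrant n) M]
    (p : M) : ℕ :=
  {i : Fin n | extChartAt (Q n) p p i = 0}.ncard

/-- The (closed) boundary hyperfaces of `M`: the closures of the connected components of the set
of points of depth one. -/
def hyperfaces (n : ℕ) (M : Type*) [TopologicalSpace M] [ChartedSpace (EuclideanQuadrant n) M] :
    Set (Set M) :=
  {F | ∃ p : M, depth n p = 1 ∧ F = closure (connectedComponentIn {q : M | depth n q = 1} p)}

/-- `r` is a boundary defining function of `F`: `r ≥ 0`, `F = {r = 0}` and `dr ≠ 0` along `F`. -/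
def IsBDF (F : Set M) (r : Fn n M) : Prop :=
  (∀ p, 0 ≤ r p) ∧ {p | r p = 0} = F ∧ ∀ p ∈ F, mfderiv (Q n) 𝓘(ℝ, ℝ) r p ≠ 0

variable [IsManifold (Q n) ∞ M]

/-- Smooth vector fields form a module over smooth functions, by pointwise multiplication. -/
instance instSMulVF : SMul (Fn n M) (VF n M) :=
  ⟨fun f X => ⟨fun p => f p • X p, f.contMDiff.smul_section X.contMDiff⟩⟩

theorem smul_apply (f : Fn n M) (X : VF n M) (p : M) : (f • X) p = f p • X p := rfl

instance instModuleVF : Module (Fn n M) (VF n M) where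
  one_smul X := by ext p; exact one_smul ℝ (X p)
  mul_smul f g X := by ext p; exact mul_smul (f p) (g p) (X p)
  smul_zero f := by ext p; exact smul_zero (f p)
  smul_add f X Y := by ext p; exact smul_add (f p) (X p) (Y p)
  add_smul f g X := by ext p; exact add_smul (f p) (g p) (X p)
  zero_smul X := by ext p; exact zero_smul ℝ (X p)

/-- `V` is a Lie structure on the manifold with corners `M` whose singular boundary hyperfaces
("at infinity") are the members of `𝓕`. For a Lie manifold in the usual sense `𝓕` is the set of
all boundary hyperfaces; for a Lie manifold with boundary the regular boundary is left out. -/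
structure IsLieStructure (𝓕 : Set (Set M)) (V : Submodule (Fn n M) (VF n M)) : Prop where
  subset_hyperfaces : 𝓕 ⊆ hyperfaces n M
  /-- Hyperfaces are embedded: they have boundary defining functions. -/
  exists_bdf : ∀ F ∈ 𝓕, ∃ r : Fn n M, IsBDF F r
  /-- `V` is a Lie algebra. -/
  bracket_mem : ∀ X ∈ V, ∀ Y ∈ V, ∃ Z ∈ V, ∀ p, Z p = VectorField.mlieBracket (Q n) X Y p
  /-- The members of `V` are tangent to all singular hyperfaces. -/
  tangent : ∀ X ∈ V, ∀ F ∈ 𝓕, ∀ r : Fn n M, IsBDF F r → ∀ p ∈ F,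
    mfderiv (Q n) 𝓘(ℝ, ℝ) r p (X p) = (0 : ℝ)
  /-- `V` is finitely generated projective, that is, `V ≅ Γ(A)` for a vector bundle `A → M`. -/
  finite : Module.Finite (Fn n M) V
  projective : Module.Projective (Fn n M) V
  /-- The anchor `A → TM` is an isomorphism away from the singular hyperfaces (injectivity there
  follows from surjectivity, since `Γ(A) → Γ(TM)` is injective). -/
  spans : ∀ p, p ∉ ⋃₀ 𝓕 → ∀ v : TangentSpace (Q n) p, ∃ X ∈ V, X p = v

/-! ### Densities -/

/-- `X₁, …, Xₙ` is a local frame over `U` of the bundle `A` with `Γ(A) = V`: over `U` each member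
of `V` is a combination of the `Xᵢ` with smooth coefficients. (`A` has rank `n`, so that `n`
generators are a frame.) -/
def IsFrameOn (V : Submodule (Fn n M) (VF n M)) (U : Set M) (X : Fin n → VF n M) : Prop :=
  (∀ i, X i ∈ V) ∧ ∀ Z ∈ V, ∃ f : Fin n → M → ℝ,
    (∀ i, ContMDiffOn (Q n) 𝓘(ℝ, ℝ) ∞ (f i) U) ∧ ∀ p ∈ U, Z p = ∑ i, f i p • X i p

/-- `f` is the smooth coefficient over `U` of the density `σ` with respect to the frame `X`, i.e.
`σ = f |X₁* ∧ … ∧ Xₙ*|` over `U`. By density of the complement of the singular hyperfaces, `f` is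
determined on the open set `U` by this. -/
def IsCoeffOn (𝓕 : Set (Set M)) (σ : (p : M) → (Fin n → TangentSpace (Q n) p) → ℂ) (U : Set M)
    (X : Fin n → VF n M) (f : M → ℂ) : Prop :=
  ContMDiffOn (Q n) 𝓘(ℝ, ℂ) ∞ f U ∧ ∀ p ∈ U, p ∉ ⋃₀ 𝓕 → f p = σ p (fun i => X i p)

/-- The space `C^∞(M, Ω¹(A))` of smooth complex sections of the bundle of one-densities of `A`,
where `Γ(A) = V`. Away from the singular hyperfaces `A = TM`, so such a section is there an ordinary
one-density, by which it is determined; it is recorded by this density (extended by `0`). It is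
smooth as a section of `Ω¹(A)` when its coefficients in local frames of `A` extend smoothly over the
singular hyperfaces. -/
def Density (𝓕 : Set (Set M)) (V : Submodule (Fn n M) (VF n M)) :
    Submodule ℂ ((p : M) → (Fin n → TangentSpace (Q n) p) → ℂ) where
  carrier := {σ |
    (∀ p ∈ ⋃₀ 𝓕, ∀ v, σ p v = 0) ∧
    (∀ p, p ∉ ⋃₀ 𝓕 → ∀ (L : TangentSpace (Q n) p →ₗ[ℝ] TangentSpace (Q n) p)
      (v : Fin n → TangentSpace (Q n) p),
      σ p (fun i => L (v i)) = ((|LinearMap.det L| : ℝ) : ℂ) * σ p v) ∧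
    ∀ U : Set M, IsOpen U → ∀ X, IsFrameOn V U X → ∃ f : M → ℂ, IsCoeffOn 𝓕 σ U X f}
  zero_mem' := by
    refine ⟨fun p _ v => rfl, fun p _ L v => by simp, fun U _ X _ => ⟨fun _ => 0, ?_, ?_⟩⟩
    · exact contMDiffOn_const
    · intro p _ _; rfl
  add_mem' := by
    rintro a b ⟨ha1, ha2, ha3⟩ ⟨hb1, hb2, hb3⟩
    refine ⟨fun p hp v => ?_, fun p hp L v => ?_, fun U hU X hX => ?_⟩
    · simp [ha1 p hp v, hb1 p hp v]
    · simp only [Pi.add_apply, ha2 p hp L v, hb2 p hp L v, mul_add]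
    · obtain ⟨f, hf, hf'⟩ := ha3 U hU X hX
      obtain ⟨g, hg, hg'⟩ := hb3 U hU X hX
      refine ⟨f + g, hf.add hg, fun p hp hp' => ?_⟩
      simp only [Pi.add_apply, hf' p hp hp', hg' p hp hp']
  smul_mem' := by
    rintro c a ⟨ha1, ha2, ha3⟩
    refine ⟨fun p hp v => ?_, fun p hp L v => ?_, fun U hU X hX => ?_⟩
    · simp [ha1 p hp v]
    · simp only [Pi.smul_apply, ha2 p hp L v, smul_eq_mul]; ring
    · obtain ⟨f, hf, hf'⟩ := ha3 U hU X hX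
      refine ⟨fun p => c • f p, ?_, fun p hp hp' => ?_⟩
      · exact ((c • ContinuousLinearMap.id ℝ ℂ : ℂ →L[ℝ] ℂ).contDiff.contMDiff).comp_contMDiffOn hf
      · simp only [Pi.smul_apply, hf' p hp hp']

/-- The density `σ` vanishes to all orders at the singular hyperfaces: so do, in charts, all
derivatives of its coefficients in frames of `A`. -/
def VanishesToAllOrders (𝓕 : Set (Set M)) (V : Submodule (Fn n M) (VF n M))
    (σ : (p : M) → (Fin n → TangentSpace (Q n) p) → ℂ) : Prop :=
  ∀ U : Set M, IsOpen U → ∀ X, IsFrameOn V U X → ∀ f : M → ℂ, IsCoeffOn 𝓕 σ U X f →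
    ∀ p ∈ U, p ∈ ⋃₀ 𝓕 → ∀ k : ℕ,
      iteratedFDerivWithin ℝ k (f ∘ (extChartAt (Q n) p).symm) (range (Q n))
        (extChartAt (Q n) p p) = 0

/-- The coefficient of the density `σ` with respect to `|dx₁ ⋯ dxₙ|` in the chart at `c`: the value
of `σ` on the coordinate vector fields. -/
def chartCoeff (σ : (p : M) → (Fin n → TangentSpace (Q n) p) → ℂ) (c : M)
    (x : EuclideanSpace ℝ (Fin n)) : ℂ :=
  σ ((extChartAt (Q n) c).symm x) fun i =>
    mfderivWithin 𝓘(ℝ, EuclideanSpace ℝ (Fin n)) (Q n) (extChartAt (Q n) c).symm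
      (range (Q n)) x (EuclideanSpace.single i (1 : ℝ))

/-- The integral of the density `σ` over (compact) `M` exists: `σ` is Lebesgue integrable in each
chart. -/
def DensityIntegrable (σ : (p : M) → (Fin n → TangentSpace (Q n) p) → ℂ) : Prop :=
  ∀ c : M, IntegrableOn (chartCoeff σ c) (extChartAt (Q n) c).target volume

/-- A smooth partition of unity subordinate to the charts. -/
def chartPartition (n : ℕ) (M : Type*) [TopologicalSpace M]
    [ChartedSpace (EuclideanQuadrant n) M] [IsManifold (Q n) ∞ M] [T2Space M] [CompactSpace M] :
    SmoothPartitionOfUnity M (Q n) M univ :=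
  (SmoothPartitionOfUnity.exists_isSubordinate_chartAt_source (Q n) M).choose

theorem chartPartition_isSubordinate [T2Space M] [CompactSpace M] :
    (chartPartition n M).IsSubordinate
      (fun c => (chartAt (EuclideanQuadrant n) c).source) :=
  (SmoothPartitionOfUnity.exists_isSubordinate_chartAt_source (Q n) M).choose_spec

/-- The integral `∫_M σ` of an integrable density, by a partition of unity subordinate to the charts
(the value does not depend on it). -/
def densityIntegral [T2Space M] [CompactSpace M]
    (σ : (p : M) → (Fin n → TangentSpace (Q n) p) → ℂ) : ℂ :=
  ∑ᶠ c : M, ∫ x in (extChartAt (Q n) c).target,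
    ((chartPartition n M c ((extChartAt (Q n) c).symm x) : ℝ) : ℂ) * chartCoeff σ c x

/-! ### Renormalizability -/

/-- `ρ^z σ` for the product `ρ = ∏_{F ∈ 𝓕} ρ_F` of boundary defining functions `ρ_F = r F`. -/
def rhoPow (𝓕 : Set (Set M)) (r : Set M → Fn n M) (z : ℂ)
    (σ : (p : M) → (Fin n → TangentSpace (Q n) p) → ℂ) :
    (p : M) → (Fin n → TangentSpace (Q n) p) → ℂ :=
  fun p v => (((∏ᶠ F ∈ 𝓕, r F p : ℝ) : ℂ) ^ z) * σ p v

/-- `c` is the regularized value of the meromorphic function `g` at `z = 0`: the coefficient of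
`z⁰` in the Laurent expansion of `g` at `0`. -/
def IsRegularizedValue (g : ℂ → ℂ) (c : ℂ) : Prop :=
  ∃ (P : Polynomial ℂ) (h : ℂ → ℂ), P.coeff 0 = 0 ∧ AnalyticAt ℂ h 0 ∧ h 0 = c ∧
    ∀ᶠ z in 𝓝[≠] (0 : ℂ), g z = P.eval z⁻¹ + h z

/-- For all `f ∈ C^∞(M, Ω¹(A))` the integral `G(f)(z) = ∫_M ρ^z f` exists on the half plane
`Re z > k - 1` and is holomorphic there. -/
def HolomorphicBeyond [T2Space M] [CompactSpace M] (𝓕 : Set (Set M))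
    (V : Submodule (Fn n M) (VF n M)) (r : Set M → Fn n M) (k : EReal) : Prop :=
  ∀ f ∈ Density 𝓕 V,
    (∀ z : ℂ, k - 1 < ((z.re : ℝ) : EReal) → DensityIntegrable (rhoPow 𝓕 r z f)) ∧
    DifferentiableOn ℂ (fun z => densityIntegral (rhoPow 𝓕 r z f))
      {z : ℂ | k - 1 < ((z.re : ℝ) : EReal)}

/-- Renormalizability of `(M, A, V)`, `Γ(A) = V`, with singular hyperfaces `𝓕`. For every choice of
boundary defining functions of the singular hyperfaces, with product `ρ`, there is a linear functional
`Tr` on `C^∞(M, Ω¹(A))` such that: `Tr` extends the (existing) integral on densities vanishing to all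
orders at the singular hyperfaces; there is a minimal `k`, either real or `-∞` (the latter occurs
when there are no singular hyperfaces), such that all `G(f)(z) = ∫_M ρ^z f` are holomorphic on
`Re z > k - 1`; each `G(f)` extends meromorphically to `ℂ`, and `Tr f` is the regularized value of
the extension at `z = 0`. -/
def IsRenormalizable [T2Space M] [CompactSpace M] (𝓕 : Set (Set M))
    (V : Submodule (Fn n M) (VF n M)) : Prop :=
  ∀ r : Set M → Fn n M, (∀ F ∈ 𝓕, IsBDF F (r F)) →
    ∃ Tr : Density 𝓕 V →ₗ[ℂ] ℂ,
      (∀ f : Density 𝓕 V, VanishesToAllOrders 𝓕 V f.1 →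
        DensityIntegrable f.1 ∧ Tr f = densityIntegral f.1) ∧
      ∃ k : EReal, k < ⊤ ∧ IsLeast {k' | HolomorphicBeyond 𝓕 V r k'} k ∧
        ∀ f : Density 𝓕 V, ∃ g : ℂ → ℂ, MeromorphicOn g univ ∧
          (∀ z : ℂ, k - 1 < ((z.re : ℝ) : EReal) →
            g z = densityIntegral (rhoPow 𝓕 r z f.1)) ∧
          IsRegularizedValue g (Tr f)

end

/-! ### Lie manifolds with boundary -/

/-- `(M, A, V)`, with singular hyperfaces `𝓕`, is a Lie manifold with boundary `(Y, B, W)`, where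
`ι : Y → M` is the inclusion of a hypersurface. Each hyperface of `M` is either singular or contained
in `Y`. So this comprises both the case that `Y` is the regular boundary of `M` (`𝓕` consisting of the
other hyperfaces) and the case that `Y` is a hypersurface of a Lie manifold `M` in the usual sense
(`𝓕` consisting of all hyperfaces). -/
structure IsLieManifoldWithBoundary {m : ℕ}
    {M : Type*} [TopologicalSpace M] [ChartedSpace (EuclideanQuadrant (m + 1)) M]
    [IsManifold (Q (m + 1)) ∞ M]
    {Y : Type*} [TopologicalSpace Y] [ChartedSpace (EuclideanQuadrant m) Y]
    [IsManifold (Q m) ∞ Y]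
    (𝓕 : Set (Set M)) (V : Submodule (Fn (m + 1) M) (VF (m + 1) M)) (ι : Y → M)
    (W : Submodule (Fn m Y) (VF m Y)) : Prop where
  lieStructure : IsLieStructure 𝓕 V
  singular_or_regular : ∀ F ∈ hyperfaces (m + 1) M, F ∈ 𝓕 ∨ F ⊆ range ι
  /-- `ι` is an embedding (an injective immersion; `Y` will be compact). -/
  contMDiff : ContMDiff (Q m) (Q (m + 1)) ∞ ι
  injective : Function.Injective ι
  immersion : ∀ y, Function.Injective (mfderiv (Q m) (Q (m + 1)) ι y)
  /-- `Y` is itself a Lie manifold, with all its hyperfaces singular. -/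
  lieStructure_boundary : IsLieStructure (hyperfaces m Y) W
  /-- `W` consists of the restrictions to `Y` of those members of `V` that are tangent to `Y`. -/
  mem_iff : ∀ w : VF m Y, w ∈ W ↔
    ∃ v ∈ V, ∀ y, mfderiv (Q m) (Q (m + 1)) ι y (w y) = v (ι y)
  /-- `∂Y` is the intersection of `Y` with the singular hyperfaces of `M`. -/
  boundary_eq : ∀ y, y ∈ (Q m).boundary Y ↔ ι y ∈ ⋃₀ 𝓕
  /-- `Y` is transverse: `T_p M = ϱ(A_p) + T_p Y` for `p ∈ ∂Y`. -/
  transverse : ∀ y ∈ (Q m).boundary Y, ∀ v : TangentSpace (Q (m + 1)) (ι y),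
    ∃ X ∈ V, ∃ w : TangentSpace (Q m) y, v = X (ι y) + mfderiv (Q m) (Q (m + 1)) ι y w

end LieMfd

end

open Set Filter Topology MeasureTheory Manifold
open scoped ContDiff

noncomputable section

/-! Integrals over `Y` are integrals over `M` in disguise. Suppose that near a point of `Y` there
are coordinates `(t, y)` of `M` in which `Y` is `{t = t₀}`, and that some choice of defining
functions on `M` has a product `ρ` that near this point is independent of `t` and equal to the given
product `r` on `Y`. For a density `f` on `Y`, a cutoff `χ` on `Y` and a bump function `ψ` with `∫ ψ
= 1`, the density `F = ψ(t) χ(y) |dt| f` satisfies `∫_M ρ^z F = ∫_Y r^z χ f` by Fubini. If `F` is a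
smooth section of the density bundle of `A`, what is known about `G(F)` passes to `Y`. A partition
of unity on `Y` then gives the functional `∑ Tr_i ∘ L_i`, where `L_i` is the extension `f ↦ F` on
the `i`-th patch and `Tr_i` belongs to the defining functions used there. Each patch may use its
own, because `M` is renormalizable for every choice.

Coordinates: transversality provides `X ∈ V` transverse to `Y`, and flowing `Y` along `X` produces
`(t, y)`. Since `X` is tangent to the singular hyperfaces, they become `{y_i = 0}`. Where `Y` is
regular boundary, `X` is taken inward and only the forward flow is used. All of this happens up to
corners, so flows and the inverse function theorem are developed on the quadrant: integral curves
are fixed points of a contraction on a space of curves (`contDiffOn_compOp`,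
`contDiffOn_of_fixedPoint`, `contDiffOn_flow`), and `exists_quad_inverse` inverts maps that respect
faces. How the faces of `Y` and `M` fit together is settled by `exists_face_bijection` and
`eventually_apply_eq_zero_of_face`; `exists_flow_box` and `IsLieManifoldWithBoundary.exists_adapted`
collect the result.

Smoothness of `F`: as `X = ∂_t` and `V` is closed under brackets, the coefficient matrix of a frame
of `V` solves a linear differential equation in `t` with smooth coefficients. By Liouville's formula
its determinant is `e^u` times its value on `Y`, with `u` smooth (`IsAdapted.exists_log_det`), and
on `Y` it is the determinant of a frame of `W` (`IsAdapted.det_frameMatrix`). So the coefficient of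
`F` is `ψ χ e^u` times that of `f`: smooth, and flat at the singular set if `f` is.

The product `ρ`: by Hadamard's lemma both products are positive smooth functions times the same
coordinates, and their quotient is absorbed into one defining function
(`IsAdapted.exists_matching_bdf`).

The minimal `k`: the finitely many abscissas from `M` only give some half plane for `Y`. The infimum
of all admissible ones is admissible because half planes are open, and the identity theorem carries
the continuation over (`exists_isLeast_holomorphicBeyond`). -/

namespace LieMfd

/-! ### Composition operators on spaces of curves -/

section Nemytskii

variable {K : Type} [TopologicalSpace K] [CompactSpace K]
  {E F G : Type} [NormedAddCommGroup E] [NormedSpace ℝ E] [NormedAddCommGroup F] [NormedSpace ℝ F]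
  [NormedAddCommGroup G] [NormedSpace ℝ G]

/-- The curves with values in `s`. -/
def curvesIn (K : Type) [TopologicalSpace K] [CompactSpace K] (s : Set E) : Set C(K, E) :=
  {γ | ∀ σ, γ σ ∈ s}

open Classical in
/-- The composition operator `γ ↦ g ∘ γ`. -/
def compOp (K : Type) [TopologicalSpace K] [CompactSpace K] (g : E → F) (γ : C(K, E)) : C(K, F) :=
  if h : Continuous (fun σ => g (γ σ)) then ⟨fun σ => g (γ σ), h⟩ else 0

/-- The default value in `compOp` is never met on curves that stay where `g` is continuous; all
later uses go through this lemma. -/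
theorem compOp_apply {s : Set E} {g : E → F} (hg : ContinuousOn g s) {γ : C(K, E)}
    (hγ : γ ∈ curvesIn K s) (σ : K) : compOp K g γ σ = g (γ σ) := by
  have h : Continuous (fun σ => g (γ σ)) := hg.comp_continuous γ.continuous hγ
  simp [compOp, h]

/-- Continuity into a space of curves is joint continuity in curve and parameter, and evaluation is
jointly continuous. -/
theorem continuousOn_compOp {s : Set E} {g : E → F} (hg : ContinuousOn g s) :
    ContinuousOn (compOp K g) (curvesIn K s) := by
  rw [continuousOn_iff_continuous_domRestrict]
  apply ContinuousMap.continuous_of_continuous_uncurry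
  have h1 : Continuous fun q : (curvesIn K s) × K => (⟨q.1.1 q.2, q.1.2 q.2⟩ : s) := by
    apply Continuous.subtype_mk
    exact (continuous_eval (F := C(K, E))).comp
      ((continuous_subtype_val.comp continuous_fst).prodMk continuous_snd)
  have h2 := (continuousOn_iff_continuous_domRestrict.1 hg).comp h1
  convert h2 using 2 with q
  ext q
  simp only [Function.uncurry, domRestrict_apply, Function.comp]
  exact compOp_apply hg q.1.2 q.2

/-- Pointwise application of curves of operators to curves of vectors. -/
def applyOp (K : Type) [TopologicalSpace K] [CompactSpace K] (E F : Type) [NormedAddCommGroup E]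
    [NormedSpace ℝ E] [NormedAddCommGroup F] [NormedSpace ℝ F] :
    C(K, E →L[ℝ] F) →L[ℝ] C(K, E) →L[ℝ] C(K, F) :=
  LinearMap.mkContinuous₂ (σ₁₃ := RingHom.id ℝ) (σ₂₃ := RingHom.id ℝ)
    (LinearMap.mk₂ ℝ (fun (A : C(K, E →L[ℝ] F)) (γ : C(K, E)) =>
        (⟨fun σ => A σ (γ σ), by fun_prop⟩ : C(K, F)))
      (fun A B γ => by ext; simp) (fun c A γ => by ext; simp)
      (fun A γ δ => by ext; simp) (fun c A γ => by ext; simp)) 1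
    (fun A γ => by
      rw [one_mul, ContinuousMap.norm_le _ (by positivity)]
      intro σ
      exact ((A σ).le_opNorm _).trans
        (mul_le_mul (A.norm_coe_le_norm σ) (γ.norm_coe_le_norm σ) (norm_nonneg _) (norm_nonneg A)))

theorem applyOp_apply (A : C(K, E →L[ℝ] F)) (γ : C(K, E)) (σ : K) :
    applyOp K E F A γ σ = A σ (γ σ) := rfl

theorem norm_applyOp_le (A : C(K, E →L[ℝ] F)) : ‖applyOp K E F A‖ ≤ ‖A‖ := by
  refine ContinuousLinearMap.opNorm_le_bound _ (norm_nonneg A) fun γ => ?_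
  rw [ContinuousMap.norm_le _ (by positivity)]
  intro σ
  exact ((A σ).le_opNorm _).trans
    (mul_le_mul (A.norm_coe_le_norm σ) (γ.norm_coe_le_norm σ) (norm_nonneg _) (norm_nonneg A))

theorem convex_curvesIn {s : Set E} (hs : Convex ℝ s) : Convex ℝ (curvesIn K s) :=
  fun γ hγ δ hδ a b ha hb hab σ => hs (hγ σ) (hδ σ) ha hb hab

/-- A sup-norm ball about the constant curve at an interior point consists of curves in `s`.
Together with convexity this makes derivatives within the set of curves unique, so the calculus
works up to the boundary of the quadrant. -/
theorem interior_curvesIn {s : Set E} (hs : (interior s).Nonempty) :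
    (interior (curvesIn K s)).Nonempty := by
  obtain ⟨x, hx⟩ := hs
  obtain ⟨ε, hε, h⟩ := Metric.isOpen_iff.1 isOpen_interior x hx
  refine ⟨ContinuousMap.const K x, mem_interior.2
    ⟨Metric.ball (ContinuousMap.const K x) ε, ?_, Metric.isOpen_ball, Metric.mem_ball_self hε⟩⟩
  intro γ hγ σ
  apply interior_subset
  apply h
  exact (ContinuousMap.dist_apply_le_dist σ).trans_lt hγ

theorem uniqueDiffOn_curvesIn {s : Set E} (hs : Convex ℝ s) (hi : (interior s).Nonempty) :
    UniqueDiffOn ℝ (curvesIn K s) :=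
  uniqueDiffOn_convex (convex_curvesIn hs) (interior_curvesIn hi)

/-- The mean value inequality on the segment from `γ σ` to `η σ` bounds the remainder at `σ` by the
variation of `g'` on that segment. Continuity of `compOp K g'` in the sup norm makes this uniform in
`σ`. -/
theorem hasFDerivWithinAt_compOp {s : Set E} (hs : Convex ℝ s) {g : E → F}
    {g' : E → E →L[ℝ] F} (hg : ∀ x ∈ s, HasFDerivWithinAt g (g' x) s x) (hg' : ContinuousOn g' s)
    {γ : C(K, E)} (hγ : γ ∈ curvesIn K s) :
    HasFDerivWithinAt (compOp K g) (applyOp K E F (compOp K g' γ)) (curvesIn K s) γ := by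
  have hgc : ContinuousOn g s := fun x hx => (hg x hx).continuousWithinAt
  rw [hasFDerivWithinAt_iff_isLittleO, Asymptotics.isLittleO_iff]
  intro ε hε
  have hc := Metric.continuousWithinAt_iff.1 (continuousOn_compOp (K := K) hg' γ hγ) ε hε
  obtain ⟨δ, hδ, hc⟩ := hc
  filter_upwards [self_mem_nhdsWithin, mem_nhdsWithin_of_mem_nhds (Metric.ball_mem_nhds γ hδ)]
    with η hη hηδ
  rw [ContinuousMap.norm_le _ (by positivity)]
  intro σ
  simp only [ContinuousMap.sub_apply, applyOp_apply, compOp_apply hgc hη, compOp_apply hgc hγ,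
    compOp_apply hg' hγ]
  have key := Convex.norm_image_sub_le_of_norm_hasFDerivWithin_le' (𝕜 := ℝ) (f := g)
    (s := segment ℝ (γ σ) (η σ)) (C := ε) (f' := g') (φ := g' (γ σ)) (x := γ σ) (y := η σ)
    (fun x hx => (hg x (hs.segment_subset (hγ σ) (hη σ) hx)).mono
      (hs.segment_subset (hγ σ) (hη σ))) ?_ (convex_segment _ _) (left_mem_segment _ _ _)
    (right_mem_segment _ _ _)
  · refine key.trans (mul_le_mul_of_nonneg_left ?_ hε.le)
    exact (η - γ).norm_coe_le_norm σ
  · rintro x ⟨a, b, ha, hb, hab, rfl⟩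
    have hmem : a • γ + b • η ∈ curvesIn K s := convex_curvesIn hs hγ hη ha hb hab
    have hd : dist (a • γ + b • η) γ < δ := by
      have : a • γ + b • η ∈ Metric.ball γ δ :=
        (convex_ball γ δ) (Metric.mem_ball_self hδ) hηδ ha hb hab
      exact this
    have := hc hmem hd
    rw [dist_eq_norm] at this
    have h2 := ((compOp K g' (a • γ + b • η)) - compOp K g' γ).norm_coe_le_norm σ
    simp only [ContinuousMap.sub_apply, compOp_apply hg' hmem, compOp_apply hg' hγ] at h2
    exact h2.trans this.le

/-- The derivative of a composition operator is the composition operator of the derivative, followed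
by the continuous linear `applyOp`. The induction ranges over all target spaces because `g'` is
operator valued. -/
theorem contDiffOn_compOp_nat {s : Set E} (hs : Convex ℝ s) (hi : (interior s).Nonempty) (k : ℕ) :
    ∀ {F : Type} [NormedAddCommGroup F] [NormedSpace ℝ F] {g : E → F}, ContDiffOn ℝ k g s →
      ContDiffOn ℝ k (compOp K g) (curvesIn K s) := by
  have hu := uniqueDiffOn_convex hs hi
  induction k with
  | zero =>
    intro F _ _ g hg
    simpa using continuousOn_compOp (K := K) hg.continuousOn
  | succ k ih =>
    intro F _ _ g hg
    push_cast at hg ⊢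
    rw [contDiffOn_succ_iff_hasFDerivWithinAt_of_uniqueDiffOn hu] at hg
    obtain ⟨-, g', hg', hgg'⟩ := hg
    rw [contDiffOn_succ_iff_hasFDerivWithinAt_of_uniqueDiffOn (uniqueDiffOn_curvesIn hs hi)]
    refine ⟨by simp, fun γ => applyOp K E F (compOp K g' γ), ?_, fun γ hγ =>
      hasFDerivWithinAt_compOp hs hgg' hg'.continuousOn hγ⟩
    exact (applyOp K E F).contDiff.comp_contDiffOn (ih hg')

theorem contDiffOn_compOp {s : Set E} (hs : Convex ℝ s) (hi : (interior s).Nonempty)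
    {g : E → F} (hg : ContDiffOn ℝ ∞ g s) : ContDiffOn ℝ ∞ (compOp K g) (curvesIn K s) :=
  contDiffOn_infty.2 fun k => contDiffOn_compOp_nat hs hi k (contDiffOn_infty.1 hg k)

end Nemytskii

/-! ### Smoothness of averages along segments, and division -/

section Average

variable {E F : Type} [NormedAddCommGroup E] [NormedSpace ℝ E] [NormedAddCommGroup F]
  [NormedSpace ℝ F]

/-- Integration of curves over the unit interval. -/
def integralOp (F : Type) [NormedAddCommGroup F] [NormedSpace ℝ F] :
    C(unitInterval, F) →L[ℝ] F :=
  LinearMap.mkContinuous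
    { toFun := fun γ => ∫ s in (0 : ℝ)..1, IccExtend (zero_le_one' ℝ) γ s
      map_add' := fun γ δ => by
        rw [← intervalIntegral.integral_add]
        · rfl
        all_goals exact (Continuous.Icc_extend' (by fun_prop)).intervalIntegrable _ _
      map_smul' := fun c γ => by
        rw [RingHom.id_apply, ← intervalIntegral.integral_smul]
        rfl } 1
    (fun γ => by
      have := intervalIntegral.norm_integral_le_of_norm_le_const (a := (0 : ℝ)) (b := 1)
        (f := IccExtend (zero_le_one' ℝ) γ) (C := ‖γ‖) (fun x _ => γ.norm_coe_le_norm _)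
      simpa using this)

theorem integralOp_apply (γ : C(unitInterval, F)) :
    integralOp F γ = ∫ s in (0 : ℝ)..1, IccExtend (zero_le_one' ℝ) γ s := rfl

/-- Averages of a smooth function along the segments from `κ v` to `v` are smooth. -/
theorem contDiffOn_average {U : Set E} (hU : Convex ℝ U) (hi : (interior U).Nonempty)
    {g : E → F} (hg : ContDiffOn ℝ ∞ g U) {κ : E → E} (hκ : ContDiff ℝ ∞ κ)
    (hκU : MapsTo κ U U) :
    ContDiffOn ℝ ∞ (fun v => ∫ s in (0 : ℝ)..1, g (κ v + s • (v - κ v))) U := by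
  let cst : E →L[ℝ] C(unitInterval, E) := ContinuousLinearMap.const ℝ unitInterval
  let lin : C(unitInterval, E →L[ℝ] E) :=
    ⟨fun s => (s : ℝ) • ContinuousLinearMap.id ℝ E, by fun_prop⟩
  -- The segment as a point of the space of curves, smooth in `v`. The average is then integration,
  -- a continuous linear map, after a composition operator, after `α`.
  let α : E → C(unitInterval, E) := fun v =>
    cst (κ v) + applyOp unitInterval E E lin (cst (v - κ v))
  have hα : ContDiff ℝ ∞ α := by
    have h1 : ContDiff ℝ ∞ fun v => cst (κ v) := cst.contDiff.comp hκ
    have h2 : ContDiff ℝ ∞ fun v => applyOp unitInterval E E lin (cst (v - κ v)) :=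
      ((applyOp unitInterval E E lin).contDiff.comp cst.contDiff).comp (contDiff_id.sub hκ)
    exact h1.add h2
  have hαa : ∀ v s, α v s = κ v + (s : ℝ) • (v - κ v) := fun v s => rfl
  have hmem : MapsTo α U (curvesIn unitInterval U) := by
    intro v hv s
    rw [hαa]
    exact hU.add_smul_sub_mem (hκU hv) hv s.2
  refine (((integralOp F).contDiff.comp_contDiffOn
    ((contDiffOn_compOp hU hi hg).comp hα.contDiffOn hmem))).congr fun v hv => ?_
  simp only [Function.comp, integralOp_apply]
  apply intervalIntegral.integral_congr
  intro s hs
  rw [uIcc_of_le zero_le_one] at hs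
  simp only [IccExtend_of_mem _ _ hs]
  rw [compOp_apply hg.continuousOn (hmem hv), hαa]

end Average

/-! ### Smooth dependence of fixed points on parameters -/

section FixedPoint

variable {P C : Type} [NormedAddCommGroup P] [NormedSpace ℝ P] [NormedAddCommGroup C]
  [NormedSpace ℝ C] [CompleteSpace C]

theorem isUnit_one_sub_of_norm_le_half {A : C →L[ℝ] C} (hA : ‖A‖ ≤ 1 / 2) : IsUnit (1 - A) :=
  (Units.oneSub A (by linarith)).isUnit

/-- Implicit differentiation of `γ = F(p, γ)`: the derivative solves `γ' = D₁ + A γ'`, and `1 - A`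
is invertible as `‖A‖ ≤ 1/2`. The a priori Lipschitz bound `hlip` turns the error of `F`, small
relative to `(q, γ q) - (p, γ p)`, into one small relative to `q - p`. -/
theorem hasFDerivWithinAt_of_fixedPoint {S : Set P} {T : Set C} {F : P × C → C} {γ : P → C}
    (hγT : MapsTo γ S T) (hfix : ∀ p ∈ S, γ p = F (p, γ p)) {p : P} (hp : p ∈ S)
    (hlip : (fun q => γ q - γ p) =O[𝓝[S] p] fun q => q - p)
    {D : P × C →L[ℝ] C} (hD : HasFDerivWithinAt F D (S ×ˢ T) (p, γ p))
    (hA : ‖D.comp (ContinuousLinearMap.inr ℝ P C)‖ ≤ 1 / 2) :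
    HasFDerivWithinAt γ ((Ring.inverse (1 - D.comp (ContinuousLinearMap.inr ℝ P C))).comp
      (D.comp (ContinuousLinearMap.inl ℝ P C))) S p := by
  set A := D.comp (ContinuousLinearMap.inr ℝ P C) with hAdef
  set R := Ring.inverse (1 - A) with hR
  have hRA : R * (1 - A) = 1 := Ring.inverse_mul_cancel _ (isUnit_one_sub_of_norm_le_half hA)
  have hcont : Tendsto γ (𝓝[S] p) (𝓝 (γ p)) := by
    have h0 : Tendsto (fun q => q - p) (𝓝[S] p) (𝓝 0) := by
      have : Tendsto (fun q => q - p) (𝓝 p) (𝓝 (p - p)) := (continuous_id.sub continuous_const).tendsto p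
      rw [sub_self] at this
      exact this.mono_left nhdsWithin_le_nhds
    exact tendsto_sub_nhds_zero_iff.1 (hlip.trans_tendsto h0)
  have htend : Tendsto (fun q => (q, γ q)) (𝓝[S] p) (𝓝[S ×ˢ T] (p, γ p)) := by
    refine tendsto_nhdsWithin_iff.2 ⟨?_, ?_⟩
    · exact (tendsto_id.mono_left nhdsWithin_le_nhds).prodMk_nhds hcont
    · filter_upwards [self_mem_nhdsWithin] with q hq using ⟨hq, hγT hq⟩
  have h1 := (hasFDerivWithinAt_iff_isLittleO.1 hD).comp_tendsto htend
  have h2 : (fun q => γ q - γ p - D (q - p, γ q - γ p)) =o[𝓝[S] p] fun q => q - p := by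
    have hO : ((fun x => x - (p, γ p)) ∘ fun q => (q, γ q)) =O[𝓝[S] p] fun q => q - p :=
      (Asymptotics.isBigO_refl (fun q => q - p) (𝓝[S] p)).prod_left hlip
    have h3 := h1.trans_isBigO hO
    refine h3.congr' ?_ EventuallyEq.rfl
    filter_upwards [self_mem_nhdsWithin] with q hq
    simp only [Function.comp]
    rw [← hfix q hq, ← hfix p hp]
    rfl
  rw [hasFDerivWithinAt_iff_isLittleO]
  have h4 := (R.isBigO_comp (fun q => γ q - γ p - D (q - p, γ q - γ p)) (𝓝[S] p)).trans_isLittleO h2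
  refine h4.congr_left fun q => ?_
  have h5 : D (q - p, γ q - γ p) = D.comp (ContinuousLinearMap.inl ℝ P C) (q - p) + A (γ q - γ p) := by
    simp only [hAdef, ContinuousLinearMap.comp_apply, ContinuousLinearMap.inl_apply,
      ContinuousLinearMap.inr_apply, ← map_add]
    simp
  have h6 : R ((1 - A) (γ q - γ p)) = γ q - γ p := by
    have := congrArg (fun B : C →L[ℝ] C => B (γ q - γ p)) hRA
    simpa using this
  rw [h5, ContinuousLinearMap.comp_apply, ← sub_sub, sub_right_comm, map_sub]
  congr 1

/-- A fixed point of a uniformly contracting family of maps depends smoothly on the parameters. -/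
theorem contDiffOn_of_fixedPoint {S : Set P} {T : Set C} (hS : UniqueDiffOn ℝ S)
    (hT : UniqueDiffOn ℝ T) {F : P × C → C} (hF : ContDiffOn ℝ ∞ F (S ×ˢ T)) {γ : P → C}
    (hγT : MapsTo γ S T) (hfix : ∀ p ∈ S, γ p = F (p, γ p))
    (hlip : ∀ p ∈ S, (fun q => γ q - γ p) =O[𝓝[S] p] fun q => q - p)
    (hA : ∀ p ∈ S, ‖(fderivWithin ℝ F (S ×ˢ T) (p, γ p)).comp
      (ContinuousLinearMap.inr ℝ P C)‖ ≤ 1 / 2) :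
    ContDiffOn ℝ ∞ γ S := by
  have hST := hS.prod hT
  set DF := fderivWithin ℝ F (S ×ˢ T) with hDF
  have hd : ∀ p ∈ S, HasFDerivWithinAt γ
      ((Ring.inverse (1 - (DF (p, γ p)).comp (ContinuousLinearMap.inr ℝ P C))).comp
      ((DF (p, γ p)).comp (ContinuousLinearMap.inl ℝ P C))) S p := fun p hp =>
    hasFDerivWithinAt_of_fixedPoint hγT hfix hp (hlip p hp)
      ((hF.differentiableOn (by simp) _ ⟨hp, hγT hp⟩).hasFDerivWithinAt) (hA p hp)
  have hDFs : ContDiffOn ℝ ∞ DF (S ×ˢ T) := hF.fderivWithin hST (by simp)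
  refine contDiffOn_infty.2 fun k => ?_
  induction k with
  | zero =>
    simp only [Nat.cast_zero]
    exact contDiffOn_zero.2 fun p hp => (hd p hp).continuousWithinAt
  | succ k ih =>
    push_cast
    rw [contDiffOn_succ_iff_hasFDerivWithinAt_of_uniqueDiffOn hS]
    refine ⟨by simp, _, ?_, hd⟩
    -- Bootstrapping: the formula for the derivative contains only `γ` itself, so a `C^k` fixed
    -- point has a `C^k` derivative.
    have hpair : ContDiffOn ℝ k (fun p => DF (p, γ p)) S :=
      (contDiffOn_infty.1 hDFs k).comp (contDiffOn_id.prodMk ih) fun p hp => ⟨hp, hγT hp⟩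
    have h1 : ContDiffOn ℝ k (fun p => (DF (p, γ p)).comp (ContinuousLinearMap.inl ℝ P C)) S :=
      hpair.clm_comp contDiffOn_const
    have h2 : ContDiffOn ℝ k (fun p => 1 - (DF (p, γ p)).comp (ContinuousLinearMap.inr ℝ P C)) S :=
      contDiffOn_const.sub (hpair.clm_comp contDiffOn_const)
    have h3 : ContDiffOn ℝ k (fun p =>
        Ring.inverse (1 - (DF (p, γ p)).comp (ContinuousLinearMap.inr ℝ P C))) S := by
      intro p hp
      obtain ⟨u, hu⟩ := isUnit_one_sub_of_norm_le_half (hA p hp)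
      have := contDiffAt_ringInverse ℝ (n := k) u
      rw [hu] at this
      exact this.comp_contDiffWithinAt p (h2 p hp)
    exact h3.clm_comp h1

end FixedPoint

/-! ### The quadrant -/

/-- Euclidean space. -/
abbrev E (n : ℕ) := EuclideanSpace ℝ (Fin n)

/-- The quadrant as a subset of Euclidean space. -/
def quad (n : ℕ) : Set (E n) := {x | ∀ i, 0 ≤ x i}

theorem range_Q (n : ℕ) : range (Q n) = quad n := by
  have : range (Q n) = range (Subtype.val : EuclideanQuadrant n → _) := rfl
  rw [this, range_euclideanQuadrant]
  rfl

theorem convex_quad (n : ℕ) : Convex ℝ (quad n) := by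
  intro x hx y hy a b ha hb _ i
  have := hx i
  have := hy i
  simp only [PiLp.add_apply, PiLp.smul_apply, smul_eq_mul]
  positivity

theorem isClosed_quad (n : ℕ) : IsClosed (quad n) := by
  simp only [quad, ofPred_forall]
  exact isClosed_iInter fun i => isClosed_le continuous_const (by fun_prop)

theorem interior_quad (n : ℕ) : interior (quad n) = {x | ∀ i, 0 < x i} := by
  apply Subset.antisymm
  · intro x hx i
    by_contra hi
    have hxi : x i = 0 := le_antisymm (not_lt.1 hi) (interior_subset hx i)
    have hc : Continuous fun s : ℝ => x - s • EuclideanSpace.single i (1 : ℝ) := by fun_prop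
    have h0 : (fun s : ℝ => x - s • EuclideanSpace.single i (1 : ℝ)) 0 ∈ interior (quad n) := by
      simpa using hx
    have := (hc.tendsto 0).eventually (isOpen_interior.mem_nhds h0)
    obtain ⟨δ, hδ, h⟩ := Metric.eventually_nhds_iff.1 this
    have h1 := interior_subset (h (y := δ / 2) (by simp [abs_of_pos hδ]; linarith)) i
    simp [hxi] at h1
    linarith
  · refine interior_maximal (fun x hx i => (hx i).le) ?_
    simp only [ofPred_forall]
    exact isOpen_iInter_of_finite fun i => isOpen_lt continuous_const (by fun_prop)

theorem interior_quad_nonempty (n : ℕ) : (interior (quad n)).Nonempty := by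
  rw [interior_quad]
  exact ⟨WithLp.toLp 2 fun _ => 1, fun i => by simp⟩

theorem uniqueDiffOn_quad (n : ℕ) : UniqueDiffOn ℝ (quad n) :=
  uniqueDiffOn_convex (convex_quad n) (interior_quad_nonempty n)

/-- The retraction of Euclidean space onto the quadrant. -/
def clip {n : ℕ} (x : E n) : E n := WithLp.toLp 2 fun i => max (x i) 0

theorem clip_apply {n : ℕ} (x : E n) (i : Fin n) : clip x i = max (x i) 0 := rfl

theorem clip_mem {n : ℕ} (x : E n) : clip x ∈ quad n := fun _ => le_max_right _ _

theorem clip_of_mem {n : ℕ} {x : E n} (hx : x ∈ quad n) : clip x = x := by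
  ext i
  exact max_eq_left (hx i)

/-- Precomposing with the retraction extends a vector field from the quadrant to all of space
without increasing its Lipschitz constant. Integral curves can thus be constructed before it is
known that they stay in the quadrant. -/
theorem norm_clip_sub_le {n : ℕ} (x y : E n) : ‖clip x - clip y‖ ≤ ‖x - y‖ := by
  rw [EuclideanSpace.norm_eq, EuclideanSpace.norm_eq]
  gcongr with i
  simp only [PiLp.sub_apply, clip_apply, Real.norm_eq_abs]
  exact abs_max_sub_max_le_abs _ _ _

theorem continuous_clip {n : ℕ} : Continuous (clip (n := n)) :=
  (LipschitzWith.of_dist_le_mul (K := 1) fun x y => by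
    simpa [dist_eq_norm] using norm_clip_sub_le x y).continuous

/-! ### Flows on the quadrant -/

section Flow

variable {F : Type} [NormedAddCommGroup F] [NormedSpace ℝ F]

/-- The primitive of a curve that vanishes at `0`. -/
def primitiveOp (F : Type) [NormedAddCommGroup F] [NormedSpace ℝ F] :
    C(unitInterval, F) →L[ℝ] C(unitInterval, F) :=
  LinearMap.mkContinuous
    { toFun := fun γ => ⟨fun σ => ∫ s in (0 : ℝ)..σ, IccExtend (zero_le_one' ℝ) γ s, by
        have : Continuous (IccExtend (zero_le_one' ℝ) γ) := Continuous.Icc_extend' (by fun_prop)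
        exact (intervalIntegral.continuous_primitive (fun a b => this.intervalIntegrable a b)
          0).comp continuous_subtype_val⟩
      map_add' := fun γ δ => by
        ext σ
        simp only [ContinuousMap.coe_mk, ContinuousMap.add_apply]
        rw [← intervalIntegral.integral_add]
        · rfl
        all_goals exact (Continuous.Icc_extend' (by fun_prop)).intervalIntegrable _ _
      map_smul' := fun c γ => by
        ext σ
        simp only [ContinuousMap.coe_mk, ContinuousMap.smul_apply, RingHom.id_apply]
        rw [← intervalIntegral.integral_smul]
        rfl } 1
    (fun γ => by
      rw [ContinuousMap.norm_le _ (by positivity)]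
      intro σ
      have := intervalIntegral.norm_integral_le_of_norm_le_const (a := (0 : ℝ)) (b := σ)
        (f := IccExtend (zero_le_one' ℝ) γ) (C := ‖γ‖) (fun x _ => γ.norm_coe_le_norm _)
      refine this.trans ?_
      rw [one_mul, sub_zero, abs_of_nonneg σ.2.1]
      exact mul_le_of_le_one_right (norm_nonneg γ) σ.2.2)

theorem primitiveOp_apply (γ : C(unitInterval, F)) (σ : unitInterval) :
    primitiveOp F γ σ = ∫ s in (0 : ℝ)..σ, IccExtend (zero_le_one' ℝ) γ s := rfl

theorem norm_primitiveOp_apply_le (γ : C(unitInterval, F)) : ‖primitiveOp F γ‖ ≤ ‖γ‖ := by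
  have := (primitiveOp F).le_of_opNorm_le (LinearMap.mkContinuous_norm_le _ zero_le_one _) γ
  simpa using this

theorem norm_primitiveOp_le : ‖primitiveOp F‖ ≤ 1 :=
  LinearMap.mkContinuous_norm_le _ zero_le_one _

variable {n : ℕ} {B : E n → E n} {K : ℝ}

theorem lipschitz_of_fderivWithin_le (hB : ContDiffOn ℝ ∞ B (quad n))
    (hK : ∀ x ∈ quad n, ‖fderivWithin ℝ B (quad n) x‖ ≤ K) {x y : E n} (hx : x ∈ quad n)
    (hy : y ∈ quad n) : ‖B x - B y‖ ≤ K * ‖x - y‖ :=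
  (convex_quad n).norm_image_sub_le_of_norm_fderivWithin_le
    (hB.differentiableOn (by simp)) hK hy hx

theorem continuous_comp_clip (hB : ContDiffOn ℝ ∞ B (quad n)) : Continuous fun x => B (clip x) :=
  hB.continuousOn.comp_continuous continuous_clip clip_mem

theorem compOp_clip_apply (hB : ContDiffOn ℝ ∞ B (quad n)) (γ : C(unitInterval, E n))
    (σ : unitInterval) : compOp unitInterval (fun x => B (clip x)) γ σ = B (clip (γ σ)) :=
  compOp_apply (s := univ) (continuous_comp_clip hB).continuousOn (fun _ => mem_univ _) σ

/-- The integral operator whose fixed point is the integral curve of `t B` from `x`. -/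
def flowMap (B : E n → E n) (p : E n × ℝ) (γ : C(unitInterval, E n)) : C(unitInterval, E n) :=
  ContinuousMap.const _ p.1 +
    p.2 • primitiveOp (E n) (compOp unitInterval (fun x => B (clip x)) γ)

/-- Integration over the unit interval has norm at most one, so the Lipschitz constant is at most
`|t| K`. The bound `1/2`, rather than merely less than one, also controls the partial derivative in
`contDiffOn_of_fixedPoint`. -/
theorem norm_flowMap_sub_le (hB : ContDiffOn ℝ ∞ B (quad n))
    (hK : ∀ x ∈ quad n, ‖fderivWithin ℝ B (quad n) x‖ ≤ K) {p : E n × ℝ}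
    (hp : |p.2| * K ≤ 1 / 2) (γ δ : C(unitInterval, E n)) :
    ‖flowMap B p γ - flowMap B p δ‖ ≤ 1 / 2 * ‖γ - δ‖ := by
  have hK0 : 0 ≤ K := (norm_nonneg _).trans (hK 0 (fun i => le_rfl))
  have h1 : flowMap B p γ - flowMap B p δ = p.2 • primitiveOp (E n)
      (compOp unitInterval (fun x => B (clip x)) γ - compOp unitInterval (fun x => B (clip x)) δ) := by
    simp only [flowMap, map_sub, smul_sub]
    abel
  rw [h1, norm_smul, Real.norm_eq_abs]
  have h2 : ‖compOp unitInterval (fun x => B (clip x)) γ -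
      compOp unitInterval (fun x => B (clip x)) δ‖ ≤ K * ‖γ - δ‖ := by
    rw [ContinuousMap.norm_le _ (by positivity)]
    intro σ
    rw [ContinuousMap.sub_apply, compOp_clip_apply hB, compOp_clip_apply hB]
    refine (lipschitz_of_fderivWithin_le hB hK (clip_mem _) (clip_mem _)).trans ?_
    exact mul_le_mul_of_nonneg_left ((norm_clip_sub_le _ _).trans
      ((γ - δ).norm_coe_le_norm σ)) hK0
  calc |p.2| * ‖primitiveOp (E n) _‖ ≤ |p.2| * (K * ‖γ - δ‖) :=
        mul_le_mul_of_nonneg_left ((norm_primitiveOp_apply_le _).trans h2) (abs_nonneg _)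
    _ = |p.2| * K * ‖γ - δ‖ := by ring
    _ ≤ _ := mul_le_mul_of_nonneg_right hp (norm_nonneg _)

theorem contractingWith_flowMap (hB : ContDiffOn ℝ ∞ B (quad n))
    (hK : ∀ x ∈ quad n, ‖fderivWithin ℝ B (quad n) x‖ ≤ K) {p : E n × ℝ}
    (hp : |p.2| * K ≤ 1 / 2) : ContractingWith (1 / 2) (flowMap B p) := by
  refine ⟨by rw [← NNReal.coe_lt_coe]; norm_num, LipschitzWith.of_dist_le_mul fun γ δ => ?_⟩
  simpa [dist_eq_norm] using norm_flowMap_sub_le hB hK hp γ δ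

open Classical in
/-- The integral curve `σ ↦ exp(σ t B) x`, where it is defined by the contraction principle. -/
def flowCurve (B : E n → E n) (p : E n × ℝ) : C(unitInterval, E n) :=
  if h : ∃ γ, flowMap B p γ = γ then h.choose else 0

theorem flowCurve_fixed (hB : ContDiffOn ℝ ∞ B (quad n))
    (hK : ∀ x ∈ quad n, ‖fderivWithin ℝ B (quad n) x‖ ≤ K) {p : E n × ℝ}
    (hp : |p.2| * K ≤ 1 / 2) : flowMap B p (flowCurve B p) = flowCurve B p := by
  have h : ∃ γ, flowMap B p γ = γ :=
    ⟨_, (contractingWith_flowMap hB hK hp).fixedPoint_isFixedPt⟩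
  simp only [flowCurve, h, dite_true]
  exact h.choose_spec

theorem flowCurve_unique (hB : ContDiffOn ℝ ∞ B (quad n))
    (hK : ∀ x ∈ quad n, ‖fderivWithin ℝ B (quad n) x‖ ≤ K) {p : E n × ℝ}
    (hp : |p.2| * K ≤ 1 / 2) {γ : C(unitInterval, E n)} (hγ : flowMap B p γ = γ) :
    γ = flowCurve B p :=
  (contractingWith_flowMap hB hK hp).fixedPoint_unique' hγ (flowCurve_fixed hB hK hp)

theorem flowCurve_eq (hB : ContDiffOn ℝ ∞ B (quad n))
    (hK : ∀ x ∈ quad n, ‖fderivWithin ℝ B (quad n) x‖ ≤ K) {p : E n × ℝ}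
    (hp : |p.2| * K ≤ 1 / 2) {s : ℝ} (hs : s ∈ Icc (0 : ℝ) 1) :
    IccExtend (zero_le_one' ℝ) (flowCurve B p) s = p.1 + p.2 • ∫ u in (0 : ℝ)..s,
      B (clip (IccExtend (zero_le_one' ℝ) (flowCurve B p) u)) := by
  rw [IccExtend_of_mem _ _ hs]
  conv_lhs => rw [← flowCurve_fixed hB hK hp]
  simp only [flowMap, ContinuousMap.add_apply, ContinuousMap.const_apply,
    ContinuousMap.smul_apply, primitiveOp_apply]
  congr 2
  apply intervalIntegral.integral_congr
  intro u hu
  simp only [IccExtend, Function.comp, compOp_clip_apply hB]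

/-- The flow of `B`. -/
def flow (B : E n → E n) (p : E n × ℝ) : E n := flowCurve B p 1

/-- The curve `σ ↦ flowCurve B (x, t) (l σ)` is a fixed point of the operator for time `l t`, and
fixed points are unique. So whole integral curves are made of endpoints, and if all endpoints for
shorter times lie in the quadrant, so does the curve. -/
theorem flowCurve_scale (hB : ContDiffOn ℝ ∞ B (quad n))
    (hK : ∀ x ∈ quad n, ‖fderivWithin ℝ B (quad n) x‖ ≤ K) {x : E n} {t : ℝ}
    (hp : |t| * K ≤ 1 / 2) (l : unitInterval) :
    flowCurve B (x, t) l = flow B (x, l * t) := by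
  have hK0 : 0 ≤ K := (norm_nonneg _).trans (hK 0 (fun i => le_rfl))
  have hp' : |(x, (l : ℝ) * t).2| * K ≤ 1 / 2 := by
    refine le_trans (mul_le_mul_of_nonneg_right ?_ hK0) hp
    rw [abs_mul, abs_of_nonneg l.2.1]
    exact mul_le_of_le_one_left (abs_nonneg _) l.2.2
  let γ : C(unitInterval, E n) := ⟨fun σ => flowCurve B (x, t) (l * σ), by fun_prop⟩
  have hγ : flowMap B (x, l * t) γ = γ := by
    ext1 σ
    have hm : (l : ℝ) * σ ∈ Icc (0 : ℝ) 1 := (l * σ).2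
    have h1 : γ σ = IccExtend (zero_le_one' ℝ) (flowCurve B (x, t)) ((l : ℝ) * σ) := by
      rw [IccExtend_of_mem _ _ hm]
      rfl
    rw [h1, flowCurve_eq hB hK (p := (x, t)) hp hm]
    simp only [flowMap, ContinuousMap.add_apply, ContinuousMap.const_apply,
      ContinuousMap.smul_apply, primitiveOp_apply]
    congr 1
    rw [mul_comm, mul_smul]
    congr 1
    have h2 := intervalIntegral.smul_integral_comp_mul_left (a := 0) (b := σ)
      (fun u => B (clip (IccExtend (zero_le_one' ℝ) (flowCurve B (x, t)) u))) (l : ℝ)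
    rw [mul_zero] at h2
    rw [← h2]
    congr 1
    apply intervalIntegral.integral_congr
    intro u hu
    rw [uIcc_of_le σ.2.1] at hu
    have hu1 : u ∈ Icc (0 : ℝ) 1 := ⟨hu.1, hu.2.trans σ.2.2⟩
    simp only
    rw [IccExtend_of_mem _ _ hu1, compOp_clip_apply hB,
      IccExtend_of_mem _ _ (show (l : ℝ) * u ∈ Icc (0 : ℝ) 1 from
        (l * ⟨u, hu1⟩ : unitInterval).2)]
    rfl
  have := flowCurve_unique hB hK hp' hγ
  rw [flow, ← this]
  simp [γ]

theorem flow_zero (hB : ContDiffOn ℝ ∞ B (quad n))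
    (hK : ∀ x ∈ quad n, ‖fderivWithin ℝ B (quad n) x‖ ≤ K) (x : E n) : flow B (x, 0) = x := by
  have h := flowCurve_eq hB hK (p := (x, 0)) (by simp) (s := 1) ⟨zero_le_one, le_rfl⟩
  rw [IccExtend_of_mem _ _ (right_mem_Icc.2 (zero_le_one' ℝ)), zero_smul, add_zero] at h
  exact h

theorem flow_integral (hB : ContDiffOn ℝ ∞ B (quad n))
    (hK : ∀ x ∈ quad n, ‖fderivWithin ℝ B (quad n) x‖ ≤ K) (x : E n) {t : ℝ}
    (hp : |t| * K ≤ 1 / 2) :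
    flow B (x, t) = x + ∫ s in (0 : ℝ)..t, B (clip (flow B (x, s))) := by
  have h := flowCurve_eq hB hK (p := (x, t)) hp (s := 1) ⟨zero_le_one, le_rfl⟩
  rw [IccExtend_of_mem _ _ (right_mem_Icc.2 (zero_le_one' ℝ))] at h
  have h' : flow B (x, t) = x + t • ∫ u in (0 : ℝ)..1,
      B (clip (IccExtend (zero_le_one' ℝ) (flowCurve B (x, t)) u)) := h
  rw [h']
  congr 1
  have h2 := intervalIntegral.smul_integral_comp_mul_left (a := 0) (b := 1)
      (fun u => B (clip (flow B (x, u)))) t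
  rw [mul_zero, mul_one] at h2
  rw [← h2]
  congr 1
  apply intervalIntegral.integral_congr
  intro u hu
  rw [uIcc_of_le zero_le_one] at hu
  simp only
  rw [IccExtend_of_mem _ _ hu, flowCurve_scale hB hK hp ⟨u, hu⟩, mul_comm]

/-- Compare both fixed points with the image of the old curve under the new operator. The
contraction contributes at most half of the left side, which is absorbed, giving the factor `2`; the
change of `x` and `t` contributes the rest. -/
theorem norm_flowCurve_sub_le (hB : ContDiffOn ℝ ∞ B (quad n))
    (hK : ∀ x ∈ quad n, ‖fderivWithin ℝ B (quad n) x‖ ≤ K) {p q : E n × ℝ}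
    (hp : |p.2| * K ≤ 1 / 2) (hq : |q.2| * K ≤ 1 / 2) :
    ‖flowCurve B q - flowCurve B p‖ ≤
      2 * (1 + ‖compOp unitInterval (fun x => B (clip x)) (flowCurve B p)‖) * ‖q - p‖ := by
  set c := compOp unitInterval (fun x => B (clip x)) (flowCurve B p) with hc
  have h1 : flowCurve B q - flowCurve B p =
      (flowMap B q (flowCurve B q) - flowMap B q (flowCurve B p)) +
      (ContinuousMap.const _ (q.1 - p.1) + (q.2 - p.2) • primitiveOp (E n) c) := by
    conv_lhs => rw [← flowCurve_fixed hB hK hp, ← flowCurve_fixed hB hK hq]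
    have : flowMap B p (flowCurve B p) = ContinuousMap.const _ p.1 + p.2 • primitiveOp (E n) c := rfl
    rw [this]
    have : flowMap B q (flowCurve B p) = ContinuousMap.const _ q.1 + q.2 • primitiveOp (E n) c := rfl
    rw [this, sub_smul]
    have : (ContinuousMap.const unitInterval (q.1 - p.1) : C(unitInterval, E n)) =
      ContinuousMap.const _ q.1 - ContinuousMap.const _ p.1 := rfl
    rw [this]
    rw [flowCurve_fixed hB hK hq]
    abel
  have h2 := norm_flowMap_sub_le hB hK hq (flowCurve B q) (flowCurve B p)
  have h3 : ‖(ContinuousMap.const unitInterval (q.1 - p.1) : C(unitInterval, E n))‖ ≤ ‖q - p‖ := by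
    rw [ContinuousMap.norm_le _ (norm_nonneg _)]
    intro σ
    exact norm_fst_le (q - p)
  have h4 : ‖(q.2 - p.2) • primitiveOp (E n) c‖ ≤ ‖q - p‖ * ‖c‖ := by
    rw [norm_smul]
    exact mul_le_mul (norm_snd_le (q - p)) (norm_primitiveOp_apply_le c) (norm_nonneg _)
      (norm_nonneg _)
  have h5 : ‖flowCurve B q - flowCurve B p‖ ≤
      1 / 2 * ‖flowCurve B q - flowCurve B p‖ + (‖q - p‖ + ‖q - p‖ * ‖c‖) := by
    conv_lhs => rw [h1]
    exact (norm_add_le _ _).trans (add_le_add h2 ((norm_add_le _ _).trans (add_le_add h3 h4)))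
  linarith

theorem continuousOn_flowCurve (hB : ContDiffOn ℝ ∞ B (quad n))
    (hK : ∀ x ∈ quad n, ‖fderivWithin ℝ B (quad n) x‖ ≤ K) :
    ContinuousOn (flowCurve B) {p | |p.2| * K ≤ 1 / 2} := by
  intro p hp
  rw [ContinuousWithinAt, tendsto_iff_norm_sub_tendsto_zero]
  have h : Tendsto (fun q : E n × ℝ =>
      2 * (1 + ‖compOp unitInterval (fun x => B (clip x)) (flowCurve B p)‖) * ‖q - p‖)
      (𝓝[{p | |p.2| * K ≤ 1 / 2}] p) (𝓝 0) := by
    have hc : Continuous (fun q : E n × ℝ =>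
      2 * (1 + ‖compOp unitInterval (fun x => B (clip x)) (flowCurve B p)‖) * ‖q - p‖) := by
      fun_prop
    have := hc.tendsto p
    simp only [sub_self, norm_zero, mul_zero] at this
    exact this.mono_left nhdsWithin_le_nhds
  refine squeeze_zero' (Eventually.of_forall fun q => norm_nonneg _) ?_ h
  filter_upwards [self_mem_nhdsWithin] with q hq
  exact norm_flowCurve_sub_le hB hK hp hq

theorem continuousOn_flow (hB : ContDiffOn ℝ ∞ B (quad n))
    (hK : ∀ x ∈ quad n, ‖fderivWithin ℝ B (quad n) x‖ ≤ K) :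
    ContinuousOn (flow B) {p | |p.2| * K ≤ 1 / 2} :=
  (continuous_eval_const (F := C(unitInterval, E n)) 1).comp_continuousOn
    (continuousOn_flowCurve hB hK)

theorem hasDerivAt_flow (hB : ContDiffOn ℝ ∞ B (quad n))
    (hK : ∀ x ∈ quad n, ‖fderivWithin ℝ B (quad n) x‖ ≤ K) (x : E n) {t : ℝ}
    (hp : |t| * K < 1 / 2) :
    HasDerivAt (fun s => flow B (x, s)) (B (clip (flow B (x, t)))) t := by
  have hopen : IsOpen {s : ℝ | |s| * K < 1 / 2} :=
    isOpen_lt (by fun_prop) continuous_const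
  have hcont : ContinuousOn (fun s => B (clip (flow B (x, s)))) {s : ℝ | |s| * K < 1 / 2} :=
    (continuous_comp_clip hB).comp_continuousOn ((continuousOn_flow hB hK).comp
      (by fun_prop) fun s (hs : |s| * K < 1 / 2) => hs.le)
  have hK0 : 0 ≤ K := (norm_nonneg _).trans (hK 0 (fun i => le_rfl))
  have hsub : uIcc 0 t ⊆ {s : ℝ | |s| * K < 1 / 2} := by
    intro s hs
    have : |s| ≤ |t| := by
      have := abs_sub_left_of_mem_uIcc hs
      simpa using this
    exact (mul_le_mul_of_nonneg_right this hK0).trans_lt hp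
  have h := intervalIntegral.integral_hasDerivAt_right
    ((hcont.mono hsub).intervalIntegrable) (hcont.stronglyMeasurableAtFilter hopen t hp)
    (hcont.continuousAt (hopen.mem_nhds hp))
  refine (h.const_add x).congr_of_eventuallyEq ?_
  filter_upwards [hopen.mem_nhds hp] with s hs
  exact flow_integral hB hK x (le_of_lt hs)

/-- Tangential coordinates stay nonnegative along the flow. -/
theorem flow_nonneg_of_tangent (hB : ContDiffOn ℝ ∞ B (quad n))
    (hK : ∀ x ∈ quad n, ‖fderivWithin ℝ B (quad n) x‖ ≤ K) {i : Fin n}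
    (hi : ∀ x ∈ quad n, x i = 0 → B x i = 0) {x : E n} (hx : x ∈ quad n) {t : ℝ}
    (hp : |t| * K < 1 / 2) : 0 ≤ flow B (x, t) i := by
  by_contra hneg
  push Not at hneg
  have hK0 : 0 ≤ K := (norm_nonneg _).trans (hK 0 (fun i => le_rfl))
  let f : ℝ → ℝ := fun l => flow B (x, l * t) i
  have hlt : ∀ l ∈ Icc (0 : ℝ) 1, |l * t| * K < 1 / 2 := by
    intro l hl
    refine lt_of_le_of_lt (mul_le_mul_of_nonneg_right ?_ hK0) hp
    rw [abs_mul, abs_of_nonneg hl.1]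
    exact mul_le_of_le_one_left (abs_nonneg _) hl.2
  have hd : ∀ l ∈ Icc (0 : ℝ) 1, HasDerivAt f (t * B (clip (flow B (x, l * t))) i) l := by
    intro l hl
    have h1 := (hasDerivAt_flow hB hK x (hlt l hl)).scomp l ((hasDerivAt_id l).mul_const t)
    have h2 := (EuclideanSpace.proj (𝕜 := ℝ) i).hasFDerivAt.comp_hasDerivAt l h1
    simpa [Function.comp_def] using h2
  have hf0 : f 0 = x i := by simp [f, flow_zero hB hK]
  have hf1 : f 1 < 0 := by simpa [f] using hneg
  have hfc : ContinuousOn f (Icc 0 1) := fun l hl => (hd l hl).continuousAt.continuousWithinAt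
  have hZc : IsCompact (Icc (0 : ℝ) 1 ∩ f ⁻¹' Ici 0) :=
    isCompact_Icc.of_isClosed_subset
      (hfc.preimage_isClosed_of_isClosed isClosed_Icc isClosed_Ici) inter_subset_left
  -- The last parameter at which the coordinate is nonnegative; it precedes `1`, where the
  -- coordinate is assumed negative.
  obtain ⟨l, ⟨hl, hfl⟩, hmax⟩ := hZc.exists_isMaxOn
    ⟨0, ⟨left_mem_Icc.2 zero_le_one, by simpa [hf0] using hx i⟩⟩ continuousOn_id
  have hafter : ∀ s ∈ Ioo l 1, f s < 0 := by
    intro s hs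
    by_contra h
    push Not at h
    have := hmax (show s ∈ Icc (0 : ℝ) 1 ∩ f ⁻¹' Ici 0 from ⟨⟨hl.1.trans hs.1.le, hs.2.le⟩, h⟩)
    exact absurd this (not_le.2 hs.1)
  have hl1 : l < 1 := lt_of_le_of_ne hl.2 (by rintro rfl; exact absurd hfl (not_le.2 hf1))
  have hconst : f 1 = f l := by
    refine (constant_of_has_deriv_right_zero (hfc.mono (Icc_subset_Icc_left hl.1)) ?_) 1
      (right_mem_Icc.2 hl1.le)
    intro s hs
    have hs1 : s ∈ Icc (0 : ℝ) 1 := ⟨hl.1.trans hs.1, hs.2.le⟩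
    have hfs : f s ≤ 0 := by
      rcases hs.1.eq_or_lt with rfl | h
      · refine le_of_tendsto ((hd l hs1).continuousAt.tendsto.mono_left
          (nhdsWithin_le_nhds (s := Ioi l))) ?_
        filter_upwards [Ioo_mem_nhdsGT hl1] with u hu using (hafter u hu).le
      · exact (hafter s ⟨h, hs.2⟩).le
    -- Where the coordinate is nonpositive, clipping puts the point on the face `i`, to which `B` is
    -- tangent. So the coordinate is constant after `l`, which contradicts the change of sign.
    have h0 : B (clip (flow B (x, s * t))) i = 0 :=
      hi _ (clip_mem _) (by rw [clip_apply]; exact max_eq_right hfs)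
    simpa [h0] using (hd s hs1).hasDerivWithinAt (s := Ici s)
  rw [hconst] at hf1
  exact absurd hfl (not_le.2 hf1)

/-- Inward pointing coordinates stay nonnegative along the forward flow. -/
theorem flow_nonneg_of_inward (hB : ContDiffOn ℝ ∞ B (quad n))
    (hK : ∀ x ∈ quad n, ‖fderivWithin ℝ B (quad n) x‖ ≤ K) {i : Fin n}
    (hi : ∀ x ∈ quad n, 0 ≤ B x i) {x : E n} (hx : x ∈ quad n) {t : ℝ} (ht : 0 ≤ t)
    (hp : |t| * K < 1 / 2) : 0 ≤ flow B (x, t) i := by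
  have hK0 : 0 ≤ K := (norm_nonneg _).trans (hK 0 (fun i => le_rfl))
  have hlt : ∀ l ∈ Icc (0 : ℝ) t, |l| * K < 1 / 2 := by
    intro l hl
    refine lt_of_le_of_lt (mul_le_mul_of_nonneg_right ?_ hK0) hp
    rw [abs_of_nonneg hl.1, abs_of_nonneg ht]
    exact hl.2
  have hd : ∀ l ∈ Icc (0 : ℝ) t,
      HasDerivAt (fun l => flow B (x, l) i) (B (clip (flow B (x, l))) i) l := fun l hl =>
    (EuclideanSpace.proj (𝕜 := ℝ) i).hasFDerivAt.comp_hasDerivAt l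
      (hasDerivAt_flow hB hK x (hlt l hl))
  have hm : MonotoneOn (fun l => flow B (x, l) i) (Icc 0 t) :=
    monotoneOn_of_hasDerivWithinAt_nonneg (convex_Icc 0 t)
      (fun l hl => (hd l hl).continuousAt.continuousWithinAt)
      (fun l hl => (hd l (interior_subset hl)).hasDerivWithinAt) fun l _ => hi _ (clip_mem _)
  have := hm (left_mem_Icc.2 ht) (right_mem_Icc.2 ht) ht
  simp only [flow_zero hB hK] at this
  exact (hx i).trans this

/-- The flow preserves the faces to which the vector field is tangent. -/
theorem flow_eq_zero_of_tangent (hB : ContDiffOn ℝ ∞ B (quad n))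
    (hK : ∀ x ∈ quad n, ‖fderivWithin ℝ B (quad n) x‖ ≤ K) {i : Fin n}
    (hi : ∀ x ∈ quad n, x i = 0 → B x i = 0) {x : E n} (hx : x i = 0) {t : ℝ}
    (hp : |t| * K < 1 / 2) : flow B (x, t) i = 0 := by
  have hK0 : 0 ≤ K := (norm_nonneg _).trans (hK 0 (fun i => le_rfl))
  let f : ℝ → ℝ := fun l => flow B (x, l * t) i
  have hlt : ∀ l ∈ Icc (0 : ℝ) 1, |l * t| * K < 1 / 2 := by
    intro l hl
    refine lt_of_le_of_lt (mul_le_mul_of_nonneg_right ?_ hK0) hp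
    rw [abs_mul, abs_of_nonneg hl.1]
    exact mul_le_of_le_one_left (abs_nonneg _) hl.2
  have hd : ∀ l ∈ Icc (0 : ℝ) 1, HasDerivAt f (t * B (clip (flow B (x, l * t))) i) l := by
    intro l hl
    have h1 := (hasDerivAt_flow hB hK x (hlt l hl)).scomp l ((hasDerivAt_id l).mul_const t)
    have h2 := (EuclideanSpace.proj (𝕜 := ℝ) i).hasFDerivAt.comp_hasDerivAt l h1
    simpa [Function.comp_def] using h2
  have h := eq_zero_of_abs_deriv_le_mul_abs_self_of_eq_zero_right (f := f) (a := 0) (b := 1)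
    (K := |t| * K) (f' := fun l => t * B (clip (flow B (x, l * t))) i)
    (fun l hl => (hd l hl).continuousAt.continuousWithinAt)
    (fun l hl => (hd l (Ico_subset_Icc_self hl)).hasDerivWithinAt)
    (by simp [f, flow_zero hB hK, hx]) ?_ 1 (right_mem_Icc.2 zero_le_one)
  · simpa [f] using h
  · intro l hl
    set y := clip (flow B (x, l * t)) with hy
    -- Setting coordinate `i` to zero lands on the face, where `B` has no component `i`. The
    -- Lipschitz bound between the two points gives `|B y i| ≤ K |y i|`, the hypothesis of
    -- Gronwall's inequality.
    have hy' : y - EuclideanSpace.single i (y i) ∈ quad n := by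
      intro j
      rcases eq_or_ne j i with rfl | hj
      · simp
      · simpa [hj] using clip_mem (flow B (x, l * t)) j
    have h1 := lipschitz_of_fderivWithin_le hB hK (clip_mem (flow B (x, l * t))) hy'
    rw [← hy, sub_sub_cancel, PiLp.norm_single] at h1
    have h2 : |B y i| ≤ K * |y i| := by
      have h3 := (PiLp.norm_apply_le (B y - B (y - EuclideanSpace.single i (y i))) i).trans h1
      have h0 : B (y - EuclideanSpace.single i (y i)) i = 0 := hi _ hy' (by simp)
      simpa [h0] using h3
    have h3 : |y i| ≤ |f l| := by
      rw [hy, clip_apply]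
      have := abs_max_sub_max_le_abs (f l) 0 0
      simpa using this
    simp only [norm_mul, Real.norm_eq_abs]
    calc |t| * |B y i| ≤ |t| * (K * |f l|) :=
          mul_le_mul_of_nonneg_left (h2.trans (mul_le_mul_of_nonneg_left h3 hK0)) (abs_nonneg _)
      _ = _ := by ring

/-- The flow is smooth on sets on which it stays in the quadrant. -/
theorem contDiffOn_flow (hB : ContDiffOn ℝ ∞ B (quad n))
    (hK : ∀ x ∈ quad n, ‖fderivWithin ℝ B (quad n) x‖ ≤ K) {a b : ℝ} (ha : a ≤ 0) (hb : 0 < b)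
    (haK : |a| * K < 1 / 2) (hbK : |b| * K < 1 / 2)
    (hmem : ∀ x ∈ quad n, ∀ t ∈ Icc a b, flow B (x, t) ∈ quad n) :
    ContDiffOn ℝ ∞ (flow B) (quad n ×ˢ Icc a b) := by
  have hK0 : 0 ≤ K := (norm_nonneg _).trans (hK 0 (fun i => le_rfl))
  set S : Set (E n × ℝ) := quad n ×ˢ Icc a b with hS
  set T : Set C(unitInterval, E n) := curvesIn unitInterval (quad n) with hT
  have hSu : UniqueDiffOn ℝ S := (uniqueDiffOn_quad n).prod (uniqueDiffOn_Icc (ha.trans_lt hb))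
  have hTu : UniqueDiffOn ℝ T := uniqueDiffOn_curvesIn (convex_quad n) (interior_quad_nonempty n)
  have hle : ∀ p ∈ S, |p.2| * K ≤ 1 / 2 := by
    rintro p ⟨-, hp⟩
    have : |p.2| ≤ max |a| |b| := abs_le_max_abs_abs hp.1 hp.2
    rcases le_max_iff.1 this with h | h
    · exact (mul_le_mul_of_nonneg_right h hK0).trans haK.le
    · exact (mul_le_mul_of_nonneg_right h hK0).trans hbK.le
  have hγT : MapsTo (flowCurve B) S T := by
    rintro ⟨x, t⟩ hp σ
    rw [flowCurve_scale hB hK (hle _ hp)]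
    refine hmem x hp.1 _ ((convex_Icc a b).smul_mem_of_zero_mem (t := (σ : ℝ)) ⟨ha, hb.le⟩ hp.2 σ.2)
  -- `flowMap` without the nonsmooth `clip`: on curves in the quadrant the two agree, and this one
  -- is smooth.
  let Fm : (E n × ℝ) × C(unitInterval, E n) → C(unitInterval, E n) := fun q =>
    ContinuousLinearMap.const ℝ unitInterval q.1.1 +
      q.1.2 • primitiveOp (E n) (compOp unitInterval B q.2)
  have hF : ContDiffOn ℝ ∞ Fm (S ×ˢ T) := by
    have h1 : ContDiffOn ℝ ∞ (fun q : (E n × ℝ) × C(unitInterval, E n) =>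
        primitiveOp (E n) (compOp unitInterval B q.2)) (S ×ˢ T) :=
      (primitiveOp (E n)).contDiff.comp_contDiffOn
        ((contDiffOn_compOp (convex_quad n) (interior_quad_nonempty n) hB).comp contDiffOn_snd
          fun q hq => hq.2)
    have h2 : ContDiff ℝ ∞ (fun q : (E n × ℝ) × C(unitInterval, E n) =>
        ContinuousLinearMap.const ℝ unitInterval (M := E n) q.1.1) :=
      (ContinuousLinearMap.const ℝ unitInterval (M := E n)).contDiff.comp
        (contDiff_fst.comp contDiff_fst)
    have h3 : ContDiff ℝ ∞ (fun q : (E n × ℝ) × C(unitInterval, E n) => q.1.2) :=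
      contDiff_snd.comp contDiff_fst
    exact h2.contDiffOn.add (h3.contDiffOn.smul h1)
  have hγ : ContDiffOn ℝ ∞ (flowCurve B) S := by
    refine contDiffOn_of_fixedPoint hSu hTu hF hγT ?_ ?_ ?_
    · intro p hp
      conv_lhs => rw [← flowCurve_fixed hB hK (hle p hp)]
      simp only [flowMap, Fm]
      congr 3
      ext1 σ
      rw [compOp_clip_apply hB, compOp_apply hB.continuousOn (hγT hp), clip_of_mem (hγT hp σ)]
    · intro p hp
      refine Asymptotics.IsBigO.of_bound
        (2 * (1 + ‖compOp unitInterval (fun x => B (clip x)) (flowCurve B p)‖)) ?_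
      filter_upwards [self_mem_nhdsWithin] with q hq
      exact norm_flowCurve_sub_le hB hK (hle p hp) (hle q hq)
    · intro p hp
      -- The partial derivative in the curve is computed twice, abstractly and explicitly.
      -- Uniqueness of derivatives on `T` identifies the two, and the explicit one has norm at most
      -- `|t| K ≤ 1/2`.
      have hd1 : HasFDerivWithinAt (fun γ => Fm (p, γ))
          ((fderivWithin ℝ Fm (S ×ˢ T) (p, flowCurve B p)).comp
            (ContinuousLinearMap.inr ℝ _ _)) T (flowCurve B p) := by
        have h1 := (hF.differentiableOn (by simp) (p, flowCurve B p)
          ⟨hp, hγT hp⟩).hasFDerivWithinAt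
        exact h1.comp (flowCurve B p) (hasFDerivAt_prodMk_right p (flowCurve B p)).hasFDerivWithinAt
          fun γ hγ => ⟨hp, hγ⟩
      have hd2 : HasFDerivWithinAt (fun γ => Fm (p, γ))
          (p.2 • (primitiveOp (E n)).comp (applyOp unitInterval (E n) (E n)
            (compOp unitInterval (fderivWithin ℝ B (quad n)) (flowCurve B p)))) T
            (flowCurve B p) := by
        have h1 := hasFDerivWithinAt_compOp (K := unitInterval) (convex_quad n)
          (fun x hx => ((hB.differentiableOn (by simp)) x hx).hasFDerivWithinAt)
          ((hB.fderivWithin (m := 0) (uniqueDiffOn_quad n) (by simp)).continuousOn) (hγT hp)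
        exact (((primitiveOp (E n)).hasFDerivAt.comp_hasFDerivWithinAt _ h1).const_smul
          p.2).const_add (ContinuousLinearMap.const ℝ unitInterval p.1)
      rw [(hTu _ (hγT hp)).eq hd1 hd2, norm_smul, Real.norm_eq_abs]
      refine le_trans (mul_le_mul_of_nonneg_left ?_ (abs_nonneg _)) (hle p hp)
      refine (ContinuousLinearMap.opNorm_comp_le _ _).trans ?_
      refine (mul_le_of_le_one_left (norm_nonneg _) norm_primitiveOp_le).trans ?_
      refine (norm_applyOp_le _).trans ((ContinuousMap.norm_le _ hK0).2 fun σ => ?_)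
      rw [compOp_apply ((hB.fderivWithin (m := 0) (uniqueDiffOn_quad n) (by simp)).continuousOn)
        (hγT hp)]
      exact hK _ (hγT hp σ)
  exact (ContinuousLinearMap.contDiff (ContinuousMap.evalCLM ℝ (1 : unitInterval))).comp_contDiffOn
    hγ

end Flow

/-! ### The inverse function theorem on the quadrant -/

theorem convex_quad_inter_ball {n : ℕ} (v : E n) (r : ℝ) :
    Convex ℝ (quad n ∩ Metric.ball v r) := (convex_quad n).inter (convex_ball v r)

theorem mem_closure_interior_quad {n : ℕ} {v : E n} (hv : v ∈ quad n) :
    v ∈ closure (interior (quad n)) := by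
  rw [(convex_quad n).closure_interior_eq_closure_of_nonempty_interior (interior_quad_nonempty n)]
  exact subset_closure hv

theorem interior_quad_inter_nonempty {n : ℕ} {v : E n} (hv : v ∈ quad n) {U : Set (E n)}
    (hU : IsOpen U) (hvU : v ∈ U) : (interior (quad n ∩ U)).Nonempty := by
  obtain ⟨x, hxU, hx⟩ := mem_closure_iff.1 (mem_closure_interior_quad hv) U hU hvU
  exact ⟨x, by rw [interior_inter, hU.interior_eq]; exact ⟨hx, hxU⟩⟩

theorem uniqueDiffOn_quad_inter {n : ℕ} {U : Set (E n)} (hU : IsOpen U) :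
    UniqueDiffOn ℝ (quad n ∩ U) := (uniqueDiffOn_quad n).inter hU

theorem eventually_pos_of_pos {n : ℕ} (v₀ : E n) :
    ∀ᶠ v in 𝓝 v₀, ∀ i, 0 < v₀ i → 0 < v i := by
  refine eventually_all.2 fun i => ?_
  by_cases h : 0 < v₀ i
  · have hc : Continuous fun v : E n => v i := by fun_prop
    filter_upwards [(hc.tendsto v₀).eventually (lt_mem_nhds h)] with v hv _ using hv
  · exact Eventually.of_forall fun v h' => absurd h' h

theorem clip_mem_ball {n : ℕ} {v₀ v : E n} (hv₀ : v₀ ∈ quad n) {r : ℝ}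
    (hv : v ∈ Metric.ball v₀ r) : clip v ∈ Metric.ball v₀ r := by
  rw [Metric.mem_ball, dist_eq_norm] at hv ⊢
  have := norm_clip_sub_le v v₀
  rw [clip_of_mem hv₀] at this
  exact this.trans_lt hv

theorem eq_sum_single {n : ℕ} (w : E n) : w = ∑ k, w k • EuclideanSpace.single k (1 : ℝ) := by
  ext l
  simp [Finset.sum_apply, Pi.single_apply]

theorem add_single_mem_quad {n : ℕ} {v : E n} (hv : v ∈ quad n) {k : Fin n} {c : ℝ} (hc : 0 ≤ c) :
    v + EuclideanSpace.single k c ∈ quad n := by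
  intro l
  rcases eq_or_ne l k with rfl | hl
  · simp only [PiLp.add_apply, PiLp.single_apply, if_true]
    linarith [hv l]
  · simpa [hl] using hv l

/-! ### One-sided derivatives of functions along rays in the quadrant -/

theorem eventually_ray_mem {n : ℕ} {v₀ w : E n} (hv₀ : v₀ ∈ quad n) {U : Set (E n)}
    (hU : U ∈ 𝓝 v₀) (hw : v₀ + w ∈ quad n) : ∀ᶠ s in 𝓝[>] (0 : ℝ), v₀ + s • w ∈ quad n ∩ U := by
  have hc : Continuous fun s : ℝ => v₀ + s • w := by fun_prop
  have h0 := hc.tendsto 0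
  simp only [zero_smul, add_zero] at h0
  filter_upwards [mem_nhdsWithin_of_mem_nhds (h0.eventually hU),
    Ioo_mem_nhdsGT (zero_lt_one' ℝ)] with s hs hs1
  exact ⟨(convex_quad n).add_smul_mem hv₀ hw ⟨hs1.1.le, hs1.2.le⟩, hs⟩

theorem tendsto_ray {n : ℕ} {v₀ w : E n} (hv₀ : v₀ ∈ quad n) {U : Set (E n)}
    (hU : U ∈ 𝓝 v₀) {g : E n → ℝ} {g' : E n →L[ℝ] ℝ}
    (hg : HasFDerivWithinAt g g' (quad n ∩ U) v₀) (h0 : g v₀ = 0) (hw : v₀ + w ∈ quad n) :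
    Tendsto (fun s : ℝ => s⁻¹ * g (v₀ + s • w)) (𝓝[>] 0) (𝓝 (g' w)) := by
  have h2 : Tendsto (fun s : ℝ => s⁻¹) (𝓝[>] 0) atTop := tendsto_inv_nhdsGT_zero
  have h3 := hg.lim (c := fun s : ℝ => s⁻¹) (d := fun s : ℝ => s • w) (α := ℝ)
    (l := 𝓝[>] (0 : ℝ)) (v := w) ?_ (eventually_ray_mem hv₀ hU hw) ?_
  · refine h3.congr fun s => ?_
    simp [h0]
  · have : Tendsto (fun s : ℝ => s • w) (𝓝 0) (𝓝 ((0 : ℝ) • w)) :=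
      (continuous_id.smul continuous_const).tendsto 0
    rw [zero_smul] at this
    exact this.mono_left nhdsWithin_le_nhds
  · refine tendsto_const_nhds.congr' ?_
    filter_upwards [self_mem_nhdsWithin] with s hs
    rw [smul_smul, inv_mul_cancel₀ (ne_of_gt hs), one_smul]

/-- The derivative of a nonnegative function at a zero is nonnegative on inward vectors. -/
theorem deriv_nonneg_of_inward {n : ℕ} {v₀ w : E n} (hv₀ : v₀ ∈ quad n) {U : Set (E n)}
    (hU : U ∈ 𝓝 v₀) {g : E n → ℝ} {g' : E n →L[ℝ] ℝ}
    (hg : HasFDerivWithinAt g g' (quad n ∩ U) v₀) (h0 : g v₀ = 0)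
    (hpos : ∀ v ∈ quad n ∩ U, 0 ≤ g v) (hw : v₀ + w ∈ quad n) : 0 ≤ g' w := by
  refine ge_of_tendsto (tendsto_ray hv₀ hU hg h0 hw) ?_
  filter_upwards [eventually_ray_mem hv₀ hU hw, self_mem_nhdsWithin] with s hs hs0
  exact mul_nonneg (inv_nonneg.2 (le_of_lt hs0)) (hpos _ hs)

/-- The derivative of a nonnegative function at a zero vanishes in interior directions. -/
theorem deriv_single_eq_zero_of_pos {n : ℕ} {v₀ : E n} (hv₀ : v₀ ∈ quad n) {U : Set (E n)}
    (hU : U ∈ 𝓝 v₀) {g : E n → ℝ} {g' : E n →L[ℝ] ℝ}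
    (hg : HasFDerivWithinAt g g' (quad n ∩ U) v₀) (h0 : g v₀ = 0)
    (hpos : ∀ v ∈ quad n ∩ U, 0 ≤ g v) {i : Fin n} (hi : 0 < v₀ i) :
    g' (EuclideanSpace.single i 1) = 0 := by
  refine le_antisymm ?_ (deriv_nonneg_of_inward hv₀ hU hg h0 hpos
    (add_single_mem_quad hv₀ zero_le_one))
  have h := deriv_nonneg_of_inward (w := (-v₀ i) • EuclideanSpace.single i (1 : ℝ)) hv₀ hU hg h0
    hpos ?_
  · rw [map_smul, smul_eq_mul] at h
    nlinarith
  · intro l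
    rcases eq_or_ne l i with rfl | hl
    · simp
    · simpa [hl] using hv₀ l

/-- The extension of a smooth map from the quadrant by its first order Taylor polynomial. -/
theorem hasStrictFDerivAt_clip_extension {n : ℕ} {F : Type} [NormedAddCommGroup F]
    [NormedSpace ℝ F] {f : E n → F} {v₀ : E n}
    (hv₀ : v₀ ∈ quad n) {r : ℝ} (hr : 0 < r) (hf : ContDiffOn ℝ ∞ f (quad n ∩ Metric.ball v₀ r)) :
    HasStrictFDerivAt
      (fun v => f (clip v) + fderivWithin ℝ f (quad n ∩ Metric.ball v₀ r) v₀ (v - clip v))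
      (fderivWithin ℝ f (quad n ∩ Metric.ball v₀ r) v₀) v₀ := by
  set D := quad n ∩ Metric.ball v₀ r
  set L := fderivWithin ℝ f D v₀
  have hu : UniqueDiffOn ℝ D := uniqueDiffOn_quad_inter Metric.isOpen_ball
  have hv₀D : v₀ ∈ D := ⟨hv₀, Metric.mem_ball_self hr⟩
  have hcont : ContinuousOn (fderivWithin ℝ f D) D :=
    (hf.fderivWithin (m := 0) hu (by simp)).continuousOn
  rw [hasStrictFDerivAt_iff_isLittleO, Asymptotics.isLittleO_iff]
  intro ε hε
  obtain ⟨δ, hδ, hδε⟩ := Metric.continuousWithinAt_iff.1 (hcont v₀ hv₀D) ε hε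
  have hmem : Metric.ball v₀ (min δ r) ∈ 𝓝 v₀ := Metric.ball_mem_nhds _ (lt_min hδ hr)
  filter_upwards [prod_mem_nhds hmem hmem] with p hp
  obtain ⟨hx, hy⟩ : p.1 ∈ Metric.ball v₀ (min δ r) ∧ p.2 ∈ Metric.ball v₀ (min δ r) := hp
  have hsub : quad n ∩ Metric.ball v₀ (min δ r) ⊆ D :=
    inter_subset_inter_right _ (Metric.ball_subset_ball (min_le_right _ _))
  have key := Convex.norm_image_sub_le_of_norm_hasFDerivWithin_le' (𝕜 := ℝ) (f := f)
    (s := quad n ∩ Metric.ball v₀ (min δ r)) (C := ε) (f' := fderivWithin ℝ f D) (φ := L)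
    (x := clip p.2) (y := clip p.1)
    (fun x hx => ((hf.differentiableOn (by simp) x (hsub hx)).hasFDerivWithinAt).mono hsub)
    (fun x hx => by
      have := hδε (hsub hx) (lt_of_lt_of_le hx.2 (min_le_left _ _))
      rw [dist_eq_norm] at this
      exact this.le)
    (convex_quad_inter_ball _ _) ⟨clip_mem _, clip_mem_ball hv₀ hy⟩
    ⟨clip_mem _, clip_mem_ball hv₀ hx⟩
  -- The linear correction makes the remainder of the extension equal to that of `f` between the
  -- clipped points, which lie in a convex set where the mean value inequality applies.
  have h2 : f (clip p.1) + L (p.1 - clip p.1) - (f (clip p.2) + L (p.2 - clip p.2)) -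
      L (p.1 - p.2) = f (clip p.1) - f (clip p.2) - L (clip p.1 - clip p.2) := by
    simp only [map_sub]
    abel
  rw [h2]
  exact key.trans (mul_le_mul_of_nonneg_left (norm_clip_sub_le _ _) hε.le)

/-- A smooth inverse on the quadrant exists as soon as a continuous inverse does and the derivative
is invertible. -/
theorem contDiffOn_of_inverse {n : ℕ} {f g : E n → E n} {S T : Set (E n)}
    (hS : UniqueDiffOn ℝ S) (hT : UniqueDiffOn ℝ T) (hf : ContDiffOn ℝ ∞ f S)
    (hg : ContinuousOn g T) (hgT : MapsTo g T S) (hfg : ∀ w ∈ T, f (g w) = w)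
    (hunit : ∀ v ∈ S, IsUnit (fderivWithin ℝ f S v)) : ContDiffOn ℝ ∞ g T := by
  have hd : ∀ w ∈ T, HasFDerivWithinAt g (Ring.inverse (fderivWithin ℝ f S (g w))) T w := by
    intro w hw
    obtain ⟨u, hu⟩ := hunit (g w) (hgT hw)
    let e := ContinuousLinearEquiv.unitsEquiv ℝ (E n) u
    have he : (e : E n →L[ℝ] E n) = fderivWithin ℝ f S (g w) := hu
    have h1 : HasFDerivWithinAt f (e : E n →L[ℝ] E n) S (g w) := by
      rw [he]
      exact (hf.differentiableOn (by simp) _ (hgT hw)).hasFDerivWithinAt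
    have h2 := HasFDerivWithinAt.of_local_left_inverse (g := g) (s := T)
      (tendsto_nhdsWithin_iff.2 ⟨hg w hw, by
        filter_upwards [self_mem_nhdsWithin] with x hx using hgT hx⟩) h1 hw
      (by filter_upwards [self_mem_nhdsWithin] with x hx using hfg x hx)
    rw [← hu, Ring.inverse_unit]
    exact h2
  have hfs := hf.fderivWithin (m := ∞) hS (by simp)
  refine contDiffOn_infty.2 fun k => ?_
  induction k with
  | zero => exact contDiffOn_zero.2 hg
  | succ k ih =>
    push_cast
    rw [contDiffOn_succ_iff_hasFDerivWithinAt_of_uniqueDiffOn hT]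
    refine ⟨by simp, _, ?_, hd⟩
    have hc := (contDiffOn_infty.1 hfs k).comp ih hgT
    intro w hw
    obtain ⟨u, hu⟩ := hunit (g w) (hgT hw)
    have := contDiffAt_ringInverse ℝ (n := k) u
    rw [hu] at this
    exact this.comp_contDiffWithinAt w (hc w hw)

/-- The first order extension of `f` is strictly differentiable at `v₀` with invertible derivative,
so it has a local inverse on the whole space. The condition `hface` keeps this inverse in the
quadrant: a point near `v₀` with a negative coordinate `i` has a negative image coordinate `j`. -/
theorem exists_quad_inverse {n : ℕ} {f : E n → E n} {v₀ : E n} (hv₀ : v₀ ∈ quad n) {r : ℝ}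
    (hr : 0 < r) (hf : ContDiffOn ℝ ∞ f (quad n ∩ Metric.ball v₀ r))
    (hfQ : MapsTo f (quad n ∩ Metric.ball v₀ r) (quad n))
    (hinj : Function.Injective (fderivWithin ℝ f (quad n ∩ Metric.ball v₀ r) v₀))
    (hface : ∀ i, v₀ i = 0 → ∃ j, ∀ v ∈ quad n ∩ Metric.ball v₀ r, v i = 0 → f v j = 0) :
    ∃ (U W : Set (E n)) (g : E n → E n), IsOpen U ∧ IsOpen W ∧ v₀ ∈ U ∧ U ⊆ Metric.ball v₀ r ∧
      MapsTo f (quad n ∩ U) (quad n ∩ W) ∧ MapsTo g (quad n ∩ W) (quad n ∩ U) ∧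
      (∀ v ∈ quad n ∩ U, g (f v) = v) ∧ (∀ w ∈ quad n ∩ W, f (g w) = w) ∧
      ContDiffOn ℝ ∞ g (quad n ∩ W) := by
  set D := quad n ∩ Metric.ball v₀ r with hD
  set L := fderivWithin ℝ f D v₀ with hL
  have hu : UniqueDiffOn ℝ D := uniqueDiffOn_quad_inter Metric.isOpen_ball
  have hv₀D : v₀ ∈ D := ⟨hv₀, Metric.mem_ball_self hr⟩
  have hfd : ∀ x ∈ D, HasFDerivWithinAt f (fderivWithin ℝ f D x) D x := fun x hx =>
    (hf.differentiableOn (by simp) x hx).hasFDerivWithinAt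
  let e : E n ≃L[ℝ] E n := (LinearEquiv.ofInjectiveEndo (L : E n →ₗ[ℝ] E n) hinj).toContinuousLinearEquiv
  have he : (e : E n →L[ℝ] E n) = L := by ext x; rfl
  have hLunit : IsUnit L := ⟨(ContinuousLinearEquiv.unitsEquiv ℝ (E n)).symm e, he⟩
  set ft : E n → E n := fun v => f (clip v) + L (v - clip v) with hft
  have hstrict : HasStrictFDerivAt ft (e : E n →L[ℝ] E n) v₀ := by
    rw [he]
    exact hasStrictFDerivAt_clip_extension hv₀ hr hf
  have hft_eq : ∀ v ∈ quad n, ft v = f v := fun v hv => by simp [hft, clip_of_mem hv]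
  have hcont : ContinuousOn (fderivWithin ℝ f D) D :=
    (hf.fderivWithin (m := 0) hu (by simp)).continuousOn
  have hunits : ∀ᶠ v in 𝓝[D] v₀, IsUnit (fderivWithin ℝ f D v) :=
    (hcont v₀ hv₀D).eventually (Units.isOpen.mem_nhds hLunit)
  have hDn : 𝓝[D] v₀ = 𝓝[quad n] v₀ := nhdsWithin_inter_of_mem'
    (mem_nhdsWithin_of_mem_nhds (Metric.ball_mem_nhds _ hr))
  rw [hDn, eventually_nhdsWithin_iff] at hunits
  obtain ⟨δ, hδ, hδu⟩ := Metric.eventually_nhds_iff_ball.1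
    (hunits.and ((eventually_pos_of_pos v₀).and (Metric.ball_mem_nhds v₀ hr)))
  let φ := hstrict.toOpenPartialHomeomorph ft
  have hφ : (φ : E n → E n) = ft := hstrict.toOpenPartialHomeomorph_coe
  set U := φ.source ∩ Metric.ball v₀ δ with hU
  have hUo : IsOpen U := φ.open_source.inter Metric.isOpen_ball
  have hUD : quad n ∩ U ⊆ D := fun v hv => ⟨hv.1, (hδu v hv.2.2).2.2⟩
  -- Only coordinates vanishing at `v₀` can become negative on `U`, so the face condition applies to
  -- `i`.
  have hback : ∀ v ∈ U, ft v ∈ quad n → v ∈ quad n := by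
    intro v hv hq i
    by_contra hi
    push Not at hi
    have hv0i : v₀ i = 0 := by
      refine le_antisymm (not_lt.1 fun h => ?_) (hv₀ i)
      exact absurd ((hδu v hv.2).2.1 i h) (not_lt.2 hi.le)
    obtain ⟨j, hj⟩ := hface i hv0i
    have hfj0 : f v₀ j = 0 := hj v₀ hv₀D hv0i
    have hcl : clip v ∈ D := ⟨clip_mem v, clip_mem_ball hv₀ (hδu v hv.2).2.2⟩
    have h1 : f (clip v) j = 0 := hj _ hcl (by rw [clip_apply]; exact max_eq_right hi.le)
    -- derivative of the `j`-th component
    have hdj : HasFDerivWithinAt (fun x => f x j) ((EuclideanSpace.proj (𝕜 := ℝ) j).comp L) D v₀ :=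
      (EuclideanSpace.proj (𝕜 := ℝ) j).hasFDerivAt.comp_hasFDerivWithinAt v₀ (hfd v₀ hv₀D)
    have hray : ∀ w : E n, v₀ + w ∈ quad n → ∀ᶠ s in 𝓝[>] (0 : ℝ), v₀ + s • w ∈ D :=
      fun w hw => eventually_ray_mem hv₀ (Metric.ball_mem_nhds _ hr) hw
    have hlim : ∀ w : E n, v₀ + w ∈ quad n → Tendsto (fun s : ℝ => s⁻¹ * f (v₀ + s • w) j)
        (𝓝[>] 0) (𝓝 (L w j)) :=
      fun w hw => tendsto_ray hv₀ (Metric.ball_mem_nhds _ hr) hdj hfj0 hw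
    have hnonneg : ∀ w : E n, v₀ + w ∈ quad n → 0 ≤ L w j := by
      intro w hw
      refine ge_of_tendsto (hlim w hw) ?_
      filter_upwards [hray w hw, self_mem_nhdsWithin] with s hs hs0
      exact mul_nonneg (inv_nonneg.2 (le_of_lt hs0)) (hfQ hs j)
    have hzero : ∀ w : E n, v₀ + w ∈ quad n → w i = 0 → L w j = 0 := by
      intro w hw hwi
      refine tendsto_nhds_unique (hlim w hw) (tendsto_const_nhds.congr' ?_)
      filter_upwards [hray w hw, self_mem_nhdsWithin] with s hs hs0
      rw [hj _ hs (by simp [hv0i, hwi]), mul_zero]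
    have hsingle : ∀ k, v₀ + EuclideanSpace.single k (1 : ℝ) ∈ quad n := fun k =>
      add_single_mem_quad hv₀ zero_le_one
    -- The component `j` of `f` vanishes along the face `i`, so its derivative there depends on
    -- coordinate `i` alone. It is nonnegative because `f` maps into the quadrant, and nonzero
    -- because `L` is onto.
    have hLk : ∀ k, k ≠ i → L (EuclideanSpace.single k (1 : ℝ)) j = 0 := fun k hk =>
      hzero _ (hsingle k) (by simp [hk.symm])
    have hLw : ∀ w, L w j = w i * L (EuclideanSpace.single i (1 : ℝ)) j := by
      intro w
      conv_lhs => rw [eq_sum_single w]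
      simp only [map_sum, map_smul, WithLp.ofLp_sum, Finset.sum_apply, PiLp.smul_apply, smul_eq_mul]
      rw [Finset.sum_eq_single i]
      · intro k _ hk
        rw [hLk k hk, mul_zero]
      · simp
    have hpos : 0 < L (EuclideanSpace.single i (1 : ℝ)) j := by
      refine lt_of_le_of_ne (hnonneg _ (hsingle i)) fun h0 => ?_
      have h5 : L (e.symm (EuclideanSpace.single j 1)) j = 0 := by rw [hLw, ← h0, mul_zero]
      rw [← he] at h5
      simp at h5
    have h6 : ft v j = v i * L (EuclideanSpace.single i (1 : ℝ)) j := by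
      simp only [hft, PiLp.add_apply, h1, zero_add]
      rw [hLw]
      simp [clip_apply, max_eq_right hi.le]
    have := hq j
    rw [h6] at this
    nlinarith
  refine ⟨U, φ '' U, φ.symm, hUo, φ.isOpen_image_of_subset_source hUo inter_subset_left,
    ⟨hstrict.mem_toOpenPartialHomeomorph_source, Metric.mem_ball_self hδ⟩,
    fun v hv => (hδu v hv.2).2.2, ?_, ?_, ?_, ?_, ?_⟩
  · intro v hv
    refine ⟨hfQ (hUD hv), v, hv.2, ?_⟩
    rw [hφ, hft_eq v hv.1]
  · rintro w ⟨hw, v, hv, rfl⟩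
    rw [φ.left_inv hv.1]
    rw [hφ] at hw
    exact ⟨hback v hv hw, hv⟩
  · intro v hv
    rw [← hft_eq v hv.1, ← hφ, φ.left_inv hv.2.1]
  · rintro w ⟨hw, v, hv, rfl⟩
    rw [φ.left_inv hv.1, hφ, hft_eq]
    rw [hφ] at hw
    exact hback v hv hw
  · have hWo : IsOpen (φ '' U) := φ.isOpen_image_of_subset_source hUo inter_subset_left
    have hmaps : MapsTo φ.symm (quad n ∩ φ '' U) (quad n ∩ U) := by
      rintro w ⟨hw, v, hv, rfl⟩
      rw [φ.left_inv hv.1]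
      rw [hφ] at hw
      exact ⟨hback v hv hw, hv⟩
    refine contDiffOn_of_inverse (S := quad n ∩ U) (uniqueDiffOn_quad_inter hUo)
      (uniqueDiffOn_quad_inter hWo) (hf.mono hUD) ?_ hmaps ?_ ?_
    · refine φ.continuousOn_symm.mono ?_
      rintro w ⟨-, v, hv, rfl⟩
      exact φ.map_source hv.1
    · rintro w ⟨hw, v, hv, rfl⟩
      rw [φ.left_inv hv.1, hφ, hft_eq]
      rw [hφ] at hw
      exact hback v hv hw
    · intro v hv
      have : fderivWithin ℝ f (quad n ∩ U) v = fderivWithin ℝ f D v :=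
        ((hfd v (hUD hv)).mono hUD).fderivWithin (uniqueDiffOn_quad_inter hUo v hv)
      rw [this]
      exact (hδu v hv.2.2).1 hv.1

/-- **Hadamard's lemma** on the quadrant. -/
theorem exists_eq_coord_mul {n : ℕ} {v₀ : E n} (hv₀ : v₀ ∈ quad n) {r : ℝ} (hr : 0 < r)
    {i : Fin n} (hi : v₀ i = 0) {g : E n → ℝ}
    (hg : ContDiffOn ℝ ∞ g (quad n ∩ Metric.ball v₀ r))
    (h0 : ∀ v ∈ quad n ∩ Metric.ball v₀ r, v i = 0 → g v = 0) :
    ∃ e : E n → ℝ, ContDiffOn ℝ ∞ e (quad n ∩ Metric.ball v₀ r) ∧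
      (∀ v ∈ quad n ∩ Metric.ball v₀ r, g v = v i * e v) ∧
      e v₀ = fderivWithin ℝ g (quad n ∩ Metric.ball v₀ r) v₀ (EuclideanSpace.single i 1) := by
  set D := quad n ∩ Metric.ball v₀ r with hD
  have hu : UniqueDiffOn ℝ D := uniqueDiffOn_quad_inter Metric.isOpen_ball
  have hc : Convex ℝ D := convex_quad_inter_ball v₀ r
  -- Projection to the face `i`. As `v₀ i = 0` it does not increase the distance to `v₀`, so the
  -- segment from `κ v` to `v` stays in the domain; the quotient is the average of `∂_i g` over it.
  let κ : E n → E n := fun v => v - v i • EuclideanSpace.single i (1 : ℝ)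
  have hκ : ContDiff ℝ ∞ κ :=
    contDiff_id.sub (((EuclideanSpace.proj (𝕜 := ℝ) i).contDiff).smul contDiff_const)
  have hκi : ∀ v, κ v i = 0 := fun v => by simp [κ]
  have hκj : ∀ v j, j ≠ i → κ v j = v j := fun v j hj => by simp [κ, hj]
  have hκD : MapsTo κ D D := by
    intro v hv
    refine ⟨fun j => ?_, ?_⟩
    · rcases eq_or_ne j i with rfl | hj
      · exact (hκi v).ge
      · rw [hκj v j hj]
        exact hv.1 j
    · have := hv.2
      rw [Metric.mem_ball, dist_eq_norm] at this ⊢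
      refine lt_of_le_of_lt ?_ this
      rw [EuclideanSpace.norm_eq, EuclideanSpace.norm_eq]
      apply Real.sqrt_le_sqrt
      refine Finset.sum_le_sum fun j _ => ?_
      rcases eq_or_ne j i with rfl | hj
      · simpa [hκi v, hi] using sq_nonneg (v j)
      · simp [hκj v j hj]
  have hfd : ∀ v ∈ D, HasFDerivWithinAt g (fderivWithin ℝ g D v) D v := fun v hv =>
    (hg.differentiableOn (by simp) v hv).hasFDerivWithinAt
  let g1 : E n → ℝ := fun v => fderivWithin ℝ g D v (EuclideanSpace.single i 1)
  have hg1 : ContDiffOn ℝ ∞ g1 D := (hg.fderivWithin hu (by simp)).clm_apply contDiffOn_const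
  refine ⟨fun v => ∫ s in (0 : ℝ)..1, g1 (κ v + s • (v - κ v)),
    contDiffOn_average hc (interior_quad_inter_nonempty hv₀ Metric.isOpen_ball
      (Metric.mem_ball_self hr)) hg1 hκ hκD, fun v hv => ?_, ?_⟩
  · have hseg : ∀ s ∈ Icc (0 : ℝ) 1, κ v + s • (v - κ v) ∈ D := fun s hs =>
      hc.add_smul_sub_mem (hκD hv) hv hs
    have hdir : v - κ v = v i • EuclideanSpace.single i (1 : ℝ) := by simp [κ]
    have hder : ∀ s ∈ Icc (0 : ℝ) 1, HasDerivWithinAt (fun s => g (κ v + s • (v - κ v)))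
        (v i * g1 (κ v + s • (v - κ v))) (Icc 0 1) s := by
      intro s hs
      have h1 : HasDerivWithinAt (fun s : ℝ => κ v + s • (v - κ v)) (v - κ v) (Icc 0 1) s := by
        simpa using (((hasDerivAt_id s).smul_const (v - κ v)).const_add (κ v)).hasDerivWithinAt
      have h2 := (hfd _ (hseg s hs)).comp_hasDerivWithinAt s h1 hseg
      have h3 : fderivWithin ℝ g D (κ v + s • (v - κ v)) (v - κ v) =
          v i * g1 (κ v + s • (v - κ v)) := by
        conv_lhs => rw [hdir]
        rw [map_smul, ← hdir]
        rfl
      rw [← h3]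
      exact h2
    have hcont : ContinuousOn (fun s : ℝ => v i * g1 (κ v + s • (v - κ v))) (Icc 0 1) :=
      continuousOn_const.mul (hg1.continuousOn.comp (by fun_prop) hseg)
    have h4 := intervalIntegral.integral_eq_sub_of_hasDerivAt_of_le zero_le_one
      (f := fun s => g (κ v + s • (v - κ v)))
      (fun s hs => (hder s hs).continuousWithinAt)
      (fun s hs => (hder s (Ioo_subset_Icc_self hs)).hasDerivAt (Icc_mem_nhds hs.1 hs.2))
      (ContinuousOn.intervalIntegrable (by rwa [uIcc_of_le zero_le_one]))
    have h5 : g (κ v) = 0 := h0 _ (hκD hv) (hκi v)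
    simp only [one_smul, add_sub_cancel, zero_smul, add_zero, h5, sub_zero] at h4
    rw [← h4, intervalIntegral.integral_const_mul]
  · have : κ v₀ = v₀ := by simp [κ, hi]
    simp [this, g1]

/-! ### Matching of boundary faces -/

/-- Suppose that functions `h j`, `j ∈ J`, with independent derivatives at `y₀`, vanish at `y₀`, are
nonnegative, and that the boundary of the quadrant is the union of their zero sets. Then they
correspond bijectively to the faces of the quadrant at `y₀`. -/
theorem exists_face_bijection {m : ℕ} {h : E m → E (m + 1)} {J : Set (Fin (m + 1))} {y₀ : E m}
    (hy₀ : y₀ ∈ quad m) {r : ℝ} (hr : 0 < r)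
    (hh : ContDiffOn ℝ ∞ h (quad m ∩ Metric.ball y₀ r))
    (hnn : ∀ j ∈ J, ∀ y ∈ quad m ∩ Metric.ball y₀ r, 0 ≤ h y j)
    (hJ0 : ∀ j ∈ J, h y₀ j = 0)
    (hbd : ∀ y ∈ quad m ∩ Metric.ball y₀ r, (∃ i, y i = 0) → ∃ j ∈ J, h y j = 0)
    (hsurj : ∀ c : Fin (m + 1) → ℝ, ∃ w, ∀ j ∈ J,
      fderivWithin ℝ h (quad m ∩ Metric.ball y₀ r) y₀ w j = c j) :
    ∃ r' > 0, r' ≤ r ∧ ∃ τ : Fin m → Fin (m + 1), BijOn τ {i | y₀ i = 0} J ∧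
      (∀ i, y₀ i = 0 → ∀ y ∈ quad m ∩ Metric.ball y₀ r', y i = 0 → h y (τ i) = 0) ∧
      ∀ i, y₀ i = 0 → 0 < fderivWithin ℝ h (quad m ∩ Metric.ball y₀ r) y₀
        (EuclideanSpace.single i 1) (τ i) := by
  set D := quad m ∩ Metric.ball y₀ r with hD
  set L := fderivWithin ℝ h D y₀ with hL
  have hu : UniqueDiffOn ℝ D := uniqueDiffOn_quad_inter Metric.isOpen_ball
  have hy₀D : y₀ ∈ D := ⟨hy₀, Metric.mem_ball_self hr⟩
  have hbn : Metric.ball y₀ r ∈ 𝓝 y₀ := Metric.ball_mem_nhds _ hr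
  have hdj : ∀ y ∈ D, ∀ j, HasFDerivWithinAt (fun x => h x j)
      ((EuclideanSpace.proj (𝕜 := ℝ) j).comp (fderivWithin ℝ h D y)) D y := fun y hy j =>
    (EuclideanSpace.proj (𝕜 := ℝ) j).hasFDerivAt.comp_hasFDerivWithinAt y
      (hh.differentiableOn (by simp) y hy).hasFDerivWithinAt
  have hLnn : ∀ j ∈ J, ∀ k, 0 ≤ L (EuclideanSpace.single k 1) j := fun j hj k =>
    deriv_nonneg_of_inward hy₀ hbn (hdj y₀ hy₀D j) (hJ0 j hj) (hnn j hj)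
      (add_single_mem_quad hy₀ zero_le_one)
  have hL0 : ∀ j ∈ J, ∀ k, y₀ k ≠ 0 → L (EuclideanSpace.single k 1) j = 0 := fun j hj k hk =>
    deriv_single_eq_zero_of_pos hy₀ hbn (hdj y₀ hy₀D j) (hJ0 j hj) (hnn j hj)
      (lt_of_le_of_ne (hy₀ k) (Ne.symm hk))
  have hexp : ∀ j w, L w j = ∑ k, w k * L (EuclideanSpace.single k 1) j := by
    intro j w
    conv_lhs => rw [eq_sum_single w]
    simp [Finset.sum_apply]
  -- each face has a function whose derivative is concentrated on it
  have hex : ∀ i, y₀ i = 0 → ∃ j ∈ J, ∀ k, k ≠ i → L (EuclideanSpace.single k 1) j = 0 := by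
    intro i hi
    -- A direction into the relative interior of the face `i`. All points of the ray are boundary
    -- points, and there are finitely many `j`, so a single `h j` vanishes for arbitrarily small
    -- parameters; hence its derivative along `w` is zero.
    let w : E m := WithLp.toLp 2 fun k => if k = i then 0 else 1
    have hw : y₀ + w ∈ quad m := by
      intro k
      have := hy₀ k
      by_cases hk : k = i <;> simp [w, hk] <;> first | linarith | (subst hk; linarith)
    have hfr : ∃ j ∈ J, ∃ᶠ s in 𝓝[>] (0 : ℝ), h (y₀ + s • w) j = 0 := by
      by_contra hcon
      push Not at hcon
      have : ∀ᶠ s in 𝓝[>] (0 : ℝ), ∀ j, j ∈ J → h (y₀ + s • w) j ≠ 0 := by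
        refine eventually_all.2 fun j => ?_
        by_cases hj : j ∈ J
        · filter_upwards [hcon j hj] with s hs _ using hs
        · exact Eventually.of_forall fun s hj' => absurd hj' hj
      obtain ⟨s, hs1, hs2⟩ := (this.and (eventually_ray_mem hy₀ hbn hw)).exists
      obtain ⟨j, hj, hj0⟩ := hbd _ hs2 ⟨i, by simp [w, hi]⟩
      exact hs1 j hj hj0
    obtain ⟨j, hj, hfr⟩ := hfr
    refine ⟨j, hj, ?_⟩
    have hlim := tendsto_ray hy₀ hbn (hdj y₀ hy₀D j) (hJ0 j hj) hw
    have hw0 : L w j = 0 := by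
      by_contra hne
      have := hlim.eventually (isOpen_ne.mem_nhds hne)
      obtain ⟨s, hs1, hs2⟩ := (hfr.and_eventually this).exists
      rw [hs1, mul_zero] at hs2
      exact hs2 rfl
    -- The derivative along `w` is a sum of nonnegative partial derivatives, so each of those with
    -- index other than `i` vanishes.
    rw [hexp, Finset.sum_eq_zero_iff_of_nonneg] at hw0
    · intro k hk
      have := hw0 k (Finset.mem_univ k)
      simpa [w, hk] using this
    · intro k _
      refine mul_nonneg ?_ (hLnn j hj k)
      by_cases hk : k = i <;> simp [w, hk]
  choose! τ hτJ hτ using hex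
  have hone : ∀ i, y₀ i = 0 → ∀ w, L w (τ i) = w i * L (EuclideanSpace.single i 1) (τ i) := by
    intro i hi w
    rw [hexp, Finset.sum_eq_single i]
    · intro k _ hk
      rw [hτ i hi k hk, mul_zero]
    · simp
  have hpos : ∀ i, y₀ i = 0 → 0 < L (EuclideanSpace.single i 1) (τ i) := by
    intro i hi
    refine lt_of_le_of_ne (hLnn _ (hτJ i hi) i) fun h0 => ?_
    obtain ⟨w, hw⟩ := hsurj fun _ => 1
    have := hw _ (hτJ i hi)
    rw [hone i hi, ← h0, mul_zero] at this
    exact zero_ne_one this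
  have hτinj : InjOn τ {i | y₀ i = 0} := by
    intro i hi k hk hik
    by_contra hne
    have h1 := hτ k hk i hne
    have h2 := hpos i hi
    rw [hik, h1] at h2
    exact lt_irrefl _ h2
  have hτsurj : SurjOn τ {i | y₀ i = 0} J := by
    intro j hj
    by_contra hcon
    -- If `j` were not hit, take `w` along which `h j` has derivative `1` and the others `0`. The
    -- others force all face coordinates of `w` to vanish, but the derivative of `h j` depends only
    -- on these.
    obtain ⟨w, hw⟩ := hsurj fun j' => if j' = j then 1 else 0
    have h1 : ∀ i, y₀ i = 0 → w i = 0 := by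
      intro i hi
      have h2 := hw _ (hτJ i hi)
      have hne : τ i ≠ j := fun h => hcon ⟨i, hi, h⟩
      rw [hone i hi, if_neg hne] at h2
      exact (mul_eq_zero.1 h2).resolve_right (hpos i hi).ne'
    have h3 := hw j hj
    rw [hexp, Finset.sum_eq_zero] at h3
    · simp at h3
    · intro k _
      by_cases hk : y₀ k = 0
      · rw [h1 k hk, zero_mul]
      · rw [hL0 j hj k hk, mul_zero]
  have hτbij : BijOn τ {i | y₀ i = 0} J := ⟨fun i hi => hτJ i hi, hτinj, hτsurj⟩
  -- a neighbourhood where the derivatives stay positive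
  have hcont : ContinuousOn (fderivWithin ℝ h D) D :=
    (hh.fderivWithin (m := 0) hu (by simp)).continuousOn
  have hev : ∀ᶠ y in 𝓝[D] y₀, ∀ i, y₀ i = 0 →
      0 < fderivWithin ℝ h D y (EuclideanSpace.single i 1) (τ i) := by
    refine eventually_all.2 fun i => ?_
    by_cases hi : y₀ i = 0
    · have hc : ContinuousOn (fun y => fderivWithin ℝ h D y (EuclideanSpace.single i 1) (τ i)) D :=
        (EuclideanSpace.proj (𝕜 := ℝ) (τ i)).continuous.comp_continuousOn
          (hcont.clm_apply continuousOn_const)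
      filter_upwards [(hc y₀ hy₀D).eventually (lt_mem_nhds (hpos i hi))] with y hy _ using hy
    · exact Eventually.of_forall fun y h' => absurd h' hi
  have hDn : 𝓝[D] y₀ = 𝓝[quad m] y₀ := nhdsWithin_inter_of_mem' (mem_nhdsWithin_of_mem_nhds hbn)
  rw [hDn, eventually_nhdsWithin_iff] at hev
  obtain ⟨δ, hδ, hδu⟩ := Metric.eventually_nhds_iff_ball.1 (hev.and (eventually_pos_of_pos y₀))
  have hsub : quad m ∩ Metric.ball y₀ (min δ r) ⊆ D :=
    inter_subset_inter_right _ (Metric.ball_subset_ball (min_le_right _ _))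
  have hface : ∀ i, y₀ i = 0 → ∀ y ∈ quad m ∩ Metric.ball y₀ (min δ r), y i = 0 →
      (∀ k, k ≠ i → 0 < y k) → h y (τ i) = 0 := by
    intro i hi y hy hyi hyk
    obtain ⟨j, hj, hj0⟩ := hbd y (hsub hy) ⟨i, hyi⟩
    obtain ⟨k, hk, rfl⟩ := hτsurj hj
    rcases eq_or_ne k i with rfl | hki
    · exact hj0
    -- At a point on the face `i` only, some `h (τ k)` vanishes. If `k ≠ i`, coordinate `k` is
    -- positive there, so the derivative of `h (τ k)` in direction `k` would be zero; near `y₀` it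
    -- is positive.
    have h1 := deriv_single_eq_zero_of_pos hy.1
      (Metric.isOpen_ball.mem_nhds (hsub hy).2) (hdj y (hsub hy) (τ k)) hj0 (hnn _ hj) (hyk k hki)
    have h2 := (hδu y (Metric.ball_subset_ball (min_le_left _ _) hy.2)).1 hy.1 k hk
    exact absurd h1 h2.ne'
  refine ⟨min δ r, lt_min hδ hr, min_le_right _ _, τ, hτbij, ?_, hpos⟩
  intro i hi y hy hyi
  -- An arbitrary point of the face is a limit of points that lie on no other face, and `h` is
  -- continuous.
  let w : E m := WithLp.toLp 2 fun k => if k = i then 0 else 1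
  have hw : y + w ∈ quad m := by
    intro k
    have := hy.1 k
    by_cases hk : k = i
    · simpa [w, hk] using hy.1 i
    · simp only [PiLp.add_apply, w, hk, if_false]
      linarith
  have hc : Continuous fun s : ℝ => y + s • w := by fun_prop
  have hc0 := hc.tendsto 0
  simp only [zero_smul, add_zero] at hc0
  have hray := eventually_ray_mem hy.1 (Metric.isOpen_ball.mem_nhds hy.2) hw
  have ht : Tendsto (fun s : ℝ => h (y + s • w) (τ i)) (𝓝[>] 0) (𝓝 (h y (τ i))) := by
    have h1 := (hdj y (hsub hy) (τ i)).continuousWithinAt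
    refine h1.tendsto.comp (tendsto_nhdsWithin_iff.2
      ⟨hc0.mono_left nhdsWithin_le_nhds, hray.mono fun s hs => hsub hs⟩)
  refine tendsto_nhds_unique ht (tendsto_const_nhds.congr' ?_)
  filter_upwards [hray, self_mem_nhdsWithin] with s hs hs0
  refine (hface i hi _ hs (by simp [w, hyi]) fun k hk => ?_).symm
  have := hy.1 k
  have hs0' : 0 < s := hs0
  simp only [PiLp.add_apply, PiLp.smul_apply, w, hk, if_false, smul_eq_mul, mul_one]
  linarith

/-! ### Derivative of a determinant along a linear differential equation -/

/-- Liouville's formula. The derivative of the determinant replaces one row at a time; replacing row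
`i` by a combination of all rows with coefficients `C i k` multiplies the determinant by `C i i`. -/
theorem hasDerivWithinAt_det {n : ℕ} {a : ℝ → Matrix (Fin n) (Fin n) ℝ} {C : Matrix (Fin n) (Fin n) ℝ}
    {t : ℝ} {s : Set ℝ}
    (h : ∀ i k, HasDerivWithinAt (fun t => a t i k) ((C * a t) i k) s t) :
    HasDerivWithinAt (fun t => (a t).det) (C.trace * (a t).det) s t := by
  let D : ContinuousMultilinearMap ℝ (fun _ : Fin n => Fin n → ℝ) ℝ :=
    { (Matrix.detRowAlternating : (Fin n → ℝ) [⋀^Fin n]→ₗ[ℝ] ℝ).toMultilinearMap with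
      cont := by
        have : Continuous fun M : Matrix (Fin n) (Fin n) ℝ => M.det :=
          Continuous.matrix_det continuous_id
        exact this }
  have hD : ∀ M : Matrix (Fin n) (Fin n) ℝ, D M = M.det := fun M => rfl
  have h1 : HasDerivWithinAt (fun t => (fun i => a t i : Fin n → Fin n → ℝ))
      (fun i => (C * a t) i) s t :=
    hasDerivWithinAt_pi.2 fun i => hasDerivWithinAt_pi.2 fun k => h i k
  have h2 := (D.hasFDerivAt (fun i => a t i)).comp_hasDerivWithinAt t h1
  have h3 : D.linearDeriv (fun i => a t i) (fun i => (C * a t) i) = C.trace * (a t).det := by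
    rw [ContinuousMultilinearMap.linearDeriv_apply, Matrix.trace, Finset.sum_mul]
    refine Finset.sum_congr rfl fun i _ => ?_
    have h4 : (C * a t) i = ∑ k, C i k • (a t) k := by
      ext k
      simp [Matrix.mul_apply, Finset.sum_apply]
    rw [h4]
    have := Matrix.det_updateRow_sum (a t) i (fun k => C i k)
    rw [smul_eq_mul] at this
    exact this
  rw [h3] at h2
  exact h2

/-! ### Local coordinates -/

section Coord

variable {n : ℕ} {M : Type*} [TopologicalSpace M] [ChartedSpace (EuclideanQuadrant n) M]

/-- The differential of a vector valued function, as a map of model spaces. -/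
def diff {F : Type*} [NormedAddCommGroup F] [NormedSpace ℝ F] (f : M → F) (p : M) : E n →L[ℝ] F :=
  mfderiv (Q n) 𝓘(ℝ, F) f p

/-- The differential of a map from the quadrant to a manifold, as a map of model spaces. -/
def diffSymm (Φ : E n → M) (v : E n) : E n →L[ℝ] E n :=
  mfderivWithin 𝓘(ℝ, E n) (Q n) Φ (quad n) v

/-- `H`, with inverse `Φ`, is a smooth coordinate system on the open set `N`. -/
structure IsCoord (N : Set M) (H : M → E n) (Φ : E n → M) : Prop where
  isOpen : IsOpen N
  contMDiffOn : ContMDiffOn (Q n) 𝓘(ℝ, E n) ∞ H N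
  exists_isOpen : ∃ U, IsOpen U ∧ H '' N = quad n ∩ U
  contMDiffOn_symm : ContMDiffOn 𝓘(ℝ, E n) (Q n) ∞ Φ (H '' N)
  left_inv : ∀ p ∈ N, Φ (H p) = p

namespace IsCoord

variable {N : Set M} {H : M → E n} {Φ : E n → M}

theorem right_inv (h : IsCoord N H Φ) {v : E n} (hv : v ∈ H '' N) : H (Φ v) = v := by
  obtain ⟨p, hp, rfl⟩ := hv
  rw [h.left_inv p hp]

theorem mapsTo_symm (h : IsCoord N H Φ) {v : E n} (hv : v ∈ H '' N) : Φ v ∈ N := by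
  obtain ⟨p, hp, rfl⟩ := hv
  rwa [h.left_inv p hp]

theorem mem_quad (h : IsCoord N H Φ) {p : M} (hp : p ∈ N) : H p ∈ quad n := by
  obtain ⟨U, -, hU⟩ := h.exists_isOpen
  exact (hU ▸ mem_image_of_mem H hp : H p ∈ quad n ∩ U).1

theorem image_subset_quad (h : IsCoord N H Φ) : H '' N ⊆ quad n := by
  rintro _ ⟨p, hp, rfl⟩
  exact h.mem_quad hp

theorem image_mem_nhdsWithin (h : IsCoord N H Φ) {p : M} (hp : p ∈ N) :
    H '' N ∈ 𝓝[quad n] (H p) := by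
  obtain ⟨U, hU, hUe⟩ := h.exists_isOpen
  rw [hUe]
  exact inter_mem_nhdsWithin _ (hU.mem_nhds (hUe ▸ mem_image_of_mem H hp : H p ∈ quad n ∩ U).2)

theorem nhdsWithin_image (h : IsCoord N H Φ) {p : M} (hp : p ∈ N) :
    𝓝[H '' N] (H p) = 𝓝[quad n] (H p) :=
  le_antisymm (nhdsWithin_mono _ h.image_subset_quad)
    (nhdsWithin_le_iff.2 (h.image_mem_nhdsWithin hp))

theorem uniqueDiffOn_image (h : IsCoord N H Φ) : UniqueDiffOn ℝ (H '' N) := by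
  obtain ⟨U, hU, hUe⟩ := h.exists_isOpen
  rw [hUe]
  exact uniqueDiffOn_quad_inter hU

theorem continuousOn (h : IsCoord N H Φ) : ContinuousOn H N := h.contMDiffOn.continuousOn

theorem continuousOn_symm (h : IsCoord N H Φ) : ContinuousOn Φ (H '' N) :=
  h.contMDiffOn_symm.continuousOn

theorem tendsto_symm (h : IsCoord N H Φ) {p : M} (hp : p ∈ N) :
    Tendsto Φ (𝓝[quad n] (H p)) (𝓝 p) := by
  have := h.continuousOn_symm (H p) (mem_image_of_mem H hp)
  rw [ContinuousWithinAt, h.nhdsWithin_image hp, h.left_inv p hp] at this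
  exact this

/-- Smaller open subsets of the domain. -/
theorem mono (h : IsCoord N H Φ) {N' : Set M} (hN' : IsOpen N') (hs : N' ⊆ N) :
    IsCoord N' H Φ where
  isOpen := hN'
  contMDiffOn := h.contMDiffOn.mono hs
  exists_isOpen := by
    obtain ⟨U, hU, hUe⟩ := h.exists_isOpen
    obtain ⟨V, hV, hVe⟩ := (continuousOn_iff'.1 h.continuousOn_symm) N' hN'
    refine ⟨U ∩ V, hU.inter hV, ?_⟩
    have : H '' N' = Φ ⁻¹' N' ∩ H '' N := by
      ext v
      constructor
      · rintro ⟨p, hp, rfl⟩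
        exact ⟨by rw [mem_preimage, h.left_inv p (hs hp)]; exact hp, mem_image_of_mem H (hs hp)⟩
      · rintro ⟨hv, hv'⟩
        exact ⟨Φ v, hv, h.right_inv hv'⟩
    rw [this, hVe, hUe]
    ext v
    simp only [mem_inter_iff]
    tauto
  contMDiffOn_symm := h.contMDiffOn_symm.mono (image_mono hs)
  left_inv p hp := h.left_inv p (hs hp)

/-- The preimage of a relatively open set. -/
theorem isOpen_inter_preimage (h : IsCoord N H Φ) {U : Set (E n)} (hU : IsOpen U) :
    IsOpen (N ∩ H ⁻¹' U) :=
  h.continuousOn.isOpen_inter_preimage h.isOpen hU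

theorem image_inter_preimage (U : Set (E n)) : H '' (N ∩ H ⁻¹' U) = H '' N ∩ U :=
  Set.image_inter_preimage H N U

theorem contMDiffOn_comp_symm (h : IsCoord N H Φ) {F : Type*} [NormedAddCommGroup F]
    [NormedSpace ℝ F] {f : M → F} {N' : Set M} (hN' : N' ⊆ N)
    (hf : ContMDiffOn (Q n) 𝓘(ℝ, F) ∞ f N') : ContDiffOn ℝ ∞ (f ∘ Φ) (H '' N') := by
  rw [← contMDiffOn_iff_contDiffOn]
  refine hf.comp (h.contMDiffOn_symm.mono (image_mono hN')) ?_
  rintro _ ⟨p, hp, rfl⟩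
  rw [mem_preimage, h.left_inv p (hN' hp)]
  exact hp

theorem contMDiffOn_of_comp (h : IsCoord N H Φ) {F : Type*} [NormedAddCommGroup F]
    [NormedSpace ℝ F] {g : E n → F} {s : Set (E n)} (hg : ContDiffOn ℝ ∞ g s) {N' : Set M}
    (hN' : N' ⊆ N) (hs : MapsTo H N' s) : ContMDiffOn (Q n) 𝓘(ℝ, F) ∞ (fun p => g (H p)) N' :=
  hg.contMDiffOn.comp (h.contMDiffOn.mono hN') hs

variable [IsManifold (Q n) ∞ M]

theorem extChartAt (c : M) :
    IsCoord (chartAt (EuclideanQuadrant n) c).source (extChartAt (Q n) c)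
      (extChartAt (Q n) c).symm where
  isOpen := (chartAt (EuclideanQuadrant n) c).open_source
  contMDiffOn := contMDiffOn_extChartAt
  exists_isOpen := by
    refine ⟨(Q n).symm ⁻¹' (chartAt (EuclideanQuadrant n) c).target,
      (chartAt (EuclideanQuadrant n) c).open_target.preimage (Q n).continuous_symm, ?_⟩
    rw [← extChartAt_source (Q n), PartialEquiv.image_source_eq_target, extChartAt_target, range_Q,
      inter_comm]
  contMDiffOn_symm := by
    rw [← extChartAt_source (Q n), PartialEquiv.image_source_eq_target]
    exact contMDiffOn_extChartAt_symm c
  left_inv p hp := (_root_.extChartAt (Q n) c).left_inv (by rwa [extChartAt_source])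

/-- The derivative of the inverse coordinate map. -/
theorem hasMFDerivWithinAt_symm (h : IsCoord N H Φ) {v : E n} (hv : v ∈ H '' N) :
    HasMFDerivWithinAt 𝓘(ℝ, E n) (Q n) Φ (quad n) v
      (mfderivWithin 𝓘(ℝ, E n) (Q n) Φ (quad n) v) := by
  have h1 := (h.contMDiffOn_symm v hv).mdifferentiableWithinAt (by simp)
  obtain ⟨p, hp, rfl⟩ := hv
  exact (h1.mono_of_mem_nhdsWithin (h.image_mem_nhdsWithin hp)).hasMFDerivWithinAt

theorem hasMFDerivAt (h : IsCoord N H Φ) {p : M} (hp : p ∈ N) :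
    HasMFDerivAt (Q n) 𝓘(ℝ, E n) H p (mfderiv (Q n) 𝓘(ℝ, E n) H p) :=
  (((h.contMDiffOn p hp).contMDiffAt (h.isOpen.mem_nhds hp)).mdifferentiableAt
    (by simp)).hasMFDerivAt

theorem diff_diffSymm (h : IsCoord N H Φ) {v : E n} (hv : v ∈ H '' N) (w : E n) :
    diff H (Φ v) (diffSymm Φ v w) = w := by
  have h1 := hasMFDerivWithinAt_iff_hasFDerivWithinAt.1
    ((h.hasMFDerivAt (h.mapsTo_symm hv)).comp_hasMFDerivWithinAt v (h.hasMFDerivWithinAt_symm hv))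
  have h2 : HasFDerivWithinAt (H ∘ Φ) (ContinuousLinearMap.id ℝ (E n)) (quad n) v := by
    refine (hasFDerivWithinAt_id v (quad n)).congr_of_eventuallyEq ?_ (h.right_inv hv)
    obtain ⟨p, hp, rfl⟩ := hv
    filter_upwards [h.image_mem_nhdsWithin hp] with u hu using h.right_inv hu
  have h3 := uniqueDiffOn_quad n v (h.image_subset_quad hv)
  exact congrArg (fun L : E n →L[ℝ] E n => L w) (h3.eq h1 h2)

theorem diffSymm_diff (h : IsCoord N H Φ) {p : M} (hp : p ∈ N) (w : E n) :
    diffSymm Φ (H p) (diff H p w) = w := by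
  have key : ∀ a, diff H p (diffSymm Φ (H p) a) = a := by
    intro a
    have h1 := h.diff_diffSymm (mem_image_of_mem H hp) a
    rwa [h.left_inv p hp] at h1
  have hsurj : Function.Surjective (diffSymm Φ (H p) : E n →ₗ[ℝ] E n) := by
    rw [← LinearMap.injective_iff_surjective]
    intro a b hab
    rw [← key a, ← key b]
    exact congrArg _ hab
  obtain ⟨a, rfl⟩ := hsurj w
  exact congrArg (diffSymm Φ (H p)) (key a)

/-- The chain rule in coordinates. -/
theorem hasFDerivWithinAt_comp_symm (h : IsCoord N H Φ) {F : Type*} [NormedAddCommGroup F]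
    [NormedSpace ℝ F] {f : M → F} {v : E n} (hv : v ∈ H '' N)
    (hf : MDifferentiableAt (Q n) 𝓘(ℝ, F) f (Φ v)) :
    HasFDerivWithinAt (f ∘ Φ) ((diff f (Φ v)).comp (diffSymm Φ v)) (quad n) v :=
  hasMFDerivWithinAt_iff_hasFDerivWithinAt.1
    (hf.hasMFDerivAt.comp_hasMFDerivWithinAt v (h.hasMFDerivWithinAt_symm hv))

theorem diff_eq (h : IsCoord N H Φ) {F : Type*} [NormedAddCommGroup F] [NormedSpace ℝ F]
    {f : M → F} {p : M} (hp : p ∈ N) (hf : MDifferentiableAt (Q n) 𝓘(ℝ, F) f p) (w : E n) :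
    diff f p w = fderivWithin ℝ (f ∘ Φ) (quad n) (H p) (diff H p w) := by
  have hf' : MDifferentiableAt (Q n) 𝓘(ℝ, F) f (Φ (H p)) := by rwa [h.left_inv p hp]
  rw [(h.hasFDerivWithinAt_comp_symm (mem_image_of_mem H hp) hf').fderivWithin
    (uniqueDiffOn_quad n _ (h.mem_quad hp)), ContinuousLinearMap.comp_apply, h.diffSymm_diff hp,
    h.left_inv p hp]

end IsCoord

/-! ### Invariance of the depth -/

variable [IsManifold (Q n) ∞ M]

/-- Coordinates of `H'` that vanish at `p` have their minimum there, so their derivatives vanish in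
every direction along which one can move both ways, that is, for `H p i ≠ 0`. The injective
transition derivative therefore embeds the span of these directions into the corresponding span for
`H'`. -/
theorem card_pos_le_of_coord {N N' : Set M} {H H' : M → E n} {Φ Φ' : E n → M}
    (h : IsCoord N H Φ) (h' : IsCoord N' H' Φ') {p : M} (hp : p ∈ N) (hp' : p ∈ N') :
    Fintype.card {i // H p i ≠ 0} ≤ Fintype.card {i // H' p i ≠ 0} := by
  have hO : IsOpen (N ∩ N') := h.isOpen.inter h'.isOpen
  have hc := h.mono hO inter_subset_left
  have hpO : p ∈ N ∩ N' := ⟨hp, hp'⟩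
  obtain ⟨U, hU, hUe⟩ := hc.exists_isOpen
  have hv : H p ∈ quad n ∩ U := hUe ▸ mem_image_of_mem H hpO
  have hd : HasFDerivWithinAt (H' ∘ Φ) ((diff H' p).comp (diffSymm Φ (H p))) (quad n) (H p) := by
    have := h.hasFDerivWithinAt_comp_symm (f := H') (mem_image_of_mem H hp)
      (by rw [h.left_inv p hp]; exact (h'.hasMFDerivAt hp').mdifferentiableAt)
    rwa [h.left_inv p hp] at this
  set L := (diff H' p).comp (diffSymm Φ (H p)) with hL
  have hLinj : Function.Injective L := by
    intro a b hab
    have h1 : diffSymm Φ (H p) a = diffSymm Φ (H p) b := by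
      rw [← h'.diffSymm_diff hp' (diffSymm Φ (H p) a), ← h'.diffSymm_diff hp' (diffSymm Φ (H p) b)]
      exact congrArg _ hab
    have h2 := h.diff_diffSymm (mem_image_of_mem H hp) a
    have h3 := h.diff_diffSymm (mem_image_of_mem H hp) b
    rw [← h2, ← h3, h1]
  have hzero : ∀ i, H p i ≠ 0 → ∀ j, H' p j = 0 → L (EuclideanSpace.single i 1) j = 0 := by
    intro i hi j hj
    refine deriv_single_eq_zero_of_pos (g := fun v => H' (Φ v) j)
      (g' := (EuclideanSpace.proj (𝕜 := ℝ) j).comp L) hv.1 (hU.mem_nhds hv.2) ?_ ?_ ?_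
      (lt_of_le_of_ne (hv.1 i) (Ne.symm hi))
    · exact ((EuclideanSpace.proj (𝕜 := ℝ) j).hasFDerivAt.comp_hasFDerivWithinAt _ hd).mono
        inter_subset_left
    · simpa [h.left_inv p hp] using hj
    · intro v hv'
      rw [← hUe] at hv'
      exact h'.mem_quad (hc.mapsTo_symm hv').2 j
  let emb : ({i // H p i ≠ 0} → ℝ) →ₗ[ℝ] E n :=
    { toFun := fun c => ∑ i, c i • EuclideanSpace.single (i : Fin n) (1 : ℝ)
      map_add' := fun c d => by simp [add_smul, Finset.sum_add_distrib]
      map_smul' := fun a c => by simp [Finset.smul_sum, smul_smul] }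
  have hemb : ∀ c (i : {i // H p i ≠ 0}), emb c i = c i := by
    intro c i
    simp only [emb, LinearMap.coe_mk, AddHom.coe_mk, WithLp.ofLp_sum, Finset.sum_apply]
    rw [Finset.sum_eq_single i]
    · simp
    · intro k _ hk
      have : (i : Fin n) ≠ k := fun h => hk (Subtype.ext h.symm)
      simp [this]
    · simp
  let A : ({i // H p i ≠ 0} → ℝ) →ₗ[ℝ] ({i // H' p i ≠ 0} → ℝ) :=
    { toFun := fun c j => L (emb c) j
      map_add' := fun c d => by ext; simp
      map_smul' := fun a c => by ext; simp }
  have hA : Function.Injective A := by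
    rw [injective_iff_map_eq_zero]
    intro c hc0
    have h1 : L (emb c) = 0 := by
      ext j
      by_cases hj : H' p j = 0
      · simp only [emb, LinearMap.coe_mk, AddHom.coe_mk, map_sum, map_smul, WithLp.ofLp_sum,
          Finset.sum_apply, PiLp.smul_apply, smul_eq_mul]
        refine Finset.sum_eq_zero fun i _ => ?_
        rw [hzero i i.2 j hj, mul_zero]
      · exact congrFun hc0 ⟨j, hj⟩
    have h2 : emb c = 0 := hLinj (by rw [h1, map_zero])
    ext i
    have h3 := hemb c i
    rw [h2] at h3
    simpa using h3.symm
  have := LinearMap.finrank_le_finrank_of_injective hA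
  simpa using this

/-- The depth can be computed in any coordinate system. -/
theorem depth_eq {N : Set M} {H : M → E n} {Φ : E n → M} (h : IsCoord N H Φ) {p : M} (hp : p ∈ N) :
    depth n p = {i | H p i = 0}.ncard := by
  have hp' : p ∈ (chartAt (EuclideanQuadrant n) p).source := mem_chart_source _ p
  have h1 := card_pos_le_of_coord h (IsCoord.extChartAt p) hp hp'
  have h2 := card_pos_le_of_coord (IsCoord.extChartAt p) h hp' hp
  have key : ∀ w : E n, {i | w i = 0}.ncard + Fintype.card {i // w i ≠ 0} = n := by
    intro w
    have h3 := Set.ncard_add_ncard_compl {i | w i = 0}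
    rw [Nat.card_eq_fintype_card, Fintype.card_fin] at h3
    rw [← Nat.card_eq_fintype_card]
    exact h3
  have h3 := key (H p)
  have h4 := key (extChartAt (Q n) p p)
  unfold depth
  omega

end Coord

/-! ### Local structure of the boundary hyperfaces -/

section Hyperfaces

variable {n : ℕ} {M : Type*} [TopologicalSpace M] [ChartedSpace (EuclideanQuadrant n) M]
  [IsManifold (Q n) ∞ M]

/-- Points of the quadrant are limits of points on which only one coordinate vanishes. -/
theorem eventually_face_mem {v : E n} (hv : v ∈ quad n) {i : Fin n} (hi : v i = 0) {U : Set (E n)}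
    (hU : U ∈ 𝓝 v) : ∀ᶠ s in 𝓝[>] (0 : ℝ),
      v + s • (WithLp.toLp 2 fun k => if k = i then 0 else 1 : E n) ∈
        {w | w ∈ quad n ∩ U ∧ w i = 0 ∧ ∀ k, k ≠ i → 0 < w k} := by
  set w : E n := WithLp.toLp 2 fun k => if k = i then 0 else 1 with hw
  have hvw : v + w ∈ quad n := by
    intro k
    by_cases hk : k = i
    · simpa [w, hk] using hv i
    · simp only [PiLp.add_apply, w, hk, if_false]
      linarith [hv k]
  filter_upwards [eventually_ray_mem hv hU hvw, self_mem_nhdsWithin] with s hs hs0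
  have hs0' : 0 < s := hs0
  refine ⟨hs, by simp [w, hi], fun k hk => ?_⟩
  simp only [PiLp.add_apply, PiLp.smul_apply, w, hk, if_false, smul_eq_mul, mul_one]
  linarith [hv k]

theorem tendsto_ray_nhds (v w : E n) :
    Tendsto (fun s : ℝ => v + s • w) (𝓝[>] 0) (𝓝 v) := by
  have hc : Continuous fun s : ℝ => v + s • w := by fun_prop
  have h0 := hc.tendsto 0
  simp only [zero_smul, add_zero] at h0
  exact h0.mono_left nhdsWithin_le_nhds

/-- Near `p`, the points of depth one form convex open parts of the faces `{H_i = 0}`, each inside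
one component of the depth one set; `F i` is the closure of that component. Different `i` may yield
the same hyperface here. Injectivity appears only with defining functions. -/
theorem exists_hyperface_nhds {N : Set M} {H : M → E n} {Φ : E n → M} (h : IsCoord N H Φ) {p : M}
    (hp : p ∈ N) : ∃ δ > 0, quad n ∩ Metric.ball (H p) δ ⊆ H '' N ∧ ∃ F : Fin n → Set M,
      (∀ q ∈ N ∩ H ⁻¹' Metric.ball (H p) δ, ∀ i, H q i = 0 → H p i = 0) ∧
      (∀ i, H p i = 0 → F i ∈ hyperfaces n M) ∧
      (∀ i, H p i = 0 → ∀ q ∈ N ∩ H ⁻¹' Metric.ball (H p) δ, H q i = 0 → q ∈ F i) ∧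
      ∀ G ∈ hyperfaces n M, ∀ q ∈ N ∩ H ⁻¹' Metric.ball (H p) δ, q ∈ G →
        ∃ i, H p i = 0 ∧ G = F i ∧ H q i = 0 := by
  have hev := h.image_mem_nhdsWithin hp
  rw [mem_nhdsWithin_iff_eventually] at hev
  obtain ⟨δ, hδ, hδu⟩ := Metric.eventually_nhds_iff_ball.1 (hev.and (eventually_pos_of_pos (H p)))
  have hsub : quad n ∩ Metric.ball (H p) δ ⊆ H '' N := fun v hv => (hδu v hv.2).1 hv.1
  set O := N ∩ H ⁻¹' Metric.ball (H p) δ with hO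
  have hOo : IsOpen O := h.isOpen_inter_preimage Metric.isOpen_ball
  have hzero : ∀ v ∈ quad n ∩ Metric.ball (H p) δ, ∀ i, v i = 0 → H p i = 0 := by
    intro v hv i hi
    by_contra hne
    exact absurd ((hδu v hv.2).2 i (lt_of_le_of_ne (h.mem_quad hp i) (Ne.symm hne))) hi.le.not_gt
  set D1 : Set M := {q | depth n q = 1} with hD1
  let B : Fin n → Set (E n) := fun i =>
    {w | w ∈ quad n ∩ Metric.ball (H p) δ ∧ w i = 0 ∧ ∀ k, k ≠ i → 0 < w k}
  have hBsub : ∀ i, B i ⊆ H '' N := fun i v hv => hsub hv.1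
  have hBconv : ∀ i, Convex ℝ (B i) := by
    intro i a ha b hb s t hs ht hst
    refine ⟨convex_quad_inter_ball _ _ ha.1 hb.1 hs ht hst, by simp [ha.2.1, hb.2.1], fun k hk => ?_⟩
    exact (convex_Ioi (0 : ℝ)) (ha.2.2 k hk) (hb.2.2 k hk) hs ht hst
  have hBpre : ∀ i, IsPreconnected (Φ '' B i) := fun i =>
    (hBconv i).isPreconnected.image Φ (h.continuousOn_symm.mono (hBsub i))
  have hBD1 : ∀ i, Φ '' B i ⊆ D1 := by
    rintro i _ ⟨v, hv, rfl⟩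
    have : {k | H (Φ v) k = 0} = {i} := by
      ext k
      rw [h.right_inv (hBsub i hv)]
      simp only [mem_ofPred_eq, mem_singleton_iff]
      constructor
      · intro hk
        by_contra hne
        exact (hv.2.2 k hne).ne' hk
      · rintro rfl
        exact hv.2.1
    change depth n (Φ v) = 1
    rw [depth_eq h (h.mapsTo_symm (hBsub i hv)), this, ncard_singleton]
  have hBne : ∀ i, H p i = 0 → ∃ v, v ∈ B i := by
    intro i hi
    obtain ⟨s, hs⟩ := (eventually_face_mem (h.mem_quad hp) hi (Metric.ball_mem_nhds _ hδ)).exists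
    exact ⟨_, hs⟩
  choose! b hb using hBne
  let F : Fin n → Set M := fun i => closure (connectedComponentIn D1 (Φ (b i)))
  have hBcomp : ∀ i, H p i = 0 → ∀ v ∈ B i, Φ '' B i ⊆ connectedComponentIn D1 (Φ v) := fun i hi v hv =>
    (hBpre i).subset_connectedComponentIn (mem_image_of_mem Φ hv) (hBD1 i)
  refine ⟨δ, hδ, hsub, F, ?_, ?_, ?_, ?_⟩
  · intro q hq i hi
    exact hzero _ ⟨h.mem_quad hq.1, hq.2⟩ i hi
  · intro i hi
    exact ⟨Φ (b i), hBD1 i (mem_image_of_mem Φ (hb i hi)), rfl⟩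
  · intro i hi q hq hqi
    refine closure_mono (hBcomp i hi _ (hb i hi)) ?_
    have h1 := eventually_face_mem (h.mem_quad hq.1) hqi (Metric.isOpen_ball.mem_nhds hq.2)
    have h2 : Tendsto (fun s : ℝ =>
        Φ (H q + s • (WithLp.toLp 2 fun k => if k = i then 0 else 1 : E n))) (𝓝[>] 0) (𝓝 q) := by
      refine (h.tendsto_symm hq.1).comp (tendsto_nhdsWithin_iff.2 ⟨tendsto_ray_nhds _ _, ?_⟩)
      filter_upwards [h1] with s hs using hs.1.1
    refine mem_closure_of_tendsto h2 ?_
    filter_upwards [h1] with s hs using mem_image_of_mem Φ hs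
  · rintro G ⟨p', hp', rfl⟩ q hq hqG
    by_contra hcon
    push Not at hcon
    set C := connectedComponentIn {q : M | depth n q = 1} p' with hC
    have hnb : ∀ᶠ q' in 𝓝 q, q' ∈ O ∧ ∀ i, H p i = 0 → closure C = F i → H q' i ≠ 0 := by
      refine Filter.Eventually.and (hOo.mem_nhds hq) (eventually_all.2 fun i => ?_)
      by_cases hi : H p i = 0 ∧ closure C = F i
      · have hc : ContinuousAt (fun q' => H q' i) q :=
          (EuclideanSpace.proj (𝕜 := ℝ) i).continuous.continuousAt.comp
            (h.continuousOn.continuousAt (h.isOpen.mem_nhds hq.1))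
        filter_upwards [hc.eventually_ne (hcon i hi.1 hi.2)] with q' hq' _ _ using hq'
      · exact Eventually.of_forall fun q' h1 h2 => absurd ⟨h1, h2⟩ hi
    -- Depth one points of the component are dense in `G`. Such a point near `q` lies in some `B i`,
    -- so its component is the one of `F i`, although `hnb` excludes this.
    obtain ⟨q', hq'C, hq'⟩ := ((mem_closure_iff_frequently.1 hqG).and_eventually hnb).exists
    have hd : q' ∈ D1 := connectedComponentIn_subset D1 p' hq'C
    change depth n q' = 1 at hd
    rw [depth_eq h hq'.1.1, ncard_eq_one] at hd
    obtain ⟨i, hi⟩ := hd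
    have hi0 : H q' i = 0 := (hi ▸ mem_singleton i : i ∈ {i | H q' i = 0})
    have hqv : H q' ∈ quad n ∩ Metric.ball (H p) δ := ⟨h.mem_quad hq'.1.1, hq'.1.2⟩
    have hpi : H p i = 0 := hzero _ hqv i hi0
    have hqB : H q' ∈ B i := by
      refine ⟨hqv, hi0, fun k hk => lt_of_le_of_ne (hqv.1 k) fun h0 => hk ?_⟩
      have : k ∈ ({i} : Set (Fin n)) := hi ▸ (show k ∈ {i | H q' i = 0} from h0.symm)
      exact this
    have h1 := hBcomp i hpi _ hqB (mem_image_of_mem Φ (hb i hpi))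
    rw [h.left_inv q' hq'.1.1] at h1
    have h2 : connectedComponentIn D1 (Φ (b i)) = C := by
      rw [← connectedComponentIn_eq h1, hC, connectedComponentIn_eq hq'C]
    refine hq'.2 i hpi ?_ hi0
    simp only [F, h2]

theorem exists_mem_hyperface {F : Set M} (hF : F ∈ hyperfaces n M) : ∃ p, p ∈ F := by
  obtain ⟨p, hp, rfl⟩ := hF
  exact ⟨p, subset_closure (mem_connectedComponentIn hp)⟩

/-- Near each point only hyperfaces among finitely many `F i` occur, and `M` is compact. Finiteness
matters because `finprod` over an infinite family would be a default value. -/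
theorem hyperfaces_finite [CompactSpace M] : (hyperfaces n M).Finite := by
  have key : ∀ p : M, ∃ O, IsOpen O ∧ p ∈ O ∧
      {G | G ∈ hyperfaces n M ∧ (G ∩ O).Nonempty}.Finite := by
    intro p
    have h := IsCoord.extChartAt (n := n) p
    obtain ⟨δ, hδ, -, F, -, -, -, h4⟩ := exists_hyperface_nhds h (mem_chart_source _ p)
    refine ⟨_, h.isOpen_inter_preimage Metric.isOpen_ball,
      ⟨mem_chart_source _ p, Metric.mem_ball_self hδ⟩, (finite_range F).subset ?_⟩
    rintro G ⟨hG, q, hqG, hq⟩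
    obtain ⟨i, -, hi, -⟩ := h4 G hG q hq hqG
    exact ⟨i, hi.symm⟩
  choose O hO hpO hfin using key
  obtain ⟨t, ht⟩ := isCompact_univ.elim_finite_subcover O hO fun p _ => mem_iUnion.2 ⟨p, hpO p⟩
  refine (t.finite_toSet.biUnion fun p _ => hfin p).subset ?_
  intro G hG
  obtain ⟨q, hq⟩ := exists_mem_hyperface hG
  obtain ⟨p, hp, hqp⟩ := mem_iUnion₂.1 (ht (mem_univ q))
  exact mem_biUnion hp ⟨hG, q, hq, hqp⟩

/-- The complement of the singular hyperfaces is dense. -/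
theorem frequently_notMem_sUnion {𝓕 : Set (Set M)} (h𝓕 : 𝓕 ⊆ hyperfaces n M) (p : M) :
    ∃ᶠ q in 𝓝 p, q ∉ ⋃₀ 𝓕 := by
  have h := IsCoord.extChartAt (n := n) p
  have hp := mem_chart_source (EuclideanQuadrant n) p
  obtain ⟨δ, hδ, hsub, F, -, -, -, h4⟩ := exists_hyperface_nhds h hp
  set H := extChartAt (Q n) p
  set w : E n := WithLp.toLp 2 fun _ => 1
  have hw : H p + w ∈ quad n := fun k => by
    simp only [PiLp.add_apply, w]
    linarith [h.mem_quad hp k]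
  have h1 := eventually_ray_mem (h.mem_quad hp) (Metric.ball_mem_nhds _ hδ) hw
  have h2 : Tendsto (fun s : ℝ => H.symm (H p + s • w)) (𝓝[>] 0) (𝓝 p) := by
    refine (h.tendsto_symm hp).comp (tendsto_nhdsWithin_iff.2 ⟨tendsto_ray_nhds _ _, ?_⟩)
    filter_upwards [h1] with s hs using hs.1
  refine h2.frequently (Eventually.frequently ?_)
  filter_upwards [h1, self_mem_nhdsWithin] with s hs hs0
  rintro ⟨G, hG, hqG⟩
  have hv := hsub hs
  have hs0' : 0 < s := hs0
  obtain ⟨i, -, -, hi⟩ := h4 G (h𝓕 hG) _ ⟨h.mapsTo_symm hv, by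
    rw [mem_preimage, h.right_inv hv]; exact hs.2⟩ hqG
  rw [h.right_inv hv] at hi
  simp only [PiLp.add_apply, PiLp.smul_apply, w, smul_eq_mul, mul_one] at hi
  linarith [h.mem_quad hp i]

theorem mem_sUnion_hyperfaces_iff {N : Set M} {H : M → E n} {Φ : E n → M} (h : IsCoord N H Φ)
    {p : M} (hp : p ∈ N) : p ∈ ⋃₀ hyperfaces n M ↔ ∃ i, H p i = 0 := by
  obtain ⟨δ, hδ, -, F, -, h2, h3, h4⟩ := exists_hyperface_nhds h hp
  have hpO : p ∈ N ∩ H ⁻¹' Metric.ball (H p) δ := ⟨hp, Metric.mem_ball_self hδ⟩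
  constructor
  · rintro ⟨G, hG, hpG⟩
    obtain ⟨i, hi, -⟩ := h4 G hG p hpO hpG
    exact ⟨i, hi⟩
  · rintro ⟨i, hi⟩
    exact ⟨F i, h2 i hi, h3 i hi p hpO hi⟩

/-- The boundary is the union of the boundary hyperfaces. -/
theorem mem_boundary_iff (p : M) : p ∈ (Q n).boundary M ↔ p ∈ ⋃₀ hyperfaces n M := by
  have h := IsCoord.extChartAt (n := n) p
  have hp := mem_chart_source (EuclideanQuadrant n) p
  rw [mem_sUnion_hyperfaces_iff h hp]
  change extChartAt (Q n) p p ∈ frontier (range (Q n)) ↔ _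
  rw [range_Q, (isClosed_quad n).frontier_eq, interior_quad]
  simp only [Set.mem_sdiff, mem_ofPred_eq, not_forall, not_lt]
  constructor
  · rintro ⟨h1, i, hi⟩
    exact ⟨i, le_antisymm hi (h1 i)⟩
  · rintro ⟨i, hi⟩
    exact ⟨h.mem_quad hp, i, hi.le⟩

end Hyperfaces

/-! ### Vector fields in coordinates -/

section VectorFields

variable {n : ℕ} {M : Type*} [TopologicalSpace M] [ChartedSpace (EuclideanQuadrant n) M]
  [IsManifold (Q n) ∞ M]

theorem trivializationAt_apply_eq_diff {c p : M}
    (hp : p ∈ (chartAt (EuclideanQuadrant n) c).source) (v : TangentSpace (Q n) p) :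
    (trivializationAt (E n) (TangentSpace (Q n) : M → Type _) c ⟨p, v⟩).2 =
      diff (extChartAt (Q n) c) p v := by
  have h1 := TangentBundle.continuousLinearMapAt_trivializationAt (I := Q n) hp
  have h2 : p ∈ (trivializationAt (E n) (TangentSpace (Q n) : M → Type _) c).baseSet := by
    rw [TangentBundle.trivializationAt_baseSet]
    exact hp
  have h3 := congrArg (fun L => L v) h1
  refine Eq.trans ?_ h3
  exact (congrFun (Bundle.Trivialization.coe_linearMapAt_of_mem (R := ℝ) _ h2) v).symm

theorem contMDiffOn_section_iff {U : Set M} (ho : IsOpen U) (s : (p : M) → TangentSpace (Q n) p) (c : M)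
    (hU : U ⊆ (chartAt (EuclideanQuadrant n) c).source) :
    ContMDiffOn (Q n) ((Q n).prod 𝓘(ℝ, E n)) ∞
      (fun p => Bundle.TotalSpace.mk' (E n) (E := (TangentSpace (Q n) : M → Type _)) p (s p)) U ↔
    ContMDiffOn (Q n) 𝓘(ℝ, E n) ∞ (fun p => diff (extChartAt (Q n) c) p (s p)) U := by
  have hU' : U ⊆ (trivializationAt (E n) (TangentSpace (Q n) : M → Type _) c).baseSet := by
    rw [TangentBundle.trivializationAt_baseSet]
    exact hU
  rw [Bundle.Trivialization.contMDiffOn_section_iff (IB := Q n) _ ho hU']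
  exact contMDiffOn_congr fun p hp => trivializationAt_apply_eq_diff (hU hp) (s p)

variable {N : Set M} {H : M → E n} {Φ : E n → M}

theorem IsCoord.contDiffOn_fderivWithin (h : IsCoord N H Φ) {F : Type*} [NormedAddCommGroup F]
    [NormedSpace ℝ F] {f : M → F} {N' : Set M} (ho : IsOpen N') (hN' : N' ⊆ N)
    (hf : ContMDiffOn (Q n) 𝓘(ℝ, F) ∞ f N') :
    ContDiffOn ℝ ∞ (fderivWithin ℝ (f ∘ Φ) (quad n)) (H '' N') := by
  have h' := h.mono ho hN'
  have h1 := (h'.contMDiffOn_comp_symm Subset.rfl hf).fderivWithin h'.uniqueDiffOn_image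
    (m := ∞) (by simp)
  refine h1.congr ?_
  rintro _ ⟨p, hp, rfl⟩
  exact fderivWithin_of_mem_nhdsWithin (h'.image_mem_nhdsWithin hp)
    (uniqueDiffOn_quad n _ (h'.mem_quad hp))
    ((h'.contMDiffOn_comp_symm Subset.rfl hf).differentiableOn (by simp) _ (mem_image_of_mem H hp))

theorem contMDiffOn_diff_apply_of {F : Type*} [NormedAddCommGroup F] [NormedSpace ℝ F]
    (h : IsCoord N H Φ) {N' : Set M} (ho : IsOpen N') (hN' : N' ⊆ N) {f : M → F}
    (hf : ContMDiffOn (Q n) 𝓘(ℝ, F) ∞ f N') {s : (p : M) → TangentSpace (Q n) p}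
    (hs : ContMDiffOn (Q n) 𝓘(ℝ, E n) ∞ (fun p => diff H p (s p)) N') :
    ContMDiffOn (Q n) 𝓘(ℝ, F) ∞ (fun p => diff f p (s p)) N' := by
  have h1 : ContMDiffOn (Q n) 𝓘(ℝ, E n →L[ℝ] F) ∞
      (fun p => fderivWithin ℝ (f ∘ Φ) (quad n) (H p)) N' :=
    h.contMDiffOn_of_comp (h.contDiffOn_fderivWithin ho hN' hf) hN' (mapsTo_image H N')
  refine (h1.clm_apply hs).congr ?_
  intro p hp
  exact h.diff_eq (hN' hp)
    (((hf p hp).contMDiffAt (ho.mem_nhds hp)).mdifferentiableAt (by simp)) _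

/-- The derivative of a smooth function along a smooth vector field is smooth. -/
theorem contMDiffOn_diff_apply {F : Type*} [NormedAddCommGroup F] [NormedSpace ℝ F]
    {N' : Set M} (ho : IsOpen N') {f : M → F}
    (hf : ContMDiffOn (Q n) 𝓘(ℝ, F) ∞ f N') (X : VF n M) :
    ContMDiffOn (Q n) 𝓘(ℝ, F) ∞ (fun p => diff f p (X p)) N' := by
  intro c hc
  have h := IsCoord.extChartAt (n := n) c
  set N := N' ∩ (chartAt (EuclideanQuadrant n) c).source
  have hN : IsOpen N := ho.inter h.isOpen
  have hcN : c ∈ N := ⟨hc, mem_chart_source _ c⟩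
  have h1 := (contMDiffOn_section_iff hN (fun p => X p) c inter_subset_right).1
    X.contMDiff.contMDiffOn
  have h2 := contMDiffOn_diff_apply_of h hN inter_subset_right (hf.mono inter_subset_left) h1
  exact ((h2 c hcN).contMDiffAt (hN.mem_nhds hcN)).contMDiffWithinAt

theorem contMDiffOn_section_of_coord (h : IsCoord N H Φ) (s : (p : M) → TangentSpace (Q n) p)
    (hs : ContMDiffOn (Q n) 𝓘(ℝ, E n) ∞ (fun p => diff H p (s p)) N) :
    ContMDiffOn (Q n) ((Q n).prod 𝓘(ℝ, E n)) ∞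
      (fun p => Bundle.TotalSpace.mk' (E n) (E := (TangentSpace (Q n) : M → Type _)) p (s p)) N := by
  intro c hc
  have h' := IsCoord.extChartAt (n := n) c
  set N' := N ∩ (chartAt (EuclideanQuadrant n) c).source
  have hN : IsOpen N' := h.isOpen.inter h'.isOpen
  have hcN : c ∈ N' := ⟨hc, mem_chart_source _ c⟩
  have h1 := contMDiffOn_diff_apply_of h hN inter_subset_left
    (h'.contMDiffOn.mono inter_subset_right) (hs.mono inter_subset_left)
  have h2 := (contMDiffOn_section_iff hN s c inter_subset_right).2 h1
  exact ((h2 c hcN).contMDiffAt (hN.mem_nhds hcN)).contMDiffWithinAt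

/-- A vector field with prescribed coordinates, vanishing outside of a closed set. -/
theorem exists_vectorField (h : IsCoord N H Φ) {a : M → E n}
    (ha : ContMDiffOn (Q n) 𝓘(ℝ, E n) ∞ a N) {K : Set M} (hK : IsClosed K) (hKN : K ⊆ N)
    (h0 : ∀ p, p ∉ K → a p = 0) :
    ∃ X : VF n M, (∀ p ∈ N, diff H p (X p) = a p) ∧ ∀ p, p ∉ K → X p = 0 := by
  let s : (p : M) → TangentSpace (Q n) p := fun p => diffSymm Φ (H p) (a p)
  have hs : ∀ p ∈ N, diff H p (s p) = a p := by
    intro p hp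
    have := h.diff_diffSymm (mem_image_of_mem H hp) (a p)
    rwa [h.left_inv p hp] at this
  have hs0 : ∀ p, p ∉ K → s p = 0 := fun p hp => by
    change diffSymm Φ (H p) (a p) = 0
    rw [h0 p hp, map_zero]
  refine ⟨⟨s, ?_⟩, hs, hs0⟩
  refine contMDiff_of_contMDiffOn_union_of_isOpen
    (contMDiffOn_section_of_coord h s (ha.congr hs)) (t := Kᶜ) ?_ ?_ h.isOpen hK.isOpen_compl
  · refine ((Bundle.contMDiff_zeroSection ℝ _).contMDiffOn (s := Kᶜ)).congr ?_
    intro p hp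
    rw [hs0 p hp]
    rfl
  · exact Set.compl_subset_iff_union.mp (Set.compl_subset_compl.mpr hKN)

theorem IsCoord.image_eventuallyEq (h : IsCoord N H Φ) {v : E n} (hv : v ∈ H '' N) :
    H '' N =ᶠ[𝓝 v] quad n := by
  obtain ⟨U, hU, hUe⟩ := h.exists_isOpen
  rw [hUe] at hv ⊢
  filter_upwards [hU.mem_nhds hv.2] with w hw
  exact propext ⟨fun h => h.1, fun h => ⟨h, hw⟩⟩

/-- The Lie bracket in coordinates. -/
theorem IsCoord.diff_mlieBracket (h : IsCoord N H Φ) (X Z : VF n M) {p : M} (hp : p ∈ N) :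
    diff H p (VectorField.mlieBracket (Q n) X Z p) =
      VectorField.lieBracketWithin ℝ (fun v => diff H (Φ v) (X (Φ v)))
        (fun v => diff H (Φ v) (Z (Φ v))) (quad n) (H p) := by
  set s := H '' N with hs
  have hps : H p ∈ s := mem_image_of_mem H hp
  have hsq : s ∈ 𝓝[quad n] (H p) := h.image_mem_nhdsWithin hp
  -- Pulling a vector field back by `Φ` applies the inverse of its derivative, which is `diff H`; so
  -- naturality of the bracket under pullback is the claim.
  have hinv : ∀ v ∈ s, ∀ w : TangentSpace (Q n) (Φ v),
      (mfderivWithin 𝓘(ℝ, E n) (Q n) Φ s v).inverse w = diff H (Φ v) w := by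
    intro v hv w
    have h1 : mfderivWithin 𝓘(ℝ, E n) (Q n) Φ s v = mfderivWithin 𝓘(ℝ, E n) (Q n) Φ (quad n) v := by
      exact mfderivWithin_congr_set (h.image_eventuallyEq hv)
    have h2 : (mfderivWithin 𝓘(ℝ, E n) (Q n) Φ (quad n) v).inverse =
        mfderiv (Q n) 𝓘(ℝ, E n) H (Φ v) := by
      refine ContinuousLinearMap.inverse_eq ?_ ?_
      · ext1 w
        have := h.diffSymm_diff (h.mapsTo_symm hv) w
        rw [h.right_inv hv] at this
        exact this
      · ext1 w
        exact h.diff_diffSymm hv w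
    rw [h1, h2]
    rfl
  have hle : ∀ k : ℕ, (k : WithTop ℕ∞) ≤ ∞ := fun k => by exact_mod_cast le_top
  haveI : IsManifold (Q n) (minSmoothness ℝ 3) M := IsManifold.of_le (n := ∞) (by simpa using hle 3)
  haveI : IsManifold (Q n) (minSmoothness ℝ 2) M := IsManifold.of_le (n := ∞) (by simpa using hle 2)
  have hmd : ∀ Z : VF n M, MDifferentiableWithinAt (Q n) ((Q n).prod 𝓘(ℝ, E n))
      (fun p => Bundle.TotalSpace.mk' (E n) (E := (TangentSpace (Q n) : M → Type _)) p (Z p))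
      univ (Φ (H p)) := fun Z =>
    ((Z.contMDiff (Φ (H p))).mdifferentiableAt (by simp)).mdifferentiableWithinAt
  have hu : UniqueMDiffOn 𝓘(ℝ, E n) s := uniqueMDiffOn_iff_uniqueDiffOn.2 h.uniqueDiffOn_image
  have hcl : H p ∈ closure (interior s) := by
    obtain ⟨U, hU, hUe⟩ := h.exists_isOpen
    rw [hs, hUe, interior_inter, hU.interior_eq]
    rw [hs, hUe] at hps
    rw [mem_closure_iff_nhds]
    intro t ht
    obtain ⟨w, hw, hw'⟩ := mem_closure_iff_nhds.1 (mem_closure_interior_quad hps.1) _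
      (inter_mem ht (hU.mem_nhds hps.2))
    exact ⟨w, hw.1, hw', hw.2⟩
  have key := VectorField.mpullbackWithin_mlieBracketWithin' (I := 𝓘(ℝ, E n)) (I' := Q n)
    (f := Φ) (V := fun p => X p) (W := fun p => Z p) (x₀ := H p) (s := s) (u := s) (t := univ)
    (n := ∞) (hmd X) (hmd Z) hu hu (h.contMDiffOn_symm _ hps) hps (by simpa using hle 2) (by simp) hcl Subset.rfl
  have hW : ∀ Z : VF n M, ∀ v ∈ s, VectorField.mpullbackWithin 𝓘(ℝ, E n) (Q n) Φ (fun p => Z p) s v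
      = diff H (Φ v) (Z (Φ v)) := fun Z v hv => hinv v hv _
  rw [VectorField.mlieBracketWithin_eq_lieBracketWithin,
    VectorField.lieBracketWithin_congr (hW X) (hW X _ hps) (hW Z) (hW Z _ hps)] at key
  have h1 := hinv _ hps (VectorField.mlieBracket (Q n) X Z (Φ (H p)))
  rw [← VectorField.lieBracketWithin_congr_set (h.image_eventuallyEq hps), ← key]
  have h2 : diff H p (VectorField.mlieBracket (Q n) X Z p) =
      diff H (Φ (H p)) (VectorField.mlieBracket (Q n) X Z (Φ (H p))) := by
    rw [h.left_inv p hp]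
  have h3 : VectorField.mlieBracket (Q n) X Z (Φ (H p)) =
    VectorField.mlieBracketWithin (Q n) (fun p => X p) (fun p => Z p) univ (Φ (H p)) := by
    rw [VectorField.mlieBracketWithin_univ]
  rw [h2, ← h1, VectorField.mpullbackWithin_apply, h3]

end VectorFields

/-! ### Boundary defining functions in coordinates -/

section BDF

variable {n : ℕ} {M : Type*} [TopologicalSpace M] [ChartedSpace (EuclideanQuadrant n) M]

theorem exists_bump [IsManifold (Q n) ∞ M] [T2Space M] [CompactSpace M] {N : Set M} (hN : IsOpen N)
    {p : M} (hp : p ∈ N) : ∃ θ : Fn n M, tsupport θ ⊆ N ∧ (∀ᶠ q in 𝓝 p, θ q = 1) ∧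
      ∀ q, θ q ∈ Icc (0 : ℝ) 1 := by
  obtain ⟨f, h0, h1, h2⟩ := exists_contMDiffMap_zero_one_nhds_of_isClosed (n := ⊤) (Q n)
    hN.isClosed_compl (isClosed_singleton (x := p))
    (disjoint_left.2 fun q hq hq' => hq (by rw [mem_singleton_iff.1 hq']; exact hp))
  refine ⟨f, ?_, by simpa using h1, h2⟩
  intro q hq
  by_contra hqN
  have h3 : ∀ᶠ q' in 𝓝 q, f q' = 0 :=
    h0.filter_mono (nhds_le_nhdsSet (show q ∈ Nᶜ from hqN))
  exact notMem_tsupport_iff_eventuallyEq.2 h3 hq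

theorem contMDiff_smul_of_tsupport {F : Type*} [NormedAddCommGroup F] [NormedSpace ℝ F]
    {N : Set M} (hN : IsOpen N) {θ : M → ℝ} (hθ : ContMDiff (Q n) 𝓘(ℝ, ℝ) ∞ θ)
    (hs : tsupport θ ⊆ N) {g : M → F} (hg : ContMDiffOn (Q n) 𝓘(ℝ, F) ∞ g N) :
    ContMDiff (Q n) 𝓘(ℝ, F) ∞ fun q => θ q • g q := by
  refine contMDiff_of_tsupport fun q hq => ?_
  have hq' : q ∈ N := hs (tsupport_smul_subset_left θ g hq)
  exact (hθ q).smul ((hg q hq').contMDiffAt (hN.mem_nhds hq'))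

variable [IsManifold (Q n) ∞ M] {N : Set M} {H : M → E n} {Φ : E n → M}

/-- Hadamard's lemma writes `r = v_i e`. At `p`, `dr ≠ 0` gives `e ≠ 0` and `r ≥ 0` gives `e ≥ 0`,
so `e` is positive on a smaller ball. -/
theorem exists_coord_mul_of_isBDF (h : IsCoord N H Φ) {p : M} (hp : p ∈ N) {δ : ℝ} (hδ : 0 < δ)
    (hsub : quad n ∩ Metric.ball (H p) δ ⊆ H '' N) {i : Fin n} (hi : H p i = 0) {F : Set M}
    (hF : ∀ q ∈ N ∩ H ⁻¹' Metric.ball (H p) δ, H q i = 0 → q ∈ F) {r : Fn n M} (hr : IsBDF F r) :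
    ∃ δ' > 0, δ' ≤ δ ∧ ∃ e : E n → ℝ, ContDiffOn ℝ ∞ e (quad n ∩ Metric.ball (H p) δ') ∧
      (∀ v ∈ quad n ∩ Metric.ball (H p) δ', 0 < e v) ∧
      (∀ v ∈ quad n ∩ Metric.ball (H p) δ', r (Φ v) = v i * e v) ∧
      ∀ v ∈ quad n ∩ Metric.ball (H p) δ', v i = 0 → ∀ w,
        diff r (Φ v) (diffSymm Φ v w) = e v * w i := by
  set D := quad n ∩ Metric.ball (H p) δ with hD
  have hp0 : H p ∈ D := ⟨h.mem_quad hp, Metric.mem_ball_self hδ⟩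
  have hg : ContDiffOn ℝ ∞ (r ∘ Φ) D :=
    (h.contMDiffOn_comp_symm Subset.rfl r.contMDiff.contMDiffOn).mono hsub
  obtain ⟨e, he, hge, -⟩ := exists_eq_coord_mul (h.mem_quad hp) hδ hi hg (fun v hv hvi => by
    have h1 : Φ v ∈ F := hF _ ⟨h.mapsTo_symm (hsub hv), by
      rw [mem_preimage, h.right_inv (hsub hv)]; exact hv.2⟩ (by rwa [h.right_inv (hsub hv)])
    rw [← hr.2.1] at h1
    exact h1)
  have hderiv : ∀ v ∈ D, v i = 0 → ∀ w, diff r (Φ v) (diffSymm Φ v w) = e v * w i := by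
    intro v hv hvi w
    have hrd : MDifferentiableAt (Q n) 𝓘(ℝ, ℝ) r (Φ v) := (r.contMDiff _).mdifferentiableAt (by simp)
    have h1 := (h.hasFDerivWithinAt_comp_symm (hsub hv) hrd).mono (t := quad n)
      (s := D) inter_subset_left
    have h2 : HasFDerivWithinAt (fun v : E n => v i * e v)
        (v i • fderivWithin ℝ e D v + e v • (EuclideanSpace.proj (𝕜 := ℝ) i : E n →L[ℝ] ℝ)) D v :=
      ((EuclideanSpace.proj (𝕜 := ℝ) i : E n →L[ℝ] ℝ).hasFDerivWithinAt).mul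
        ((he.differentiableOn (by simp)) v hv).hasFDerivWithinAt
    have h3 := (uniqueDiffOn_quad_inter Metric.isOpen_ball v hv).eq h1
      (h2.congr (fun u hu => hge u hu) (hge v hv))
    have h4 := congrArg (fun L : E n →L[ℝ] ℝ => L w) h3
    simpa [hvi] using h4
  have hne : e (H p) ≠ 0 := by
    intro h0
    have hpF : p ∈ F := hF p ⟨hp, Metric.mem_ball_self hδ⟩ hi
    refine hr.2.2 p hpF ?_
    have h5 : ∀ w, diff (n := n) r p w = 0 := by
      intro w
      have := hderiv _ hp0 hi (diff H p w)
      rwa [h0, zero_mul, h.diffSymm_diff hp, h.left_inv p hp] at this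
    exact ContinuousLinearMap.ext (f := (diff r p : E n →L[ℝ] ℝ)) (g := 0) h5
  have hcont : ContinuousWithinAt e D (H p) := he.continuousOn _ hp0
  have hray := eventually_ray_mem (v₀ := H p) (w := EuclideanSpace.single i 1) (h.mem_quad hp)
    (Metric.ball_mem_nhds _ hδ) (add_single_mem_quad (h.mem_quad hp) zero_le_one)
  have hge0 : 0 ≤ e (H p) := by
    have ht : Tendsto (fun s : ℝ => e (H p + s • EuclideanSpace.single i (1 : ℝ))) (𝓝[>] 0)
        (𝓝 (e (H p))) :=
      hcont.tendsto.comp (tendsto_nhdsWithin_iff.2 ⟨tendsto_ray_nhds _ _, hray⟩)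
    refine ge_of_tendsto ht ?_
    filter_upwards [hray, self_mem_nhdsWithin] with s hs hs0
    have h6 := hr.1 (Φ (H p + s • EuclideanSpace.single i (1 : ℝ)))
    have h7 := hge _ hs
    rw [Function.comp_apply] at h7
    rw [h7] at h6
    simp only [PiLp.add_apply, PiLp.smul_apply, hi, PiLp.single_apply, if_true,
      smul_eq_mul, mul_one, zero_add] at h6
    exact nonneg_of_mul_nonneg_right h6 hs0
  have hpos : 0 < e (H p) := lt_of_le_of_ne hge0 (Ne.symm hne)
  have hev : ∀ᶠ v in 𝓝[D] (H p), 0 < e v := hcont.eventually (lt_mem_nhds hpos)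
  rw [eventually_nhdsWithin_iff] at hev
  obtain ⟨δ₁, hδ₁, hδ₁e⟩ := Metric.eventually_nhds_iff_ball.1 hev
  have hs1 : quad n ∩ Metric.ball (H p) (min δ δ₁) ⊆ D :=
    inter_subset_inter_right _ (Metric.ball_subset_ball (min_le_left _ _))
  refine ⟨min δ δ₁, lt_min hδ hδ₁, min_le_left _ _, e, he.mono hs1, ?_, ?_, ?_⟩
  · exact fun v hv => hδ₁e v (Metric.ball_subset_ball (min_le_right _ _) hv.2) (hs1 hv)
  · exact fun v hv => hge v (hs1 hv)
  · exact fun v hv => hderiv v (hs1 hv)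

/-- The singular hyperfaces and the product of their defining functions in coordinates. -/
theorem exists_singular_coords [CompactSpace M] (h : IsCoord N H Φ) {p : M} (hp : p ∈ N)
    {𝓕 : Set (Set M)} (h𝓕 : 𝓕 ⊆ hyperfaces n M) {r : Set M → Fn n M}
    (hr : ∀ F ∈ 𝓕, IsBDF F (r F)) :
    ∃ δ > 0, quad n ∩ Metric.ball (H p) δ ⊆ H '' N ∧ ∃ (A : Finset (Fin n)) (e : E n → ℝ),
      ContDiffOn ℝ ∞ e (quad n ∩ Metric.ball (H p) δ) ∧
      (∀ v ∈ quad n ∩ Metric.ball (H p) δ, 0 < e v) ∧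
      (∀ i ∈ A, H p i = 0) ∧
      (∀ v ∈ quad n ∩ Metric.ball (H p) δ, ∀ i, v i = 0 → H p i = 0) ∧
      (∀ v ∈ quad n ∩ Metric.ball (H p) δ, ∏ᶠ F ∈ 𝓕, r F (Φ v) = e v * ∏ i ∈ A, v i) ∧
      (∀ v ∈ quad n ∩ Metric.ball (H p) δ, Φ v ∈ ⋃₀ 𝓕 ↔ ∃ i ∈ A, v i = 0) ∧
      (∀ i, H p i = 0 → i ∉ A → ∃ G ∈ hyperfaces n M, G ∉ 𝓕 ∧
        ∀ v ∈ quad n ∩ Metric.ball (H p) δ, v i = 0 → Φ v ∈ G) ∧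
      ∀ i ∈ A, ∃ F ∈ 𝓕, ∀ v ∈ quad n ∩ Metric.ball (H p) δ, v i = 0 →
        Φ v ∈ F ∧ ∃ c ≠ (0 : ℝ), ∀ w, diff (r F) (Φ v) (diffSymm Φ v w) = c * w i := by
  classical
  obtain ⟨δ₀, hδ₀, hsub, F, hF1, hF2, hF3, hF4⟩ := exists_hyperface_nhds h hp
  set D₀ := quad n ∩ Metric.ball (H p) δ₀ with hD₀
  have hO : ∀ v ∈ D₀, Φ v ∈ N ∩ H ⁻¹' Metric.ball (H p) δ₀ := fun v hv =>
    ⟨h.mapsTo_symm (hsub hv), by rw [mem_preimage, h.right_inv (hsub hv)]; exact hv.2⟩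
  let A : Finset (Fin n) := Finset.univ.filter fun i => H p i = 0 ∧ F i ∈ 𝓕
  have hA : ∀ i, i ∈ A ↔ H p i = 0 ∧ F i ∈ 𝓕 := fun i => by simp [A]
  have key : ∀ i, ∃ δ' > 0, δ' ≤ δ₀ ∧ ∃ e : E n → ℝ, i ∈ A →
      ContDiffOn ℝ ∞ e (quad n ∩ Metric.ball (H p) δ') ∧
      (∀ v ∈ quad n ∩ Metric.ball (H p) δ', 0 < e v) ∧
      (∀ v ∈ quad n ∩ Metric.ball (H p) δ', r (F i) (Φ v) = v i * e v) ∧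
      ∀ v ∈ quad n ∩ Metric.ball (H p) δ', v i = 0 → ∀ w,
        diff (r (F i)) (Φ v) (diffSymm Φ v w) = e v * w i := by
    intro i
    by_cases hi : i ∈ A
    · obtain ⟨δ', h1, h2, e, h3⟩ := exists_coord_mul_of_isBDF h hp hδ₀ hsub ((hA i).1 hi).1
        (hF3 i ((hA i).1 hi).1) (hr _ ((hA i).1 hi).2)
      exact ⟨δ', h1, h2, e, fun _ => h3⟩
    · exact ⟨δ₀, hδ₀, le_rfl, fun _ => 0, fun h => absurd h hi⟩
  choose δ' hδ' hδ'le e he using key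
  obtain ⟨δ, ⟨hδ0, hδle⟩, hδ⟩ : ∃ δ, (δ ≤ δ₀ ∧ ∀ i, δ ≤ δ' i) ∧ 0 < δ := by
    refine Eventually.exists (f := 𝓝[>] (0 : ℝ)) (Eventually.and (Eventually.and ?_ ?_)
      self_mem_nhdsWithin)
    · exact nhdsWithin_le_nhds (Iic_mem_nhds hδ₀)
    · exact eventually_all.2 fun i => nhdsWithin_le_nhds (Iic_mem_nhds (hδ' i))
  set D := quad n ∩ Metric.ball (H p) δ with hD
  have hDD₀ : D ⊆ D₀ := inter_subset_inter_right _ (Metric.ball_subset_ball hδ0)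
  have hDi : ∀ i, D ⊆ quad n ∩ Metric.ball (H p) (δ' i) := fun i =>
    inter_subset_inter_right _ (Metric.ball_subset_ball (hδle i))
  -- A hyperface with a defining function has only one local face: `r (F i) = v_i e` with `e > 0`
  -- vanishes on no part of the face `j` where `v_i > 0`.
  have hinj : ∀ i ∈ A, ∀ j ∈ A, F i = F j → i = j := by
    intro i hi j hj hij
    by_contra hne
    obtain ⟨s, hs⟩ := (eventually_face_mem (h.mem_quad hp) ((hA j).1 hj).1
      (Metric.ball_mem_nhds _ hδ)).exists
    set v := H p + s • (WithLp.toLp 2 fun k => if k = j then 0 else 1 : E n)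
    have h1 : Φ v ∈ F j := hF3 j ((hA j).1 hj).1 _ (hO v (hDD₀ hs.1))
      (by rw [h.right_inv (hsub (hDD₀ hs.1))]; exact hs.2.1)
    rw [← hij, ← (hr _ ((hA i).1 hi).2).2.1] at h1
    have h2 := (he i hi).2.2.1 v (hDi i hs.1)
    have h3 : r (F i) (Φ v) = 0 := h1
    rw [h3] at h2
    exact (mul_pos (hs.2.2 i hne) ((he i hi).2.1 v (hDi i hs.1))).ne h2
  have hfin : 𝓕.Finite := hyperfaces_finite.subset h𝓕
  -- The singular hyperfaces that miss the neighbourhood. Their defining functions are positive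
  -- there and go into the factor `e`.
  let 𝓑 : Finset (Set M) := hfin.toFinset \ A.image F
  have h𝓑 : ∀ G ∈ 𝓑, G ∈ 𝓕 ∧ ∀ i ∈ A, F i ≠ G := by
    intro G hG
    simpa [𝓑] using hG
  have hmem : ∀ G ∈ 𝓕, ∀ v ∈ D, Φ v ∈ G → ∃ i ∈ A, G = F i ∧ v i = 0 := by
    intro G hG v hv hvG
    obtain ⟨i, hi, rfl, hvi⟩ := hF4 G (h𝓕 hG) _ (hO v (hDD₀ hv)) hvG
    rw [h.right_inv (hsub (hDD₀ hv))] at hvi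
    exact ⟨i, (hA i).2 ⟨hi, hG⟩, rfl, hvi⟩
  have hFmem : ∀ i, H p i = 0 → ∀ v ∈ D, v i = 0 → Φ v ∈ F i := fun i hi v hv hvi =>
    hF3 i hi _ (hO v (hDD₀ hv)) (by rwa [h.right_inv (hsub (hDD₀ hv))])
  have hpos : ∀ G ∈ 𝓑, ∀ v ∈ D, 0 < r G (Φ v) := by
    intro G hG v hv
    refine lt_of_le_of_ne ((hr G (h𝓑 G hG).1).1 _) fun h0 => ?_
    have h1 : Φ v ∈ G := by
      rw [← (hr G (h𝓑 G hG).1).2.1]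
      exact h0.symm
    obtain ⟨i, hi, rfl, -⟩ := hmem G (h𝓑 G hG).1 v hv h1
    exact (h𝓑 _ hG).2 i hi rfl
  refine ⟨δ, hδ, hDD₀.trans hsub, A, fun v => (∏ i ∈ A, e i v) * ∏ G ∈ 𝓑, r G (Φ v),
    ?_, ?_, ?_, ?_, ?_, ?_, ?_, ?_⟩
  · refine ContDiffOn.mul (contDiffOn_prod fun i hi => (he i hi).1.mono (hDi i))
      (contDiffOn_prod fun G _ => ?_)
    exact (h.contMDiffOn_comp_symm Subset.rfl (r G).contMDiff.contMDiffOn).mono (hDD₀.trans hsub)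
  · intro v hv
    exact mul_pos (Finset.prod_pos fun i hi => (he i hi).2.1 v (hDi i hv))
      (Finset.prod_pos fun G hG => hpos G hG v hv)
  · exact fun i hi => ((hA i).1 hi).1
  · intro v hv i hi
    exact hF1 _ (hO v (hDD₀ hv)) i (by rwa [h.right_inv (hsub (hDD₀ hv))])
  · intro v hv
    have hsubset : A.image F ⊆ hfin.toFinset := by
      intro G hG
      obtain ⟨i, hi, rfl⟩ := Finset.mem_image.1 hG
      simpa using ((hA i).1 hi).2
    rw [finprod_mem_eq_finite_toFinset_prod _ hfin, ← Finset.prod_sdiff hsubset,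
      Finset.prod_image fun i hi j hj => hinj i hi j hj,
      Finset.prod_congr rfl fun i hi => (he i hi).2.2.1 v (hDi i hv), Finset.prod_mul_distrib]
    ring
  · intro v hv
    constructor
    · rintro ⟨G, hG, hvG⟩
      obtain ⟨i, hi, -, hvi⟩ := hmem G hG v hv hvG
      exact ⟨i, hi, hvi⟩
    · rintro ⟨i, hi, hvi⟩
      exact ⟨F i, ((hA i).1 hi).2, hFmem i ((hA i).1 hi).1 v hv hvi⟩
  · intro i hi hiA
    exact ⟨F i, hF2 i hi, fun hF => hiA ((hA i).2 ⟨hi, hF⟩), hFmem i hi⟩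
  · intro i hi
    refine ⟨F i, ((hA i).1 hi).2, fun v hv hvi => ⟨hFmem i ((hA i).1 hi).1 v hv hvi, e i v,
      ((he i hi).2.1 v (hDi i hv)).ne', (he i hi).2.2.2 v (hDi i hv) hvi⟩⟩

end BDF

/-! ### Integration of densities in coordinates -/

section Density

variable {n : ℕ} {M : Type*} [TopologicalSpace M] [ChartedSpace (EuclideanQuadrant n) M]

/-- The transformation law of densities. -/
def IsDensity (σ : (p : M) → (Fin n → TangentSpace (Q n) p) → ℂ) : Prop :=
  ∀ (p : M) (L : E n →ₗ[ℝ] E n) (v : Fin n → E n),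
    σ p (fun i => L (v i)) = ((|LinearMap.det L| : ℝ) : ℂ) * σ p v

/-- The coefficient of a density with respect to coordinates. -/
def coordCoeff (Φ : E n → M) (σ : (p : M) → (Fin n → TangentSpace (Q n) p) → ℂ) (v : E n) : ℂ :=
  σ (Φ v) fun i => diffSymm Φ v (EuclideanSpace.single i 1)

variable {σ : (p : M) → (Fin n → TangentSpace (Q n) p) → ℂ}

theorem IsDensity.apply_single (hσ : IsDensity σ) (p : M) (A : E n →L[ℝ] E n) :
    σ p (fun i => A (EuclideanSpace.single i 1)) =
      ((|A.det| : ℝ) : ℂ) * σ p (fun i => (EuclideanSpace.single i 1 : E n)) :=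
  hσ p A fun i => EuclideanSpace.single i 1

theorem IsDensity.apply_comp (hσ : IsDensity σ) (p : M) (A T : E n →L[ℝ] E n) :
    σ p (fun i => A (T (EuclideanSpace.single i 1))) =
      ((|T.det| : ℝ) : ℂ) * σ p (fun i => A (EuclideanSpace.single i 1)) := by
  have h1 := hσ.apply_single p (A.comp T)
  have h2 : (A.comp T).det = A.det * T.det :=
    LinearMap.det_comp (A : E n →ₗ[ℝ] E n) (T : E n →ₗ[ℝ] E n)
  rw [h2, abs_mul] at h1
  rw [hσ.apply_single p A]
  refine Eq.trans h1 ?_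
  push_cast
  ring

variable [IsManifold (Q n) ∞ M]

theorem Density.isDensity {𝓕 : Set (Set M)} {V : Submodule (Fn n M) (VF n M)}
    (hσ : σ ∈ Density 𝓕 V) : IsDensity σ := by
  intro p L v
  by_cases hp : p ∈ ⋃₀ 𝓕
  · have h0 : ∀ w : Fin n → E n, σ p w = 0 := fun w => hσ.1 p hp w
    exact (h0 _).trans (by rw [h0 v, mul_zero])
  · exact hσ.2.1 p hp L v

theorem chartCoeff_eq_coordCoeff (c : M) :
    chartCoeff σ c = coordCoeff (extChartAt (Q n) c).symm σ := by
  ext v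
  unfold chartCoeff coordCoeff diffSymm
  rw [range_Q]
  rfl

variable {N N' : Set M} {H H' : M → E n} {Φ Φ' : E n → M}

theorem IsCoord.measurableSet_image (h : IsCoord N H Φ) : MeasurableSet (H '' N) := by
  obtain ⟨U, hU, hUe⟩ := h.exists_isOpen
  rw [hUe]
  exact (isClosed_quad n).measurableSet.inter hU.measurableSet

theorem IsCoord.hasFDerivWithinAt_transition (h : IsCoord N H Φ) (h' : IsCoord N' H' Φ') {v : E n}
    (hv : v ∈ H '' N) (hv' : Φ v ∈ N') :
    HasFDerivWithinAt (H' ∘ Φ) ((diff H' (Φ v)).comp (diffSymm Φ v)) (quad n) v :=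
  h.hasFDerivWithinAt_comp_symm hv (h'.hasMFDerivAt hv').mdifferentiableAt

theorem coordCoeff_transition (hσ : IsDensity σ) (h : IsCoord N H Φ) (h' : IsCoord N' H' Φ') {v : E n}
    (hv : v ∈ H '' N) (hv' : Φ v ∈ N') :
    coordCoeff Φ σ v =
      |((diff H' (Φ v)).comp (diffSymm Φ v)).det| • coordCoeff Φ' σ (H' (Φ v)) := by
  have h1 := hσ.apply_comp (Φ v) (diffSymm Φ' (H' (Φ v))) ((diff H' (Φ v)).comp (diffSymm Φ v))
  have h2 : Φ' (H' (Φ v)) = Φ v := h'.left_inv _ hv'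
  unfold coordCoeff
  rw [h2, Complex.real_smul, ← h1]
  congr 1
  funext i
  exact (h'.diffSymm_diff hv' _).symm

theorem image_transition {O : Set M} (h : IsCoord N H Φ) (hO : O ⊆ N) :
    (H' ∘ Φ) '' (H '' O) = H' '' O := by
  rw [image_image]
  refine image_congr fun p hp => ?_
  rw [Function.comp_apply, h.left_inv p (hO hp)]

theorem injOn_transition {O : Set M} (h : IsCoord N H Φ) (h' : IsCoord N' H' Φ') (hO : O ⊆ N)
    (hO' : O ⊆ N') : InjOn (H' ∘ Φ) (H '' O) := by
  rintro _ ⟨p, hp, rfl⟩ _ ⟨q, hq, rfl⟩ hpq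
  rw [Function.comp_apply, Function.comp_apply, h.left_inv p (hO hp), h.left_inv q (hO hq)] at hpq
  rw [← h'.left_inv p (hO' hp), hpq, h'.left_inv q (hO' hq)]

theorem integrableOn_coordCoeff_iff (hσ : IsDensity σ) (h : IsCoord N H Φ) (h' : IsCoord N' H' Φ')
    {O : Set M} (ho : IsOpen O) (hO : O ⊆ N) (hO' : O ⊆ N') :
    IntegrableOn (coordCoeff Φ' σ) (H' '' O) volume ↔
      IntegrableOn (coordCoeff Φ σ) (H '' O) volume := by
  have hm : MeasurableSet (H '' O) := (h.mono ho hO).measurableSet_image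
  have hmem : ∀ v ∈ H '' O, Φ v ∈ N' := by
    rintro _ ⟨p, hp, rfl⟩
    rw [h.left_inv p (hO hp)]
    exact hO' hp
  rw [← image_transition (H' := H') h hO, integrableOn_image_iff_integrableOn_abs_det_fderiv_smul _ hm
    (fun v hv => (h.hasFDerivWithinAt_transition h' (image_mono hO hv) (hmem v hv)).mono
      ((image_mono hO).trans h.image_subset_quad)) (injOn_transition h h' hO hO')]
  exact integrableOn_congr_fun (fun v hv =>
    (coordCoeff_transition hσ h h' (image_mono hO hv) (hmem v hv)).symm) hm

theorem setIntegral_coordCoeff_eq (hσ : IsDensity σ) (h : IsCoord N H Φ) (h' : IsCoord N' H' Φ')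
    {O : Set M} (ho : IsOpen O) (hO : O ⊆ N) (hO' : O ⊆ N') (g : M → ℂ) :
    ∫ v in H' '' O, g (Φ' v) * coordCoeff Φ' σ v = ∫ v in H '' O, g (Φ v) * coordCoeff Φ σ v := by
  have hm : MeasurableSet (H '' O) := (h.mono ho hO).measurableSet_image
  have hmem : ∀ v ∈ H '' O, Φ v ∈ N' := by
    rintro _ ⟨p, hp, rfl⟩
    rw [h.left_inv p (hO hp)]
    exact hO' hp
  rw [← image_transition (H' := H') h hO, integral_image_eq_integral_abs_det_fderiv_smul _ hm
    (fun v hv => (h.hasFDerivWithinAt_transition h' (image_mono hO hv) (hmem v hv)).mono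
      ((image_mono hO).trans h.image_subset_quad)) (injOn_transition h h' hO hO')]
  refine setIntegral_congr_fun hm fun v hv => ?_
  simp only [Function.comp_apply]
  rw [coordCoeff_transition hσ h h' (image_mono hO hv) (hmem v hv), h'.left_inv _ (hmem v hv),
    Complex.real_smul, Complex.real_smul]
  ring

/-! ### Densities supported in one coordinate patch -/

theorem image_source_extChartAt (c : M) :
    extChartAt (Q n) c '' (chartAt (EuclideanQuadrant n) c).source = (extChartAt (Q n) c).target := by
  rw [← extChartAt_source (Q n), PartialEquiv.image_source_eq_target]

theorem integrableOn_target_of (h : IsCoord N H Φ) {c : M} {g : E n → ℂ}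
    (hg : IntegrableOn g (extChartAt (Q n) c '' (N ∩ (chartAt (EuclideanQuadrant n) c).source)) volume)
    (h0 : ∀ v, (extChartAt (Q n) c).symm v ∉ N → g v = 0) :
    IntegrableOn g (extChartAt (Q n) c).target volume := by
  have hc := IsCoord.extChartAt (n := n) c
  refine hg.of_forall_sdiff_eq_zero ?_ ?_
  · rw [← image_source_extChartAt]
    exact hc.measurableSet_image
  · rintro v ⟨hv, hv'⟩
    refine h0 v fun hvN => hv' ?_
    rw [← image_source_extChartAt] at hv
    exact ⟨_, ⟨hvN, hc.mapsTo_symm hv⟩, hc.right_inv hv⟩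

/-- By the change of variables formula, integrability may be tested on overlaps with charts.
Finitely many charts cover `M`, and outside `N` the density is zero. -/
theorem densityIntegrable_iff [CompactSpace M] (hσ : IsDensity σ) (h : IsCoord N H Φ)
    (h0 : ∀ p, p ∉ N → ∀ v, σ p v = 0) :
    DensityIntegrable σ ↔ IntegrableOn (coordCoeff Φ σ) (H '' N) volume := by
  constructor
  · intro hi
    obtain ⟨t, ht⟩ := isCompact_univ.elim_finite_subcover
      (fun c : M => (chartAt (EuclideanQuadrant n) c).source)
      (fun c => (chartAt (EuclideanQuadrant n) c).open_source)
      (fun p _ => mem_iUnion.2 ⟨p, mem_chart_source _ p⟩)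
    have hcov : H '' N = ⋃ c ∈ t, H '' (N ∩ (chartAt (EuclideanQuadrant n) c).source) := by
      rw [← image_iUnion₂, ← inter_iUnion₂, inter_eq_left.2 ((subset_univ N).trans ht)]
    rw [hcov, integrableOn_finset_iUnion]
    intro c _
    have hc := IsCoord.extChartAt (n := n) c
    rw [← integrableOn_coordCoeff_iff hσ h hc (h.isOpen.inter hc.isOpen) inter_subset_left
      inter_subset_right, ← chartCoeff_eq_coordCoeff]
    refine (hi c).mono_set ?_
    rw [← image_source_extChartAt]
    exact image_mono inter_subset_right
  · intro hi c
    have hc := IsCoord.extChartAt (n := n) c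
    rw [chartCoeff_eq_coordCoeff]
    refine integrableOn_target_of h ?_ fun v hv => h0 _ hv _
    rw [integrableOn_coordCoeff_iff hσ h hc (h.isOpen.inter hc.isOpen) inter_subset_left
      inter_subset_right]
    exact hi.mono_set (image_mono inter_subset_left)

theorem finite_chartPartition [T2Space M] [CompactSpace M] :
    {c : M | (Function.support (chartPartition n M c)).Nonempty}.Finite :=
  (chartPartition n M).locallyFinite.finite_nonempty_of_compact

theorem chartPartition_eq_zero [T2Space M] [CompactSpace M] {c p : M}
    (hp : p ∉ (chartAt (EuclideanQuadrant n) c).source) : chartPartition n M c p = 0 := by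
  by_contra hne
  exact hp (chartPartition_isSubordinate c (subset_tsupport _ hne))

/-- Change of variables moves every term of the chart partition into the one coordinate system;
there the cutoffs add up to `1`. In particular the partition chosen in `densityIntegral` does not
matter. -/
theorem densityIntegral_eq [T2Space M] [CompactSpace M] (hσ : IsDensity σ) (h : IsCoord N H Φ)
    (h0 : ∀ p, p ∉ N → ∀ v, σ p v = 0) (hi : DensityIntegrable σ) :
    densityIntegral σ = ∫ v in H '' N, coordCoeff Φ σ v := by
  rw [densityIntegrable_iff hσ h h0] at hi
  have h1 : ∀ c : M, ∫ x in (extChartAt (Q n) c).target,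
      ((chartPartition n M c ((extChartAt (Q n) c).symm x) : ℝ) : ℂ) * chartCoeff σ c x =
      ∫ v in H '' N, ((chartPartition n M c (Φ v) : ℝ) : ℂ) * coordCoeff Φ σ v := by
    intro c
    have hc := IsCoord.extChartAt (n := n) c
    have hs : extChartAt (Q n) c '' (N ∩ (chartAt (EuclideanQuadrant n) c).source) ⊆
        (extChartAt (Q n) c).target := by
      rw [← image_source_extChartAt]
      exact image_mono inter_subset_right
    rw [chartCoeff_eq_coordCoeff, setIntegral_eq_of_subset_of_forall_sdiff_eq_zero ?_ hs ?_,
      setIntegral_coordCoeff_eq hσ h hc (h.isOpen.inter hc.isOpen) inter_subset_left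
      inter_subset_right (fun p => ((chartPartition n M c p : ℝ) : ℂ)),
      ← setIntegral_eq_of_subset_of_forall_sdiff_eq_zero h.measurableSet_image
        (image_mono inter_subset_left)]
    · rintro _ ⟨⟨p, hp, rfl⟩, hv'⟩
      rw [h.left_inv p hp, chartPartition_eq_zero fun hpc => hv' (mem_image_of_mem H ⟨hp, hpc⟩)]
      simp
    · rw [← image_source_extChartAt]
      exact hc.measurableSet_image
    · rintro v ⟨hv, hv'⟩
      rw [← image_source_extChartAt] at hv
      have : (extChartAt (Q n) c).symm v ∉ N := fun hvN =>
        hv' ⟨_, ⟨hvN, hc.mapsTo_symm hv⟩, hc.right_inv hv⟩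
      rw [show coordCoeff (extChartAt (Q n) c).symm σ v = 0 from h0 _ this _, mul_zero]
  have hfin := finite_chartPartition (n := n) (M := M)
  have hzero : ∀ c : M, c ∉ hfin.toFinset → ∀ p, chartPartition n M c p = 0 := by
    intro c hc p
    by_contra hne
    exact hc (hfin.mem_toFinset.2 ⟨p, hne⟩)
  unfold densityIntegral
  rw [finsum_congr h1, finsum_eq_sum_of_support_subset (s := hfin.toFinset), ← integral_finsetSum]
  · refine setIntegral_congr_fun h.measurableSet_image fun v _ => ?_
    rw [← Finset.sum_mul, ← Complex.ofReal_sum, ← finsum_eq_sum_of_support_subset,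
      (chartPartition n M).sum_eq_one (mem_univ _), Complex.ofReal_one, one_mul]
    intro c hc
    by_contra hc'
    exact hc (hzero c hc' _)
  · intro c _
    refine Integrable.bdd_mul (c := 1) hi ?_ ?_
    · refine ContinuousOn.aestronglyMeasurable ?_ h.measurableSet_image
      exact Complex.continuous_ofReal.comp_continuousOn
        ((chartPartition n M c).contMDiff.continuous.comp_continuousOn h.continuousOn_symm)
    · refine Eventually.of_forall fun v => ?_
      rw [Complex.norm_real, Real.norm_of_nonneg ((chartPartition n M).nonneg c _)]
      exact (chartPartition n M).le_one c _
  · intro c hc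
    by_contra hc'
    refine hc ?_
    simp [hzero c hc']

theorem densityIntegrable_sum {ι : Type*} (t : Finset ι)
    {τ : ι → (p : M) → (Fin n → TangentSpace (Q n) p) → ℂ} (h : ∀ i ∈ t, DensityIntegrable (τ i)) :
    DensityIntegrable fun p v => ∑ i ∈ t, τ i p v := fun c =>
  integrable_finsetSum t fun i hi => h i hi c

theorem densityIntegral_sum [T2Space M] [CompactSpace M] {ι : Type*} (t : Finset ι)
    {τ : ι → (p : M) → (Fin n → TangentSpace (Q n) p) → ℂ} (h : ∀ i ∈ t, DensityIntegrable (τ i)) :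
    densityIntegral (fun p v => ∑ i ∈ t, τ i p v) = ∑ i ∈ t, densityIntegral (τ i) := by
  have hfin := finite_chartPartition (n := n) (M := M)
  have hzero : ∀ c : M, c ∉ hfin.toFinset → ∀ p, chartPartition n M c p = 0 := by
    intro c hc p
    by_contra hne
    exact hc (hfin.mem_toFinset.2 ⟨p, hne⟩)
  have key : ∀ τ' : (p : M) → (Fin n → TangentSpace (Q n) p) → ℂ, densityIntegral τ' =
      ∑ c ∈ hfin.toFinset, ∫ x in (extChartAt (Q n) c).target,
        ((chartPartition n M c ((extChartAt (Q n) c).symm x) : ℝ) : ℂ) * chartCoeff τ' c x := by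
    intro τ'
    refine finsum_eq_sum_of_support_subset _ fun c hc => ?_
    by_contra hc'
    refine hc ?_
    simp [hzero c hc']
  rw [key, Finset.sum_congr rfl fun i _ => key (τ i), Finset.sum_comm]
  refine Finset.sum_congr rfl fun c _ => ?_
  have hc := IsCoord.extChartAt (n := n) c
  have hm : MeasurableSet (extChartAt (Q n) c).target := by
    rw [← image_source_extChartAt]
    exact hc.measurableSet_image
  rw [← integral_finsetSum]
  · refine setIntegral_congr_fun hm fun v _ => ?_
    simp only [chartCoeff, Finset.mul_sum]
  · intro i hi
    refine Integrable.bdd_mul (c := 1) (h i hi c) ?_ ?_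
    · refine ContinuousOn.aestronglyMeasurable ?_ hm
      refine Complex.continuous_ofReal.comp_continuousOn
        ((chartPartition n M c).contMDiff.continuous.comp_continuousOn ?_)
      exact continuousOn_extChartAt_symm c
    · refine Eventually.of_forall fun v => ?_
      rw [Complex.norm_real, Real.norm_of_nonneg ((chartPartition n M).nonneg c _)]
      exact (chartPartition n M).le_one c _

end Density

/-! ### Frames -/

section Frames

variable {n : ℕ} {M : Type*} [TopologicalSpace M] [ChartedSpace (EuclideanQuadrant n) M]

theorem contMDiffOn_det {ι : Type*} [Fintype ι] [DecidableEq ι] {a : M → Matrix ι ι ℝ} {s : Set M}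
    (ha : ∀ i j, ContMDiffOn (Q n) 𝓘(ℝ, ℝ) ∞ (fun p => a p i j) s) :
    ContMDiffOn (Q n) 𝓘(ℝ, ℝ) ∞ (fun p => (a p).det) s := by
  simp only [Matrix.det_apply']
  refine contMDiffOn_finsetSum fun τ _ => ?_
  exact contMDiffOn_const.mul (contMDiffOn_finsetProd fun i _ => ha _ _)

theorem contMDiffOn_inv_mulVec {ι : Type*} [Fintype ι] [DecidableEq ι] {a : M → Matrix ι ι ℝ}
    {s : Set M} (ha : ∀ i j, ContMDiffOn (Q n) 𝓘(ℝ, ℝ) ∞ (fun p => a p i j) s)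
    (hdet : ∀ p ∈ s, (a p).det ≠ 0) {z : M → ι → ℝ}
    (hz : ∀ i, ContMDiffOn (Q n) 𝓘(ℝ, ℝ) ∞ (fun p => z p i) s) (i : ι) :
    ContMDiffOn (Q n) 𝓘(ℝ, ℝ) ∞ (fun p => ((a p)⁻¹.mulVec (z p)) i) s := by
  simp only [Matrix.inv_def, Matrix.mulVec, dotProduct, Matrix.smul_apply, Matrix.adjugate_apply,
    Ring.inverse_eq_inv', smul_eq_mul]
  refine contMDiffOn_finsetSum fun j _ => ((ContMDiffOn.inv₀ (contMDiffOn_det ha) hdet).mul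
    (contMDiffOn_det fun k l => ?_)).mul (hz j)
  by_cases hk : k = j
  · subst hk
    simp only [Matrix.updateRow_self]
    exact contMDiffOn_const
  · simp only [Matrix.updateRow_ne hk]
    exact ha k l

/-- A density on the images of `n` vectors. -/
theorem IsDensity.apply_vec {σ : (p : M) → (Fin n → TangentSpace (Q n) p) → ℂ} (hσ : IsDensity σ)
    (p : M) (A : E n →L[ℝ] E n) (w : Fin n → E n) :
    σ p (fun i => A (w i)) = ((|(Matrix.of fun i k => w i k).det| : ℝ) : ℂ) *
      σ p (fun i => A (EuclideanSpace.single i 1)) := by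
  let b := (EuclideanSpace.basisFun (Fin n) ℝ).toBasis
  have hb : ∀ i, b i = EuclideanSpace.single i 1 := fun i => by simp [b]
  let T : E n →L[ℝ] E n := LinearMap.toContinuousLinearMap (b.constr ℝ w)
  have hT : ∀ i, T (EuclideanSpace.single i 1) = w i := fun i => by
    rw [← hb]
    exact b.constr_basis ℝ w i
  have hdet : T.det = (Matrix.of fun i k => w i k).det := by
    have h1 : T.det = LinearMap.det (b.constr ℝ w) := rfl
    rw [h1, ← LinearMap.det_toMatrix b, ← Matrix.det_transpose]
    congr 1
    ext i k
    rw [Matrix.transpose_apply, LinearMap.toMatrix_apply, b.constr_basis]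
    simp [b]
  have h2 := hσ.apply_comp p A T
  rw [hdet] at h2
  refine Eq.trans ?_ h2
  congr 1
  funext i
  exact congrArg A (hT i).symm

variable [IsManifold (Q n) ∞ M] {N : Set M} {H : M → E n} {Φ : E n → M}

/-- The coefficients of vector fields with respect to coordinate vector fields. -/
def frameMatrix (H : M → E n) (X : Fin n → VF n M) (p : M) : Matrix (Fin n) (Fin n) ℝ :=
  Matrix.of fun i k => diff H p (X i p) k

theorem contMDiffOn_frameMatrix (h : IsCoord N H Φ) (X : Fin n → VF n M) (i k : Fin n) :
    ContMDiffOn (Q n) 𝓘(ℝ, ℝ) ∞ (fun p => frameMatrix H X p i k) N :=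
  (EuclideanSpace.proj (𝕜 := ℝ) k : E n →L[ℝ] ℝ).contDiff.contMDiff.comp_contMDiffOn
    (contMDiffOn_diff_apply h.isOpen h.contMDiffOn (X i))

theorem IsDensity.apply_frame {σ : (p : M) → (Fin n → TangentSpace (Q n) p) → ℂ} (hσ : IsDensity σ)
    (h : IsCoord N H Φ) (X : Fin n → VF n M) {p : M} (hp : p ∈ N) :
    σ p (fun i => X i p) = ((|(frameMatrix H X p).det| : ℝ) : ℂ) * coordCoeff Φ σ (H p) := by
  have h1 := hσ.apply_vec p (diffSymm Φ (H p)) fun i => diff H p (X i p)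
  unfold coordCoeff
  rw [h.left_inv p hp]
  refine Eq.trans ?_ h1
  congr 1
  funext i
  exact (h.diffSymm_diff hp _).symm

theorem eq_of_diff_eq (h : IsCoord N H Φ) {p : M} (hp : p ∈ N) {v w : E n}
    (hvw : diff H p v = diff H p w) : v = w := by
  rw [← h.diffSymm_diff hp v, hvw, h.diffSymm_diff hp w]

theorem diff_sum_smul {F : Type*} [NormedAddCommGroup F] [NormedSpace ℝ F] {ι : Type*} (f : M → F)
    (p : M) (t : Finset ι) (c : ι → ℝ) (X : ι → TangentSpace (Q n) p) :
    diff f p (∑ i ∈ t, c i • X i) = ∑ i ∈ t, c i • diff f p (X i) := by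
  have : ∀ Y : ι → E n, diff f p (∑ i ∈ t, c i • Y i) = ∑ i ∈ t, c i • diff f p (Y i) := fun Y => by
    rw [map_sum]
    simp only [map_smul]
  exact this X

theorem exists_coeff_of_det_ne_zero (h : IsCoord N H Φ) {X : Fin n → VF n M} {O : Set M}
    (hO : O ⊆ N) (hdet : ∀ p ∈ O, (frameMatrix H X p).det ≠ 0) (Z : VF n M) :
    ∃ f : Fin n → M → ℝ, (∀ i, ContMDiffOn (Q n) 𝓘(ℝ, ℝ) ∞ (f i) O) ∧
      ∀ p ∈ O, Z p = ∑ i, f i p • X i p := by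
  refine ⟨fun i p => ((frameMatrix H X p).transpose⁻¹.mulVec fun k => diff H p (Z p) k) i,
    fun i => contMDiffOn_inv_mulVec (a := fun p => (frameMatrix H X p).transpose) (fun i k => (contMDiffOn_frameMatrix h X k i).mono hO)
      (fun p hp => by rw [Matrix.det_transpose]; exact hdet p hp) (fun k => ?_) i, fun p hp => ?_⟩
  · exact ((EuclideanSpace.proj (𝕜 := ℝ) k : E n →L[ℝ] ℝ).contDiff.contMDiff.comp_contMDiffOn
      (contMDiffOn_diff_apply h.isOpen h.contMDiffOn Z)).mono hO
  · refine eq_of_diff_eq h (hO hp) ?_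
    refine Eq.trans ?_ (diff_sum_smul H p _ _ _).symm
    have hunit : IsUnit (frameMatrix H X p).transpose.det := by
      rw [Matrix.det_transpose]
      exact (hdet p hp).isUnit
    have h1 := Matrix.mulVec_mulVec (fun k => diff H p (Z p) k) (frameMatrix H X p).transpose
      (frameMatrix H X p).transpose⁻¹
    rw [Matrix.mul_nonsing_inv _ hunit, Matrix.one_mulVec] at h1
    ext k
    have h2 := congrFun h1 k
    rw [← h2]
    simp only [Matrix.mulVec, dotProduct, WithLp.ofLp_sum, Finset.sum_apply, PiLp.smul_apply,
      smul_eq_mul, Matrix.transpose_apply, frameMatrix, Matrix.of_apply]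
    exact Finset.sum_congr rfl fun i _ => mul_comm _ _

theorem coeff_eq_zero {X : Fin n → VF n M} {p : M} (hdet : (frameMatrix H X p).det ≠ 0)
    {c : Fin n → ℝ} (hc : ∑ i, c i • X i p = 0) (i : Fin n) : c i = 0 := by
  have h1 := congrArg (fun w : E n => diff H p w) hc
  have h2 := (diff_sum_smul H p Finset.univ c fun i => X i p).symm.trans (h1.trans (map_zero _))
  have h3 : (frameMatrix H X p).transpose.mulVec c = 0 := by
    funext k
    have h4 := congrArg (fun w : E n => w k) h2
    simp only [WithLp.ofLp_sum, Finset.sum_apply, PiLp.smul_apply, smul_eq_mul] at h4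
    refine Eq.trans ?_ h4
    simp only [Matrix.mulVec, dotProduct, Matrix.transpose_apply, frameMatrix, Matrix.of_apply]
    exact Finset.sum_congr rfl fun i _ => mul_comm _ _
  exact congrFun (Matrix.eq_zero_of_mulVec_eq_zero (by rwa [Matrix.det_transpose]) h3) i

theorem det_frameMatrix_ne_zero_of_span (h : IsCoord N H Φ) {X : Fin n → VF n M} {p : M} (hp : p ∈ N)
    (hX : ∀ v : E n, ∃ c : Fin n → ℝ, v = ∑ i, c i • X i p) : (frameMatrix H X p).det ≠ 0 := by
  rw [← Matrix.det_transpose]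
  refine IsUnit.ne_zero ?_
  rw [← Matrix.isUnit_iff_isUnit_det, ← Matrix.mulVec_surjective_iff_isUnit]
  intro z
  obtain ⟨c, hc⟩ := hX (diffSymm Φ (H p) (WithLp.toLp 2 z))
  refine ⟨c, ?_⟩
  have h1 := h.diff_diffSymm (mem_image_of_mem H hp) (WithLp.toLp 2 z)
  rw [h.left_inv p hp, hc] at h1
  have h2 := (diff_sum_smul H p Finset.univ c fun i => X i p).symm.trans h1
  funext k
  have h3 := congrArg (fun w : E n => w k) h2
  simp only [WithLp.ofLp_sum, Finset.sum_apply, PiLp.smul_apply, smul_eq_mul] at h3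
  rw [← h3]
  simp only [Matrix.mulVec, dotProduct, Matrix.transpose_apply, frameMatrix, Matrix.of_apply]
  exact Finset.sum_congr rfl fun i _ => mul_comm _ _

theorem sum_apply_VF {ι : Type*} (t : Finset ι) (X : ι → VF n M) (p : M) :
    (∑ i ∈ t, X i) p = ∑ i ∈ t, X i p := by
  classical
  induction t using Finset.induction_on with
  | empty => rfl
  | insert a t ha ih => rw [Finset.sum_insert ha, Finset.sum_insert ha, ← ih]; rfl

theorem sum_apply_Fn {ι : Type*} (t : Finset ι) (f : ι → Fn n M) (p : M) :
    (∑ i ∈ t, f i) p = ∑ i ∈ t, f i p := by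
  classical
  induction t using Finset.induction_on with
  | empty => rfl
  | insert a t ha ih => rw [Finset.sum_insert ha, Finset.sum_insert ha, ← ih]; rfl

theorem const_smul_mem {V : Submodule (Fn n M) (VF n M)} {X : VF n M} (hX : X ∈ V) (c : ℝ) :
    c • X ∈ V := by
  let g : Fn n M := ⟨fun _ => c, contMDiff_const⟩
  have : c • X = g • X := rfl
  rw [this]
  exact V.smul_mem _ hX

variable {𝓕 : Set (Set M)} {V : Submodule (Fn n M) (VF n M)}

/-- Dual bases of a finitely generated projective module of vector fields. -/
theorem IsLieStructure.exists_dualBasis (hV : IsLieStructure 𝓕 V) :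
    ∃ (L : ℕ) (X : Fin L → V) (s : V →ₗ[Fn n M] (Fin L → Fn n M)),
      ∀ Z : V, Z = ∑ k, s Z k • X k := by
  haveI := hV.finite
  haveI := hV.projective
  obtain ⟨L, f, hf⟩ := Module.Finite.exists_fin' (Fn n M) V
  obtain ⟨s, hs⟩ := Module.projective_lifting_property f LinearMap.id hf
  refine ⟨L, fun k => f (Pi.single k 1), s, fun Z => ?_⟩
  have h1 : f (s Z) = Z := LinearMap.congr_fun hs Z
  conv_lhs => rw [← h1, LinearMap.pi_apply_eq_sum_univ f (s Z)]
  refine Finset.sum_congr rfl fun k _ => ?_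
  congr 2
  funext j
  simp [Pi.single_apply, eq_comm]

/-- Locally every vector field is a combination of members of `V`, off the singular hyperfaces. -/
theorem IsLieStructure.exists_local_basis (hV : IsLieStructure 𝓕 V) (h : IsCoord N H Φ) {p : M}
    (hp : p ∈ N) (hpS : p ∉ ⋃₀ 𝓕) : ∃ (X : Fin n → VF n M), (∀ i, X i ∈ V) ∧ ∃ O, IsOpen O ∧
      p ∈ O ∧ O ⊆ N ∧ ∀ q ∈ O, (frameMatrix H X q).det ≠ 0 := by
  choose X hXV hX using fun i => hV.spans p hpS (diffSymm Φ (H p) (EuclideanSpace.single i 1))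
  have hdet : (frameMatrix H X p).det ≠ 0 := by
    have : frameMatrix H X p = 1 := by
      ext i k
      have h1 := h.diff_diffSymm (mem_image_of_mem H hp) (EuclideanSpace.single i 1)
      rw [h.left_inv p hp] at h1
      have h2 : diff H p (X i p) = EuclideanSpace.single i 1 := by
        rw [← h1]
        exact congrArg (diff H p) (hX i)
      simp only [frameMatrix, Matrix.of_apply, h2, Matrix.one_apply]
      simp [eq_comm]
    rw [this, Matrix.det_one]
    exact one_ne_zero
  have hc : ContinuousOn (fun q => (frameMatrix H X q).det) N :=
    (contMDiffOn_det (contMDiffOn_frameMatrix h X)).continuousOn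
  refine ⟨X, hXV, N ∩ (fun q => (frameMatrix H X q).det) ⁻¹' {0}ᶜ,
    hc.isOpen_inter_preimage h.isOpen isOpen_compl_singleton, ⟨hp, hdet⟩, inter_subset_left,
    fun q hq => hq.2⟩

/-- Linear functionals on `V` vanish where the argument does, off the singular hyperfaces. -/
theorem IsLieStructure.linearMap_apply_eq_zero [T2Space M] [CompactSpace M]
    (hV : IsLieStructure 𝓕 V) (s : V →ₗ[Fn n M] Fn n M) {Z : V} {p : M} (hpS : p ∉ ⋃₀ 𝓕)
    (hZ : (Z : VF n M) p = 0) : s Z p = 0 := by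
  have h := IsCoord.extChartAt (n := n) p
  obtain ⟨X, hXV, O, hO, hpO, hON, hdet⟩ := hV.exists_local_basis h (mem_chart_source _ p) hpS
  obtain ⟨f, hf, hfZ⟩ := exists_coeff_of_det_ne_zero h hON hdet (Z : VF n M)
  obtain ⟨θ, hθs, hθ1, -⟩ := exists_bump (n := n) hO hpO
  -- The local coefficients of `Z`, cut off to global functions so that linearity over `C^∞(M)`
  -- applies to `θ Z = ∑ g_i X_i`. All `g_i` vanish at `p`.
  let g : Fin n → Fn n M := fun i =>
    ⟨fun q => θ q • f i q, contMDiff_smul_of_tsupport hO θ.contMDiff hθs (hf i)⟩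
  have hfp : ∀ i, f i p = 0 := coeff_eq_zero (hdet p hpO) (by rw [← hfZ p hpO, hZ])
  have hsum : θ • Z = ∑ i, g i • (⟨X i, hXV i⟩ : V) := by
    apply Subtype.ext
    ext q
    have h1 : ((∑ i, g i • (⟨X i, hXV i⟩ : V) : V) : VF n M) q = ∑ i, g i q • X i q := by
      rw [AddSubmonoidClass.coe_finsetSum, sum_apply_VF]
      rfl
    rw [h1]
    change θ q • (Z : VF n M) q = _
    by_cases hq : q ∈ O
    · rw [hfZ q hq, Finset.smul_sum]
      exact Finset.sum_congr rfl fun i _ => smul_smul _ _ _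
    · have h0 : θ q = 0 := image_eq_zero_of_notMem_tsupport fun hq' => hq (hθs hq')
      have hg : ∀ i, g i q = 0 := fun i => by
        change θ q • f i q = 0
        rw [h0, zero_smul]
      rw [h0, zero_smul]
      exact (Finset.sum_eq_zero fun i _ => by rw [hg, zero_smul]).symm
  have h8 := congrArg s hsum
  rw [map_smul, map_sum] at h8
  simp only [map_smul, smul_eq_mul] at h8
  have h9 : (θ * s Z : Fn n M) p = ∑ i, g i p * s ⟨X i, hXV i⟩ p := by
    rw [h8, sum_apply_Fn]
    rfl
  have hg : ∀ i, g i p = 0 := fun i => by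
    change θ p • f i p = 0
    rw [hfp i, smul_zero]
  rw [Finset.sum_eq_zero fun i _ => by rw [hg i, zero_mul]] at h9
  change θ p * s Z p = 0 at h9
  rwa [hθ1.self_of_nhds, one_mul] at h9

/-- **Frames exist.** -/
theorem IsLieStructure.exists_frame [T2Space M] [CompactSpace M] (hV : IsLieStructure 𝓕 V) (p₀ : M) :
    ∃ U, IsOpen U ∧ p₀ ∈ U ∧ ∃ Y : Fin n → VF n M, IsFrameOn V U Y := by
  classical
  obtain ⟨L, X, s, hs⟩ := hV.exists_dualBasis
  -- The idempotent matrix function that cuts `V` out of a free module: `s Z` is a fixed vector of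
  -- `P`. The range of `P p` is the fibre at `p` of the bundle to be trivialized.
  let P : M → Matrix (Fin L) (Fin L) ℝ := fun p => Matrix.of fun j k => s (X k) j p
  have hPsm : ∀ j k, ContMDiff (Q n) 𝓘(ℝ, ℝ) ∞ fun p => P p j k := fun j k => (s (X k) j).contMDiff
  have hPs : ∀ (Z : V) p, (P p).mulVec (fun k => s Z k p) = fun k => s Z k p := by
    intro Z p
    funext j
    have h1 : s Z j = ∑ k, s Z k * s (X k) j := by
      have h2 := congrArg (fun W => s W j) (hs Z)
      simpa only [map_sum, map_smul, Finset.sum_apply, Pi.smul_apply, smul_eq_mul] using h2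
    have h3 : s Z j p = ∑ k, s Z k p * s (X k) j p := by
      conv_lhs => rw [h1]
      rw [sum_apply_Fn]
      rfl
    rw [h3]
    simp only [P, Matrix.mulVec, dotProduct, Matrix.of_apply]
    exact Finset.sum_congr rfl fun k _ => mul_comm _ _
  have hev : ∀ (Z : V) p, (Z : VF n M) p = ∑ k, s Z k p • (X k : VF n M) p := by
    intro Z p
    have h1 : (Z : VF n M) = ∑ k, s Z k • (X k : VF n M) := by
      conv_lhs => rw [hs Z]
      rw [AddSubmonoidClass.coe_finsetSum]
      rfl
    rw [congrArg (fun W : VF n M => W p) h1]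
    exact sum_apply_VF _ _ _
  have hPP : ∀ p, P p * P p = P p := by
    intro p
    ext j k
    exact congrFun (hPs (X k) p) j
  -- The standard intertwiner of nearby projections: `P(p) B(p) = B(p) P(p₀)` and `B(p₀) = 1`. Where
  -- `B` is invertible it carries the fibre at `p₀` to the fibre at `p`.
  let B : M → Matrix (Fin L) (Fin L) ℝ := fun p => P p * P p₀ + (1 - P p) * (1 - P p₀)
  have hPB : ∀ p, P p * B p = P p * P p₀ := by
    intro p
    simp only [B, mul_add, ← mul_assoc, mul_sub, mul_one, hPP, sub_self, zero_mul, add_zero]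
  have hBP : ∀ p, B p * P p₀ = P p * P p₀ := by
    intro p
    have : (1 - P p₀) * P p₀ = 0 := by rw [sub_mul, one_mul, hPP, sub_self]
    simp only [B, add_mul, mul_assoc, hPP, this, mul_zero, add_zero]
  have hB0 : B p₀ = 1 := by
    simp only [B, hPP, mul_sub, sub_mul, mul_one, one_mul]
    abel
  have hBsm : ∀ j k, ContMDiff (Q n) 𝓘(ℝ, ℝ) ∞ fun p => B p j k := by
    intro j k
    simp only [B, Matrix.add_apply, Matrix.mul_apply, Matrix.sub_apply]
    refine ContMDiff.add (contMDiff_finsetSum fun l _ => (hPsm j l).mul contMDiff_const)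
      (contMDiff_finsetSum fun l _ => (contMDiff_const.sub (hPsm j l)).mul contMDiff_const)
  let O : Set M := {p | (B p).det ≠ 0}
  have hdc : Continuous fun p => (B p).det :=
    continuousOn_univ.1 (contMDiffOn_det (n := n) fun j k => (hBsm j k).contMDiffOn).continuousOn
  have hO : IsOpen O := isOpen_compl_singleton.preimage hdc
  have hp₀O : p₀ ∈ O := by
    change (B p₀).det ≠ 0
    rw [hB0, Matrix.det_one]
    exact one_ne_zero
  let R : Submodule ℝ (Fin L → ℝ) := LinearMap.range (P p₀).mulVecLin
  let b := Module.finBasis ℝ R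
  set ρ := Module.finrank ℝ R with hρ
  let proj : (Fin L → ℝ) →ₗ[ℝ] R := (P p₀).mulVecLin.rangeRestrict
  have hproj : ∀ w : R, proj w = w := by
    rintro ⟨_, x, rfl⟩
    apply Subtype.ext
    change (P p₀).mulVec ((P p₀).mulVec x) = (P p₀).mulVec x
    rw [Matrix.mulVec_mulVec, hPP]
  -- A basis of the fibre at `p₀`, extended with constant coefficients in the generators `X j`. Its
  -- coordinate vectors at `p` are `P(p) b_a`, which equals `B(p) b_a`.
  let Y : Fin ρ → VF n M := fun a => ∑ j, ((b a : Fin L → ℝ) j) • (X j : VF n M)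
  have hYV : ∀ a, Y a ∈ V := fun a => V.sum_mem fun j _ => const_smul_mem (X j).2 _
  have hPb : ∀ a, (P p₀).mulVec (b a : Fin L → ℝ) = (b a : Fin L → ℝ) := fun a =>
    congrArg Subtype.val (hproj (b a))
  have hsY : ∀ a p, (fun k => s ⟨Y a, hYV a⟩ k p) = (P p).mulVec (b a : Fin L → ℝ) := by
    intro a p
    let cst : ℝ → Fn n M := fun c => ⟨fun _ => c, contMDiff_const⟩
    have h1 : (⟨Y a, hYV a⟩ : V) = ∑ j, cst ((b a : Fin L → ℝ) j) • X j := by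
      apply Subtype.ext
      rw [AddSubmonoidClass.coe_finsetSum]
      rfl
    funext k
    have h2 : s ⟨Y a, hYV a⟩ k = ∑ j, cst ((b a : Fin L → ℝ) j) * s (X j) k := by
      rw [h1]
      simp only [map_sum, map_smul, Finset.sum_apply, Pi.smul_apply, smul_eq_mul]
    rw [h2, sum_apply_Fn]
    exact Finset.sum_congr rfl fun j _ => mul_comm _ _
  -- every member of `V` is a combination of the `Y a` over `O`
  have hcomb : ∀ Z ∈ V, ∃ f : Fin ρ → M → ℝ,
      (∀ a, ContMDiffOn (Q n) 𝓘(ℝ, ℝ) ∞ (f a) O) ∧ ∀ p ∈ O, Z p = ∑ a, f a p • Y a p := by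
    intro Z hZ
    let w : M → Fin L → ℝ := fun p => (B p)⁻¹.mulVec fun k => s ⟨Z, hZ⟩ k p
    have hw : ∀ k, ContMDiffOn (Q n) 𝓘(ℝ, ℝ) ∞ (fun p => w p k) O := fun k =>
      contMDiffOn_inv_mulVec (fun j k => (hBsm j k).contMDiffOn) (fun p hp => hp)
        (fun k => (s ⟨Z, hZ⟩ k).contMDiff.contMDiffOn) k
    refine ⟨fun a p => b.repr (proj (w p)) a, fun a => ?_, fun p hp => ?_⟩
    · let Λ : (Fin L → ℝ) →ₗ[ℝ] ℝ := (b.coord a).comp proj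
      have h1 : ∀ p, b.repr (proj (w p)) a = ∑ k, w p k * Λ (Pi.single k 1) := fun p => by
        have := LinearMap.pi_apply_eq_sum_univ Λ (w p)
        refine Eq.trans this (Finset.sum_congr rfl fun k _ => ?_)
        rw [smul_eq_mul]
        congr 2
        funext j
        simp [Pi.single_apply, eq_comm]
      simp only [h1]
      exact contMDiffOn_finsetSum fun k _ => (hw k).mul contMDiffOn_const
    · have hunit : IsUnit (B p).det := IsUnit.mk0 _ hp
      have hBw : (B p).mulVec (w p) = fun k => s ⟨Z, hZ⟩ k p := by
        simp only [w]
        rw [Matrix.mulVec_mulVec, Matrix.mul_nonsing_inv _ hunit, Matrix.one_mulVec]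
      -- Pulling the `P(p)`-fixed vector `s Z` back by `B(p)` gives a vector in the range of
      -- `P(p₀)`, hence a combination of the `b_a`.
      have hPw : (P p₀).mulVec (w p) = w p := by
        have h1 : (B p).mulVec ((P p₀).mulVec (w p)) = (B p).mulVec (w p) := by
          rw [Matrix.mulVec_mulVec, hBP, ← hPB, ← Matrix.mulVec_mulVec, hBw, hPs]
        exact Matrix.mulVec_injective_of_isUnit ((Matrix.isUnit_iff_isUnit_det _).2 hunit) h1
      have hsum : w p = ∑ a, b.repr (proj (w p)) a • (b a : Fin L → ℝ) := by
        have h1 := congrArg Subtype.val (b.sum_repr (proj (w p)))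
        rw [AddSubmonoidClass.coe_finsetSum] at h1
        exact hPw.symm.trans h1.symm
      have hsZ : ∀ k, s ⟨Z, hZ⟩ k p =
          ∑ a, b.repr (proj (w p)) a * s ⟨Y a, hYV a⟩ k p := by
        intro k
        have h1 : (fun k => s ⟨Z, hZ⟩ k p) = (P p).mulVec (w p) := by
          calc (fun k => s ⟨Z, hZ⟩ k p) = (B p).mulVec ((P p₀).mulVec (w p)) := by rw [hPw, hBw]
            _ = (P p).mulVec ((P p₀).mulVec (w p)) := by
              rw [Matrix.mulVec_mulVec, hBP, ← Matrix.mulVec_mulVec]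
            _ = (P p).mulVec (w p) := by rw [hPw]
        have h2 : (P p).mulVec (w p) = ∑ a, b.repr (proj (w p)) a • (P p).mulVec (b a : Fin L → ℝ) := by
          conv_lhs => rw [hsum]
          exact (map_sum (P p).mulVecLin _ _).trans
            (Finset.sum_congr rfl fun a _ => map_smul (P p).mulVecLin _ _)
        have h3 := congrFun (h1.trans h2) k
        rw [Finset.sum_apply] at h3
        refine h3.trans (Finset.sum_congr rfl fun a _ => ?_)
        rw [← hsY]
        rfl
      refine (hev ⟨Z, hZ⟩ p).trans ?_
      simp only [hsZ, Finset.sum_smul]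
      rw [Finset.sum_comm]
      refine Finset.sum_congr rfl fun a _ => ?_
      refine Eq.trans ?_ (congrArg (fun v => b.repr (proj (w p)) a • v) (hev ⟨Y a, hYV a⟩ p).symm)
      rw [Finset.smul_sum]
      exact Finset.sum_congr rfl fun k _ => (smul_smul _ _ _).symm
  -- The rank is `n`: at a nonsingular point near `p₀` the `Y a` form a basis of the tangent space.
  -- Independence uses that `s` at `q` only sees the value of the field at `q`.
  obtain ⟨q, hqS, hqO⟩ := ((frequently_notMem_sUnion hV.subset_hyperfaces p₀).and_eventually
    (hO.mem_nhds hp₀O)).exists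
  have hli : LinearIndependent ℝ fun a => (Y a q : E n) := by
    rw [Fintype.linearIndependent_iff]
    intro d hd
    let cst : ℝ → Fn n M := fun c => ⟨fun _ => c, contMDiff_const⟩
    let W : V := ∑ a, cst (d a) • ⟨Y a, hYV a⟩
    have hW0 : (W : VF n M) q = 0 := by
      have h1 : (W : VF n M) q = ∑ a, d a • Y a q := by
        simp only [W]
        rw [AddSubmonoidClass.coe_finsetSum, sum_apply_VF]
        rfl
      exact h1.trans hd
    have h2 : ∀ k, s W k q = 0 := fun k =>
      hV.linearMap_apply_eq_zero ((LinearMap.proj k).comp s) hqS hW0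
    have h3 : ∀ k, s W k q = ((P q).mulVec (∑ a, d a • (b a : Fin L → ℝ))) k := by
      intro k
      have h4 : (P q).mulVec (∑ a, d a • (b a : Fin L → ℝ)) =
          ∑ a, d a • (P q).mulVec (b a : Fin L → ℝ) :=
        (map_sum (P q).mulVecLin _ _).trans
          (Finset.sum_congr rfl fun a _ => map_smul (P q).mulVecLin _ _)
      rw [h4, Finset.sum_apply]
      simp only [W, map_sum, map_smul, Finset.sum_apply, sum_apply_Fn]
      refine Finset.sum_congr rfl fun a _ => ?_
      rw [← hsY]
      rfl
    have h5 : (B q).mulVec (∑ a, d a • (b a : Fin L → ℝ)) = 0 := by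
      have h6 : (P p₀).mulVec (∑ a, d a • (b a : Fin L → ℝ)) = ∑ a, d a • (b a : Fin L → ℝ) :=
        (map_sum (P p₀).mulVecLin _ _).trans (Finset.sum_congr rfl fun a _ =>
          (map_smul (P p₀).mulVecLin _ _).trans (congrArg (fun v => d a • v) (hPb a)))
      rw [← h6, Matrix.mulVec_mulVec, hBP, ← Matrix.mulVec_mulVec, h6]
      funext k
      rw [← h3, h2]
      rfl
    have h7 := Matrix.eq_zero_of_mulVec_eq_zero hqO h5
    have h8 : ∑ a, d a • b a = 0 := by
      apply Subtype.ext
      rw [AddSubmonoidClass.coe_finsetSum]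
      exact h7
    exact Fintype.linearIndependent_iff.1 b.linearIndependent d h8
  have hspan : ⊤ ≤ Submodule.span ℝ (range fun a => (Y a q : E n)) := by
    intro v _
    obtain ⟨Z, hZ, hZv⟩ := hV.spans q hqS v
    obtain ⟨f, -, hf⟩ := hcomb Z hZ
    have h1 : v = ∑ a, f a q • (Y a q : E n) := hZv.symm.trans (hf q hqO)
    rw [h1]
    exact Submodule.sum_mem _ fun a _ => Submodule.smul_mem _ _ (Submodule.subset_span ⟨a, rfl⟩)
  have hn : n = ρ := by
    have h1 := Module.finrank_eq_card_basis (Module.Basis.mk hli hspan)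
    rw [Fintype.card_fin] at h1
    exact finrank_euclideanSpace_fin.symm.trans h1
  refine ⟨O, hO, hp₀O, fun i => Y (finCongr hn i), fun i => hYV _, fun Z hZ => ?_⟩
  obtain ⟨f, hf, hfZ⟩ := hcomb Z hZ
  refine ⟨fun i => f (finCongr hn i), fun i => hf _, fun p hp => ?_⟩
  rw [hfZ p hp]
  exact ((finCongr hn).sum_comp fun a => f a p • Y a p).symm

end Frames

/-! ### Flat functions -/

section Flat

/-- Each term of the iterated chain rule contains a derivative of `g` at `f x`. The quantitative
form of the chain rule is used with bound `C = 0` for these derivatives. -/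
theorem iteratedFDerivWithin_comp_eq_zero {m n : ℕ} {g : E m → ℂ} {f : E n → E m} {s : Set (E n)}
    {t : Set (E m)} (hg : ContDiffOn ℝ ∞ g t) (hf : ContDiffOn ℝ ∞ f s) (ht : UniqueDiffOn ℝ t)
    (hs : UniqueDiffOn ℝ s) (hst : MapsTo f s t) {x : E n} (hx : x ∈ s)
    (h0 : ∀ k, iteratedFDerivWithin ℝ k g t (f x) = 0) (k : ℕ) :
    iteratedFDerivWithin ℝ k (g ∘ f) s x = 0 := by
  -- The estimate asks for `‖D^i f‖ ≤ D^i`; since `D ≥ 1`, dominating all the norms by `D` itself is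
  -- enough.
  set D : ℝ := 1 + ∑ i ∈ Finset.range (k + 1), ‖iteratedFDerivWithin ℝ i f s x‖ with hD
  have hD1 : 1 ≤ D := by
    have : 0 ≤ ∑ i ∈ Finset.range (k + 1), ‖iteratedFDerivWithin ℝ i f s x‖ :=
      Finset.sum_nonneg fun i _ => norm_nonneg _
    linarith
  have h1 := norm_iteratedFDerivWithin_comp_le hg hf (n := k) (by exact_mod_cast le_top) ht hs hst hx
    (C := 0) (D := D) (fun i _ => by rw [h0, norm_zero]) (fun i hi hik => by
      have h2 : ‖iteratedFDerivWithin ℝ i f s x‖ ≤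
          ∑ i ∈ Finset.range (k + 1), ‖iteratedFDerivWithin ℝ i f s x‖ :=
        Finset.single_le_sum (f := fun i => ‖iteratedFDerivWithin ℝ i f s x‖)
          (fun i _ => norm_nonneg _) (Finset.mem_range.2 (Nat.lt_succ_of_le hik))
      calc ‖iteratedFDerivWithin ℝ i f s x‖ ≤ D := by linarith
        _ = D ^ 1 := (pow_one D).symm
        _ ≤ D ^ i := pow_le_pow_right₀ hD1 hi)
  rw [mul_zero, zero_mul] at h1
  exact norm_le_zero_iff.1 h1

variable {m n : ℕ} {M : Type*} [TopologicalSpace M] [ChartedSpace (EuclideanQuadrant n) M]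
  {M' : Type*} [TopologicalSpace M'] [ChartedSpace (EuclideanQuadrant m) M']

/-- All derivatives of `f` vanish at `p`. -/
def FlatAt (n : ℕ) {M : Type*} [TopologicalSpace M] [ChartedSpace (EuclideanQuadrant n) M]
    (f : M → ℂ) (p : M) : Prop :=
  ∀ k : ℕ, iteratedFDerivWithin ℝ k (f ∘ (extChartAt (Q n) p).symm) (range (Q n))
    (extChartAt (Q n) p p) = 0

theorem contMDiffOn_complex_mul {f g : M → ℂ} {s : Set M} (hf : ContMDiffOn (Q n) 𝓘(ℝ, ℂ) ∞ f s)
    (hg : ContMDiffOn (Q n) 𝓘(ℝ, ℂ) ∞ g s) :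
    ContMDiffOn (Q n) 𝓘(ℝ, ℂ) ∞ (fun p => f p * g p) s :=
  (contDiff_mul (𝕜 := ℝ) (𝔸 := ℂ)).contMDiff.comp_contMDiffOn (hf.prodMk_space hg)

variable [IsManifold (Q n) ∞ M] [IsManifold (Q m) ∞ M']

theorem FlatAt.congr {f g : M → ℂ} {p : M} (hf : FlatAt n f p) (h : f =ᶠ[𝓝 p] g) :
    FlatAt n g p := by
  intro k
  have hc := IsCoord.extChartAt (n := n) p
  have hp := mem_chart_source (EuclideanQuadrant n) p
  have h1 : (g ∘ (extChartAt (Q n) p).symm) =ᶠ[𝓝[range (Q n)] (extChartAt (Q n) p p)]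
      (f ∘ (extChartAt (Q n) p).symm) := by
    rw [range_Q]
    filter_upwards [(hc.tendsto_symm hp).eventually h] with v hv using hv.symm
  rw [h1.iteratedFDerivWithin_eq, hf k]
  simp only [Function.comp_apply]
  rw [hc.left_inv p hp]
  exact h.self_of_nhds.symm

theorem flatAt_zero (p : M) : FlatAt n (fun _ : M => (0 : ℂ)) p := by
  intro k
  have : ((fun _ : M => (0 : ℂ)) ∘ (extChartAt (Q n) p).symm) = fun _ => 0 := rfl
  rw [this, iteratedFDerivWithin_fun_zero]
  rfl

theorem iteratedFDerivWithin_range_eq {f : E n → ℂ} {N : Set M} {H : M → E n} {Φ : E n → M}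
    (h : IsCoord N H Φ) {p : M} (hp : p ∈ N) (k : ℕ) :
    iteratedFDerivWithin ℝ k f (range (Q n)) (H p) = iteratedFDerivWithin ℝ k f (H '' N) (H p) := by
  rw [range_Q]
  exact (iteratedFDerivWithin_congr_set (h.image_eventuallyEq (mem_image_of_mem H hp)) k).symm

/-- It will be applied to the projection of a neighbourhood in `M` onto `Y`, to pull back the
coefficient of a flat density. -/
theorem FlatAt.comp {f : M' → ℂ} {π : M → M'} {p : M} {O : Set M} {O' : Set M'} (ho : IsOpen O)
    (ho' : IsOpen O') (hp : p ∈ O) (hp' : π p ∈ O') (hπ : ContMDiffOn (Q n) (Q m) ∞ π O)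
    (hf : ContMDiffOn (Q m) 𝓘(ℝ, ℂ) ∞ f O') (hflat : FlatAt m f (π p)) : FlatAt n (f ∘ π) p := by
  have hc := IsCoord.extChartAt (n := n) p
  have hc' := IsCoord.extChartAt (n := m) (π p)
  set O₁' := O' ∩ (chartAt (EuclideanQuadrant m) (π p)).source
  have ho₁' : IsOpen O₁' := ho'.inter hc'.isOpen
  set O₁ := (O ∩ π ⁻¹' O₁') ∩ (chartAt (EuclideanQuadrant n) p).source
  have ho₁ : IsOpen O₁ := (hπ.continuousOn.isOpen_inter_preimage ho ho₁').inter hc.isOpen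
  have hpO₁ : p ∈ O₁ := ⟨⟨hp, hp', mem_chart_source _ _⟩, mem_chart_source _ _⟩
  have h1 := hc.mono ho₁ inter_subset_right
  have h1' := hc'.mono ho₁' inter_subset_right
  have hmaps : MapsTo (extChartAt (Q m) (π p) ∘ π ∘ (extChartAt (Q n) p).symm)
      (extChartAt (Q n) p '' O₁) (extChartAt (Q m) (π p) '' O₁') := by
    intro v hv
    exact mem_image_of_mem _ (h1.mapsTo_symm hv).1.2
  intro k
  have heq : EqOn ((f ∘ π) ∘ (extChartAt (Q n) p).symm) ((f ∘ (extChartAt (Q m) (π p)).symm) ∘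
      (extChartAt (Q m) (π p) ∘ π ∘ (extChartAt (Q n) p).symm)) (extChartAt (Q n) p '' O₁) := by
    intro v hv
    simp only [Function.comp_apply]
    rw [h1'.left_inv _ (h1.mapsTo_symm hv).1.2]
  have hx := mem_image_of_mem (extChartAt (Q n) p) hpO₁
  rw [iteratedFDerivWithin_range_eq h1 hpO₁, iteratedFDerivWithin_congr heq hx]
  refine iteratedFDerivWithin_comp_eq_zero
    (h1'.contMDiffOn_comp_symm Subset.rfl (hf.mono inter_subset_left)) ?_ h1'.uniqueDiffOn_image
    h1.uniqueDiffOn_image hmaps hx (fun k => ?_) k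
  · refine h1.contMDiffOn_comp_symm Subset.rfl (f := extChartAt (Q m) (π p) ∘ π) ?_
    exact h1'.contMDiffOn.comp (hπ.mono fun q hq => hq.1.1) fun q hq => hq.1.2
  · have h2 := hflat k
    rw [iteratedFDerivWithin_range_eq h1' ⟨hp', mem_chart_source _ _⟩] at h2
    simpa only [Function.comp_apply, hc.left_inv p (mem_chart_source _ p)] using h2

theorem FlatAt.mul_left {a f : M → ℂ} {p : M} {O : Set M} (ho : IsOpen O) (hp : p ∈ O)
    (ha : ContMDiffOn (Q n) 𝓘(ℝ, ℂ) ∞ a O) (hf : ContMDiffOn (Q n) 𝓘(ℝ, ℂ) ∞ f O)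
    (hflat : FlatAt n f p) : FlatAt n (fun q => a q * f q) p := by
  have hc := IsCoord.extChartAt (n := n) p
  have ho₁ : IsOpen (O ∩ (chartAt (EuclideanQuadrant n) p).source) := ho.inter hc.isOpen
  have h1 := hc.mono ho₁ inter_subset_right
  have hpO₁ : p ∈ O ∩ (chartAt (EuclideanQuadrant n) p).source := ⟨hp, mem_chart_source _ _⟩
  have hx := mem_image_of_mem (extChartAt (Q n) p) hpO₁
  intro k
  rw [iteratedFDerivWithin_range_eq h1 hpO₁]
  have h2 := norm_iteratedFDerivWithin_mul_le
    (h1.contMDiffOn_comp_symm Subset.rfl (ha.mono inter_subset_left))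
    (h1.contMDiffOn_comp_symm Subset.rfl (hf.mono inter_subset_left)) h1.uniqueDiffOn_image hx
    (n := k) (by exact_mod_cast le_top)
  rw [Finset.sum_eq_zero] at h2
  · exact norm_le_zero_iff.1 h2
  · intro i _
    have h3 := hflat (k - i)
    rw [iteratedFDerivWithin_range_eq h1 hpO₁] at h3
    rw [h3, norm_zero, mul_zero]

end Flat

/-! ### Densities given by their coefficient in one frame -/

section Local

variable {n : ℕ} {M : Type*} [TopologicalSpace M] [ChartedSpace (EuclideanQuadrant n) M]
  [IsManifold (Q n) ∞ M] {𝓕 : Set (Set M)} {V : Submodule (Fn n M) (VF n M)}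

/-- Nonsingular points are dense. So identities for coefficients of densities, given only where the
anchor is invertible, extend across the singular hyperfaces. -/
theorem eqOn_of_eqOn_compl (h𝓕 : 𝓕 ⊆ hyperfaces n M) {F : Type*} [TopologicalSpace F] [T2Space F]
    {f g : M → F} {O : Set M} (hO : IsOpen O) (hf : ContinuousOn f O) (hg : ContinuousOn g O)
    (h : ∀ p ∈ O, p ∉ ⋃₀ 𝓕 → f p = g p) : EqOn f g O := by
  intro p hp
  refine tendsto_nhds_unique_of_frequently_eq (hf.continuousAt (hO.mem_nhds hp))
    (hg.continuousAt (hO.mem_nhds hp)) ?_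
  have hev : ∀ᶠ q in 𝓝 p, q ∈ O := hO.mem_nhds hp
  exact ((frequently_notMem_sUnion h𝓕 p).and_eventually hev).mono fun q hq => h q hq.2 hq.1

theorem IsFrameOn.mono {U U' : Set M} {X : Fin n → VF n M} (hX : IsFrameOn V U X) (h : U' ⊆ U) :
    IsFrameOn V U' X := by
  refine ⟨hX.1, fun Z hZ => ?_⟩
  obtain ⟨f, hf, hfZ⟩ := hX.2 Z hZ
  exact ⟨f, fun i => (hf i).mono h, fun p hp => hfZ p (h hp)⟩

theorem IsFrameOn.det_ne_zero (hV : IsLieStructure 𝓕 V) {U : Set M} {X : Fin n → VF n M}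
    (hX : IsFrameOn V U X) {p : M} (hpU : p ∈ U) (hp : p ∉ ⋃₀ 𝓕) {N : Set M} {H : M → E n}
    {Φ : E n → M} (h : IsCoord N H Φ) (hpN : p ∈ N) : (frameMatrix H X p).det ≠ 0 := by
  refine det_frameMatrix_ne_zero_of_span h hpN fun v => ?_
  obtain ⟨Z, hZ, hZv⟩ := hV.spans p hp v
  obtain ⟨f, -, hf⟩ := hX.2 Z hZ
  exact ⟨fun i => f i p, hZv.symm.trans (hf p hpU)⟩

theorem frameMatrix_mul {H : M → E n} {X Z : Fin n → VF n M} {p : M} {g : Fin n → Fin n → ℝ}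
    (hg : ∀ i, X i p = ∑ j, g i j • Z j p) :
    frameMatrix H X p = Matrix.of g * frameMatrix H Z p := by
  ext i k
  have h1 := congrArg (fun v : E n => diff H p v) (hg i)
  have h2 := congrArg (fun v : E n => v k) (h1.trans (diff_sum_smul H p _ _ _))
  simp only [WithLp.ofLp_sum, Finset.sum_apply, PiLp.smul_apply, smul_eq_mul] at h2
  simp only [frameMatrix, Matrix.mul_apply, Matrix.of_apply]
  exact h2

/-- Change of frame. -/
theorem exists_frame_change (hV : IsLieStructure 𝓕 V) {U U' : Set M} (hU : IsOpen U)
    (hU' : IsOpen U') {X Z : Fin n → VF n M} (hX : IsFrameOn V U X) (hZ : IsFrameOn V U' Z) :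
    ∃ h : M → ℝ, ContMDiffOn (Q n) 𝓘(ℝ, ℝ) ∞ h (U ∩ U') ∧ ∀ p ∈ U ∩ U', p ∉ ⋃₀ 𝓕 →
      ∀ σ : (p : M) → (Fin n → TangentSpace (Q n) p) → ℂ, IsDensity σ →
        σ p (fun i => X i p) = (h p : ℂ) * σ p (fun i => Z i p) := by
  choose g hg hgX using fun i => hZ.2 (X i) (hX.1 i)
  choose k hk hkZ using fun i => hX.2 (Z i) (hZ.1 i)
  have hO : IsOpen (U ∩ U') := hU.inter hU'
  have hg' : ∀ i j, ContMDiffOn (Q n) 𝓘(ℝ, ℝ) ∞ (g i j) (U ∩ U') := fun i j =>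
    (hg i j).mono inter_subset_right
  have hk' : ∀ i j, ContMDiffOn (Q n) 𝓘(ℝ, ℝ) ∞ (k i j) (U ∩ U') := fun i j =>
    (hk i j).mono inter_subset_left
  let G : M → Matrix (Fin n) (Fin n) ℝ := fun p => Matrix.of fun i j => g i j p
  let K : M → Matrix (Fin n) (Fin n) ℝ := fun p => Matrix.of fun i j => k i j p
  have hGsm := contMDiffOn_det (a := G) hg'
  have hKsm := contMDiffOn_det (a := K) hk'
  -- The two transition determinants are inverse to each other at nonsingular points, hence
  -- everywhere by density. So `det G` has no zeros even on the singular set, where the frame fields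
  -- themselves may be dependent as vectors, and `|det G|` is smooth.
  have h1 : EqOn (fun p => (K p).det * (G p).det) (fun _ => 1) (U ∩ U') := by
    refine eqOn_of_eqOn_compl hV.subset_hyperfaces hO (hKsm.mul hGsm).continuousOn
      continuousOn_const fun p hp hpS => ?_
    have hc := IsCoord.extChartAt (n := n) p
    have hdet := hZ.det_ne_zero hV hp.2 hpS hc (mem_chart_source _ p)
    have h2 := congrArg Matrix.det (frameMatrix_mul (H := extChartAt (Q n) p)
      (g := fun i j => g i j p) fun i => hgX i p hp.2)
    have h3 := congrArg Matrix.det (frameMatrix_mul (H := extChartAt (Q n) p)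
      (g := fun i j => k i j p) fun i => hkZ i p hp.1)
    rw [Matrix.det_mul] at h2 h3
    rw [h2, ← mul_assoc] at h3
    exact mul_right_cancel₀ hdet (by rw [one_mul]; exact h3.symm)
  have hne : ∀ p ∈ U ∩ U', (G p).det ≠ 0 := fun p hp h0 => by
    have h2 := h1 hp
    simp only [h0, mul_zero] at h2
    exact zero_ne_one h2
  refine ⟨fun p => |(G p).det|, fun p hp => ?_, fun p hp hpS σ hσ => ?_⟩
  · exact (contDiffAt_abs (hne p hp)).contMDiffAt.comp_contMDiffWithinAt p (hGsm p hp)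
  · have hc := IsCoord.extChartAt (n := n) p
    rw [hσ.apply_frame hc X (mem_chart_source _ p), hσ.apply_frame hc Z (mem_chart_source _ p),
      frameMatrix_mul (g := fun i j => g i j p) fun i => hgX i p hp.2, Matrix.det_mul, abs_mul]
    push_cast
    ring

variable {N : Set M} {Z : Fin n → VF n M} {K : Set M}
  {σ : (p : M) → (Fin n → TangentSpace (Q n) p) → ℂ} {c : M → ℂ}

/-- One frame on a neighbourhood of the support suffices. In any other frame the coefficient is `c`
times the smooth frame change on `U ∩ N` and zero on `U \ K`; these open sets cover `U`. -/
theorem exists_coeff_of_local (hV : IsLieStructure 𝓕 V) (hN : IsOpen N) (hZ : IsFrameOn V N Z)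
    (hK : IsClosed K) (hKN : K ⊆ N) (hσ : IsDensity σ) (hσK : ∀ p, p ∉ K → ∀ v, σ p v = 0)
    (hc : ContMDiffOn (Q n) 𝓘(ℝ, ℂ) ∞ c N)
    (hcσ : ∀ p ∈ N, p ∉ ⋃₀ 𝓕 → c p = σ p (fun i => Z i p)) {U : Set M} (hU : IsOpen U)
    {X : Fin n → VF n M} (hX : IsFrameOn V U X) : ∃ (f : M → ℂ) (h : M → ℂ), IsCoeffOn 𝓕 σ U X f ∧
      ContMDiffOn (Q n) 𝓘(ℝ, ℂ) ∞ h (U ∩ N) ∧ (∀ p ∈ U ∩ N, f p = h p * c p) ∧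
      ∀ p ∈ U \ K, f p = 0 := by
  classical
  obtain ⟨h, hh, hhσ⟩ := exists_frame_change hV hU hN hX hZ
  have hh' : ContMDiffOn (Q n) 𝓘(ℝ, ℂ) ∞ (fun p => (h p : ℂ)) (U ∩ N) :=
    Complex.ofRealCLM.contDiff.contMDiff.comp_contMDiffOn hh
  have hc0 : ∀ p ∈ N \ K, c p = 0 := by
    refine eqOn_of_eqOn_compl hV.subset_hyperfaces (hN.sdiff hK)
      (hc.continuousOn.mono sdiff_subset) continuousOn_const fun p hp hpS => ?_
    rw [hcσ p hp.1 hpS, hσK p hp.2]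
  let f : M → ℂ := fun p => if p ∈ N then (h p : ℂ) * c p else 0
  have hf1 : ∀ p ∈ U ∩ N, f p = (h p : ℂ) * c p := fun p hp => if_pos hp.2
  have hf0 : ∀ p ∈ U \ K, f p = 0 := by
    intro p hp
    by_cases hpN : p ∈ N
    · rw [hf1 p ⟨hp.1, hpN⟩, hc0 p ⟨hpN, hp.2⟩, mul_zero]
    · exact if_neg hpN
  refine ⟨f, fun p => (h p : ℂ), ⟨?_, fun p hp hpS => ?_⟩, hh', hf1, hf0⟩
  · have hcov : U = (U ∩ N) ∪ (U \ K) := by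
      ext p
      constructor
      · intro hp
        by_cases hpK : p ∈ K
        · exact Or.inl ⟨hp, hKN hpK⟩
        · exact Or.inr ⟨hp, hpK⟩
      · rintro (hp | hp)
        · exact hp.1
        · exact hp.1
    rw [hcov]
    refine ContMDiffOn.union_of_isOpen ?_ ?_ (hU.inter hN) (hU.sdiff hK)
    · exact (contMDiffOn_complex_mul hh' (hc.mono inter_subset_right)).congr hf1
    · exact contMDiffOn_const.congr hf0
  · by_cases hpN : p ∈ N
    · rw [hf1 p ⟨hp, hpN⟩, hcσ p hpN hpS, hhσ p ⟨hp, hpN⟩ hpS σ hσ]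
    · rw [hf0 p ⟨hp, fun hpK => hpN (hKN hpK)⟩, hσK p fun hpK => hpN (hKN hpK)]

theorem mem_density_of_local (hV : IsLieStructure 𝓕 V) (hN : IsOpen N) (hZ : IsFrameOn V N Z)
    (hK : IsClosed K) (hKN : K ⊆ N) (hσ : IsDensity σ) (hσK : ∀ p, p ∉ K → ∀ v, σ p v = 0)
    (hσS : ∀ p ∈ ⋃₀ 𝓕, ∀ v, σ p v = 0) (hc : ContMDiffOn (Q n) 𝓘(ℝ, ℂ) ∞ c N)
    (hcσ : ∀ p ∈ N, p ∉ ⋃₀ 𝓕 → c p = σ p (fun i => Z i p)) : σ ∈ Density 𝓕 V := by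
  refine ⟨hσS, fun p _ L v => hσ p L v, fun U hU X hX => ?_⟩
  obtain ⟨f, -, hf, -⟩ := exists_coeff_of_local hV hN hZ hK hKN hσ hσK hc hcσ hU hX
  exact ⟨f, hf⟩

/-- A change of frame multiplies the coefficient by a smooth function, which preserves flatness by
the Leibniz rule. -/
theorem vanishesToAllOrders_of_local (hV : IsLieStructure 𝓕 V) (hN : IsOpen N)
    (hZ : IsFrameOn V N Z) (hK : IsClosed K) (hKN : K ⊆ N) (hσ : IsDensity σ)
    (hσK : ∀ p, p ∉ K → ∀ v, σ p v = 0) (hc : ContMDiffOn (Q n) 𝓘(ℝ, ℂ) ∞ c N)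
    (hcσ : ∀ p ∈ N, p ∉ ⋃₀ 𝓕 → c p = σ p (fun i => Z i p))
    (hflat : ∀ p ∈ N, p ∈ ⋃₀ 𝓕 → FlatAt n c p) : VanishesToAllOrders 𝓕 V σ := by
  intro U hU X hX f' hf' p hpU hpS
  obtain ⟨f, h, hf, hh, hfh, hf0⟩ := exists_coeff_of_local hV hN hZ hK hKN hσ hσK hc hcσ hU hX
  have heq : EqOn f f' U := eqOn_of_eqOn_compl hV.subset_hyperfaces hU hf.1.continuousOn
    hf'.1.continuousOn fun q hq hqS => by rw [hf.2 q hq hqS, hf'.2 q hq hqS]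
  refine FlatAt.congr (f := f) ?_ (heq.eventuallyEq_of_mem (hU.mem_nhds hpU))
  by_cases hpN : p ∈ N
  · have hO : IsOpen (U ∩ N) := hU.inter hN
    refine FlatAt.congr ((hflat p hpN hpS).mul_left hO ⟨hpU, hpN⟩ hh (hc.mono inter_subset_right)) ?_
    filter_upwards [hO.mem_nhds ⟨hpU, hpN⟩] with q hq using (hfh q hq).symm
  · have hpK : p ∈ U \ K := ⟨hpU, fun hpK => hpN (hKN hpK)⟩
    refine FlatAt.congr (flatAt_zero p) ?_
    filter_upwards [(hU.sdiff hK).mem_nhds hpK] with q hq using (hf0 q hq).symm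

end Local

/-! ### Hypersurfaces of the quadrant containing a face -/

section RegularFace

variable {m : ℕ} {h : E m → E (m + 1)} {y₀ : E m} {r : ℝ} {j : Fin (m + 1)}

/-- By `hreg` the hypersurface covers the face `j` near `h y₀`, so it contains points a little way
off in direction `e_k`. The parameters of these points are at distance of the same order because `L`
is injective; if `e_k` had positive distance to the closed range of `L`, first order approximation
would fail. -/
theorem single_mem_range_of_face (hy₀ : y₀ ∈ quad m) (hr : 0 < r)
    (hh : ContDiffOn ℝ ∞ h (quad m ∩ Metric.ball y₀ r))
    (hhQ : MapsTo h (quad m ∩ Metric.ball y₀ r) (quad (m + 1)))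
    (hinj : Function.Injective (fderivWithin ℝ h (quad m ∩ Metric.ball y₀ r) y₀))
    (hj : h y₀ j = 0)
    (hreg : ∀ r' > 0, ∃ ε > 0, ∀ v ∈ quad (m + 1) ∩ Metric.ball (h y₀) ε, v j = 0 →
      ∃ y ∈ quad m ∩ Metric.ball y₀ r', h y = v) {k : Fin (m + 1)} (hk : k ≠ j) :
    ∃ w, fderivWithin ℝ h (quad m ∩ Metric.ball y₀ r) y₀ w = EuclideanSpace.single k 1 := by
  set D := quad m ∩ Metric.ball y₀ r with hD
  set L := fderivWithin ℝ h D y₀ with hL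
  have hy₀D : y₀ ∈ D := ⟨hy₀, Metric.mem_ball_self hr⟩
  have hder : HasFDerivWithinAt h L D y₀ :=
    (hh.differentiableOn (by simp) y₀ hy₀D).hasFDerivWithinAt
  obtain ⟨K, hK0, hK⟩ := (L : E m →ₗ[ℝ] E (m + 1)).exists_antilipschitzWith
    (LinearMap.ker_eq_bot.2 hinj)
  replace hK0 : (0 : ℝ) < K := hK0
  have hcl : IsClosed (range L) := by
    exact (LinearMap.range (L : E m →ₗ[ℝ] E (m + 1))).closed_of_finiteDimensional
  by_contra hcon
  have hmem : (EuclideanSpace.single k 1 : E (m + 1)) ∈ (range L)ᶜ := fun ⟨w, hw⟩ => hcon ⟨w, hw⟩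
  obtain ⟨ε, hε, hball⟩ := Metric.isOpen_iff.1 hcl.isOpen_compl _ hmem
  have hlow : ∀ w, ε ≤ ‖L w - EuclideanSpace.single k 1‖ := by
    intro w
    by_contra hlt
    push Not at hlt
    exact hball (mem_ball_iff_norm.2 hlt) ⟨w, rfl⟩
  -- For a point at distance `ρ / 2`, the bound `1 / (2 K)` gives `‖y - y₀‖ ≤ K ρ`. Then `ε / (4 K)`
  -- makes the error at most `ε ρ / 4`, below the required `ε ρ / 2`.
  have hlit := (hasFDerivWithinAt_iff_isLittleO.1 hder).def 
    (c := min (ε / (4 * K)) (1 / (2 * K))) (by positivity)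
  obtain ⟨r', hr', hb⟩ := Metric.mem_nhdsWithin_iff.1 hlit
  obtain ⟨ρ, hρ, hsurj⟩ := hreg (min r r') (lt_min hr hr')
  have hv : h y₀ + EuclideanSpace.single k (ρ / 2) ∈ quad (m + 1) ∩ Metric.ball (h y₀) ρ := by
    refine ⟨add_single_mem_quad (hhQ hy₀D) (by positivity), ?_⟩
    rw [mem_ball_iff_norm, add_sub_cancel_left, PiLp.norm_single, Real.norm_of_nonneg (by positivity)]
    linarith
  obtain ⟨y, ⟨hyq, hyb⟩, hy⟩ := hsurj _ hv (by simp [hj, hk.symm])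
  have hyb' := Metric.mem_ball.1 hyb
  have h1 : ‖h y - h y₀ - L (y - y₀)‖ ≤ min (ε / (4 * K)) (1 / (2 * K)) * ‖y - y₀‖ :=
    hb ⟨Metric.mem_ball.2 (hyb'.trans_le (min_le_right _ _)), hyq,
      Metric.mem_ball.2 (hyb'.trans_le (min_le_left _ _))⟩
  rw [hy, add_sub_cancel_left] at h1
  have h2 : ‖y - y₀‖ ≤ 2 * K * (ρ / 2) := by
    have e1 : ‖y - y₀‖ ≤ K * ‖L (y - y₀)‖ := by
      simpa [dist_eq_norm] using hK.le_mul_dist (y - y₀) 0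
    have e2 : ‖L (y - y₀)‖ ≤ ρ / 2 + 1 / (2 * K) * ‖y - y₀‖ := by
      have e3 := norm_sub_norm_le (L (y - y₀)) (EuclideanSpace.single k (ρ / 2))
      rw [norm_sub_rev, PiLp.norm_single, Real.norm_of_nonneg (by positivity)] at e3
      have e4 : min (ε / (4 * K)) (1 / (2 * K)) * ‖y - y₀‖ ≤ 1 / (2 * K) * ‖y - y₀‖ := by
        gcongr
        exact min_le_right _ _
      linarith
    have e5 : K * ‖L (y - y₀)‖ ≤ K * (ρ / 2 + 1 / (2 * K) * ‖y - y₀‖) := by gcongr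
    have e6 : K * (ρ / 2 + 1 / (2 * K) * ‖y - y₀‖) = K * (ρ / 2) + ‖y - y₀‖ / 2 := by
      field_simp
    linarith
  have h3 : EuclideanSpace.single k (ρ / 2) - L (y - y₀) =
      -((ρ / 2) • (L ((ρ / 2)⁻¹ • (y - y₀)) - (EuclideanSpace.single k 1 : E (m + 1)))) := by
    rw [map_smul, smul_sub, smul_smul, mul_inv_cancel₀ (by positivity), one_smul, neg_sub]
    congr 1
    ext i
    by_cases hi : i = k <;> simp [hi]
  rw [h3, norm_neg, norm_smul, Real.norm_of_nonneg (by positivity)] at h1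
  have h4 := mul_le_mul_of_nonneg_left (hlow ((ρ / 2)⁻¹ • (y - y₀))) (half_pos hρ).le
  have h5 : min (ε / (4 * K)) (1 / (2 * K)) * ‖y - y₀‖ ≤ ε / (4 * K) * (2 * K * (ρ / 2)) := by
    gcongr
    exact min_le_left _ _
  have h6 : ε / (4 * K) * (2 * K * (ρ / 2)) = (ρ / 2) * ε / 2 := by field_simp; ring
  have : 0 < ρ / 2 * ε := by positivity
  linarith

/-- Otherwise the range of the derivative, which contains every `e_k` with `k ≠ j`, would be all of
the `m + 1` dimensional space. -/
theorem fderivWithin_apply_eq_zero_of_face (hy₀ : y₀ ∈ quad m) (hr : 0 < r)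
    (hh : ContDiffOn ℝ ∞ h (quad m ∩ Metric.ball y₀ r))
    (hhQ : MapsTo h (quad m ∩ Metric.ball y₀ r) (quad (m + 1)))
    (hinj : Function.Injective (fderivWithin ℝ h (quad m ∩ Metric.ball y₀ r) y₀))
    (hj : h y₀ j = 0)
    (hreg : ∀ r' > 0, ∃ ε > 0, ∀ v ∈ quad (m + 1) ∩ Metric.ball (h y₀) ε, v j = 0 →
      ∃ y ∈ quad m ∩ Metric.ball y₀ r', h y = v) (w : E m) :
    fderivWithin ℝ h (quad m ∩ Metric.ball y₀ r) y₀ w j = 0 := by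
  set L := fderivWithin ℝ h (quad m ∩ Metric.ball y₀ r) y₀ with hL
  by_contra hne
  have hk : ∀ k, (EuclideanSpace.single k 1 : E (m + 1)) ∈
      LinearMap.range (L : E m →ₗ[ℝ] E (m + 1)) := by
    have h1 : ∀ k, k ≠ j → (EuclideanSpace.single k 1 : E (m + 1)) ∈
        LinearMap.range (L : E m →ₗ[ℝ] E (m + 1)) := fun k hk => by
      obtain ⟨w, hw⟩ := single_mem_range_of_face hy₀ hr hh hhQ hinj hj hreg hk
      exact ⟨w, hw⟩
    intro k
    by_cases hkj : k = j
    · subst hkj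
      have h2 : (EuclideanSpace.single k 1 : E (m + 1)) =
          (L w k)⁻¹ • (L w - ∑ i ∈ Finset.univ.erase k, L w i • EuclideanSpace.single i (1 : ℝ)) := by
        have h3 : L w - ∑ i ∈ Finset.univ.erase k, L w i • EuclideanSpace.single i (1 : ℝ) =
            L w k • EuclideanSpace.single k (1 : ℝ) := by
          rw [sub_eq_iff_eq_add, Finset.add_sum_erase _ (fun i => L w i • EuclideanSpace.single i (1 : ℝ))
            (Finset.mem_univ k)]
          exact eq_sum_single _
        rw [h3, smul_smul, inv_mul_cancel₀ hne, one_smul]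
      rw [h2]
      refine Submodule.smul_mem _ _ (Submodule.sub_mem _ ⟨w, rfl⟩ (Submodule.sum_mem _ fun i hi => ?_))
      exact Submodule.smul_mem _ _ (h1 i (Finset.ne_of_mem_erase hi))
    · exact h1 k hkj
  have htop : LinearMap.range (L : E m →ₗ[ℝ] E (m + 1)) = ⊤ := by
    refine eq_top_iff.2 fun v _ => ?_
    rw [eq_sum_single v]
    exact Submodule.sum_mem _ fun i _ => Submodule.smul_mem _ _ (hk i)
  have h4 := (L : E m →ₗ[ℝ] E (m + 1)).finrank_range_le
  rw [htop, finrank_top] at h4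
  simp at h4

/-- Let `p` project to the hyperplane `v_j = 0`. Since `p ∘ h` has injective derivative it is
injective near `y₀`. The point `p (h y)` lies on the face, so it is `h y'` with `y'` near `y₀`; then
`p (h y') = p (h y)`, whence `y' = y` and `h y` is on the face. -/
theorem eventually_apply_eq_zero_of_face (hy₀ : y₀ ∈ quad m) (hr : 0 < r)
    (hh : ContDiffOn ℝ ∞ h (quad m ∩ Metric.ball y₀ r))
    (hhQ : MapsTo h (quad m ∩ Metric.ball y₀ r) (quad (m + 1)))
    (hinj : Function.Injective (fderivWithin ℝ h (quad m ∩ Metric.ball y₀ r) y₀))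
    (hj : h y₀ j = 0)
    (hreg : ∀ r' > 0, ∃ ε > 0, ∀ v ∈ quad (m + 1) ∩ Metric.ball (h y₀) ε, v j = 0 →
      ∃ y ∈ quad m ∩ Metric.ball y₀ r', h y = v) :
    ∃ r' > 0, ∀ y ∈ quad m ∩ Metric.ball y₀ r', h y j = 0 := by
  set D := quad m ∩ Metric.ball y₀ r with hD
  set L := fderivWithin ℝ h D y₀ with hL
  have hy₀D : y₀ ∈ D := ⟨hy₀, Metric.mem_ball_self hr⟩
  let p : E (m + 1) →L[ℝ] E (m + 1) := ContinuousLinearMap.id ℝ _ -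
    (EuclideanSpace.proj (𝕜 := ℝ) j).smulRight (EuclideanSpace.single j (1 : ℝ))
  have hpj : ∀ v, p v j = 0 := fun v => by simp [p]
  have hpk : ∀ v k, k ≠ j → p v k = v k := fun v k hk => by simp [p, hk]
  have hpid : ∀ v : E (m + 1), v j = 0 → p v = v := fun v hv => by simp [p, hv]
  have hu := uniqueDiffOn_quad_inter (n := m) (Metric.isOpen_ball (x := y₀) (ε := r))
  have hder : HasFDerivWithinAt (fun y => p (h y)) (p.comp L) D y₀ :=
    p.hasFDerivAt.comp_hasFDerivWithinAt y₀
      (hh.differentiableOn (by simp) y₀ hy₀D).hasFDerivWithinAt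
  have hpL : p.comp L = L := by
    ext1 w
    exact hpid _ (fderivWithin_apply_eq_zero_of_face hy₀ hr hh hhQ hinj hj hreg w)
  have hfd : fderivWithin ℝ (fun y => p (h y)) D y₀ = L := by
    rw [hder.fderivWithin (hu y₀ hy₀D), hpL]
  have hst := hasStrictFDerivAt_clip_extension hy₀ hr (p.contDiff.comp_contDiffOn hh)
  have hst' := hst
  change HasStrictFDerivAt (fun v => p (h (clip v)) + fderivWithin ℝ (fun y => p (h y)) D y₀ _)
    (fderivWithin ℝ (fun y => p (h y)) D y₀) y₀ at hst'
  rw [hfd] at hst'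
  obtain ⟨K, hK0, hK⟩ := (L : E m →ₗ[ℝ] E (m + 1)).exists_antilipschitzWith
    (LinearMap.ker_eq_bot.2 hinj)
  -- The approximation constant is half of the lower bound `K⁻¹` of `L`, so the nonlinear error
  -- cannot cancel `L a - L b`.
  obtain ⟨s, hs, happ⟩ := hst'.approximates_deriv_on_nhds (c := K⁻¹ / 2)
    (Or.inr (by positivity))
  have hinjOn : InjOn (fun v => p (h (clip v)) + L (v - clip v)) s := by
    have h1 := happ.lipschitz_sub
    intro a ha b hb hab
    have h2 := h1.dist_le_mul ⟨a, ha⟩ ⟨b, hb⟩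
    have h3 := hK.le_mul_dist a b
    simp only [Subtype.dist_eq, dist_eq_norm, Set.domRestrict_apply] at h2 h3
    have hab' : p (h (clip a)) + L (a - clip a) = p (h (clip b)) + L (b - clip b) := hab
    have h4 : (p (h (clip a)) + L (a - clip a) - L a) - (p (h (clip b)) + L (b - clip b) - L b) =
        -(L a - L b) := by rw [hab']; abel
    have h5 : ‖L a - L b‖ ≤ ((K⁻¹ / 2 : NNReal) : ℝ) * ‖a - b‖ := by
      rw [← norm_neg, ← h4]; exact h2
    have h6 : ‖a - b‖ ≤ K * ‖L a - L b‖ := h3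
    have hK0' : (0 : ℝ) < K := hK0
    have h7 : (K : ℝ) * ‖L a - L b‖ ≤ K * (((K⁻¹ / 2 : NNReal) : ℝ) * ‖a - b‖) := by gcongr
    have h8 : (K : ℝ) * (((K⁻¹ / 2 : NNReal) : ℝ) * ‖a - b‖) = ‖a - b‖ / 2 := by
      push_cast; field_simp
    have h9 : ‖a - b‖ = 0 := by
      have := norm_nonneg (a - b)
      linarith
    exact sub_eq_zero.1 (norm_eq_zero.1 h9)
  obtain ⟨ρ, hρ, hρs⟩ := Metric.mem_nhds_iff.1 hs
  obtain ⟨ε, hε, hsurj⟩ := hreg (min r ρ) (lt_min hr hρ)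
  have hcont : ContinuousWithinAt (fun y => p (h y)) D y₀ := hder.continuousWithinAt
  have hp0 : p (h y₀) = h y₀ := hpid _ hj
  have hev : ∀ᶠ y in 𝓝[D] y₀, p (h y) ∈ Metric.ball (h y₀) ε :=
    hcont.eventually (p := fun x => x ∈ Metric.ball (h y₀) ε) (by
      change _ ∈ 𝓝 (p (h y₀)); rw [hp0]; exact Metric.ball_mem_nhds _ hε)
  obtain ⟨ρ', hρ', hb⟩ := Metric.mem_nhdsWithin_iff.1 hev
  refine ⟨min (min r ρ) ρ', lt_min (lt_min hr hρ) hρ', fun y ⟨hyq, hyb⟩ => ?_⟩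
  have hyb' := Metric.mem_ball.1 hyb
  have hyr : y ∈ Metric.ball y₀ r :=
    Metric.mem_ball.2 (hyb'.trans_le ((min_le_left _ _).trans (min_le_left _ _)))
  have hyρ : y ∈ Metric.ball y₀ ρ :=
    Metric.mem_ball.2 (hyb'.trans_le ((min_le_left _ _).trans (min_le_right _ _)))
  have hpq : p (h y) ∈ quad (m + 1) := by
    intro k
    by_cases hk : k = j
    · rw [hk, hpj]
    · rw [hpk _ _ hk]; exact hhQ ⟨hyq, hyr⟩ k
  obtain ⟨y', ⟨hyq', hyb''⟩, hy'⟩ := hsurj (p (h y))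
    ⟨hpq, hb ⟨Metric.mem_ball.2 (hyb'.trans_le (min_le_right _ _)), hyq, hyr⟩⟩ (hpj _)
  have hy'ρ : y' ∈ Metric.ball y₀ ρ :=
    Metric.mem_ball.2 ((Metric.mem_ball.1 hyb'').trans_le (min_le_right _ _))
  have : y' = y := by
    apply hinjOn (hρs hy'ρ) (hρs hyρ)
    simp only [clip_of_mem hyq, clip_of_mem hyq', sub_self, map_zero, add_zero]
    rw [hy', hpid _ (hpj _)]
  rw [← this, hy', hpj]

end RegularFace

/-! ### Flow boxes at hypersurfaces of the quadrant -/

/-- The point with first coordinate `t` and other coordinates `y`. -/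
def consE {m : ℕ} (t : ℝ) (y : E m) : E (m + 1) := WithLp.toLp 2 (Fin.cons t y : Fin (m + 1) → ℝ)

@[simp] theorem consE_zero {m : ℕ} (t : ℝ) (y : E m) : consE t y 0 = t := rfl

@[simp] theorem consE_succ {m : ℕ} (t : ℝ) (y : E m) (i : Fin m) : consE t y i.succ = y i := rfl

/-- The coordinates other than the first one. -/
def tailE (m : ℕ) : E (m + 1) →L[ℝ] E m :=
  LinearMap.toContinuousLinearMap
    { toFun := fun v => WithLp.toLp 2 fun i => v i.succ
      map_add' := fun _ _ => rfl
      map_smul' := fun _ _ => rfl }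

@[simp] theorem tailE_apply {m : ℕ} (v : E (m + 1)) (i : Fin m) : tailE m v i = v i.succ := rfl

/-- The inclusion of the last coordinates. -/
def inclE (m : ℕ) : E m →L[ℝ] E (m + 1) :=
  LinearMap.toContinuousLinearMap
    { toFun := fun y => consE 0 y
      map_add' := fun x y => by
        ext i; refine Fin.cases ?_ (fun i => ?_) i <;> simp
      map_smul' := fun c y => by
        ext i; refine Fin.cases ?_ (fun i => ?_) i <;> simp }

theorem inclE_apply {m : ℕ} (y : E m) : inclE m y = consE 0 y := rfl

@[simp] theorem tailE_consE {m : ℕ} (t : ℝ) (y : E m) : tailE m (consE t y) = y := by ext i; simp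

theorem consE_tailE {m : ℕ} (v : E (m + 1)) : consE (v 0) (tailE m v) = v := by
  ext i; refine Fin.cases ?_ (fun i => ?_) i <;> simp

theorem consE_eq_add {m : ℕ} (t : ℝ) (y : E m) :
    consE t y = t • EuclideanSpace.single 0 1 + inclE m y := by
  ext i; refine Fin.cases ?_ (fun i => ?_) i <;> simp [inclE_apply]

theorem contDiff_consE {m : ℕ} : ContDiff ℝ ∞ fun p : ℝ × E m => consE p.1 p.2 := by
  simp only [consE_eq_add]
  fun_prop

theorem consE_mem_quad {m : ℕ} {t : ℝ} {y : E m} (ht : 0 ≤ t) (hy : y ∈ quad m) :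
    consE t y ∈ quad (m + 1) := by
  intro i; refine Fin.cases ?_ (fun i => ?_) i <;> simp [ht, hy _]

theorem tailE_mem_quad {m : ℕ} {v : E (m + 1)} (hv : v ∈ quad (m + 1)) : tailE m v ∈ quad m :=
  fun i => hv i.succ

theorem abs_apply_le_norm {n : ℕ} (v : E n) (i : Fin n) : |v i| ≤ ‖v‖ := PiLp.norm_apply_le v i

theorem norm_tailE_le {m : ℕ} (v : E (m + 1)) : ‖tailE m v‖ ≤ ‖v‖ := by
  rw [EuclideanSpace.norm_eq, EuclideanSpace.norm_eq, Fin.sum_univ_succ]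
  apply Real.sqrt_le_sqrt
  simp only [tailE_apply]
  have := sq_nonneg ‖v 0‖
  linarith

/-- A cutoff gives the vector field compact support and hence a globally bounded derivative, so the
flow exists for a uniform time at all points of the quadrant. -/
theorem exists_flow_box_aux {n : ℕ} {X : E n → E n} {v₀ : E n} (hv₀ : v₀ ∈ quad n) {δ : ℝ}
    (hδ : 0 < δ) (hX : ContDiffOn ℝ ∞ X (quad n ∩ Metric.ball v₀ δ)) :
    ∃ (χ : E n → ℝ) (ρ : ℝ), 0 < ρ ∧ (∀ v, 0 ≤ χ v) ∧ (∀ v ∈ Metric.ball v₀ ρ, χ v = 1) ∧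
      (∀ v, v ∉ Metric.ball v₀ δ → χ v = 0) ∧ ContDiffOn ℝ ∞ (fun v => χ v • X v) (quad n) ∧
      ∃ K, ∀ x ∈ quad n, ‖fderivWithin ℝ (fun v => χ v • X v) (quad n) x‖ ≤ K := by
  let χ : ContDiffBump v₀ := ⟨δ / 4, δ / 2, by positivity, by linarith⟩
  have h0 : ∀ v, v ∉ Metric.ball v₀ (δ / 2) → χ v = 0 := fun v hv => by
    have : v ∉ Function.support χ := by rw [χ.support_eq]; exact hv
    simpa using this
  have hsm : ContDiffOn ℝ ∞ (fun v => χ v • X v) (quad n) := by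
    intro v hv
    by_cases hvb : v ∈ Metric.ball v₀ δ
    · have h1 : ContDiffWithinAt ℝ ∞ (fun v => χ v • X v) (quad n ∩ Metric.ball v₀ δ) v :=
        χ.contDiff.contDiffAt.contDiffWithinAt.smul (hX v ⟨hv, hvb⟩)
      exact (contDiffWithinAt_inter (Metric.isOpen_ball.mem_nhds hvb)).1 h1
    · have hvc : v ∈ (Metric.closedBall v₀ (δ / 2))ᶜ := fun h =>
        hvb (Metric.closedBall_subset_ball (by linarith) h)
      have : (fun v => χ v • X v) =ᶠ[𝓝 v] fun _ => 0 := by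
        filter_upwards [Metric.isClosed_closedBall.isOpen_compl.mem_nhds hvc] with w hw
        rw [h0 w fun h => hw (Metric.ball_subset_closedBall h), zero_smul]
      exact (contDiffAt_const.congr_of_eventuallyEq this).contDiffWithinAt
  refine ⟨χ, δ / 4, by positivity, fun v => χ.nonneg, fun v hv =>
    χ.one_of_mem_closedBall (Metric.ball_subset_closedBall hv), fun v hv => h0 v fun h => hv
    (Metric.ball_subset_ball (by linarith) h), hsm, ?_⟩
  have hc : IsCompact (quad n ∩ Metric.closedBall v₀ (δ / 2)) :=
    (isCompact_closedBall v₀ _).inter_left (isClosed_quad n)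
  have hcont : ContinuousOn (fderivWithin ℝ (fun v => χ v • X v) (quad n)) (quad n) :=
    hsm.continuousOn_fderivWithin (uniqueDiffOn_quad n) (by simp)
  obtain ⟨K, hK⟩ := hc.exists_bound_of_continuousOn (hcont.mono inter_subset_left)
  refine ⟨max K 0, fun x hx => ?_⟩
  by_cases hxb : x ∈ Metric.closedBall v₀ (δ / 2)
  · exact (hK x ⟨hx, hxb⟩).trans (le_max_left _ _)
  · have : (fun v => χ v • X v) =ᶠ[𝓝 x] fun _ => 0 := by
      filter_upwards [Metric.isClosed_closedBall.isOpen_compl.mem_nhds hxb] with w hw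
      rw [h0 w fun h => hw (Metric.ball_subset_closedBall h), zero_smul]
    rw [this.fderivWithin_eq_of_nhds]
    simp

/-- The first coordinate may be zero at `w`, so only the forward difference quotient is available.
It determines the derivative because `e_0` points into the quadrant. -/
theorem fderivWithin_single_zero {m : ℕ} {f : E (m + 1) → E (m + 1)} {w : E (m + 1)}
    (hw : w ∈ quad (m + 1))
    (hf : DifferentiableWithinAt ℝ f (quad (m + 1)) w) {d : E (m + 1)}
    (hd : HasDerivWithinAt (fun t : ℝ => f (w + t • (EuclideanSpace.single 0 1 : E (m + 1)))) d (Ici 0) 0) :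
    fderivWithin ℝ f (quad (m + 1)) w (EuclideanSpace.single 0 1) = d := by
  have h1 : HasDerivWithinAt (fun t : ℝ => w + t • (EuclideanSpace.single 0 1 : E (m + 1)))
      (EuclideanSpace.single 0 1) (Ici 0) 0 := by
    simpa using ((hasDerivWithinAt_id (0 : ℝ) (Ici 0)).smul_const
      (EuclideanSpace.single 0 1 : E (m + 1))).const_add w
  have hm : MapsTo (fun t : ℝ => w + t • (EuclideanSpace.single 0 1 : E (m + 1))) (Ici 0)
      (quad (m + 1)) := by
    intro t ht
    have := add_single_mem_quad hw (k := 0) (c := t) ht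
    convert this using 2
    ext i; refine Fin.cases ?_ (fun i => ?_) i <;> simp
  have hf' : HasFDerivWithinAt f (fderivWithin ℝ f (quad (m + 1)) w) (quad (m + 1))
      (w + (0 : ℝ) • (EuclideanSpace.single 0 1 : E (m + 1))) := by
    simpa using hf.hasFDerivWithinAt
  exact (uniqueDiffOn_Ici (0 : ℝ) 0 self_mem_Ici).eq_deriv _
    (hf'.comp_hasDerivWithinAt (0 : ℝ) h1 hm) hd

/-- A vector field `X` on the quadrant that is tangent to the faces in `A` and points inward at the other
faces at `v₀` is a coordinate vector field in coordinates in which a given transverse hypersurface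
`h` is a level set of the first coordinate. -/
theorem exists_flow_box {m : ℕ} {X : E (m + 1) → E (m + 1)} {δ : ℝ} (hδ : 0 < δ)
    {h : E m → E (m + 1)} {y₀ : E m} (hy₀ : y₀ ∈ quad m) {r : ℝ} (hr : 0 < r)
    (hX : ContDiffOn ℝ ∞ X (quad (m + 1) ∩ Metric.ball (h y₀) δ)) {A : Set (Fin (m + 1))}
    (hA : ∀ j ∈ A, ∀ v ∈ quad (m + 1) ∩ Metric.ball (h y₀) δ, v j = 0 → X v j = 0)
    (hact : ∀ v ∈ quad (m + 1) ∩ Metric.ball (h y₀) δ, ∀ j, v j = 0 → h y₀ j = 0)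
    (hreg : ∀ j, j ∉ A → h y₀ j = 0 → 0 < X (h y₀) j)
    (hh : ContDiffOn ℝ ∞ h (quad m ∩ Metric.ball y₀ r))
    (hhQ : MapsTo h (quad m ∩ Metric.ball y₀ r) (quad (m + 1)))
    (hinj : Function.Injective (fderivWithin ℝ h (quad m ∩ Metric.ball y₀ r) y₀))
    (hXL : ∀ w, fderivWithin ℝ h (quad m ∩ Metric.ball y₀ r) y₀ w ≠ X (h y₀))
    (hfaceA : ∀ i, y₀ i = 0 → ∃ j ∈ A, ∀ y ∈ quad m ∩ Metric.ball y₀ r, y i = 0 → h y j = 0)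
    (hfaceR : ∀ j, j ∉ A → h y₀ j = 0 → ∀ y ∈ quad m ∩ Metric.ball y₀ r, h y j = 0) :
    ∃ t₀ : ℝ, 0 ≤ t₀ ∧ ∃ (f g : E (m + 1) → E (m + 1)) (U W : Set (E (m + 1))),
      IsOpen U ∧ IsOpen W ∧ consE t₀ y₀ ∈ U ∧ MapsTo f (quad (m + 1) ∩ U) (quad (m + 1) ∩ W) ∧
      MapsTo f (quad (m + 1) ∩ U) (Metric.ball (h y₀) δ) ∧
      MapsTo g (quad (m + 1) ∩ W) (quad (m + 1) ∩ U) ∧ (∀ v ∈ quad (m + 1) ∩ U, g (f v) = v) ∧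
      (∀ w ∈ quad (m + 1) ∩ W, f (g w) = w) ∧ ContDiffOn ℝ ∞ f (quad (m + 1) ∩ U) ∧
      ContDiffOn ℝ ∞ g (quad (m + 1) ∩ W) ∧
      (∀ y ∈ quad m, consE t₀ y ∈ U → f (consE t₀ y) = h y) ∧
      ∀ w ∈ quad (m + 1) ∩ U,
        fderivWithin ℝ f (quad (m + 1)) w (EuclideanSpace.single 0 1) = X (f w) := by
  have hy₀D : y₀ ∈ quad m ∩ Metric.ball y₀ r := ⟨hy₀, Metric.mem_ball_self hr⟩
  have hv₀ : h y₀ ∈ quad (m + 1) := hhQ hy₀D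
  -- make `X` point inward on a ball
  obtain ⟨δ', hδ', hδδ, hpos⟩ : ∃ δ' > 0, δ' ≤ δ ∧ ∀ v ∈ quad (m + 1) ∩ Metric.ball (h y₀) δ',
      ∀ j, j ∉ A → h y₀ j = 0 → 0 ≤ X v j := by
    have hc := hX.continuousOn (h y₀) ⟨hv₀, Metric.mem_ball_self hδ⟩
    have hev : ∀ᶠ v in 𝓝[quad (m + 1) ∩ Metric.ball (h y₀) δ] (h y₀),
        ∀ j, j ∉ A → h y₀ j = 0 → 0 ≤ X v j := by
      refine eventually_all.2 fun j => ?_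
      by_cases hj : j ∉ A ∧ h y₀ j = 0
      · have hcj : ContinuousWithinAt (fun v => X v j) (quad (m + 1) ∩ Metric.ball (h y₀) δ)
            (h y₀) := (EuclideanSpace.proj (𝕜 := ℝ) j).continuous.continuousAt.comp_continuousWithinAt hc
        filter_upwards [hcj.eventually (lt_mem_nhds (hreg j hj.1 hj.2))] with v hv _ _ using hv.le
      · exact Eventually.of_forall fun v h1 h2 => absurd ⟨h1, h2⟩ hj
    obtain ⟨ε, hε, hb⟩ := Metric.mem_nhdsWithin_iff.1 hev
    refine ⟨min ε δ, lt_min hε hδ, min_le_right _ _, fun v hv => hb ⟨?_, hv.1, ?_⟩⟩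
    · exact Metric.ball_subset_ball (min_le_left _ _) hv.2
    · exact Metric.ball_subset_ball (min_le_right _ _) hv.2
  have hsub : quad (m + 1) ∩ Metric.ball (h y₀) δ' ⊆ quad (m + 1) ∩ Metric.ball (h y₀) δ :=
    inter_subset_inter_right _ (Metric.ball_subset_ball hδδ)
  obtain ⟨χ, ρ, hρ, hχ0, hχ1, hχs, hB, K, hK⟩ := exists_flow_box_aux hv₀ hδ' (hX.mono hsub)
  set B : E (m + 1) → E (m + 1) := fun v => χ v • X v with hBdef
  have hK0 : 0 ≤ K := (norm_nonneg _).trans (hK 0 fun i => le_rfl)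
  -- At faces in `A` this is the tangency of `X`. Faces with `h y₀ j ≠ 0` do not meet the ball at
  -- all, so the cutoff field is zero on them.
  have htan : ∀ j, (j ∈ A ∨ h y₀ j ≠ 0) → ∀ x ∈ quad (m + 1), x j = 0 → B x j = 0 := by
    intro j hj x hx hxj
    simp only [hBdef, PiLp.smul_apply, smul_eq_mul]
    by_cases hxb : x ∈ Metric.ball (h y₀) δ'
    · rcases hj with hj | hj
      · rw [hA j hj x (hsub ⟨hx, hxb⟩) hxj, mul_zero]
      · exact absurd (hact x (hsub ⟨hx, hxb⟩) j hxj) hj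
    · rw [hχs x hxb, zero_mul]
  have hinw : ∀ j, j ∉ A → h y₀ j = 0 → ∀ x ∈ quad (m + 1), 0 ≤ B x j := by
    intro j hj hj0 x hx
    simp only [hBdef, PiLp.smul_apply, smul_eq_mul]
    by_cases hxb : x ∈ Metric.ball (h y₀) δ'
    · exact mul_nonneg (hχ0 x) (hpos x ⟨hx, hxb⟩ j hj hj0)
    · rw [hχs x hxb, zero_mul]
  set ε : ℝ := 1 / (4 * (K + 1)) with hε
  have hε0 : 0 < ε := by positivity
  have hεK : ε * K < 1 / 2 := by
    rw [hε, div_mul_eq_mul_div, one_mul, div_lt_div_iff₀ (by positivity) (by norm_num)]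
    linarith
  -- the interval on which the flow preserves the quadrant
  obtain ⟨a, t₀, ha, haε, ht₀, hat, hmem, ht₀0⟩ : ∃ a t₀ : ℝ, a ≤ 0 ∧ -ε ≤ a ∧ 0 ≤ t₀ ∧
      (∀ t, 0 ≤ t → |t - t₀| < ε → a ≤ t - t₀) ∧
      (∀ x ∈ quad (m + 1), ∀ t ∈ Icc a ε, flow B (x, t) ∈ quad (m + 1)) ∧
      (t₀ = 0 → ∃ j, j ∉ A ∧ h y₀ j = 0) := by
    -- If `h` runs inside a regular face, only the forward flow stays in the quadrant, and `t₀ = 0`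
    -- makes the hypersurface the face of the first coordinate. Otherwise all relevant faces are
    -- invariant and both directions are allowed; `t₀ = 1` is an arbitrary positive value exceeding
    -- `ε`.
    by_cases hR : ∃ j, j ∉ A ∧ h y₀ j = 0
    · refine ⟨0, 0, le_rfl, by linarith, le_rfl, fun t ht _ => by simpa using ht, ?_, fun _ => hR⟩
      intro x hx t ht j
      have htK : |t| * K < 1 / 2 := lt_of_le_of_lt
        (mul_le_mul_of_nonneg_right (by rw [abs_of_nonneg ht.1]; exact ht.2) hK0) hεK
      by_cases hj : j ∉ A ∧ h y₀ j = 0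
      · exact flow_nonneg_of_inward hB hK (hinw j hj.1 hj.2) hx ht.1 htK
      · exact flow_nonneg_of_tangent hB hK (htan j (by tauto)) hx htK
    · refine ⟨-ε, 1, by linarith, le_rfl, zero_le_one, fun t ht h => (abs_lt.1 h).1.le, ?_,
        fun h => absurd h one_ne_zero⟩
      intro x hx t ht j
      have htK : |t| * K < 1 / 2 := lt_of_le_of_lt
        (mul_le_mul_of_nonneg_right (abs_le.2 ⟨ht.1, ht.2⟩) hK0) hεK
      exact flow_nonneg_of_tangent hB hK
        (htan j (by by_contra hc; push Not at hc; exact hR ⟨j, hc.1, hc.2⟩)) hx htK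
  have haK : |a| * K < 1 / 2 := lt_of_le_of_lt
    (mul_le_mul_of_nonneg_right (abs_le.2 ⟨haε, ha.trans hε0.le⟩) hK0) hεK
  have hflow := contDiffOn_flow hB hK ha hε0 haK (by rwa [abs_of_pos hε0]) hmem
  let w₀ : E (m + 1) := consE t₀ y₀
  have hw₀ : w₀ ∈ quad (m + 1) := consE_mem_quad ht₀ hy₀
  -- The flow box: start at `h y` and flow along the cutoff field for time `t - t₀`.
  let f : E (m + 1) → E (m + 1) := fun w => flow B (h (tailE m w), w 0 - t₀)
  have htail : ∀ w ∈ quad (m + 1) ∩ Metric.ball w₀ (min ε r),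
      tailE m w ∈ quad m ∩ Metric.ball y₀ r := by
    rintro w ⟨hw, hwb⟩
    refine ⟨tailE_mem_quad hw, mem_ball_iff_norm.2 ?_⟩
    have h1 : tailE m w - y₀ = tailE m (w - w₀) := by simp [w₀]
    rw [h1]
    exact (norm_tailE_le _).trans_lt ((mem_ball_iff_norm.1 hwb).trans_le (min_le_right _ _))
  have htime : ∀ w ∈ Metric.ball w₀ (min ε r), |w 0 - t₀| < ε := by
    intro w hwb
    have h1 : w 0 - t₀ = (w - w₀) 0 := by simp [w₀]
    rw [h1]
    exact (abs_apply_le_norm _ _).trans_lt ((mem_ball_iff_norm.1 hwb).trans_le (min_le_left _ _))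
  have htimeI : ∀ w ∈ quad (m + 1) ∩ Metric.ball w₀ (min ε r), w 0 - t₀ ∈ Icc a ε := fun w hw =>
    ⟨hat _ (hw.1 0) (htime w hw.2), (le_abs_self _).trans (htime w hw.2).le⟩
  have htimeK : ∀ w ∈ Metric.ball w₀ (min ε r), |w 0 - t₀| * K < 1 / 2 := fun w hw =>
    lt_of_le_of_lt (mul_le_mul_of_nonneg_right (htime w hw).le hK0) hεK
  have hf : ContDiffOn ℝ ∞ f (quad (m + 1) ∩ Metric.ball w₀ (min ε r)) := by
    refine hflow.comp (f := fun w => (h (tailE m w), w 0 - t₀)) ?_ fun w hw =>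
      ⟨hhQ (htail w hw), htimeI w hw⟩
    exact (hh.comp (tailE m).contDiff.contDiffOn htail).prodMk
      (((EuclideanSpace.proj (𝕜 := ℝ) (0 : Fin (m + 1))).contDiff.sub contDiff_const).contDiffOn)
  have hfQ : MapsTo f (quad (m + 1) ∩ Metric.ball w₀ (min ε r)) (quad (m + 1)) := fun w hw =>
    hmem _ (hhQ (htail w hw)) _ (htimeI w hw)
  have hf0 : ∀ y, f (consE t₀ y) = h y := fun y => by
    simp only [f, tailE_consE, consE_zero, sub_self]
    exact flow_zero hB hK _
  -- shrink the domain
  obtain ⟨r₁, hr₁, hr₁ε, hfρ⟩ : ∃ r₁ > 0, r₁ ≤ min ε r ∧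
      MapsTo f (quad (m + 1) ∩ Metric.ball w₀ r₁) (Metric.ball (h y₀) (min ρ δ)) := by
    have hc := hf.continuousOn w₀ ⟨hw₀, Metric.mem_ball_self (lt_min hε0 hr)⟩
    have := hc.eventually (p := fun x => x ∈ Metric.ball (h y₀) (min ρ δ)) (by
      rw [hf0]; exact Metric.ball_mem_nhds _ (lt_min hρ hδ))
    obtain ⟨ε', hε', hb⟩ := Metric.mem_nhdsWithin_iff.1 this
    refine ⟨min ε' (min ε r), lt_min hε' (lt_min hε0 hr), min_le_right _ _, fun w hw => hb ⟨?_, hw.1, ?_⟩⟩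
    · exact Metric.ball_subset_ball (min_le_left _ _) hw.2
    · exact Metric.ball_subset_ball (min_le_right _ _) hw.2
  have hsub₁ : quad (m + 1) ∩ Metric.ball w₀ r₁ ⊆ quad (m + 1) ∩ Metric.ball w₀ (min ε r) :=
    inter_subset_inter_right _ (Metric.ball_subset_ball hr₁ε)
  have hf₁ := hf.mono hsub₁
  have hw₀D : w₀ ∈ quad (m + 1) ∩ Metric.ball w₀ r₁ := ⟨hw₀, Metric.mem_ball_self hr₁⟩
  have hfd : ∀ w ∈ quad (m + 1) ∩ Metric.ball w₀ r₁, DifferentiableWithinAt ℝ f (quad (m + 1)) w :=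
    fun w hw => (differentiableWithinAt_inter (Metric.isOpen_ball.mem_nhds hw.2)).1
      (hf₁.differentiableOn (by simp) w hw)
  have hfX : ∀ w ∈ quad (m + 1) ∩ Metric.ball w₀ r₁,
      fderivWithin ℝ f (quad (m + 1)) w (EuclideanSpace.single 0 1) = X (f w) := by
    intro w hw
    have hXB : X (f w) = B (f w) := by
      simp only [hBdef]
      rw [hχ1 _ (Metric.ball_subset_ball (min_le_left _ _) (hfρ hw)), one_smul]
    rw [hXB]
    refine fderivWithin_single_zero hw.1 (hfd w hw) ?_
    have h1 := hasDerivAt_flow hB hK (h (tailE m w)) (htimeK w (hsub₁ hw).2)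
    rw [clip_of_mem (hfQ (hsub₁ hw))] at h1
    have h2 : HasDerivAt (fun t : ℝ => w 0 - t₀ + t) 1 0 := by
      simpa using (hasDerivAt_id (0 : ℝ)).const_add (w 0 - t₀)
    have h3 : HasDerivAt (fun s => flow B (h (tailE m w), s)) (B (f w)) (w 0 - t₀ + 0) := by
      rw [add_zero]; exact h1
    have h4 := h3.scomp (0 : ℝ) h2
    rw [one_smul] at h4
    refine HasDerivAt.hasDerivWithinAt (h4.congr_of_eventuallyEq (Eventually.of_forall fun t => ?_))
    have h5 : tailE m (w + t • (EuclideanSpace.single 0 1 : E (m + 1))) = tailE m w := by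
      ext i; simp
    change flow B (h (tailE m (w + t • _)), (w + t • EuclideanSpace.single 0 1 : E (m + 1)) 0 - t₀) = _
    rw [h5]
    simp only [Function.comp, PiLp.add_apply, PiLp.smul_apply, PiLp.single_apply, if_true,
      smul_eq_mul, mul_one]
    congr 2
    ring
  have hfeq : fderivWithin ℝ f (quad (m + 1) ∩ Metric.ball w₀ r₁) w₀ =
      fderivWithin ℝ f (quad (m + 1)) w₀ :=
    fderivWithin_inter (Metric.isOpen_ball.mem_nhds hw₀D.2)
  have hfL : ∀ u, fderivWithin ℝ f (quad (m + 1)) w₀ (inclE m u) =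
      fderivWithin ℝ h (quad m ∩ Metric.ball y₀ r) y₀ u := by
    have h1 : HasFDerivWithinAt (fun y : E m => consE t₀ y) (inclE m) (quad m) y₀ := by
      have : (fun y : E m => consE t₀ y) =
          fun y => t₀ • (EuclideanSpace.single 0 1 : E (m + 1)) + inclE m y := by
        ext1 y; exact consE_eq_add t₀ y
      rw [this]
      exact ((inclE m).hasFDerivWithinAt).const_add _
    have h2 := (hfd w₀ hw₀D).hasFDerivWithinAt.comp y₀ h1 fun y hy => consE_mem_quad ht₀ hy
    have h3 : HasFDerivWithinAt h ((fderivWithin ℝ f (quad (m + 1)) w₀).comp (inclE m))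
        (quad m ∩ Metric.ball y₀ r) y₀ :=
      (h2.congr (fun y _ => (hf0 y).symm) (hf0 y₀).symm).mono inter_subset_left
    intro u
    rw [h3.fderivWithin (uniqueDiffOn_quad_inter Metric.isOpen_ball y₀ hy₀D)]
    rfl
  -- At `w₀` the derivative is `X` on the first basis vector and that of `h` on the others; `hXL`
  -- says that these are independent.
  have hfinj : Function.Injective (fderivWithin ℝ f (quad (m + 1) ∩ Metric.ball w₀ r₁) w₀) := by
    rw [hfeq]
    refine (injective_iff_map_eq_zero _).2 fun u hu => ?_
    have hu' : u = u 0 • EuclideanSpace.single 0 1 + inclE m (tailE m u) := by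
      rw [← consE_eq_add, consE_tailE]
    rw [hu', map_add, map_smul, hfX w₀ hw₀D, hfL, hf0] at hu
    have h0 : u 0 = 0 := by
      by_contra hne
      refine hXL (-(u 0)⁻¹ • tailE m u) ?_
      rw [map_smul, eq_neg_of_add_eq_zero_right hu, smul_neg, neg_smul, neg_neg, smul_smul,
        inv_mul_cancel₀ hne, one_smul]
    rw [h0, zero_smul, zero_add] at hu
    have h1 : tailE m u = 0 := hinj (by rw [hu, map_zero])
    rw [hu', h0, h1, zero_smul, map_zero, add_zero]
  obtain ⟨U, W, g, hU, hW, hwU, hUb, hfU, hgW, hgf, hfg, hg⟩ := exists_quad_inverse hw₀ hr₁ hf₁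
    (hfQ.mono_left hsub₁) hfinj (by
      -- Faces match: the face of the first coordinate is present only if `t₀ = 0` and goes to a
      -- regular face by `hfaceR`. The other faces start in a singular face by `hfaceA` and stay
      -- there by tangency.
      intro i hi
      revert hi
      refine Fin.cases (fun hi => ?_) (fun i hi => ?_) i
      · obtain ⟨j, hjA, hj⟩ := ht₀0 hi
        refine ⟨j, fun v hv hv0 => ?_⟩
        have ht : t₀ = 0 := hi
        simp only [f, hv0, ht, sub_self]
        rw [flow_zero hB hK]
        exact hfaceR j hjA hj _ (htail v (hsub₁ hv))
      · obtain ⟨j, hjA, hj⟩ := hfaceA i hi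
        exact ⟨j, fun v hv hvi => flow_eq_zero_of_tangent hB hK (htan j (Or.inl hjA))
          (hj _ (htail v (hsub₁ hv)) hvi) (htimeK v (hsub₁ hv).2)⟩)
  have hUD : quad (m + 1) ∩ U ⊆ quad (m + 1) ∩ Metric.ball w₀ r₁ := inter_subset_inter_right _ hUb
  exact ⟨t₀, ht₀, f, g, U, W, hU, hW, hwU, hfU,
    fun w hw => Metric.ball_subset_ball (min_le_right _ _) (hfρ (hUD hw)), hgW, hgf, hfg,
    hf₁.mono hUD, hg, fun y _ _ => hf0 y, fun w hw => hfX w (hUD hw)⟩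

/-! ### Coordinates adapted to a hypersurface -/

section

variable {n : ℕ} {M : Type*} [TopologicalSpace M] [ChartedSpace (EuclideanQuadrant n) M]
  [IsManifold (Q n) ∞ M] {N : Set M} {H : M → E n} {Φ : E n → M}

theorem IsCoord.image_comp_eq (h : IsCoord N H Φ) {f g : E n → E n} {U W : Set (E n)}
    (hfU : MapsTo f (quad n ∩ U) (quad n ∩ W)) (hgW : MapsTo g (quad n ∩ W) (quad n ∩ U))
    (hgf : ∀ v ∈ quad n ∩ U, g (f v) = v) (hWN : quad n ∩ W ⊆ H '' N) :
    (g ∘ H) '' (N ∩ H ⁻¹' W) = quad n ∩ U := by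
  rw [Set.image_comp, image_inter_preimage]
  apply Subset.antisymm
  · rintro _ ⟨w, ⟨hwN, hwW⟩, rfl⟩
    exact hgW ⟨h.image_subset_quad hwN, hwW⟩
  · intro u hu
    exact ⟨f u, ⟨hWN (hfU hu), (hfU hu).2⟩, hgf u hu⟩

theorem IsCoord.comp (h : IsCoord N H Φ) {f g : E n → E n} {U W : Set (E n)} (hU : IsOpen U)
    (hW : IsOpen W) (hfU : MapsTo f (quad n ∩ U) (quad n ∩ W))
    (hgW : MapsTo g (quad n ∩ W) (quad n ∩ U)) (hgf : ∀ v ∈ quad n ∩ U, g (f v) = v)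
    (hfg : ∀ w ∈ quad n ∩ W, f (g w) = w) (hf : ContDiffOn ℝ ∞ f (quad n ∩ U))
    (hg : ContDiffOn ℝ ∞ g (quad n ∩ W)) (hWN : quad n ∩ W ⊆ H '' N) :
    IsCoord (N ∩ H ⁻¹' W) (g ∘ H) (Φ ∘ f) where
  isOpen := h.isOpen_inter_preimage hW
  contMDiffOn := h.contMDiffOn_of_comp hg inter_subset_left fun p hp => ⟨h.mem_quad hp.1, hp.2⟩
  exists_isOpen := ⟨U, hU, h.image_comp_eq hfU hgW hgf hWN⟩
  contMDiffOn_symm := by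
    rw [h.image_comp_eq hfU hgW hgf hWN]
    exact h.contMDiffOn_symm.comp hf.contMDiffOn fun u hu => hWN (hfU hu)
  left_inv p hp := by
    change Φ (f (g (H p))) = p
    rw [hfg _ ⟨h.mem_quad hp.1, hp.2⟩, h.left_inv p hp.1]

end

section

variable {m : ℕ} {M : Type*} [TopologicalSpace M] [ChartedSpace (EuclideanQuadrant (m + 1)) M]
  [IsManifold (Q (m + 1)) ∞ M] {Y : Type*} [TopologicalSpace Y] [ChartedSpace (EuclideanQuadrant m) Y]
  [IsManifold (Q m) ∞ Y] {ι : Y → M}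

/-- The differential of a map of manifolds, as a map of model spaces. -/
def diffMap (ι : Y → M) (y : Y) : E m →L[ℝ] E (m + 1) := mfderiv (Q m) (Q (m + 1)) ι y

theorem diff_comp_apply {F : Type*} [NormedAddCommGroup F] [NormedSpace ℝ F] {f : M → F} {y : Y}
    (hf : MDifferentiableAt (Q (m + 1)) 𝓘(ℝ, F) f (ι y))
    (hι : MDifferentiableAt (Q m) (Q (m + 1)) ι y) (w : E m) :
    diff (f ∘ ι) y w = diff f (ι y) (diffMap ι y w) :=
  congrArg (fun L : E m →L[ℝ] F => L w) (mfderiv_comp y hf hι)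

/-- A continuous injection of a compact space into a Hausdorff space is an embedding: points of `Y`
that are close in `M` are close in `Y`. -/
theorem eventually_preimage_mem [T2Space M] [CompactSpace Y] (hι : Continuous ι)
    (hinj : Function.Injective ι) {y₀ : Y} {O : Set Y} (hO : O ∈ 𝓝 y₀) :
    ∀ᶠ p in 𝓝 (ι y₀), ∀ y, ι y = p → y ∈ O := by
  rw [(hι.isClosedEmbedding hinj).isInducing.nhds_eq_comap] at hO
  obtain ⟨P, hP, hPO⟩ := hO
  filter_upwards [hP] with p hp y hy
  exact hPO (by rw [mem_preimage, hy]; exact hp)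

variable {𝓕 : Set (Set M)} {V : Submodule (Fn (m + 1) M) (VF (m + 1) M)}
  {W : Submodule (Fn m Y) (VF m Y)}

/-- Transversality at all points of `Y`: on `∂Y` it is assumed, and elsewhere `Y` is off the
singular set, where `V` spans the tangent space. -/
theorem IsLieManifoldWithBoundary.exists_sub_eq (hMY : IsLieManifoldWithBoundary 𝓕 V ι W) (y : Y)
    (v : E (m + 1)) : ∃ X ∈ V, ∃ w : E m, v - diffMap ι y w = X (ι y) := by
  by_cases hy : y ∈ (Q m).boundary Y
  · obtain ⟨X, hX, w, hw⟩ := hMY.transverse y hy v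
    exact ⟨X, hX, w, sub_eq_iff_eq_add.2 hw⟩
  · obtain ⟨X, hX, hXv⟩ := hMY.lieStructure.spans (ι y)
      (fun h => hy ((hMY.boundary_eq y).2 h)) v
    refine ⟨X, hX, 0, ?_⟩
    rw [map_zero, sub_zero]
    exact hXv.symm

end

section

variable {m : ℕ} {M : Type*} [TopologicalSpace M] [ChartedSpace (EuclideanQuadrant (m + 1)) M]
  [IsManifold (Q (m + 1)) ∞ M] [T2Space M] [CompactSpace M] {Y : Type*} [TopologicalSpace Y]
  [ChartedSpace (EuclideanQuadrant m) Y] [IsManifold (Q m) ∞ Y] [CompactSpace Y]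
  {ι : Y → M} {𝓕 : Set (Set M)} {V : Submodule (Fn (m + 1) M) (VF (m + 1) M)}
  {W : Submodule (Fn m Y) (VF m Y)}

/-- Near a point of the hypersurface `Y` there are coordinates of `M` in which some member of `V` is
the first coordinate vector field, and `Y` is a level set of the first coordinate. -/
theorem IsLieManifoldWithBoundary.exists_adapted_coord (hMY : IsLieManifoldWithBoundary 𝓕 V ι W)
    {Ny : Set Y} {Hy : Y → E m} {Φy : E m → Y} (hy : IsCoord Ny Hy Φy) {y₀ : Y} (hy₀ : y₀ ∈ Ny) : ∃ (N : Set M) (H : M → E (m + 1)) (Φ : E (m + 1) → M) (X : VF (m + 1) M) (t₀ : ℝ),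
      IsCoord N H Φ ∧ ι y₀ ∈ N ∧ X ∈ V ∧ 0 ≤ t₀ ∧
      (∀ p ∈ N, diff H p (X p) = EuclideanSpace.single 0 1) ∧
      ∀ᶠ y in 𝓝 y₀, ι y ∈ N ∧ H (ι y) = consE t₀ (Hy y) := by
  have hV := hMY.lieStructure
  have hιm : ∀ y, MDifferentiableAt (Q m) (Q (m + 1)) ι y := fun y =>
    hMY.contMDiff.mdifferentiable (by simp) y
  choose! b hb using hV.exists_bdf
  obtain ⟨N₁, H₁, Φ₁, h₁, hp₀⟩ : ∃ (N₁ : Set M) (H₁ : M → E (m + 1)) (Φ₁ : E (m + 1) → M),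
      IsCoord N₁ H₁ Φ₁ ∧ ι y₀ ∈ N₁ :=
    ⟨_, _, _, IsCoord.extChartAt (n := m + 1) (ι y₀), mem_chart_source _ _⟩
  have hH₁d : ∀ p ∈ N₁, MDifferentiableAt (Q (m + 1)) 𝓘(ℝ, E (m + 1)) H₁ p := fun p hp =>
    (h₁.hasMFDerivAt hp).mdifferentiableAt
  obtain ⟨δ, hδ, hδN, A, e, -, -, hA0, hact, -, hS, hnA, hAF⟩ :=
    exists_singular_coords h₁ hp₀ hV.subset_hyperfaces hb
  -- the hypersurface in charts
  set h : E m → E (m + 1) := fun y => H₁ (ι (Φy y)) with hh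
  have hh₀ : h (Hy y₀) = H₁ (ι y₀) := by simp only [hh, hy.left_inv y₀ hy₀]
  have hŷ₀ : Hy y₀ ∈ quad m := hy.mem_quad hy₀
  obtain ⟨r, hr, hrN⟩ : ∃ r > 0, ∀ y ∈ quad m ∩ Metric.ball (Hy y₀) r, y ∈ Hy '' Ny ∧
      ι (Φy y) ∈ N₁ ∧ h y ∈ Metric.ball (H₁ (ι y₀)) δ := by
    have hO : IsOpen (N₁ ∩ H₁ ⁻¹' Metric.ball (H₁ (ι y₀)) δ) :=
      h₁.isOpen_inter_preimage Metric.isOpen_ball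
    have h1 : ∀ᶠ p in 𝓝 (ι y₀), p ∈ N₁ ∩ H₁ ⁻¹' Metric.ball (H₁ (ι y₀)) δ :=
      hO.mem_nhds ⟨hp₀, Metric.mem_ball_self hδ⟩
    have h2 : ∀ᶠ y in 𝓝[quad m] (Hy y₀), ι (Φy y) ∈ N₁ ∩ H₁ ⁻¹' Metric.ball (H₁ (ι y₀)) δ :=
      ((hMY.contMDiff.continuous.tendsto y₀).comp (hy.tendsto_symm hy₀)).eventually h1
    have h3 : ∀ᶠ y in 𝓝[quad m] (Hy y₀), y ∈ Hy '' Ny := hy.image_mem_nhdsWithin hy₀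
    obtain ⟨r, hr, hb⟩ := Metric.mem_nhdsWithin_iff.1 (h3.and h2)
    exact ⟨r, hr, fun y hy => ⟨(hb ⟨hy.2, hy.1⟩).1, (hb ⟨hy.2, hy.1⟩).2.1, (hb ⟨hy.2, hy.1⟩).2.2⟩⟩
  set D := quad m ∩ Metric.ball (Hy y₀) r with hD
  have hŷ₀D : Hy y₀ ∈ D := ⟨hŷ₀, Metric.mem_ball_self hr⟩
  have hhs : ContDiffOn ℝ ∞ h D := by
    have hO : IsOpen (Ny ∩ ι ⁻¹' N₁) := hy.isOpen.inter (h₁.isOpen.preimage hMY.contMDiff.continuous)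
    have hc : ContMDiffOn (Q m) 𝓘(ℝ, E (m + 1)) ∞ (H₁ ∘ ι) (Ny ∩ ι ⁻¹' N₁) :=
      h₁.contMDiffOn.comp hMY.contMDiff.contMDiffOn fun y hy => hy.2
    refine (hy.contMDiffOn_comp_symm inter_subset_left hc).mono fun y hyD => ?_
    obtain ⟨hyN, hyN₁, -⟩ := hrN y hyD
    exact ⟨Φy y, ⟨hy.mapsTo_symm hyN, hyN₁⟩, hy.right_inv hyN⟩
  have hhQ : MapsTo h D (quad (m + 1)) := fun y hyD => h₁.mem_quad (hrN y hyD).2.1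
  have hu : UniqueDiffOn ℝ D := uniqueDiffOn_quad_inter Metric.isOpen_ball
  set L := fderivWithin ℝ h D (Hy y₀) with hL
  have hLeq : ∀ w, L w = diff H₁ (ι y₀) (diffMap ι y₀ (diffSymm Φy (Hy y₀) w)) := by
    intro w
    have hd : MDifferentiableAt (Q m) 𝓘(ℝ, E (m + 1)) (H₁ ∘ ι) (Φy (Hy y₀)) := by
      rw [hy.left_inv y₀ hy₀]
      exact (hH₁d _ hp₀).comp y₀ (hιm y₀)
    have h1 := (hy.hasFDerivWithinAt_comp_symm (mem_image_of_mem Hy hy₀) hd).mono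
      (inter_subset_left : D ⊆ quad m)
    have h2 : L = _ := h1.fderivWithin (hu _ hŷ₀D)
    rw [h2, ContinuousLinearMap.comp_apply, hy.left_inv y₀ hy₀]
    exact diff_comp_apply (hH₁d _ hp₀) (hιm y₀) _
  have hLinj : Function.Injective L := by
    refine (injective_iff_map_eq_zero _).2 fun w hw => ?_
    rw [hLeq] at hw
    have h1 : diffMap ι y₀ (diffSymm Φy (Hy y₀) w) = 0 :=
      eq_of_diff_eq h₁ hp₀ (hw.trans (map_zero (diff H₁ (ι y₀))).symm)
    have h2 : diffSymm Φy (Hy y₀) w = 0 :=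
      hMY.immersion y₀ (h1.trans (map_zero (diffMap ι y₀)).symm)
    have h3 := hy.diff_diffSymm (mem_image_of_mem Hy hy₀) w
    rw [h2, map_zero] at h3
    exact h3.symm
  -- vector fields in charts
  let xh : VF (m + 1) M → E (m + 1) → E (m + 1) := fun X v => diff H₁ (Φ₁ v) (X (Φ₁ v))
  have hxh : ∀ X, ContDiffOn ℝ ∞ (xh X) (quad (m + 1) ∩ Metric.ball (H₁ (ι y₀)) δ) := fun X =>
    (h₁.contMDiffOn_comp_symm subset_rfl (contMDiffOn_diff_apply h₁.isOpen h₁.contMDiffOn X)).mono hδN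
  have hxh₀ : ∀ X, xh X (H₁ (ι y₀)) = diff H₁ (ι y₀) (X (ι y₀)) := by
    intro X
    simp only [xh]
    rw [h₁.left_inv _ hp₀]
  have htan : ∀ X ∈ V, ∀ j ∈ A, ∀ v ∈ quad (m + 1) ∩ Metric.ball (H₁ (ι y₀)) δ, v j = 0 →
      xh X v j = 0 := by
    intro X hX j hj v hv hvj
    obtain ⟨F, hF, hFv⟩ := hAF j hj
    obtain ⟨hvF, c, hc, hcw⟩ := hFv v hv hvj
    have h1 : diff (b F) (Φ₁ v) (X (Φ₁ v)) = 0 := hV.tangent X hX F hF (b F) (hb F hF) _ hvF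
    have hvN := h₁.mapsTo_symm (hδN hv)
    have h2 := hcw (xh X v)
    have h3 : diffSymm Φ₁ v (xh X v) = X (Φ₁ v) := by
      have := h₁.diffSymm_diff hvN (X (Φ₁ v))
      rwa [h₁.right_inv (hδN hv)] at this
    rw [h3] at h2
    have h4 : c * xh X v j = 0 := h2.symm.trans h1
    exact (mul_eq_zero.1 h4).resolve_left hc
  have hspan : ∀ v, ∃ X ∈ V, ∃ w, v - L w = xh X (H₁ (ι y₀)) := by
    intro v
    obtain ⟨X, hX, w, hw⟩ := hMY.exists_sub_eq y₀ (diffSymm Φ₁ (H₁ (ι y₀)) v)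
    refine ⟨X, hX, diff Hy y₀ w, ?_⟩
    have h1 := h₁.diff_diffSymm (mem_image_of_mem H₁ hp₀) v
    rw [h₁.left_inv _ hp₀] at h1
    rw [hxh₀, hLeq, hy.diffSymm_diff hy₀, ← h1, ← map_sub]
    exact congrArg (diff H₁ (ι y₀)) hw
  -- faces of the hypersurface
  have hAact : ∀ j ∈ A, h (Hy y₀) j = 0 := fun j hj => by rw [hh₀]; exact hA0 j hj
  -- The components `h j` with `j ∈ A` cut out `∂Y`. Their derivatives are independent by
  -- transversality: members of `V` have no `A`-components at `H₁ (ι y₀)`, so those are supplied by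
  -- `TY` alone.
  obtain ⟨r', hr', hr'r, τ, hτ, hτ0, -⟩ := exists_face_bijection (J := (A : Set (Fin (m + 1)))) hŷ₀ hr hhs
    (fun j _ y hyD => hhQ hyD j) hAact (by
      intro y hyD hyi
      obtain ⟨hyN, hyN₁, hyδ⟩ := hrN y hyD
      have h1 : Φy y ∈ ⋃₀ hyperfaces m Y :=
        (mem_sUnion_hyperfaces_iff hy (hy.mapsTo_symm hyN)).2 (by rwa [hy.right_inv hyN])
      have h2 := (hMY.boundary_eq _).1 ((mem_boundary_iff _).2 h1)
      have h3 : Φ₁ (h y) = ι (Φy y) := h₁.left_inv _ hyN₁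
      rw [← h3] at h2
      exact (hS _ ⟨hhQ hyD, hyδ⟩).1 h2) (by
      intro c
      obtain ⟨X, hX, w, hw⟩ := hspan (WithLp.toLp 2 c)
      refine ⟨w, fun j hj => ?_⟩
      have h1 := htan X hX j hj _ ⟨hh₀ ▸ hhQ hŷ₀D, Metric.mem_ball_self hδ⟩ (hA0 j hj)
      rw [← hw] at h1
      have h2 : c j - L w j = 0 := h1
      linarith)
  -- regular faces
  have hregface : ∀ j, j ∉ A → h (Hy y₀) j = 0 → ∀ r'' > 0, ∃ ε > 0,
      ∀ v ∈ quad (m + 1) ∩ Metric.ball (h (Hy y₀)) ε, v j = 0 →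
        ∃ y ∈ quad m ∩ Metric.ball (Hy y₀) r'', h y = v := by
    intro j hjA hj r'' hr''
    rw [hh₀] at hj ⊢
    obtain ⟨G, hG, hG𝓕, hGj⟩ := hnA j hj hjA
    -- A boundary face that is not singular is contained in `Y`, so `h` covers it; the embedding
    -- property keeps the parameters near `Hy y₀`.
    have hGι : G ⊆ range ι := (hMY.singular_or_regular G hG).resolve_left hG𝓕
    have hO : Ny ∩ Hy ⁻¹' Metric.ball (Hy y₀) r'' ∈ 𝓝 y₀ :=
      (hy.isOpen_inter_preimage Metric.isOpen_ball).mem_nhds ⟨hy₀, Metric.mem_ball_self hr''⟩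
    have h1 := (h₁.tendsto_symm hp₀).eventually
      (eventually_preimage_mem hMY.contMDiff.continuous hMY.injective hO)
    obtain ⟨ε, hε, hb⟩ := Metric.mem_nhdsWithin_iff.1 h1
    refine ⟨min ε δ, lt_min hε hδ, fun v hv hvj => ?_⟩
    have hvδ : v ∈ quad (m + 1) ∩ Metric.ball (H₁ (ι y₀)) δ :=
      ⟨hv.1, Metric.ball_subset_ball (min_le_right _ _) hv.2⟩
    obtain ⟨y, hyv⟩ := hGι (hGj v hvδ hvj)
    have hyO := hb ⟨Metric.ball_subset_ball (min_le_left _ _) hv.2, hv.1⟩ y hyv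
    refine ⟨Hy y, ⟨hy.mem_quad hyO.1, hyO.2⟩, ?_⟩
    simp only [hh]
    rw [hy.left_inv y hyO.1, hyv]
    exact h₁.right_inv (hδN hvδ)
  have hsingle := fun j hjA hj k hk => single_mem_range_of_face hŷ₀ hr hhs hhQ hLinj hj
    (hregface j hjA hj) (k := k) hk
  have hL0 := fun j hjA hj => fderivWithin_apply_eq_zero_of_face hŷ₀ hr hhs hhQ hLinj hj
    (hregface j hjA hj)
  obtain ⟨r'', hr'', hr''r', hfaceR⟩ : ∃ r'' > 0, r'' ≤ r' ∧ ∀ j, j ∉ A → h (Hy y₀) j = 0 →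
      ∀ y ∈ quad m ∩ Metric.ball (Hy y₀) r'', h y j = 0 := by
    by_cases hR : ∃ j, j ∉ A ∧ h (Hy y₀) j = 0
    · obtain ⟨j, hjA, hj⟩ := hR
      obtain ⟨ρ, hρ, hρ0⟩ := eventually_apply_eq_zero_of_face hŷ₀ hr hhs hhQ hLinj hj
        (hregface j hjA hj)
      refine ⟨min ρ r', lt_min hρ hr', min_le_right _ _, fun k hkA hk y hy => ?_⟩
      -- At most one regular face passes through the point: the derivative of `h` has every `e_k`
      -- with `k ≠ j` in its range, but its component along a regular face's coordinate vanishes.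
      have : k = j := by
        by_contra hne
        obtain ⟨w, hw⟩ := hsingle j hjA hj k hne
        have h1 := hL0 k hkA hk w
        rw [hw] at h1
        simp at h1
      rw [this]
      exact hρ0 y ⟨hy.1, Metric.ball_subset_ball (min_le_left _ _) hy.2⟩
    · exact ⟨r', hr', le_rfl, fun j hjA hj => absurd ⟨j, hjA, hj⟩ hR⟩
  -- a transverse vector field
  obtain ⟨X, hXV, hXL, hXreg⟩ : ∃ X ∈ V, (∀ w, L w ≠ xh X (H₁ (ι y₀))) ∧
      ∀ j, j ∉ A → h (Hy y₀) j = 0 → 0 < xh X (H₁ (ι y₀)) j := by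
    -- Such a vector exists by dimension. Its class modulo `TY` is represented by a member of `V`,
    -- which is then transverse.
    obtain ⟨v, hv⟩ : ∃ v, ∀ w, L w ≠ v := by
      by_contra hcon
      push Not at hcon
      have := LinearMap.finrank_le_finrank_of_injective
        (f := ((LinearEquiv.ofBijective (L : E m →ₗ[ℝ] E (m + 1)) ⟨hLinj, hcon⟩).symm :
          E (m + 1) →ₗ[ℝ] E m)) (LinearEquiv.injective _)
      simp at this
    obtain ⟨X, hX, w, hw⟩ := hspan v
    have hXL : ∀ w, L w ≠ xh X (H₁ (ι y₀)) := by
      intro w' hw'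
      refine hv (w' + w) ?_
      rw [map_add, hw', ← hw, sub_add_cancel]
    by_cases hR : ∃ j, j ∉ A ∧ h (Hy y₀) j = 0
    · obtain ⟨j, hjA, hj⟩ := hR
      have huniq : ∀ k, k ∉ A → h (Hy y₀) k = 0 → k = j := by
        intro k hkA hk
        by_contra hne
        obtain ⟨w, hw⟩ := hsingle j hjA hj k hne
        have h1 := hL0 k hkA hk w
        rw [hw] at h1
        simp at h1
      -- All `e_k` with `k ≠ j` are tangent to `Y`; a transverse field must therefore have a
      -- component along `e_j`. Changing the sign of `X` if necessary makes it point inward.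
      have hXj : xh X (H₁ (ι y₀)) j ≠ 0 := by
        intro h0
        choose! u hu using hsingle j hjA hj
        refine hXL (∑ k ∈ Finset.univ.erase j, xh X (H₁ (ι y₀)) k • u k) ?_
        rw [map_sum]
        conv_rhs => rw [eq_sum_single (xh X (H₁ (ι y₀))), ← Finset.add_sum_erase _ _
          (Finset.mem_univ j), h0, zero_smul, zero_add]
        refine Finset.sum_congr rfl fun k hk => ?_
        rw [map_smul, hu k (Finset.ne_of_mem_erase hk)]
      rcases lt_or_gt_of_ne hXj with hneg | hpos
      · have hnx : xh (-X) (H₁ (ι y₀)) = -xh X (H₁ (ι y₀)) := by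
          rw [hxh₀, hxh₀]
          exact map_neg (diff H₁ (ι y₀)) _
        refine ⟨-X, V.neg_mem hX, fun w hw => hXL (-w) ?_, fun k hkA hk => ?_⟩
        · rw [map_neg, hw, hnx, neg_neg]
        · rw [huniq k hkA hk, hnx]
          simpa using hneg
      · exact ⟨X, hX, hXL, fun k hkA hk => by rw [huniq k hkA hk]; exact hpos⟩
    · exact ⟨X, hX, hXL, fun j hjA hj => absurd ⟨j, hjA, hj⟩ hR⟩
  -- the flow box
  have hsub : quad m ∩ Metric.ball (Hy y₀) r'' ⊆ D :=
    inter_subset_inter_right _ (Metric.ball_subset_ball (hr''r'.trans hr'r))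
  have hLr : fderivWithin ℝ h (quad m ∩ Metric.ball (Hy y₀) r'') (Hy y₀) = L := by
    rw [hL, fderivWithin_inter (Metric.ball_mem_nhds _ hr''),
      fderivWithin_inter (Metric.ball_mem_nhds _ hr)]
  obtain ⟨t₀, ht₀, f, g, U, W', hU, hW', hmU, hfU, hfδ, hgW, hgf, hfg, hf, hg, hfh, hfX⟩ :=
    exists_flow_box (X := xh X) (A := (A : Set (Fin (m + 1)))) hδ hŷ₀ hr'' (hh₀ ▸ hxh X) (hh₀ ▸ htan X hXV)
      (by rw [hh₀]; exact hact) (by rw [hh₀] at hXreg ⊢; exact hXreg) (hhs.mono hsub)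
      (hhQ.mono_left hsub) (by rw [hLr]; exact hLinj) (by rw [hLr, hh₀]; exact hXL)
      (fun i hi => ⟨τ i, hτ.mapsTo hi, fun y hy => hτ0 i hi y
        ⟨hy.1, Metric.ball_subset_ball hr''r' hy.2⟩⟩) hfaceR
  rw [hh₀] at hfδ
  have hWN : quad (m + 1) ∩ W' ⊆ H₁ '' N₁ := by
    intro w hw
    have h1 := hδN ⟨(hfU (hgW hw)).1, hfδ (hgW hw)⟩
    rwa [hfg w hw] at h1
  have hcoord := h₁.comp hU hW' hfU hgW hgf hfg hf hg hWN
  have hloc : ∀ᶠ y in 𝓝 y₀, y ∈ Ny ∧ Hy y ∈ Metric.ball (Hy y₀) r ∧ consE t₀ (Hy y) ∈ U := by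
    have hc : ContinuousAt Hy y₀ := hy.continuousOn.continuousAt (hy.isOpen.mem_nhds hy₀)
    have hc' : Continuous fun y : E m => consE t₀ y :=
      contDiff_consE.continuous.comp (by fun_prop : Continuous fun y : E m => (t₀, y))
    filter_upwards [hy.isOpen.mem_nhds hy₀, hc.eventually (Metric.ball_mem_nhds _ hr),
      (hc'.continuousAt.comp hc).eventually (hU.mem_nhds hmU)] with y h1 h2 h3 using ⟨h1, h2, h3⟩
  have hpt : ∀ y, y ∈ Ny ∧ Hy y ∈ Metric.ball (Hy y₀) r ∧ consE t₀ (Hy y) ∈ U →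
      ι y ∈ N₁ ∩ H₁ ⁻¹' W' ∧ (g ∘ H₁) (ι y) = consE t₀ (Hy y) := by
    rintro y ⟨h1, h2, h3⟩
    have hq := hy.mem_quad h1
    have h4 : f (consE t₀ (Hy y)) = H₁ (ι y) := by
      rw [hfh _ hq h3]
      simp only [hh]
      rw [hy.left_inv y h1]
    have h5 : consE t₀ (Hy y) ∈ quad (m + 1) ∩ U := ⟨consE_mem_quad ht₀ hq, h3⟩
    have h6 := hrN (Hy y) ⟨hq, h2⟩
    rw [hy.left_inv y h1] at h6
    refine ⟨⟨h6.2.1, ?_⟩, ?_⟩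
    · rw [mem_preimage, ← h4]; exact (hfU h5).2
    · rw [Function.comp, ← h4, hgf _ h5]
  refine ⟨N₁ ∩ H₁ ⁻¹' W', g ∘ H₁, Φ₁ ∘ f, X, t₀, hcoord, (hpt y₀ hloc.self_of_nhds).1, hXV, ht₀, ?_,
    hloc.mono hpt⟩
  intro p hp
  set H := g ∘ H₁ with hH
  have hHp : H p ∈ quad (m + 1) ∩ U := hgW ⟨h₁.mem_quad hp.1, hp.2⟩
  have hfH : f (H p) = H₁ p := hfg _ ⟨h₁.mem_quad hp.1, hp.2⟩
  have hHm : H p ∈ H '' (N₁ ∩ H₁ ⁻¹' W') := mem_image_of_mem H hp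
  -- Seen in the original chart, `∂_0` of the new coordinates is the derivative of the flow box in
  -- its first coordinate, which is `X`.
  have h1 : diff H₁ p (diffSymm (Φ₁ ∘ f) (H p) (EuclideanSpace.single 0 1)) = diff H₁ p (X p) := by
    rw [hcoord.diff_eq hp (hH₁d p hp.1)]
    have h2 := hcoord.diff_diffSymm hHm (EuclideanSpace.single 0 1)
    rw [hcoord.left_inv p hp] at h2
    rw [h2]
    have h3 : H₁ ∘ (Φ₁ ∘ f) =ᶠ[𝓝[quad (m + 1)] (H p)] f := by
      filter_upwards [inter_mem_nhdsWithin _ (hU.mem_nhds hHp.2)] with u hu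
      exact h₁.right_inv (hWN (hfU hu))
    rw [h3.fderivWithin_eq (h₁.right_inv (hWN (hfU hHp))), hfX _ hHp, hfH]
    simp only [xh]
    rw [h₁.left_inv p hp.1]
  have h4 := eq_of_diff_eq h₁ hp.1 h1
  have h5 := hcoord.diff_diffSymm hHm (EuclideanSpace.single 0 1)
  rw [hcoord.left_inv p hp] at h5
  rw [← h5]
  exact congrArg (diff H p) h4.symm

end

/-! ### Boxes adapted to a hypersurface -/

/-- A box around `(t₀, y₀)`. -/
def box {m : ℕ} (t₀ : ℝ) (y₀ : E m) (δ : ℝ) : Set (E (m + 1)) :=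
  {v | |v 0 - t₀| < δ ∧ tailE m v ∈ Metric.ball y₀ δ}

theorem isOpen_box {m : ℕ} (t₀ : ℝ) (y₀ : E m) (δ : ℝ) : IsOpen (box t₀ y₀ δ) :=
  (isOpen_lt (f := fun v : E (m + 1) => |v 0 - t₀|) (by fun_prop) continuous_const).inter
    (Metric.isOpen_ball.preimage (tailE m).continuous)

theorem box_mono {m : ℕ} {t₀ : ℝ} {y₀ : E m} {δ δ' : ℝ} (h : δ' ≤ δ) :
    box t₀ y₀ δ' ⊆ box t₀ y₀ δ := fun _ hv =>
  ⟨hv.1.trans_le h, Metric.ball_subset_ball h hv.2⟩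

theorem consE_mem_box {m : ℕ} {t₀ : ℝ} {y₀ y : E m} {δ : ℝ} (hδ : 0 < δ)
    (hy : y ∈ Metric.ball y₀ δ) : consE t₀ y ∈ box t₀ y₀ δ := by
  refine ⟨by simpa using hδ, by simpa using hy⟩

theorem exists_box_subset {m : ℕ} {t₀ : ℝ} {y₀ : E m} {O : Set (E (m + 1))}
    (hO : O ∈ 𝓝 (consE t₀ y₀)) : ∃ δ > 0, box t₀ y₀ δ ⊆ O := by
  obtain ⟨ε, hε, hb⟩ := Metric.mem_nhds_iff.1 hO
  refine ⟨ε / 2, by positivity, fun v hv => hb ?_⟩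
  rw [mem_ball_iff_norm]
  have h1 : v - consE t₀ y₀ = consE (v 0 - t₀) (tailE m v - y₀) := by
    ext i; refine Fin.cases ?_ (fun i => ?_) i <;> simp
  have h2 : ‖inclE m (tailE m v - y₀)‖ ≤ ‖tailE m v - y₀‖ := by
    rw [EuclideanSpace.norm_eq, EuclideanSpace.norm_eq, Fin.sum_univ_succ]
    simp [inclE_apply]
  have h3 := mem_ball_iff_norm.1 hv.2
  rw [h1, consE_eq_add]
  refine (norm_add_le _ _).trans_lt ?_
  rw [norm_smul, PiLp.norm_single, norm_one, mul_one, Real.norm_eq_abs]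
  linarith [hv.1]

theorem convex_box {m : ℕ} (t₀ : ℝ) (y₀ : E m) (δ : ℝ) : Convex ℝ (box t₀ y₀ δ) := by
  have h1 : {v : E (m + 1) | |v 0 - t₀| < δ} =
      (EuclideanSpace.proj (𝕜 := ℝ) (0 : Fin (m + 1))) ⁻¹' Metric.ball t₀ δ := by
    ext v
    simp [Real.dist_eq]
  have h2 : box t₀ y₀ δ = {v : E (m + 1) | |v 0 - t₀| < δ} ∩ tailE m ⁻¹' Metric.ball y₀ δ := rfl
  rw [h2, h1]
  exact ((convex_ball t₀ δ).linear_preimage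
    (EuclideanSpace.proj (𝕜 := ℝ) (0 : Fin (m + 1)) : E (m + 1) →ₗ[ℝ] ℝ)).inter
    ((convex_ball y₀ δ).linear_preimage (tailE m : E (m + 1) →ₗ[ℝ] E m))

/-! ### Adapted pairs of coordinates of `M` and `Y` -/

section

variable {m : ℕ} {M : Type*} [TopologicalSpace M] [ChartedSpace (EuclideanQuadrant (m + 1)) M]
  [IsManifold (Q (m + 1)) ∞ M] {Y : Type*} [TopologicalSpace Y]
  [ChartedSpace (EuclideanQuadrant m) Y] [IsManifold (Q m) ∞ Y]

/-- Coordinates `H` of `M` on `N` and `Hy` of `Y` on `Ny`, with boxes as images, such that `Y` is a level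
set of the first coordinate, that `X` is the first coordinate vector field, and that the other
coordinates detect the singular hyperfaces. -/
structure IsAdapted (ι : Y → M) (𝓕 : Set (Set M)) (X : VF (m + 1) M) (N : Set M) (H : M → E (m + 1))
    (Φ : E (m + 1) → M) (Ny : Set Y) (Hy : Y → E m) (Φy : E m → Y) (t₀ : ℝ) (y₀ : E m) (δ : ℝ) :
    Prop where
  coord : IsCoord N H Φ
  coordY : IsCoord Ny Hy Φy
  pos : 0 < δ
  nonneg : 0 ≤ t₀
  mem_quad : y₀ ∈ quad m
  image : H '' N = quad (m + 1) ∩ box t₀ y₀ δ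
  imageY : Hy '' Ny = quad m ∩ Metric.ball y₀ δ
  hypersurface : ∀ y ∈ Ny, ι y ∈ N ∧ H (ι y) = consE t₀ (Hy y)
  field : ∀ p ∈ N, diff H p (X p) = EuclideanSpace.single 0 1
  singular : ∀ p ∈ N, p ∈ ⋃₀ 𝓕 ↔ ∃ i : Fin m, H p i.succ = 0

namespace IsAdapted

variable {ι : Y → M} {𝓕 : Set (Set M)} {X : VF (m + 1) M} {N : Set M} {H : M → E (m + 1)}
  {Φ : E (m + 1) → M} {Ny : Set Y} {Hy : Y → E m} {Φy : E m → Y} {t₀ : ℝ} {y₀ : E m} {δ : ℝ}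

theorem mono (h : IsAdapted ι 𝓕 X N H Φ Ny Hy Φy t₀ y₀ δ) {δ' : ℝ} (hδ' : 0 < δ') (hle : δ' ≤ δ) :
    IsAdapted ι 𝓕 X (N ∩ H ⁻¹' box t₀ y₀ δ') H Φ (Ny ∩ Hy ⁻¹' Metric.ball y₀ δ') Hy Φy t₀ y₀ δ' where
  coord := h.coord.mono (h.coord.isOpen_inter_preimage (isOpen_box _ _ _)) inter_subset_left
  coordY := h.coordY.mono (h.coordY.isOpen_inter_preimage Metric.isOpen_ball) inter_subset_left
  pos := hδ'
  nonneg := h.nonneg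
  mem_quad := h.mem_quad
  image := by
    rw [image_inter_preimage, h.image, inter_assoc, inter_eq_self_of_subset_right (box_mono hle)]
  imageY := by
    rw [image_inter_preimage, h.imageY, inter_assoc,
      inter_eq_self_of_subset_right (Metric.ball_subset_ball hle)]
  hypersurface y hy := by
    obtain ⟨h1, h2⟩ := h.hypersurface y hy.1
    exact ⟨⟨h1, by rw [mem_preimage, h2]; exact consE_mem_box hδ' hy.2⟩, h2⟩
  field p hp := h.field p hp.1
  singular p hp := h.singular p hp.1

theorem base_mem (h : IsAdapted ι 𝓕 X N H Φ Ny Hy Φy t₀ y₀ δ) : consE t₀ y₀ ∈ H '' N := by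
  rw [h.image]
  exact ⟨consE_mem_quad h.nonneg h.mem_quad, consE_mem_box h.pos (Metric.mem_ball_self h.pos)⟩

theorem baseY_mem (h : IsAdapted ι 𝓕 X N H Φ Ny Hy Φy t₀ y₀ δ) : y₀ ∈ Hy '' Ny := by
  rw [h.imageY]
  exact ⟨h.mem_quad, Metric.mem_ball_self h.pos⟩

theorem tail_mem (h : IsAdapted ι 𝓕 X N H Φ Ny Hy Φy t₀ y₀ δ) {v : E (m + 1)} (hv : v ∈ H '' N) :
    tailE m v ∈ Hy '' Ny := by
  rw [h.image] at hv
  rw [h.imageY]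
  exact ⟨tailE_mem_quad hv.1, hv.2.2⟩

theorem cons_mem (h : IsAdapted ι 𝓕 X N H Φ Ny Hy Φy t₀ y₀ δ) {y : E m} (hy : y ∈ Hy '' Ny) :
    consE t₀ y ∈ H '' N := by
  rw [h.imageY] at hy
  rw [h.image]
  exact ⟨consE_mem_quad h.nonneg hy.1, consE_mem_box h.pos hy.2⟩

theorem symm_cons (h : IsAdapted ι 𝓕 X N H Φ Ny Hy Φy t₀ y₀ δ) {y : E m} (hy : y ∈ Hy '' Ny) :
    Φ (consE t₀ y) = ι (Φy y) := by
  obtain ⟨h1, h2⟩ := h.hypersurface _ (h.coordY.mapsTo_symm hy)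
  rw [h.coordY.right_inv hy] at h2
  rw [← h2, h.coord.left_inv _ h1]

/-- Small boxes are contained in a given neighbourhood. -/
theorem exists_subset (h : IsAdapted ι 𝓕 X N H Φ Ny Hy Φy t₀ y₀ δ) {O : Set M}
    (hO : O ∈ 𝓝 (Φ (consE t₀ y₀))) :
    ∃ δ' > 0, δ' ≤ δ ∧ N ∩ H ⁻¹' box t₀ y₀ δ' ⊆ O := by
  have h1 := h.coord.tendsto_symm (h.coord.mapsTo_symm h.base_mem)
  rw [h.coord.right_inv h.base_mem] at h1
  have h2 := h1.eventually hO
  rw [eventually_nhdsWithin_iff] at h2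
  obtain ⟨δ', hδ', hb⟩ := exists_box_subset h2
  refine ⟨min δ' δ, lt_min hδ' h.pos, min_le_right _ _, fun p hp => ?_⟩
  have h3 := hb (box_mono (min_le_left _ _) hp.2) (h.coord.mem_quad hp.1)
  rw [h.coord.left_inv p hp.1] at h3
  exact h3

theorem exists_subsetY (h : IsAdapted ι 𝓕 X N H Φ Ny Hy Φy t₀ y₀ δ) {O : Set Y}
    (hO : O ∈ 𝓝 (Φy y₀)) :
    ∃ δ' > 0, δ' ≤ δ ∧ Ny ∩ Hy ⁻¹' Metric.ball y₀ δ' ⊆ O := by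
  have h1 := h.coordY.tendsto_symm (h.coordY.mapsTo_symm h.baseY_mem)
  rw [h.coordY.right_inv h.baseY_mem] at h1
  obtain ⟨δ', hδ', hb⟩ := Metric.mem_nhdsWithin_iff.1 (h1.eventually hO)
  refine ⟨min δ' δ, lt_min hδ' h.pos, min_le_right _ _, fun p hp => ?_⟩
  have h3 := hb ⟨Metric.ball_subset_ball (min_le_left _ _) hp.2, h.coordY.mem_quad hp.1⟩
  have h4 : Φy (Hy p) ∈ O := h3
  rwa [h.coordY.left_inv p hp.1] at h4

end IsAdapted

variable [T2Space M] [CompactSpace M] [CompactSpace Y]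
  {ι : Y → M} {𝓕 : Set (Set M)} {V : Submodule (Fn (m + 1) M) (VF (m + 1) M)}
  {W : Submodule (Fn m Y) (VF m Y)}

/-- Shrinking to a common box makes the images products. The remaining point is that the singular
coordinates of `M` are those of `Y` shifted by one, which follows from `∂Y` being the intersection
with the singular set. -/
theorem IsLieManifoldWithBoundary.exists_adapted (hMY : IsLieManifoldWithBoundary 𝓕 V ι W) (y₀ : Y) :
    ∃ (X : VF (m + 1) M) (N : Set M) (H : M → E (m + 1)) (Φ : E (m + 1) → M) (Ny : Set Y)
      (Hy : Y → E m) (Φy : E m → Y) (t₀ : ℝ) (δ : ℝ), X ∈ V ∧ y₀ ∈ Ny ∧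
      IsAdapted ι 𝓕 X N H Φ Ny Hy Φy t₀ (Hy y₀) δ := by
  have hV := hMY.lieStructure
  choose! b hb using hV.exists_bdf
  obtain ⟨Ny, Hy, Φy, hy, hy₀⟩ : ∃ (Ny : Set Y) (Hy : Y → E m) (Φy : E m → Y),
      IsCoord Ny Hy Φy ∧ y₀ ∈ Ny :=
    ⟨_, _, _, IsCoord.extChartAt (n := m) y₀, mem_chart_source _ _⟩
  obtain ⟨N, H, Φ, X, t₀, h, hp₀, hXV, ht₀, hX, hloc⟩ := hMY.exists_adapted_coord hy hy₀
  have hH₀ : H (ι y₀) = consE t₀ (Hy y₀) := hloc.self_of_nhds.2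
  obtain ⟨δ, hδ, hδN, A, e, -, -, hA0, hact, -, hS, -, -⟩ :=
    exists_singular_coords h hp₀ hV.subset_hyperfaces hb
  rw [hH₀] at hδN hA0 hact hS
  -- a common radius
  have h1 := (hy.tendsto_symm hy₀).eventually hloc
  have h2 : ∀ᶠ y in 𝓝[quad m] (Hy y₀), y ∈ Hy '' Ny := hy.image_mem_nhdsWithin hy₀
  obtain ⟨ε, hε, hbε⟩ := Metric.mem_nhdsWithin_iff.1 (h2.and h1)
  obtain ⟨ε', hε', hbε'⟩ := exists_box_subset (Metric.ball_mem_nhds (consE t₀ (Hy y₀)) hδ)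
  have hρ : 0 < min ε ε' := lt_min hε hε'
  have hyY : ∀ y ∈ quad m ∩ Metric.ball (Hy y₀) (min ε ε'), y ∈ Hy '' Ny ∧ ι (Φy y) ∈ N ∧
      H (ι (Φy y)) = consE t₀ y := by
    intro y hyq
    obtain ⟨h3, h4, h5⟩ := hbε ⟨Metric.ball_subset_ball (min_le_left _ _) hyq.2, hyq.1⟩
    rw [hy.right_inv h3] at h5
    exact ⟨h3, h4, h5⟩
  have hbox : ∀ v ∈ quad (m + 1) ∩ box t₀ (Hy y₀) (min ε ε'),
      v ∈ quad (m + 1) ∩ Metric.ball (consE t₀ (Hy y₀)) δ := fun v hv =>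
    ⟨hv.1, hbε' (box_mono (min_le_right _ _) hv.2)⟩
  have hYS : ∀ y ∈ quad m ∩ Metric.ball (Hy y₀) (min ε ε'),
      (∃ i, y i = 0) ↔ ∃ k ∈ A, consE t₀ y k = 0 := by
    intro y hyq
    obtain ⟨h3, h4, h5⟩ := hyY y hyq
    rw [← hS _ (hbox _ ⟨consE_mem_quad ht₀ hyq.1, consE_mem_box hρ hyq.2⟩), ← h5, h.left_inv _ h4,
      ← hMY.boundary_eq, mem_boundary_iff, mem_sUnion_hyperfaces_iff hy (hy.mapsTo_symm h3),
      hy.right_inv h3]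
  have hŷ₀ : Hy y₀ ∈ quad m := hy.mem_quad hy₀
  -- If the face `t = 0` were singular, then `t₀ = 0` and all of `Y` in the box would be singular;
  -- but `Y` has interior points there.
  have h0A : (0 : Fin (m + 1)) ∉ A := by
    intro h0
    obtain ⟨y, hyi, hyb⟩ : ∃ y ∈ interior (quad m), y ∈ Metric.ball (Hy y₀) (min ε ε') := by
      obtain ⟨y, hy1, hy2⟩ := mem_closure_iff_nhds.1 (mem_closure_interior_quad hŷ₀) _
        (Metric.ball_mem_nhds _ hρ)
      exact ⟨y, hy2, hy1⟩
    obtain ⟨i, hi⟩ := (hYS y ⟨interior_subset hyi, hyb⟩).2 ⟨0, h0, by simpa using hA0 0 h0⟩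
    rw [interior_quad] at hyi
    exact (hyi i).ne' hi
  -- A point of `Y` on the boundary face `i` alone is singular in `M`, and the only coordinate that
  -- can account for this is `i.succ`.
  have hAsucc : ∀ i : Fin m, Hy y₀ i = 0 → i.succ ∈ A := by
    intro i hi
    obtain ⟨s, ⟨hsq, hsb⟩, hsi, hsk⟩ :=
      (eventually_face_mem hŷ₀ hi (Metric.ball_mem_nhds _ hρ)).exists
    obtain ⟨k, hkA, hk⟩ := (hYS _ ⟨hsq, hsb⟩).1 ⟨i, hsi⟩
    revert hkA hk
    refine Fin.cases (fun h0 _ => absurd h0 h0A) (fun j hjA hj => ?_) k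
    have : j = i := by
      by_contra hne
      exact (hsk j hne).ne' hj
    rwa [← this]
  refine ⟨X, N ∩ H ⁻¹' box t₀ (Hy y₀) (min ε ε'), H, Φ,
    Ny ∩ Hy ⁻¹' Metric.ball (Hy y₀) (min ε ε'), Hy, Φy, t₀, min ε ε', hXV,
    ⟨hy₀, Metric.mem_ball_self hρ⟩, ?_⟩
  refine ⟨h.mono (h.isOpen_inter_preimage (isOpen_box _ _ _)) inter_subset_left,
    hy.mono (hy.isOpen_inter_preimage Metric.isOpen_ball) inter_subset_left, hρ, ht₀, hŷ₀, ?_, ?_,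
    fun y hyN => ?_, fun p hp => hX p hp.1, fun p hp => ?_⟩
  · rw [image_inter_preimage]
    exact Subset.antisymm (inter_subset_inter_left _ h.image_subset_quad) fun v hv =>
      ⟨hδN (hbox v hv), hv.2⟩
  · rw [image_inter_preimage]
    exact Subset.antisymm (inter_subset_inter_left _ hy.image_subset_quad) fun y hyq =>
      ⟨(hyY y hyq).1, hyq.2⟩
  · have h3 := hyY (Hy y) ⟨hy.mem_quad hyN.1, hyN.2⟩
    rw [hy.left_inv y hyN.1] at h3
    exact ⟨⟨h3.2.1, by rw [mem_preimage, h3.2.2]; exact consE_mem_box hρ hyN.2⟩, h3.2.2⟩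
  · have hv := hbox (H p) ⟨h.mem_quad hp.1, hp.2⟩
    have h3 := hS (H p) hv
    rw [h.left_inv p hp.1] at h3
    rw [h3]
    constructor
    · rintro ⟨k, hkA, hk⟩
      revert hkA hk
      exact Fin.cases (fun h0 _ => absurd h0 h0A) (fun j _ hj => ⟨j, hj⟩) k
    · rintro ⟨i, hi⟩
      exact ⟨i.succ, hAsucc i (by simpa using hact _ hv i.succ hi), hi⟩

end

/-! ### Matching of boundary defining functions -/

theorem IsBDF.mul_pos {n : ℕ} {M : Type*} [TopologicalSpace M] [ChartedSpace (EuclideanQuadrant n) M]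
    [IsManifold (Q n) ∞ M] {F : Set M} {b : Fn n M} (hb : IsBDF F b) {a : Fn n M}
    (ha : ∀ p, 0 < a p) : IsBDF F (a * b) := by
  refine ⟨fun p => mul_nonneg (ha p).le (hb.1 p), ?_, fun p hp h0 => hb.2.2 p hp ?_⟩
  · rw [← hb.2.1]
    ext p
    change a p * b p = 0 ↔ b p = 0
    simp [(ha p).ne']
  · have ha' := (a.contMDiff.mdifferentiable (by simp) p).hasMFDerivAt
    have hb' := (b.contMDiff.mdifferentiable (by simp) p).hasMFDerivAt
    have hbp : b p = 0 := by
      have : p ∈ {p | b p = 0} := hb.2.1 ▸ hp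
      exact this
    have h1 := (ha'.mul hb').mfderiv
    have h2 : mfderiv (Q n) 𝓘(ℝ, ℝ) (a * b : Fn n M) p = _ := h1
    rw [h0, hbp] at h2
    ext v
    have h3 := congrArg (fun L : E n →L[ℝ] ℝ => L v) h2
    have h4 : (0 : ℝ) = a p * diff b p v + 0 * diff a p v := h3
    have h5 : a p * diff b p v = 0 := by linarith
    exact (mul_eq_zero.1 h5).resolve_left (ha p).ne'

section

variable {m : ℕ} {M : Type*} [TopologicalSpace M] [ChartedSpace (EuclideanQuadrant (m + 1)) M]
  [IsManifold (Q (m + 1)) ∞ M] {Y : Type*} [TopologicalSpace Y]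
  [ChartedSpace (EuclideanQuadrant m) Y] [IsManifold (Q m) ∞ Y]
  [T2Space M] [CompactSpace M] [CompactSpace Y]
  {ι : Y → M} {𝓕 : Set (Set M)} {V : Submodule (Fn (m + 1) M) (VF (m + 1) M)}
  {W : Submodule (Fn m Y) (VF m Y)} {X : VF (m + 1) M} {N : Set M} {H : M → E (m + 1)}
  {Φ : E (m + 1) → M} {Ny : Set Y} {Hy : Y → E m} {Φy : E m → Y} {t₀ : ℝ} {y₀ : E m} {δ : ℝ}

-- A positive factor is absorbed into the defining function of one single hyperface, so that it
-- enters the product once. This is why some singular hyperface has to exist.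
open Classical in
theorem exists_scaled_bdf (h𝓕 : 𝓕 ⊆ hyperfaces (m + 1) M) (hne : 𝓕.Nonempty)
    {b : Set M → Fn (m + 1) M} (hb : ∀ F ∈ 𝓕, IsBDF F (b F)) {a : Fn (m + 1) M} (ha : ∀ p, 0 < a p) :
    ∃ R : Set M → Fn (m + 1) M, (∀ F ∈ 𝓕, IsBDF F (R F)) ∧
      ∀ p, ∏ᶠ F ∈ 𝓕, R F p = a p * ∏ᶠ F ∈ 𝓕, b F p := by
  obtain ⟨F₀, hF₀⟩ := hne
  have hfin : 𝓕.Finite := hyperfaces_finite.subset h𝓕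
  refine ⟨fun F => (if F = F₀ then a else 1) * b F, fun F hF => (hb F hF).mul_pos fun p => ?_,
    fun p => ?_⟩
  · split_ifs
    · exact ha p
    · exact one_pos
  · rw [finprod_mem_eq_finite_toFinset_prod _ hfin, finprod_mem_eq_finite_toFinset_prod _ hfin]
    have h1 : ∀ F, ((if F = F₀ then a else 1) * b F) p = (if F = F₀ then a p else 1) * b F p := by
      intro F
      split_ifs <;> rfl
    simp only [h1, Finset.prod_mul_distrib, Finset.prod_ite_eq']
    rw [if_pos (hfin.mem_toFinset.2 hF₀)]

/-- Both products are a positive smooth function times the same coordinates `y_i`. The quotient of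
the positive factors is extended from a neighbourhood to a global positive function and absorbed
into a defining function on `M`. -/
theorem IsAdapted.exists_matching_bdf (hMY : IsLieManifoldWithBoundary 𝓕 V ι W)
    (h : IsAdapted ι 𝓕 X N H Φ Ny Hy Φy t₀ y₀ δ) {r : Set Y → Fn m Y}
    (hr : ∀ F ∈ hyperfaces m Y, IsBDF F (r F)) :
    ∃ δ' > 0, δ' ≤ δ ∧ ∃ R : Set M → Fn (m + 1) M, (∀ F ∈ 𝓕, IsBDF F (R F)) ∧
      ∀ p ∈ N ∩ H ⁻¹' box t₀ y₀ δ',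
        ∏ᶠ F ∈ 𝓕, R F p = ∏ᶠ F ∈ hyperfaces m Y, r F (Φy (tailE m (H p))) := by
  have hV := hMY.lieStructure
  choose! b hb using hV.exists_bdf
  rcases eq_empty_or_nonempty 𝓕 with he | hne
  · refine ⟨δ, h.pos, le_rfl, b, hb, fun p _ => ?_⟩
    -- Without singular hyperfaces there is nothing to rescale, but then `Y` has no boundary and
    -- both products are empty.
    have hY : hyperfaces m Y = ∅ := by
      rw [eq_empty_iff_forall_notMem]
      intro F hF
      obtain ⟨q, hq⟩ := exists_mem_hyperface hF
      have := (hMY.boundary_eq q).1 ((mem_boundary_iff q).2 ⟨F, hF, hq⟩)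
      simp [he] at this
    rw [he, hY, finprod_mem_empty, finprod_mem_empty]
  have hp₀ : Φ (consE t₀ y₀) ∈ N := h.coord.mapsTo_symm h.base_mem
  have hH₀ : H (Φ (consE t₀ y₀)) = consE t₀ y₀ := h.coord.right_inv h.base_mem
  have hq₀ : Φy y₀ ∈ Ny := h.coordY.mapsTo_symm h.baseY_mem
  have hHy₀ : Hy (Φy y₀) = y₀ := h.coordY.right_inv h.baseY_mem
  obtain ⟨δ₁, hδ₁, hδN, A, e, hes, hepos, hA0, -, heprod, hS, -, -⟩ :=
    exists_singular_coords h.coord hp₀ hV.subset_hyperfaces hb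
  obtain ⟨δ₂, hδ₂, hδN₂, A', e', hes', hepos', hA0', -, heprod', -, hnA', -⟩ :=
    exists_singular_coords h.coordY hq₀ subset_rfl hr
  rw [hH₀] at hδN hes hepos hA0 heprod hS
  rw [hHy₀] at hδN₂ hes' hepos' hA0' heprod' hnA'
  have hc₀ : consE t₀ y₀ ∈ quad (m + 1) := consE_mem_quad h.nonneg h.mem_quad
  have hA' : ∀ i, i ∈ A' ↔ y₀ i = 0 := fun i => ⟨hA0' i, fun hi => by
    by_contra hn
    obtain ⟨G, hG, hG', -⟩ := hnA' i hi hn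
    exact hG' hG⟩
  have hface : ∀ k, consE t₀ y₀ k = 0 → ∃ v ∈ quad (m + 1) ∩ Metric.ball (consE t₀ y₀) δ₁,
      v k = 0 ∧ ∀ j, j ≠ k → 0 < v j := fun k hk => by
    obtain ⟨s, hs, hsk, hsj⟩ := (eventually_face_mem hc₀ hk (Metric.ball_mem_nhds _ hδ₁)).exists
    exact ⟨_, hs, hsk, hsj⟩
  have hsing : ∀ v ∈ quad (m + 1) ∩ Metric.ball (consE t₀ y₀) δ₁,
      (∃ k ∈ A, v k = 0) ↔ ∃ i : Fin m, v i.succ = 0 := fun v hv => by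
    rw [← hS v hv, h.singular _ (h.coord.mapsTo_symm (hδN hv)), h.coord.right_inv (hδN hv)]
  -- Both index sets are read off from points on exactly one face, where the coordinate responsible
  -- for singularity is unique.
  have hAA' : A = A'.map (Fin.succEmb m) := by
    ext k
    rw [Finset.mem_map]
    constructor
    · intro hk
      obtain ⟨v, hv, hvk, hvj⟩ := hface k (hA0 k hk)
      obtain ⟨i, hi⟩ := (hsing v hv).1 ⟨k, hk, hvk⟩
      have hik : i.succ = k := by
        by_contra hne
        exact (hvj _ hne).ne' hi
      refine ⟨i, (hA' i).2 ?_, hik⟩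
      have := hA0 k hk
      rwa [← hik] at this
    · rintro ⟨i, hi, rfl⟩
      obtain ⟨v, hv, hvk, hvj⟩ := hface i.succ ((hA' i).1 hi)
      obtain ⟨k, hk, hvk'⟩ := (hsing v hv).2 ⟨i, hvk⟩
      have hik : k = i.succ := by
        by_contra hne
        exact (hvj _ hne).ne' hvk'
      change i.succ ∈ A
      rwa [← hik]
  -- the box on which both product formulas hold
  obtain ⟨ε, hε, hbε⟩ := exists_box_subset (Metric.ball_mem_nhds (consE t₀ y₀) hδ₁)
  have hρ : 0 < min (min ε δ₂) δ := lt_min (lt_min hε hδ₂) h.pos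
  set ρ := min (min ε δ₂) δ with hρdef
  have hbox₁ : ∀ v ∈ quad (m + 1) ∩ box t₀ y₀ ρ, v ∈ quad (m + 1) ∩ Metric.ball (consE t₀ y₀) δ₁ :=
    fun v hv => ⟨hv.1, hbε (box_mono ((min_le_left _ _).trans (min_le_left _ _)) hv.2)⟩
  have hbox₂ : ∀ v ∈ quad (m + 1) ∩ box t₀ y₀ ρ, tailE m v ∈ quad m ∩ Metric.ball y₀ δ₂ :=
    fun v hv => ⟨tailE_mem_quad hv.1,
      Metric.ball_subset_ball ((min_le_left _ _).trans (min_le_right _ _)) hv.2.2⟩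
  have h' := h.mono hρ (min_le_right _ _)
  have hg : ContDiffOn ℝ ∞ (fun v => Real.log (e' (tailE m v) / e v)) (quad (m + 1) ∩ box t₀ y₀ ρ) := by
    refine ContDiffOn.log (ContDiffOn.div (hes'.comp (tailE m).contDiff.contDiffOn hbox₂)
      (hes.mono hbox₁) fun v hv => (hepos v (hbox₁ v hv)).ne') fun v hv =>
      (div_pos (hepos' _ (hbox₂ v hv)) (hepos v (hbox₁ v hv))).ne'
  have hgM : ContMDiffOn (Q (m + 1)) 𝓘(ℝ, ℝ) ∞
      (fun p => Real.log (e' (tailE m (H p)) / e (H p))) (N ∩ H ⁻¹' box t₀ y₀ ρ) :=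
    h.coord.contMDiffOn_of_comp hg inter_subset_left fun p hp => ⟨h.coord.mem_quad hp.1, hp.2⟩
  have hp₀' : Φ (consE t₀ y₀) ∈ N ∩ H ⁻¹' box t₀ y₀ ρ := h'.coord.mapsTo_symm h'.base_mem
  obtain ⟨θ, hθs, hθ1, -⟩ := exists_bump (n := m + 1) h'.coord.isOpen hp₀'
  -- Cutting off the logarithm keeps the extension positive: it is `e' / e` where `θ = 1` and `1`
  -- outside the support of `θ`.
  let a : Fn (m + 1) M := ⟨fun p => Real.exp (θ p • Real.log (e' (tailE m (H p)) / e (H p))),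
    Real.contDiff_exp.contMDiff.comp
      (contMDiff_smul_of_tsupport h'.coord.isOpen θ.contMDiff hθs hgM)⟩
  obtain ⟨R, hR, hRprod⟩ := exists_scaled_bdf hV.subset_hyperfaces hne hb (a := a)
    fun p => Real.exp_pos _
  obtain ⟨δ', hδ', hδ'ρ, hsub⟩ := h'.exists_subset hθ1
  refine ⟨δ', hδ', hδ'ρ.trans (min_le_right _ _), R, hR, fun p hp => ?_⟩
  have hpρ : p ∈ N ∩ H ⁻¹' box t₀ y₀ ρ := ⟨hp.1, box_mono hδ'ρ hp.2⟩
  have hθp : θ p = 1 := hsub ⟨hpρ, hp.2⟩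
  have hv : H p ∈ quad (m + 1) ∩ box t₀ y₀ ρ := ⟨h.coord.mem_quad hp.1, hpρ.2⟩
  have hap : a p = e' (tailE m (H p)) / e (H p) := by
    change Real.exp (θ p • Real.log _) = _
    rw [hθp, one_smul, Real.exp_log (div_pos (hepos' _ (hbox₂ _ hv)) (hepos _ (hbox₁ _ hv)))]
  have h1 := heprod (H p) (hbox₁ _ hv)
  rw [h.coord.left_inv p hp.1] at h1
  rw [hRprod, h1, heprod' _ (hbox₂ _ hv), hap, hAA', Finset.prod_map, ← mul_assoc,
    div_mul_cancel₀ _ (hepos _ (hbox₁ _ hv)).ne']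
  rfl

end

/-! ### Adapted frames -/

section

variable {n : ℕ} {M : Type*} [TopologicalSpace M] [ChartedSpace (EuclideanQuadrant n) M]
  [IsManifold (Q n) ∞ M]

theorem diff_smul_apply {F : Type*} [NormedAddCommGroup F] [NormedSpace ℝ F] (f : M → F) (p : M)
    (c : ℝ) (v : TangentSpace (Q n) p) : diff f p (c • v) = c • diff f p v :=
  map_smul (diff f p) c v

end

section

variable {m : ℕ} {M : Type*} [TopologicalSpace M] [ChartedSpace (EuclideanQuadrant (m + 1)) M]
  [IsManifold (Q (m + 1)) ∞ M] {V : Submodule (Fn (m + 1) M) (VF (m + 1) M)}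

/-- A member of `V` with a nonvanishing coefficient can be exchanged for a frame field. -/
theorem IsFrameOn.exchange {N : Set M} {Z : Fin (m + 1) → VF (m + 1) M} (hZ : IsFrameOn V N Z)
    {X : VF (m + 1) M} (hX : X ∈ V) {f : Fin (m + 1) → M → ℝ}
    (hf : ∀ i, ContMDiffOn (Q (m + 1)) 𝓘(ℝ, ℝ) ∞ (f i) N)
    (hXf : ∀ p ∈ N, X p = ∑ i, f i p • Z i p) {b : Fin (m + 1)} (hb : ∀ p ∈ N, f b p ≠ 0) :
    IsFrameOn V N (Fin.cons X fun i => Z (b.succAbove i) : Fin (m + 1) → VF (m + 1) M) := by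
  refine ⟨fun i => ?_, fun T hT => ?_⟩
  · refine Fin.cases ?_ (fun i => ?_) i
    · exact hX
    · exact hZ.1 _
  · obtain ⟨g, hg, hTg⟩ := hZ.2 T hT
    refine ⟨Fin.cons (fun p => g b p / f b p) fun i p =>
      g (b.succAbove i) p - g b p / f b p * f (b.succAbove i) p, fun i => ?_, fun p hp => ?_⟩
    · have hq : ContMDiffOn (Q (m + 1)) 𝓘(ℝ, ℝ) ∞ (fun p => g b p / f b p) N :=
        (hg b).div₀ (hf b) hb
      refine Fin.cases hq (fun i => ?_) i
      exact (hg _).sub (hq.mul (hf _))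
    · rw [hTg p hp, Fin.sum_univ_succAbove (fun i => g i p • Z i p) b, Fin.sum_univ_succ]
      simp only [Fin.cons_zero, Fin.cons_succ]
      rw [hXf p hp, Fin.sum_univ_succAbove (fun i => f i p • Z i p) b, smul_add, smul_smul,
        div_mul_cancel₀ _ (hb p hp), Finset.smul_sum, add_assoc, ← Finset.sum_add_distrib]
      congr 1
      refine Finset.sum_congr rfl fun i _ => ?_
      rw [smul_smul, ← add_smul]
      congr 1
      ring

variable {Y : Type*} [TopologicalSpace Y] [ChartedSpace (EuclideanQuadrant m) Y]
  [IsManifold (Q m) ∞ Y] [T2Space M] [CompactSpace M]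
  {ι : Y → M} {𝓕 : Set (Set M)}
  {W : Submodule (Fn m Y) (VF m Y)} {X : VF (m + 1) M} {N : Set M} {H : M → E (m + 1)}
  {Φ : E (m + 1) → M} {Ny : Set Y} {Hy : Y → E m} {Φy : E m → Y} {t₀ : ℝ} {y₀ : E m} {δ : ℝ}

/-- `X` does not vanish, so some coefficient in a given frame is nonzero and `X` can replace that
frame field. Subtracting multiples of `X` then makes the other fields tangent to the level sets of
`t`. -/
theorem IsAdapted.exists_frame (h : IsAdapted ι 𝓕 X N H Φ Ny Hy Φy t₀ y₀ δ)
    (hV : IsLieStructure 𝓕 V) (hX : X ∈ V) : ∃ δ' > 0, δ' ≤ δ ∧ ∃ Z : Fin (m + 1) → VF (m + 1) M,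
      Z 0 = X ∧ IsFrameOn V (N ∩ H ⁻¹' box t₀ y₀ δ') Z ∧
      ∀ p ∈ N ∩ H ⁻¹' box t₀ y₀ δ', ∀ i : Fin m, diff H p (Z i.succ p) 0 = 0 := by
  have hp₀ : Φ (consE t₀ y₀) ∈ N := h.coord.mapsTo_symm h.base_mem
  obtain ⟨U, hU, hpU, T, hT⟩ := hV.exists_frame (Φ (consE t₀ y₀))
  obtain ⟨f, hf, hXf⟩ := hT.2 X hX
  obtain ⟨b, hb⟩ : ∃ b, f b (Φ (consE t₀ y₀)) ≠ 0 := by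
    by_contra hcon
    push Not at hcon
    have h1 := h.field _ hp₀
    have h2 : X (Φ (consE t₀ y₀)) = 0 := by
      rw [hXf _ hpU]
      exact Finset.sum_eq_zero fun i _ => by rw [hcon i, zero_smul]
    rw [h2] at h1
    have h3 : (0 : E (m + 1)) = EuclideanSpace.single 0 1 := (map_zero (diff H _)).symm.trans h1
    have h4 := congrArg (fun v : E (m + 1) => v 0) h3
    simp at h4
  have hO : {p | p ∈ U ∧ f b p ≠ 0} ∈ 𝓝 (Φ (consE t₀ y₀)) :=
    inter_mem (hU.mem_nhds hpU) (((hf b).continuousOn.continuousAt (hU.mem_nhds hpU)).eventually_ne hb)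
  obtain ⟨δ₁, hδ₁, hδ₁δ, hsub⟩ := h.exists_subset hO
  have h₁ := h.mono hδ₁ hδ₁δ
  set N₁ := N ∩ H ⁻¹' box t₀ y₀ δ₁ with hN₁
  have hsubU : N₁ ⊆ U := fun p hp => (hsub hp).1
  have hZ' := (hT.mono hsubU).exchange hX (fun i => (hf i).mono hsubU) (fun p hp => hXf p (hsubU hp))
    fun p hp => (hsub hp).2
  set Z' : Fin (m + 1) → VF (m + 1) M := Fin.cons X fun i => T (b.succAbove i) with hZ'def
  have hg : ∀ i : Fin m, ContMDiffOn (Q (m + 1)) 𝓘(ℝ, ℝ) ∞ (fun p => diff H p (Z' i.succ p) 0) N₁ :=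
    fun i => contMDiffOn_frameMatrix h₁.coord Z' i.succ 0
  obtain ⟨θ, hθs, hθ1, -⟩ := exists_bump (n := m + 1) h₁.coord.isOpen
    (h₁.coord.mapsTo_symm h₁.base_mem)
  let g : Fin m → Fn (m + 1) M := fun i => ⟨fun p => θ p • diff H p (Z' i.succ p) 0,
    contMDiff_smul_of_tsupport h₁.coord.isOpen θ.contMDiff hθs (hg i)⟩
  obtain ⟨δ₂, hδ₂, hδ₂δ₁, hsub₂⟩ := h₁.exists_subset hθ1
  have hN₂ : N ∩ H ⁻¹' box t₀ y₀ δ₂ ⊆ N₁ := fun p hp => ⟨hp.1, box_mono hδ₂δ₁ hp.2⟩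
  have hθ2 : ∀ p ∈ N ∩ H ⁻¹' box t₀ y₀ δ₂, θ p = 1 := fun p hp => hsub₂ ⟨hN₂ hp, hp.2⟩
  -- The `t`-components are smooth only locally; the cutoff `θ` makes the correction global, and
  -- where `θ = 1` it removes the component exactly.
  let Z : Fin (m + 1) → VF (m + 1) M := Fin.cons X fun i => θ • Z' i.succ - g i • X
  have hZs : ∀ p ∈ N ∩ H ⁻¹' box t₀ y₀ δ₂, ∀ i : Fin m,
      Z i.succ p = Z' i.succ p - diff H p (Z' i.succ p) 0 • X p := by
    intro p hp i
    have h1 : Z i.succ p = θ p • Z' i.succ p - (θ p • diff H p (Z' i.succ p) 0) • X p := rfl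
    rw [h1, hθ2 p hp, one_smul, one_smul]
  refine ⟨δ₂, hδ₂, hδ₂δ₁.trans hδ₁δ, Z, rfl, ⟨fun i => ?_, fun S hS => ?_⟩, fun p hp i => ?_⟩
  · refine Fin.cases hX (fun i => ?_) i
    exact V.sub_mem (V.smul_mem _ (hZ'.1 i.succ)) (V.smul_mem _ hX)
  · obtain ⟨c, hc, hSc⟩ := hZ'.2 S hS
    -- The multiples of `X` subtracted from the other fields are returned to the coefficient of `X`.
    refine ⟨Fin.cons (fun p => c 0 p + ∑ i : Fin m, c i.succ p * diff H p (Z' i.succ p) 0)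
      fun i => c i.succ, fun i => ?_, fun p hp => ?_⟩
    · refine Fin.cases ?_ (fun i => (hc i.succ).mono hN₂) i
      refine ContMDiffOn.mono ?_ hN₂
      exact (hc 0).add (contMDiffOn_finsetSum fun i _ => (hc i.succ).mul (hg i))
    · rw [hSc p (hN₂ hp), Fin.sum_univ_succ, Fin.sum_univ_succ]
      simp only [Fin.cons_zero, Fin.cons_succ, hZs p hp]
      have h1 : Z' 0 = X := rfl
      have h2 : Z 0 = X := rfl
      rw [h1, h2, add_smul, Finset.sum_smul, add_assoc, ← Finset.sum_add_distrib]
      congr 1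
      refine Finset.sum_congr rfl fun i _ => ?_
      rw [smul_sub, smul_smul]
      abel
  · have h1 : diff H p (Z i.succ p) = diff H p (Z' i.succ p) -
        diff H p (Z' i.succ p) 0 • (EuclideanSpace.single 0 1 : E (m + 1)) := by
      rw [hZs p hp i, ← h.field p hp.1]
      exact (map_sub (diff H p) _ _).trans (congrArg _ (map_smul (diff H p) _ _))
    have h2 := congrArg (fun v : E (m + 1) => v 0) h1
    rw [show diff H p (Z i.succ p) 0 = _ from h2]
    simp

theorem IsAdapted.diff_diffMap (h : IsAdapted ι 𝓕 X N H Φ Ny Hy Φy t₀ y₀ δ) {y : Y} (hy : y ∈ Ny)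
    (hι : MDifferentiableAt (Q m) (Q (m + 1)) ι y) (w : E m) :
    diff H (ι y) (diffMap ι y w) = inclE m (diff Hy y w) := by
  obtain ⟨hιN, -⟩ := h.hypersurface y hy
  have hH := (h.coord.hasMFDerivAt hιN).mdifferentiableAt
  rw [← diff_comp_apply hH hι, h.coordY.diff_eq hy (hH.comp y hι)]
  have h1 : (H ∘ ι) ∘ Φy =ᶠ[𝓝[quad m] (Hy y)] fun v => consE t₀ v := by
    filter_upwards [h.coordY.image_mem_nhdsWithin hy] with v hv
    have := (h.hypersurface _ (h.coordY.mapsTo_symm hv)).2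
    rwa [h.coordY.right_inv hv] at this
  have h2 : (fun v : E m => consE t₀ v) =
      fun v => t₀ • (EuclideanSpace.single 0 1 : E (m + 1)) + inclE m v := by
    ext1 v; exact consE_eq_add t₀ v
  rw [h1.fderivWithin_eq (h1.self_of_nhdsWithin (h.coordY.mem_quad hy)), h2,
    fderivWithin_const_add, (inclE m).fderivWithin (uniqueDiffOn_quad m _ (h.coordY.mem_quad hy))]

variable [CompactSpace Y] [T2Space Y]

/-- The fields `Z i.succ` are tangent to `Y`, so after a cutoff they restrict to members of `W`. A
member of `W` is the restriction of some `∑ f_i Z_i`, and forgetting the `t`-component removes the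
term with `X`. -/
theorem IsAdapted.exists_frame_hypersurface (h : IsAdapted ι 𝓕 X N H Φ Ny Hy Φy t₀ y₀ δ)
    (hMY : IsLieManifoldWithBoundary 𝓕 V ι W) {Z : Fin (m + 1) → VF (m + 1) M} (hZ0 : Z 0 = X)
    (hZ : IsFrameOn V N Z) (hZs : ∀ p ∈ N, ∀ i : Fin m, diff H p (Z i.succ p) 0 = 0) :
    ∃ δ' > 0, δ' ≤ δ ∧ ∃ w : Fin m → VF m Y, IsFrameOn W (Ny ∩ Hy ⁻¹' Metric.ball y₀ δ') w ∧
      ∀ y ∈ Ny ∩ Hy ⁻¹' Metric.ball y₀ δ', ∀ i,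
        diff Hy y (w i y) = tailE m (diff H (ι y) (Z i.succ (ι y))) := by
  have hιm : ∀ y, MDifferentiableAt (Q m) (Q (m + 1)) ι y := fun y =>
    hMY.contMDiff.mdifferentiable (by simp) y
  have hcont := hMY.contMDiff.continuous
  have hq₀ : Φy y₀ ∈ Ny := h.coordY.mapsTo_symm h.baseY_mem
  -- a cutoff on `M` whose restriction to `Y` is supported in `Ny`
  obtain ⟨P, hP, hPo, hpP⟩ := eventually_nhds_iff.1 (eventually_preimage_mem hcont hMY.injective
    (h.coordY.isOpen.mem_nhds hq₀))
  obtain ⟨θ, hθs, hθ1, -⟩ := exists_bump (n := m + 1) hPo hpP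
  have hKN : ι ⁻¹' tsupport θ ⊆ Ny := fun y hy => hP _ (hθs hy) y rfl
  have hmaps : MapsTo ι Ny N := fun y hy => (h.hypersurface y hy).1
  have hθι : ContMDiff (Q m) 𝓘(ℝ, ℝ) ∞ fun y => θ (ι y) := θ.contMDiff.comp hMY.contMDiff
  have hw : ∀ i : Fin m, ∃ w : VF m Y, (∀ y ∈ Ny, diff Hy y (w y) =
      θ (ι y) • tailE m (diff H (ι y) (Z i.succ (ι y)))) ∧ ∀ y, y ∉ ι ⁻¹' tsupport θ → w y = 0 := by
    intro i
    refine exists_vectorField h.coordY (a := fun y => θ (ι y) •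
      tailE m (diff H (ι y) (Z i.succ (ι y)))) ?_ ((isClosed_tsupport θ).preimage hcont) hKN ?_
    · have h1 : ContMDiffOn (Q (m + 1)) 𝓘(ℝ, E (m + 1)) ∞ (fun p => diff H p (Z i.succ p)) N :=
        contMDiffOn_diff_apply h.coord.isOpen h.coord.contMDiffOn _
      have h2 : ContMDiffOn (Q m) 𝓘(ℝ, E (m + 1)) ∞
          (fun y => diff H (ι y) (Z i.succ (ι y))) Ny :=
        h1.comp hMY.contMDiff.contMDiffOn hmaps
      exact hθι.contMDiffOn.smul ((tailE m).contDiff.contMDiff.comp_contMDiffOn h2)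
    · intro y hy
      rw [image_eq_zero_of_notMem_tsupport hy, zero_smul]
  choose w hw hw0 using hw
  have hιw : ∀ i y, diffMap ι y (w i y) = (θ • Z i.succ) (ι y) := by
    intro i y
    have h1 : (θ • Z i.succ) (ι y) = θ (ι y) • Z i.succ (ι y) := rfl
    by_cases hy : y ∈ Ny
    · apply eq_of_diff_eq h.coord (hmaps hy)
      refine (h.diff_diffMap hy (hιm y) _).trans ?_
      have h2 : diff H (ι y) ((θ • Z i.succ) (ι y)) = θ (ι y) • diff H (ι y) (Z i.succ (ι y)) :=
        diff_smul_apply H (ι y) _ _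
      refine Eq.trans ?_ h2.symm
      rw [show diff Hy y (w i y) = _ from hw i y hy, map_smul]
      congr 1
      have h3 := consE_eq_add (diff H (ι y) (Z i.succ (ι y)) 0)
        (tailE m (diff H (ι y) (Z i.succ (ι y))))
      rw [consE_tailE, hZs _ (hmaps hy), zero_smul, zero_add] at h3
      exact h3.symm
    · have hyK : y ∉ ι ⁻¹' tsupport θ := fun hyK => hy (hKN hyK)
      have h2 : θ (ι y) = 0 := image_eq_zero_of_notMem_tsupport hyK
      rw [h1, h2, zero_smul, hw0 i y hyK]
      exact map_zero (diffMap ι y)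
  obtain ⟨δ', hδ', hδ'δ, hsub⟩ := h.exists_subsetY (O := {y | θ (ι y) = 1})
    ((hcont.tendsto _).eventually hθ1)
  have hNy' : Ny ∩ Hy ⁻¹' Metric.ball y₀ δ' ⊆ Ny := inter_subset_left
  refine ⟨δ', hδ', hδ'δ, w, ⟨fun i => ?_, fun u hu => ?_⟩, fun y hy i => ?_⟩
  · exact (hMY.mem_iff (w i)).2 ⟨θ • Z i.succ, V.smul_mem _ (hZ.1 _), hιw i⟩
  · obtain ⟨v, hv, huv⟩ := (hMY.mem_iff u).1 hu
    obtain ⟨f, hf, hvf⟩ := hZ.2 v hv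
    refine ⟨fun i y => f i.succ (ι y), fun i => ?_, fun y hy => ?_⟩
    · exact ((hf i.succ).comp hMY.contMDiff.contMDiffOn hmaps).mono hNy'
    · have hyN := hmaps (hNy' hy)
      have h1 : diff H (ι y) (v (ι y)) = inclE m (diff Hy y (u y)) :=
        (congrArg (diff H (ι y)) (huv y)).symm.trans (h.diff_diffMap (hNy' hy) (hιm y) _)
      have h2 : diff H (ι y) (v (ι y)) = ∑ i, f i (ι y) • diff H (ι y) (Z i (ι y)) := by
        rw [hvf _ hyN]
        exact diff_sum_smul (n := m + 1) H (ι y) _ _ _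
      rw [Fin.sum_univ_succ, hZ0, h.field _ hyN] at h2
      apply eq_of_diff_eq h.coordY (hNy' hy)
      have h3 : diff Hy y (∑ i, f i.succ (ι y) • w i y) =
          ∑ i, f i.succ (ι y) • diff Hy y (w i y) := diff_sum_smul (n := m) Hy y _ _ _
      refine Eq.trans ?_ h3.symm
      have h4 : ∀ i, diff Hy y (w i y) = tailE m (diff H (ι y) (Z i.succ (ι y))) := fun i => by
        rw [hw i y (hNy' hy), hsub hy, one_smul]
      have h5 : diff Hy y (u y) = tailE m (diff H (ι y) (v (ι y))) := by
        rw [h1]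
        exact (tailE_consE 0 _).symm
      rw [h5, h2, map_add, map_smul, map_sum]
      have h6 : tailE m (EuclideanSpace.single 0 1) = 0 := by ext i; simp
      rw [h6, smul_zero, zero_add]
      refine Finset.sum_congr rfl fun i _ => ?_
      rw [h4 i, map_smul]
  · rw [hw i y (hNy' hy), hsub hy, one_smul]

end

/-! ### Determinants of adapted frames -/

theorem eq_mul_exp_integral {y k : ℝ → ℝ} (hk : ContinuousOn k (Icc 0 1))
    (hy : ∀ s ∈ Icc (0 : ℝ) 1, HasDerivWithinAt y (k s * y s) (Icc 0 1) s) :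
    y 1 = y 0 * Real.exp (∫ s in (0 : ℝ)..1, k s) := by
  let k' : ℝ → ℝ := IccExtend (zero_le_one' ℝ) ((Icc (0 : ℝ) 1).domRestrict k)
  have hk' : Continuous k' := (continuousOn_iff_continuous_domRestrict.1 hk).Icc_extend'
  have hkk : ∀ s ∈ Icc (0 : ℝ) 1, k' s = k s := fun s hs => IccExtend_of_mem _ _ hs
  have hint : ∀ s, HasDerivAt (fun s => ∫ σ in (0 : ℝ)..s, k' σ) (k' s) s := fun s =>
    (hk'.integral_hasStrictDerivAt 0 s).hasDerivAt
  let z : ℝ → ℝ := fun s => y s * Real.exp (-∫ σ in (0 : ℝ)..s, k' σ)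
  have hz : ∀ s ∈ Icc (0 : ℝ) 1, HasDerivWithinAt z 0 (Icc 0 1) s := by
    intro s hs
    have h1 := (hy s hs).mul ((hint s).neg.exp.hasDerivWithinAt (s := Icc 0 1))
    refine h1.congr_deriv ?_
    rw [hkk s hs]
    simp only [Pi.neg_apply]
    change _ = (0 : ℝ)
    ring
  have h1 := constant_of_has_deriv_right_zero (f := z) (a := 0) (b := 1)
    (fun s hs => (hz s hs).continuousWithinAt) (fun s hs =>
      (hz s (Ico_subset_Icc_self hs)).mono_of_mem_nhdsWithin (Icc_mem_nhdsGE_of_mem hs)) 1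
      (right_mem_Icc.2 zero_le_one)
  have h2 : z 0 = y 0 := by simp [z]
  have h3 : ∫ s in (0 : ℝ)..1, k' s = ∫ s in (0 : ℝ)..1, k s :=
    intervalIntegral.integral_congr fun s hs => hkk s (by rwa [uIcc_of_le zero_le_one] at hs)
  rw [← h2, ← h1]
  simp only [z]
  rw [h3, mul_assoc, ← Real.exp_add, neg_add_cancel, Real.exp_zero, mul_one]

section

variable {m : ℕ} {M : Type*} [TopologicalSpace M] [ChartedSpace (EuclideanQuadrant (m + 1)) M]
  [IsManifold (Q (m + 1)) ∞ M] {V : Submodule (Fn (m + 1) M) (VF (m + 1) M)}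
  {Y : Type*} [TopologicalSpace Y] [ChartedSpace (EuclideanQuadrant m) Y]
  [IsManifold (Q m) ∞ Y] {ι : Y → M} {𝓕 : Set (Set M)}
  {W : Submodule (Fn m Y) (VF m Y)} {X : VF (m + 1) M} {N : Set M} {H : M → E (m + 1)}
  {Φ : E (m + 1) → M} {Ny : Set Y} {Hy : Y → E m} {Φy : E m → Y} {t₀ : ℝ} {y₀ : E m} {δ : ℝ}

/-- In these coordinates `X` is the constant field `e_0`, so the bracket with `X` is the derivative
of the components in that direction. -/
theorem IsAdapted.fderivWithin_frame (h : IsAdapted ι 𝓕 X N H Φ Ny Hy Φy t₀ y₀ δ)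
    (T : VF (m + 1) M) {v : E (m + 1)} (hv : v ∈ H '' N) :
    fderivWithin ℝ (fun v => diff H (Φ v) (T (Φ v))) (quad (m + 1)) v (EuclideanSpace.single 0 1) =
      diff H (Φ v) (VectorField.mlieBracket (Q (m + 1)) X T (Φ v)) := by
  have hΦ := h.coord.mapsTo_symm hv
  rw [h.coord.diff_mlieBracket X T hΦ, h.coord.right_inv hv, VectorField.lieBracketWithin]
  have h1 : (fun v => diff H (Φ v) (X (Φ v))) =ᶠ[𝓝[quad (m + 1)] v]
      fun _ => (EuclideanSpace.single 0 1 : E (m + 1)) := by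
    have h2 := h.coord.image_mem_nhdsWithin hΦ
    rw [h.coord.right_inv hv] at h2
    filter_upwards [h2] with w hw
    exact h.field _ (h.coord.mapsTo_symm hw)
  have h3 : fderivWithin ℝ (fun v => diff H (Φ v) (X (Φ v))) (quad (m + 1)) v = 0 := by
    rw [h1.fderivWithin_eq (h.field _ hΦ)]
    simp
  rw [h3, show diff H (Φ v) (X (Φ v)) = _ from h.field _ hΦ]
  simp

/-- Closure of `V` under brackets gives `[X, Z_i] = ∑ C_il Z_l` with `C` smooth up to the singular
set. Along the `t`-lines the frame matrix thus solves a linear equation, and Liouville's formula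
yields `u = ∫ tr C`, which is smooth as an average. The determinant itself may vanish on the
singular set; the factor `e^u` does not. -/
theorem IsAdapted.exists_log_det (h : IsAdapted ι 𝓕 X N H Φ Ny Hy Φy t₀ y₀ δ)
    (hV : IsLieStructure 𝓕 V) (hX : X ∈ V) {Z : Fin (m + 1) → VF (m + 1) M}
    (hZ : IsFrameOn V N Z) : ∃ u : M → ℝ, ContMDiffOn (Q (m + 1)) 𝓘(ℝ, ℝ) ∞ u N ∧
      ∀ p ∈ N, (frameMatrix H Z p).det =
        (frameMatrix H Z (Φ (consE t₀ (tailE m (H p))))).det * Real.exp (u p) := by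
  have hB : ∀ i, ∃ C : Fin (m + 1) → M → ℝ,
      (∀ l, ContMDiffOn (Q (m + 1)) 𝓘(ℝ, ℝ) ∞ (C l) N) ∧
      ∀ p ∈ N, VectorField.mlieBracket (Q (m + 1)) X (Z i) p = ∑ l, C l p • Z l p := by
    intro i
    obtain ⟨B, hB, hBe⟩ := hV.bracket_mem X hX (Z i) (hZ.1 i)
    obtain ⟨C, hC, hBC⟩ := hZ.2 B hB
    exact ⟨C, hC, fun p hp => (hBe p).symm.trans (hBC p hp)⟩
  choose C hC hBC using hB
  let zh : Fin (m + 1) → E (m + 1) → E (m + 1) := fun i v => diff H (Φ v) (Z i (Φ v))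
  have hzh : ∀ i, ContDiffOn ℝ ∞ (zh i) (H '' N) := fun i =>
    h.coord.contMDiffOn_comp_symm subset_rfl
      (contMDiffOn_diff_apply h.coord.isOpen h.coord.contMDiffOn (Z i))
  have hzd : ∀ i, ∀ v ∈ H '' N, fderivWithin ℝ (zh i) (quad (m + 1)) v (EuclideanSpace.single 0 1) =
      ∑ l, C i l (Φ v) • zh l v := by
    intro i v hv
    rw [h.fderivWithin_frame (Z i) hv, hBC i _ (h.coord.mapsTo_symm hv)]
    exact diff_sum_smul (n := m + 1) H (Φ v) _ _ _
  let c : E (m + 1) → ℝ := fun v => ∑ i, C i i (Φ v)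
  have hc : ContDiffOn ℝ ∞ c (H '' N) := ContDiffOn.sum fun i _ =>
    h.coord.contMDiffOn_comp_symm subset_rfl (hC i i)
  let κ : E (m + 1) → E (m + 1) := fun v => consE t₀ (tailE m v)
  have hκ : ContDiff ℝ ∞ κ := contDiff_consE.comp (contDiff_const.prodMk (tailE m).contDiff)
  have hκU : MapsTo κ (H '' N) (H '' N) := fun v hv => h.cons_mem (h.tail_mem hv)
  have hconv : Convex ℝ (H '' N) := by
    rw [h.image]
    exact (convex_quad _).inter (convex_box _ _ _)
  have hint : (interior (H '' N)).Nonempty := by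
    rw [h.image]
    exact interior_quad_inter_nonempty (consE_mem_quad h.nonneg h.mem_quad) (isOpen_box _ _ _)
      (consE_mem_box h.pos (Metric.mem_ball_self h.pos))
  have havg := contDiffOn_average hconv hint hc hκ hκU
  have hu : ContDiffOn ℝ ∞ (fun v : E (m + 1) =>
      (v 0 - t₀) * ∫ s in (0 : ℝ)..1, c (κ v + s • (v - κ v))) (H '' N) := by
    refine ContDiffOn.mul (ContDiff.contDiffOn ?_) havg
    exact (EuclideanSpace.proj (𝕜 := ℝ) (0 : Fin (m + 1))).contDiff.sub contDiff_const
  refine ⟨fun p => (H p 0 - t₀) * ∫ s in (0 : ℝ)..1, c (κ (H p) + s • (H p - κ (H p))),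
    h.coord.contMDiffOn_of_comp hu subset_rfl (mapsTo_image _ _), fun p hp => ?_⟩
  have hv : H p ∈ H '' N := mem_image_of_mem H hp
  set v := H p with hvdef
  let γ : ℝ → E (m + 1) := fun s => κ v + s • (v - κ v)
  have hγ : ∀ s ∈ Icc (0 : ℝ) 1, γ s ∈ H '' N := fun s hs =>
    hconv.add_smul_sub_mem (hκU hv) hv hs
  have hvκ : v - κ v = (v 0 - t₀) • (EuclideanSpace.single 0 1 : E (m + 1)) := by
    ext i; refine Fin.cases ?_ (fun i => ?_) i <;> simp [κ]
  have hγd : ∀ s, HasDerivWithinAt γ (v - κ v) (Icc 0 1) s := fun s => by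
    have h1 := ((hasDerivWithinAt_id s (Icc 0 1)).smul_const (v - κ v)).const_add (κ v)
    rw [one_smul] at h1
    exact h1
  have had : ∀ s ∈ Icc (0 : ℝ) 1, ∀ i k, HasDerivWithinAt
      (fun s => frameMatrix H Z (Φ (γ s)) i k)
      ((((v 0 - t₀) • Matrix.of fun i l => C i l (Φ (γ s))) * frameMatrix H Z (Φ (γ s))) i k)
      (Icc 0 1) s := by
    intro s hs i k
    have hγs := hγ s hs
    have h1 : HasFDerivWithinAt (zh i) (fderivWithin ℝ (zh i) (quad (m + 1)) (γ s))
        (quad (m + 1)) (γ s) := by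
      have h2 : DifferentiableWithinAt ℝ (zh i) (H '' N) (γ s) :=
        (hzh i).differentiableOn (by simp) _ hγs
      have h3 := h.coord.image_mem_nhdsWithin (h.coord.mapsTo_symm hγs)
      rw [h.coord.right_inv hγs] at h3
      exact (h2.mono_of_mem_nhdsWithin h3).hasFDerivWithinAt
    have h4 := h1.comp_hasDerivWithinAt s (hγd s) fun s hs => h.coord.image_subset_quad (hγ s hs)
    rw [hvκ, map_smul, hzd i _ hγs] at h4
    have h5 := (EuclideanSpace.proj (𝕜 := ℝ) k).hasFDerivAt.comp_hasDerivWithinAt s h4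
    have h6 : (EuclideanSpace.proj (𝕜 := ℝ) k) ((v 0 - t₀) • ∑ l, C i l (Φ (γ s)) • zh l (γ s)) =
        (((v 0 - t₀) • Matrix.of fun i l => C i l (Φ (γ s))) * frameMatrix H Z (Φ (γ s))) i k := by
      rw [map_smul, map_sum, Matrix.smul_mul, Matrix.smul_apply, Matrix.mul_apply]
      rfl
    rw [← h6]
    exact h5
  have hdet := fun s hs => hasDerivWithinAt_det (had s hs)
  have hcont : ContinuousOn (fun s => (v 0 - t₀) * c (γ s)) (Icc 0 1) :=
    continuousOn_const.mul (hc.continuousOn.comp (fun s hs => (hγd s).continuousWithinAt) hγ)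
  have hfin := eq_mul_exp_integral (y := fun s => (frameMatrix H Z (Φ (γ s))).det) hcont
    fun s hs => by
      refine (hdet s hs).congr_deriv ?_
      simp [Matrix.trace, c, Finset.mul_sum]
  have hγ1 : γ 1 = v := by simp [γ]
  have hγ0 : γ 0 = κ v := by simp [γ]
  simp only [hγ1, hγ0] at hfin
  rw [intervalIntegral.integral_const_mul, hvdef, h.coord.left_inv p hp] at hfin
  exact hfin

/-- The first column of the larger matrix is `(1, 0, …, 0)`: only `Z 0 = X` has a `t`-component, and
it equals `1`. -/
theorem IsAdapted.det_frameMatrix (h : IsAdapted ι 𝓕 X N H Φ Ny Hy Φy t₀ y₀ δ)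
    {Z : Fin (m + 1) → VF (m + 1) M} (hZ0 : Z 0 = X)
    (hZs : ∀ p ∈ N, ∀ i : Fin m, diff H p (Z i.succ p) 0 = 0) {w : Fin m → VF m Y} {y : Y}
    (hy : y ∈ Ny) (hw : ∀ i, diff Hy y (w i y) = tailE m (diff H (ι y) (Z i.succ (ι y)))) :
    (frameMatrix H Z (ι y)).det = (frameMatrix Hy w y).det := by
  have hιN := (h.hypersurface y hy).1
  rw [Matrix.det_succ_column_zero, Fin.sum_univ_succ]
  have h0 : ∀ i : Fin m, frameMatrix H Z (ι y) i.succ 0 = 0 := fun i => hZs _ hιN i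
  have h1 : frameMatrix H Z (ι y) 0 0 = 1 := by
    have := congrArg (fun v : E (m + 1) => v 0) (h.field _ hιN)
    rw [← hZ0] at this
    exact this.trans (by simp)
  have h2 : (frameMatrix H Z (ι y)).submatrix (Fin.succAbove 0) Fin.succ = frameMatrix Hy w y := by
    ext i k
    exact (congrArg (fun v : E m => v k) (hw i)).symm
  simp only [h0, h1, h2, mul_zero, zero_mul, Finset.sum_const_zero, add_zero, Fin.val_zero, pow_zero,
    one_mul]

end

/-! ### Integration over boxes -/

/-- Splitting off the first coordinate. -/
def splitE (m : ℕ) : E (m + 1) ≃ₜ ℝ × E m where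
  toFun v := (v 0, tailE m v)
  invFun q := consE q.1 q.2
  left_inv v := consE_tailE v
  right_inv q := by simp
  continuous_toFun := by fun_prop
  continuous_invFun := contDiff_consE.continuous

theorem measurePreserving_splitE (m : ℕ) : MeasurePreserving (splitE m) := by
  have h1 : MeasurePreserving (@WithLp.ofLp 2 (Fin (m + 1) → ℝ)) :=
    PiLp.volume_preserving_ofLp (Fin (m + 1))
  have h2 := volume_preserving_piFinSuccAbove (fun _ : Fin (m + 1) => ℝ) 0
  have h3 : MeasurePreserving (@WithLp.toLp 2 (Fin m → ℝ)) := PiLp.volume_preserving_toLp (Fin m)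
  have h4 := ((MeasurePreserving.id (volume : Measure ℝ)).prod h3).comp (h2.comp h1)
  exact h4

/-- Fubini in the direction from the product to the factor. Since `g` has integral `1` it is nonzero
on a set of positive measure, so some slice of the product is a nonzero multiple of `G`, and `G` is
integrable. -/
theorem integrableOn_of_mul {m : ℕ} {I : Set ℝ} {B : Set (E m)} {g : ℝ → ℂ} {G : E m → ℂ}
    (hg : ∫ t in I, g t = 1)
    (h : IntegrableOn (fun v : E (m + 1) => g (v 0) * G (tailE m v))
      {v | v 0 ∈ I ∧ tailE m v ∈ B} volume) :
    IntegrableOn G B volume ∧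
      ∫ v in {v : E (m + 1) | v 0 ∈ I ∧ tailE m v ∈ B}, g (v 0) * G (tailE m v) = ∫ y in B, G y := by
  have hset : {v : E (m + 1) | v 0 ∈ I ∧ tailE m v ∈ B} = splitE m ⁻¹' (I ×ˢ B) := rfl
  have hemb := (splitE m).measurableEmbedding
  rw [hset] at h ⊢
  have h1 : IntegrableOn (fun q : ℝ × E m => g q.1 * G q.2) (I ×ˢ B) volume :=
    ((measurePreserving_splitE m).integrableOn_comp_preimage hemb).1 h
  have h2 : ∫ v in splitE m ⁻¹' (I ×ˢ B), g (v 0) * G (tailE m v) =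
      ∫ q in I ×ˢ B, g q.1 * G q.2 :=
    (measurePreserving_splitE m).setIntegral_preimage_emb hemb (fun q => g q.1 * G q.2) _
  have h3 : IntegrableOn (fun q : ℝ × E m => g q.1 * G q.2) (I ×ˢ B)
    ((volume : Measure ℝ).prod volume) := h1
  rw [IntegrableOn, ← Measure.prod_restrict] at h3
  refine ⟨?_, ?_⟩
  · by_contra hG
    have h4 : ∀ᵐ t ∂(volume.restrict I), g t = 0 := by
      filter_upwards [h3.prod_right_ae] with t ht
      by_contra hne
      refine hG ?_
      have h5 := ht.const_mul (g t)⁻¹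
      refine h5.congr (Eventually.of_forall fun y => ?_)
      change (g t)⁻¹ * (g t * G y) = G y
      rw [← mul_assoc, inv_mul_cancel₀ hne, one_mul]
    rw [integral_congr_ae h4] at hg
    simp at hg
  · rw [h2]
    have h6 := setIntegral_prod_mul (μ := (volume : Measure ℝ)) (ν := (volume : Measure (E m))) g G I B
    rw [hg, one_mul] at h6
    exact h6

/-! ### Extension of densities from a hypersurface -/

section

variable {m : ℕ} {M : Type*} [TopologicalSpace M] [ChartedSpace (EuclideanQuadrant (m + 1)) M]
  {Y : Type*} [TopologicalSpace Y] [ChartedSpace (EuclideanQuadrant m) Y]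

open Classical in
/-- The density `ψ(t) χ(y) |dt| f` in adapted coordinates `(t, y)`. -/
def extendDensity (N : Set M) (H : M → E (m + 1)) (Φy : E m → Y) (ψ : ℝ → ℝ) (χ : Y → ℝ)
    (f : (y : Y) → (Fin m → TangentSpace (Q m) y) → ℂ) :
    (p : M) → (Fin (m + 1) → TangentSpace (Q (m + 1)) p) → ℂ := fun p v =>
  if p ∈ N then ((|(Matrix.of fun i k => diff H p (v i) k).det| : ℝ) : ℂ) *
    (((ψ (H p 0) * χ (Φy (tailE m (H p))) : ℝ) : ℂ) * coordCoeff Φy f (tailE m (H p))) else 0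

variable {N : Set M} {H : M → E (m + 1)} {Φy : E m → Y} {ψ : ℝ → ℝ} {χ : Y → ℝ}
  {f : (y : Y) → (Fin m → TangentSpace (Q m) y) → ℂ}

theorem extendDensity_of_notMem {p : M} (hp : p ∉ N) (v : Fin (m + 1) → TangentSpace (Q (m + 1)) p) :
    extendDensity N H Φy ψ χ f p v = 0 := if_neg hp

theorem extendDensity_of_mem {p : M} (hp : p ∈ N) (v : Fin (m + 1) → TangentSpace (Q (m + 1)) p) :
    extendDensity N H Φy ψ χ f p v = ((|(Matrix.of fun i k => diff H p (v i) k).det| : ℝ) : ℂ) *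
    (((ψ (H p 0) * χ (Φy (tailE m (H p))) : ℝ) : ℂ) * coordCoeff Φy f (tailE m (H p))) := if_pos hp

theorem det_apply_eq {n : ℕ} (T : E n →ₗ[ℝ] E n) (v : Fin n → E n) :
    (Matrix.of fun i k => T (v i) k).det =
      LinearMap.det T * (Matrix.of fun i k => v i k).det := by
  let b := (EuclideanSpace.basisFun (Fin n) ℝ).toBasis
  have h1 : ∀ w : Fin n → E n, b.det w = (Matrix.of fun i k => w i k).det := by
    intro w
    rw [Module.Basis.det_apply, ← Matrix.det_transpose]
    congr 1
  rw [← h1, ← h1, ← Module.Basis.det_comp]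
  rfl

theorem isDensity_extendDensity [IsManifold (Q (m + 1)) ∞ M] {Φ : E (m + 1) → M} (h : IsCoord N H Φ) :
    IsDensity (extendDensity N H Φy ψ χ f) := by
  intro p L v
  by_cases hp : p ∈ N
  · have e1 := extendDensity_of_mem (H := H) (Φy := Φy) (ψ := ψ) (χ := χ) (f := f) hp
      (fun i => L (v i))
    have e2 := extendDensity_of_mem (H := H) (Φy := Φy) (ψ := ψ) (χ := χ) (f := f) hp v
    refine e1.trans (Eq.trans ?_ (congrArg _ e2.symm))
    let T : E (m + 1) →L[ℝ] E (m + 1) := diff H p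
    have h1 := det_apply_eq ((T : E (m + 1) →ₗ[ℝ] E (m + 1)).comp L) v
    have h2 := det_apply_eq (T : E (m + 1) →ₗ[ℝ] E (m + 1)) v
    have h3 : (Matrix.of fun i k => diff H p (L (v i)) k).det =
        LinearMap.det L * (Matrix.of fun i k => diff H p (v i) k).det := by
      refine h1.trans ?_
      rw [LinearMap.det_comp, mul_comm (LinearMap.det _) (LinearMap.det L), mul_assoc]
      exact congrArg _ h2.symm
    have h4 : |(Matrix.of fun i k => diff H p (L (v i)) k).det| =
        |LinearMap.det L| * |(Matrix.of fun i k => diff H p (v i) k).det| := by rw [h3, abs_mul]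
    generalize ((ψ (H p 0) * χ (Φy (tailE m (H p))) : ℝ) : ℂ) * coordCoeff Φy f (tailE m (H p)) = c
    refine (congrArg (fun x : ℝ => (x : ℂ) * c) h4).trans ?_
    push_cast
    ring
  · have e1 := extendDensity_of_notMem (H := H) (Φy := Φy) (ψ := ψ) (χ := χ) (f := f) hp
      (fun i => L (v i))
    have e2 := extendDensity_of_notMem (H := H) (Φy := Φy) (ψ := ψ) (χ := χ) (f := f) hp v
    rw [e2, mul_zero]
    exact e1

end

/-! ### Local models at a hypersurface -/

theorem IsDensity.mul_left {n : ℕ} {M : Type*} [TopologicalSpace M]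
    [ChartedSpace (EuclideanQuadrant n) M] {σ : (p : M) → (Fin n → TangentSpace (Q n) p) → ℂ}
    (hσ : IsDensity σ) (c : M → ℂ) : IsDensity fun p v => c p * σ p v := fun p L v => by
  refine (congrArg (fun x => c p * x) (hσ p L v)).trans ?_
  ring

section

variable {m : ℕ} {M : Type*} [TopologicalSpace M] [ChartedSpace (EuclideanQuadrant (m + 1)) M]
  [IsManifold (Q (m + 1)) ∞ M] {Y : Type*} [TopologicalSpace Y]
  [ChartedSpace (EuclideanQuadrant m) Y] [IsManifold (Q m) ∞ Y]

/-- Adapted coordinates together with adapted frames `Z` of `V` and `w` of `W`, and with boundary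
defining functions `R` whose product restricts to the product of the boundary defining functions `r`. -/
structure IsLocalModel (ι : Y → M) (𝓕 : Set (Set M)) (V : Submodule (Fn (m + 1) M) (VF (m + 1) M))
    (W : Submodule (Fn m Y) (VF m Y)) (r : Set Y → Fn m Y) (X : VF (m + 1) M) (N : Set M)
    (H : M → E (m + 1)) (Φ : E (m + 1) → M) (Ny : Set Y) (Hy : Y → E m) (Φy : E m → Y) (t₀ : ℝ)
    (y₀ : E m) (δ : ℝ) (Z : Fin (m + 1) → VF (m + 1) M) (w : Fin m → VF m Y) (u : M → ℝ)
    (R : Set M → Fn (m + 1) M) : Prop where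
  adapted : IsAdapted ι 𝓕 X N H Φ Ny Hy Φy t₀ y₀ δ
  frame : IsFrameOn V N Z
  frameY : IsFrameOn W Ny w
  contMDiffOn : ContMDiffOn (Q (m + 1)) 𝓘(ℝ, ℝ) ∞ u N
  det_eq : ∀ p ∈ N, (frameMatrix H Z p).det =
    (frameMatrix Hy w (Φy (tailE m (H p)))).det * Real.exp (u p)
  isBDF : ∀ F ∈ 𝓕, IsBDF F (R F)
  prod_eq : ∀ p ∈ N, ∏ᶠ F ∈ 𝓕, R F p = ∏ᶠ F ∈ hyperfaces m Y, r F (Φy (tailE m (H p)))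

variable {ι : Y → M} {𝓕 : Set (Set M)} {V : Submodule (Fn (m + 1) M) (VF (m + 1) M)}
  {W : Submodule (Fn m Y) (VF m Y)} {r : Set Y → Fn m Y}

theorem IsLieManifoldWithBoundary.exists_localModel [T2Space M] [CompactSpace M] [T2Space Y]
    [CompactSpace Y] (hMY : IsLieManifoldWithBoundary 𝓕 V ι W)
    (hr : ∀ F ∈ hyperfaces m Y, IsBDF F (r F)) (y₀ : Y) :
    ∃ (X : VF (m + 1) M) (N : Set M) (H : M → E (m + 1)) (Φ : E (m + 1) → M) (Ny : Set Y)
      (Hy : Y → E m) (Φy : E m → Y) (t₀ : ℝ) (δ : ℝ) (Z : Fin (m + 1) → VF (m + 1) M)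
      (w : Fin m → VF m Y) (u : M → ℝ) (R : Set M → Fn (m + 1) M), y₀ ∈ Ny ∧
      IsLocalModel ι 𝓕 V W r X N H Φ Ny Hy Φy t₀ (Hy y₀) δ Z w u R := by
  have hV := hMY.lieStructure
  obtain ⟨X, N, H, Φ, Ny, Hy, Φy, t₀, δ, hX, hy₀, h⟩ := hMY.exists_adapted y₀
  obtain ⟨δ₁, hδ₁, hle₁, Z, hZ0, hZ, hZs⟩ := h.exists_frame hV hX
  have h₁ := h.mono hδ₁ hle₁
  obtain ⟨u, hu, hdet⟩ := h₁.exists_log_det hV hX hZ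
  obtain ⟨δ₂, hδ₂, hle₂, w, hw, hwZ⟩ := h₁.exists_frame_hypersurface hMY hZ0 hZ hZs
  have h₂ := h₁.mono hδ₂ hle₂
  obtain ⟨δ₃, hδ₃, hle₃, R, hR, hRr⟩ := h₂.exists_matching_bdf hMY hr
  have h₃ := h₂.mono hδ₃ hle₃
  refine ⟨X, _, H, Φ, _, Hy, Φy, t₀, δ₃, Z, w, u, R, ?_, h₃, hZ.mono fun p hp => hp.1.1,
    hw.mono fun y hy => hy.1, hu.mono fun p hp => hp.1.1, fun p hp => ?_, hR, hRr⟩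
  · exact ⟨⟨⟨hy₀, Metric.mem_ball_self hδ₁⟩, Metric.mem_ball_self hδ₂⟩, Metric.mem_ball_self hδ₃⟩
  -- Follow the `t`-line through `p` back to `Y`, picking up `e^u`, and use there that the
  -- determinants for `Z` and `w` agree.
  · have hv : H p ∈ H '' _ := mem_image_of_mem H hp
    have hq := h₃.tail_mem hv
    have hqN := h₃.coordY.mapsTo_symm hq
    rw [hdet p hp.1.1, h₃.symm_cons hq, h₁.det_frameMatrix hZ0 hZs hqN.1.1
      (hwZ _ ⟨hqN.1.1, hqN.1.2⟩)]

namespace IsLocalModel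

variable {X : VF (m + 1) M} {N : Set M} {H : M → E (m + 1)} {Φ : E (m + 1) → M} {Ny : Set Y}
  {Hy : Y → E m} {Φy : E m → Y} {t₀ : ℝ} {y₀ : E m} {δ : ℝ} {Z : Fin (m + 1) → VF (m + 1) M}
  {w : Fin m → VF m Y} {u : M → ℝ} {R : Set M → Fn (m + 1) M}
  {ψ : ℝ → ℝ} {χ : Fn m Y} {f : (y : Y) → (Fin m → TangentSpace (Q m) y) → ℂ}

theorem proj_mem (h : IsLocalModel ι 𝓕 V W r X N H Φ Ny Hy Φy t₀ y₀ δ Z w u R) {p : M} (hp : p ∈ N) :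
    Φy (tailE m (H p)) ∈ Ny ∧ Hy (Φy (tailE m (H p))) = tailE m (H p) := by
  have hq := h.adapted.tail_mem (mem_image_of_mem H hp)
  exact ⟨h.adapted.coordY.mapsTo_symm hq, h.adapted.coordY.right_inv hq⟩

theorem contMDiffOn_proj (h : IsLocalModel ι 𝓕 V W r X N H Φ Ny Hy Φy t₀ y₀ δ Z w u R) :
    ContMDiffOn (Q (m + 1)) (Q m) ∞ (fun p => Φy (tailE m (H p))) N :=
  h.adapted.coordY.contMDiffOn_symm.comp
    ((tailE m).contDiff.contMDiff.comp_contMDiffOn h.adapted.coord.contMDiffOn)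
    fun _ hp => h.adapted.tail_mem (mem_image_of_mem H hp)

theorem mem_singular_iff (h : IsLocalModel ι 𝓕 V W r X N H Φ Ny Hy Φy t₀ y₀ δ Z w u R) {p : M}
    (hp : p ∈ N) : p ∈ ⋃₀ 𝓕 ↔ Φy (tailE m (H p)) ∈ ⋃₀ hyperfaces m Y := by
  obtain ⟨h1, h2⟩ := h.proj_mem hp
  rw [h.adapted.singular p hp, mem_sUnion_hyperfaces_iff h.adapted.coordY h1, h2]
  rfl

/-- The support lies in the compact image of `supp ψ × supp χ`. As `ψ` is supported to the right of
`t₀ ≥ 0`, this stays in the quadrant and inside the box, also when `Y` is itself a boundary face. -/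
theorem exists_support (h : IsLocalModel ι 𝓕 V W r X N H Φ Ny Hy Φy t₀ y₀ δ Z w u R)
    [T2Space M] [CompactSpace Y] (hψ : tsupport ψ ⊆ Ioo t₀ (t₀ + δ)) (hχ : tsupport χ ⊆ Ny) :
    ∃ K : Set M, IsClosed K ∧ K ⊆ N ∧ ∀ f : (y : Y) → (Fin m → TangentSpace (Q m) y) → ℂ,
      ∀ p, p ∉ K → ∀ v, extendDensity N H Φy ψ χ f p v = 0 := by
  have hψc : IsCompact (tsupport ψ) :=
    isCompact_Icc.of_isClosed_subset (isClosed_tsupport ψ) (hψ.trans Ioo_subset_Icc_self)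
  have hχc : IsCompact (Hy '' tsupport χ) := (isClosed_tsupport χ).isCompact.image_of_continuousOn
    (h.adapted.coordY.continuousOn.mono hχ)
  let C : Set (E (m + 1)) := (fun q : ℝ × E m => consE q.1 q.2) '' (tsupport ψ ×ˢ (Hy '' tsupport χ))
  have hC : IsCompact C := (hψc.prod hχc).image contDiff_consE.continuous
  have hCN : C ⊆ H '' N := by
    rintro _ ⟨⟨t, _⟩, ⟨ht, y, hy, rfl⟩, rfl⟩
    have h1 := mem_image_of_mem Hy (hχ hy)
    rw [h.adapted.imageY] at h1
    rw [h.adapted.image]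
    have h2 := hψ ht
    refine ⟨consE_mem_quad (h.adapted.nonneg.trans h2.1.le) h1.1, ?_, by simpa using h1.2⟩
    rw [consE_zero, abs_lt]
    constructor <;> linarith [h2.1, h2.2, h.adapted.pos]
  refine ⟨Φ '' C, (hC.image_of_continuousOn (h.adapted.coord.continuousOn_symm.mono hCN)).isClosed,
    ?_, fun f p hp v => ?_⟩
  · rintro _ ⟨v, hv, rfl⟩
    exact h.adapted.coord.mapsTo_symm (hCN hv)
  · by_cases hpN : p ∈ N
    · have h1 : ψ (H p 0) * χ (Φy (tailE m (H p))) = 0 := by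
        by_contra hne
        refine hp ⟨H p, ⟨(H p 0, tailE m (H p)), ⟨?_, Φy (tailE m (H p)), ?_, (h.proj_mem hpN).2⟩,
          consE_tailE _⟩, h.adapted.coord.left_inv p hpN⟩
        · exact subset_tsupport _ (left_ne_zero_of_mul hne)
        · exact subset_tsupport _ (right_ne_zero_of_mul hne)
      rw [extendDensity_of_mem hpN, h1, Complex.ofReal_zero, zero_mul, mul_zero]
    · exact extendDensity_of_notMem hpN v

/-- The coefficient of an extended density with respect to an adapted frame. -/
theorem extendDensity_frame (h : IsLocalModel ι 𝓕 V W r X N H Φ Ny Hy Φy t₀ y₀ δ Z w u R)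
    (hf : f ∈ Density (hyperfaces m Y) W) {φ : Y → ℂ} (hφ : IsCoeffOn (hyperfaces m Y) f Ny w φ) {p : M}
    (hp : p ∈ N) (hpS : p ∉ ⋃₀ 𝓕) :
    ((ψ (H p 0) * χ (Φy (tailE m (H p))) * Real.exp (u p) : ℝ) : ℂ) * φ (Φy (tailE m (H p))) =
      extendDensity N H Φy ψ χ f p (fun i => Z i p) := by
  obtain ⟨h1, h2⟩ := h.proj_mem hp
  rw [extendDensity_of_mem hp]
  have h3 : (Matrix.of fun i k => diff H p (Z i p) k).det = (frameMatrix H Z p).det := rfl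
  have h4 := (Density.isDensity hf).apply_frame h.adapted.coordY w h1
  rw [hφ.2 _ h1 fun hS => hpS ((h.mem_singular_iff hp).2 hS), h4, h2, h3, h.det_eq p hp, abs_mul,
    abs_of_pos (Real.exp_pos _)]
  push_cast
  ring

theorem contMDiffOn_coeff (h : IsLocalModel ι 𝓕 V W r X N H Φ Ny Hy Φy t₀ y₀ δ Z w u R)
    (hψs : ContDiff ℝ ∞ ψ) {φ : Y → ℂ} (hφ : ContMDiffOn (Q m) 𝓘(ℝ, ℂ) ∞ φ Ny) :
    ContMDiffOn (Q (m + 1)) 𝓘(ℝ, ℂ) ∞ (fun p =>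
      ((ψ (H p 0) * χ (Φy (tailE m (H p))) * Real.exp (u p) : ℝ) : ℂ)) N ∧
    ContMDiffOn (Q (m + 1)) 𝓘(ℝ, ℂ) ∞ (fun p => φ (Φy (tailE m (H p)))) N := by
  have h1 : ContMDiffOn (Q (m + 1)) 𝓘(ℝ, ℝ) ∞ (fun p => ψ (H p 0)) N :=
    (hψs.comp (EuclideanSpace.proj (𝕜 := ℝ) (0 : Fin (m + 1))).contDiff).contMDiff.comp_contMDiffOn
      h.adapted.coord.contMDiffOn
  have h2 : ContMDiffOn (Q (m + 1)) 𝓘(ℝ, ℝ) ∞ (fun p => χ (Φy (tailE m (H p)))) N :=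
    χ.contMDiff.comp_contMDiffOn h.contMDiffOn_proj
  have h3 : ContMDiffOn (Q (m + 1)) 𝓘(ℝ, ℝ) ∞ (fun p => Real.exp (u p)) N :=
    Real.contDiff_exp.contMDiff.comp_contMDiffOn h.contMDiffOn
  exact ⟨Complex.ofRealCLM.contDiff.contMDiff.comp_contMDiffOn ((h1.mul h2).mul h3),
    hφ.comp h.contMDiffOn_proj fun p hp => (h.proj_mem hp).1⟩

variable [T2Space M] [CompactSpace Y]

/-- The determinant of the frame of `W`, which may degenerate at the singular set, is part of the
smooth coefficient `φ` of `f`. What remains in front is `ψ χ e^u`, so the coefficient in the adapted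
frame is smooth. -/
theorem extendDensity_mem (h : IsLocalModel ι 𝓕 V W r X N H Φ Ny Hy Φy t₀ y₀ δ Z w u R)
    (hMY : IsLieManifoldWithBoundary 𝓕 V ι W) (hψs : ContDiff ℝ ∞ ψ)
    (hψ : tsupport ψ ⊆ Ioo t₀ (t₀ + δ)) (hχ : tsupport χ ⊆ Ny)
    (hf : f ∈ Density (hyperfaces m Y) W) : extendDensity N H Φy ψ χ f ∈ Density 𝓕 V := by
  obtain ⟨K, hK, hKN, hK0⟩ := h.exists_support hψ hχ
  obtain ⟨φ, hφ⟩ := hf.2.2 Ny h.adapted.coordY.isOpen w h.frameY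
  obtain ⟨h1, h2⟩ := h.contMDiffOn_coeff (χ := χ) hψs hφ.1
  refine mem_density_of_local hMY.lieStructure h.adapted.coord.isOpen h.frame hK hKN
    (isDensity_extendDensity h.adapted.coord) (hK0 f) (fun p hp v => ?_) (contMDiffOn_complex_mul h1 h2)
    fun p hp hpS => h.extendDensity_frame hf hφ hp hpS
  by_cases hpN : p ∈ N
  · have h3 : coordCoeff Φy f (tailE m (H p)) = 0 := hf.1 _ ((h.mem_singular_iff hpN).1 hp) _
    rw [extendDensity_of_mem hpN, h3, mul_zero, mul_zero]
  · exact extendDensity_of_notMem hpN v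

theorem vanishesToAllOrders_extendDensity
    (h : IsLocalModel ι 𝓕 V W r X N H Φ Ny Hy Φy t₀ y₀ δ Z w u R)
    (hMY : IsLieManifoldWithBoundary 𝓕 V ι W) (hψs : ContDiff ℝ ∞ ψ)
    (hψ : tsupport ψ ⊆ Ioo t₀ (t₀ + δ)) (hχ : tsupport χ ⊆ Ny)
    (hf : f ∈ Density (hyperfaces m Y) W) (hflat : VanishesToAllOrders (hyperfaces m Y) W f) :
    VanishesToAllOrders 𝓕 V (extendDensity N H Φy ψ χ f) := by
  obtain ⟨K, hK, hKN, hK0⟩ := h.exists_support hψ hχ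
  obtain ⟨φ, hφ⟩ := hf.2.2 Ny h.adapted.coordY.isOpen w h.frameY
  obtain ⟨h1, h2⟩ := h.contMDiffOn_coeff (χ := χ) hψs hφ.1
  refine vanishesToAllOrders_of_local hMY.lieStructure h.adapted.coord.isOpen h.frame hK hKN
    (isDensity_extendDensity h.adapted.coord) (hK0 f) (contMDiffOn_complex_mul h1 h2)
    (fun p hp hpS => h.extendDensity_frame hf hφ hp hpS) fun p hp hpS => ?_
  have hq := (h.proj_mem hp).1
  exact FlatAt.mul_left h.adapted.coord.isOpen hp h1 h2 (FlatAt.comp h.adapted.coord.isOpen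
    h.adapted.coordY.isOpen hp hq h.contMDiffOn_proj hφ.1
    (hflat Ny h.adapted.coordY.isOpen w h.frameY φ hφ _ hq ((h.mem_singular_iff hp).1 hpS)))

/-- In adapted coordinates the integrand is `ψ(t)` times a function of `y`, because `prod_eq` makes
the product of defining functions independent of `t`. The domain is an interval times the chart of
`Y`, and `∫ ψ = 1`. -/
theorem integral_extendDensity [CompactSpace M] [T2Space Y]
    (h : IsLocalModel ι 𝓕 V W r X N H Φ Ny Hy Φy t₀ y₀ δ Z w u R)
    (hψ : tsupport ψ ⊆ Ioo t₀ (t₀ + δ)) (hψ1 : ∫ t, ψ t = 1) (hχ : tsupport χ ⊆ Ny)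
    (hf : f ∈ Density (hyperfaces m Y) W) {z : ℂ}
    (hi : DensityIntegrable (rhoPow 𝓕 R z (extendDensity N H Φy ψ χ f))) :
    DensityIntegrable (fun y v => ((χ y : ℝ) : ℂ) * rhoPow (hyperfaces m Y) r z f y v) ∧
      densityIntegral (rhoPow 𝓕 R z (extendDensity N H Φy ψ χ f)) =
        densityIntegral (fun y v => ((χ y : ℝ) : ℂ) * rhoPow (hyperfaces m Y) r z f y v) := by
  set σ := rhoPow 𝓕 R z (extendDensity N H Φy ψ χ f) with hσ
  set τ : (y : Y) → (Fin m → TangentSpace (Q m) y) → ℂ :=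
    fun y v => ((χ y : ℝ) : ℂ) * rhoPow (hyperfaces m Y) r z f y v with hτ
  have hσd : IsDensity σ := (isDensity_extendDensity h.adapted.coord).mul_left _
  have hτd : IsDensity τ := ((Density.isDensity hf).mul_left _).mul_left _
  have hσ0 : ∀ p, p ∉ N → ∀ v, σ p v = 0 := fun p hp v => by
    simp only [hσ, rhoPow]
    rw [extendDensity_of_notMem hp, mul_zero]
  have hτ0 : ∀ y, y ∉ Ny → ∀ v, τ y v = 0 := fun y hy v => by
    simp only [hτ]
    rw [image_eq_zero_of_notMem_tsupport fun hy' => hy (hχ hy'), Complex.ofReal_zero, zero_mul]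
  let I : Set ℝ := {t | 0 ≤ t ∧ |t - t₀| < δ}
  have himage : H '' N = {v | v 0 ∈ I ∧ tailE m v ∈ Hy '' Ny} := by
    rw [h.adapted.image, h.adapted.imageY]
    ext v
    constructor
    · rintro ⟨h1, h2, h3⟩
      exact ⟨⟨h1 0, h2⟩, tailE_mem_quad h1, h3⟩
    · rintro ⟨⟨h1, h2⟩, h3, h4⟩
      refine ⟨?_, h2, h4⟩
      rw [← consE_tailE v]
      exact consE_mem_quad h1 h3
  have hψI : ∫ t in I, ((ψ t : ℝ) : ℂ) = 1 := by
    rw [setIntegral_eq_integral_of_forall_compl_eq_zero, integral_complex_ofReal, hψ1,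
      Complex.ofReal_one]
    intro t ht
    rw [Complex.ofReal_eq_zero]
    by_contra hne
    have h1 := hψ (subset_tsupport ψ hne)
    refine ht ⟨h.adapted.nonneg.trans h1.1.le, ?_⟩
    rw [abs_lt]
    constructor <;> linarith [h1.1, h1.2, h.adapted.pos]
  have hcoeff : ∀ v ∈ H '' N, coordCoeff Φ σ v = ((ψ (v 0) : ℝ) : ℂ) * coordCoeff Φy τ (tailE m v) := by
    intro v hv
    have hΦ := h.adapted.coord.mapsTo_symm hv
    have hdet : (Matrix.of fun i k => diff H (Φ v) (diffSymm Φ v (EuclideanSpace.single i 1)) k) =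
        (1 : Matrix (Fin (m + 1)) (Fin (m + 1)) ℝ) := by
      ext i k
      rw [Matrix.of_apply, h.adapted.coord.diff_diffSymm hv, Matrix.one_apply, PiLp.single_apply]
      simp only [eq_comm]
    have h1 : extendDensity N H Φy ψ χ f (Φ v) (fun i => diffSymm Φ v (EuclideanSpace.single i 1)) =
        ((ψ (v 0) * χ (Φy (tailE m v)) : ℝ) : ℂ) * coordCoeff Φy f (tailE m v) := by
      refine (extendDensity_of_mem hΦ _).trans ?_
      rw [hdet, Matrix.det_one, abs_one, Complex.ofReal_one, one_mul, h.adapted.coord.right_inv hv]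
    have h2 := h.prod_eq _ hΦ
    rw [h.adapted.coord.right_inv hv] at h2
    have h3 : coordCoeff Φ σ v = (((∏ᶠ F ∈ 𝓕, R F (Φ v) : ℝ) : ℂ) ^ z) *
        extendDensity N H Φy ψ χ f (Φ v) (fun i => diffSymm Φ v (EuclideanSpace.single i 1)) := rfl
    have h4 : coordCoeff Φy τ (tailE m v) = ((χ (Φy (tailE m v)) : ℝ) : ℂ) *
      ((((∏ᶠ F ∈ hyperfaces m Y, r F (Φy (tailE m v)) : ℝ) : ℂ) ^ z) *
        coordCoeff Φy f (tailE m v)) := rfl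
    rw [h3, h1, h2, h4]
    push_cast
    ring
  have hi' := (densityIntegrable_iff hσd h.adapted.coord hσ0).1 hi
  have hmeas := h.adapted.coord.measurableSet_image
  have hi'' := hi'.congr_fun hcoeff hmeas
  rw [himage] at hi''
  obtain ⟨hτi, hτe⟩ := integrableOn_of_mul hψI hi''
  have hτI := (densityIntegrable_iff hτd h.adapted.coordY hτ0).2 hτi
  refine ⟨hτI, ?_⟩
  rw [densityIntegral_eq hσd h.adapted.coord hσ0 hi, densityIntegral_eq hτd h.adapted.coordY hτ0 hτI,
    setIntegral_congr_fun hmeas hcoeff, himage, hτe]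

end IsLocalModel

end

/-! ### The extension operator -/

section

variable {m : ℕ} {Y : Type*} [TopologicalSpace Y] [ChartedSpace (EuclideanQuadrant m) Y]

theorem coordCoeff_add (Φy : E m → Y) (f g : (y : Y) → (Fin m → TangentSpace (Q m) y) → ℂ) (v : E m) :
    coordCoeff Φy (f + g) v = coordCoeff Φy f v + coordCoeff Φy g v := rfl

theorem coordCoeff_smul (Φy : E m → Y) (c : ℂ) (f : (y : Y) → (Fin m → TangentSpace (Q m) y) → ℂ)
    (v : E m) : coordCoeff Φy (c • f) v = c * coordCoeff Φy f v := rfl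

variable {M : Type*} [TopologicalSpace M] [ChartedSpace (EuclideanQuadrant (m + 1)) M]
  (N : Set M) (H : M → E (m + 1)) (Φy : E m → Y) (ψ : ℝ → ℝ) (χ : Y → ℝ)

theorem extendDensity_add (f g : (y : Y) → (Fin m → TangentSpace (Q m) y) → ℂ) :
    extendDensity N H Φy ψ χ (f + g) = extendDensity N H Φy ψ χ f + extendDensity N H Φy ψ χ g := by
  funext p v
  simp only [extendDensity, Pi.add_apply, coordCoeff_add]
  split_ifs
  · ring
  · rw [add_zero]

theorem extendDensity_smul (c : ℂ) (f : (y : Y) → (Fin m → TangentSpace (Q m) y) → ℂ) :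
    extendDensity N H Φy ψ χ (c • f) = c • extendDensity N H Φy ψ χ f := by
  funext p v
  simp only [extendDensity, Pi.smul_apply, coordCoeff_smul, smul_eq_mul]
  split_ifs
  · ring
  · rw [mul_zero]

variable [IsManifold (Q (m + 1)) ∞ M] [IsManifold (Q m) ∞ Y] [T2Space M] [CompactSpace M] [T2Space Y]
  [CompactSpace Y] {ι : Y → M} {𝓕 : Set (Set M)} {V : Submodule (Fn (m + 1) M) (VF (m + 1) M)}
  {W : Submodule (Fn m Y) (VF m Y)}

/-- Near each point of the hypersurface `Y`, densities on `Y` extend to densities on `M` in such a way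
that their regularized integrals agree. -/
theorem IsLieManifoldWithBoundary.exists_extension (hMY : IsLieManifoldWithBoundary 𝓕 V ι W)
    {r : Set Y → Fn m Y} (hr : ∀ F ∈ hyperfaces m Y, IsBDF F (r F)) (y₀ : Y) :
    ∃ O : Set Y, IsOpen O ∧ y₀ ∈ O ∧ ∀ χ : Fn m Y, tsupport χ ⊆ O →
      ∃ R : Set M → Fn (m + 1) M, (∀ F ∈ 𝓕, IsBDF F (R F)) ∧
      ∃ L : Density (hyperfaces m Y) W →ₗ[ℂ] Density 𝓕 V,
        (∀ f, VanishesToAllOrders (hyperfaces m Y) W f.1 → VanishesToAllOrders 𝓕 V (L f).1) ∧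
        ∀ f z, DensityIntegrable (rhoPow 𝓕 R z (L f).1) →
          DensityIntegrable (fun y v => ((χ y : ℝ) : ℂ) * rhoPow (hyperfaces m Y) r z f.1 y v) ∧
          densityIntegral (rhoPow 𝓕 R z (L f).1) =
            densityIntegral (fun y v => ((χ y : ℝ) : ℂ) * rhoPow (hyperfaces m Y) r z f.1 y v) := by
  obtain ⟨X, N, H, Φ, Ny, Hy, Φy, t₀, δ, Z, w, u, R, hy₀, h⟩ := hMY.exists_localModel hr y₀
  refine ⟨Ny, h.adapted.coordY.isOpen, hy₀, fun χ hχ => ?_⟩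
  have hδ := h.adapted.pos
  -- Centred away from `Y` and supported strictly between `t₀` and `t₀ + δ`, so one choice serves
  -- both for boundary and for interior hypersurfaces.
  let b : ContDiffBump (t₀ + δ / 2) := ⟨δ / 8, δ / 4, by positivity, by linarith⟩
  have hψs : ContDiff ℝ ∞ (b.normed volume) := b.contDiff_normed
  have hψ : tsupport (b.normed volume) ⊆ Ioo t₀ (t₀ + δ) := by
    rw [b.tsupport_normed_eq]
    intro t ht
    have h1 : |t - (t₀ + δ / 2)| ≤ δ / 4 := by
      have := Metric.mem_closedBall.1 ht
      rwa [Real.dist_eq] at this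
    rw [abs_le] at h1
    constructor <;> linarith [h1.1, h1.2]
  refine ⟨R, h.isBDF,
    { toFun := fun f => ⟨extendDensity N H Φy (b.normed volume) χ f.1,
        h.extendDensity_mem hMY hψs hψ hχ f.2⟩
      map_add' := fun f g => Subtype.ext (extendDensity_add _ _ _ _ _ _ _)
      map_smul' := fun c f => Subtype.ext (extendDensity_smul _ _ _ _ _ _ _) },
    fun f hf => h.vanishesToAllOrders_extendDensity hMY hψs hψ hχ f.2 hf, fun f z hi =>
    h.integral_extendDensity hψ b.integral_normed hχ f.2 hi⟩

end

/-! ### Regularized values -/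

theorem isRegularizedValue_sum {α : Type*} (t : Finset α) {g : α → ℂ → ℂ} {c : α → ℂ}
    (h : ∀ i ∈ t, IsRegularizedValue (g i) (c i)) :
    IsRegularizedValue (fun z => ∑ i ∈ t, g i z) (∑ i ∈ t, c i) := by
  classical
  induction t using Finset.induction_on with
  | empty => exact ⟨0, fun _ => 0, by simp, analyticAt_const, by simp, by simp⟩
  | insert a t ha ih =>
    obtain ⟨P, k, hP, hk, hk0, hPk⟩ := h a (Finset.mem_insert_self a t)
    obtain ⟨P', k', hP', hk', hk0', hPk'⟩ := ih fun i hi => h i (Finset.mem_insert_of_mem hi)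
    refine ⟨P + P', fun z => k z + k' z, by simp [hP, hP'], hk.add hk', ?_, ?_⟩
    · simp only [Finset.sum_insert ha, hk0, hk0']
    · filter_upwards [hPk, hPk'] with z h1 h2
      rw [Finset.sum_insert ha, h1, h2, Polynomial.eval_add]
      ring

theorem IsRegularizedValue.congr {g g' : ℂ → ℂ} {c : ℂ} (h : IsRegularizedValue g c)
    (hg : g' =ᶠ[𝓝[≠] 0] g) : IsRegularizedValue g' c := by
  obtain ⟨P, k, hP, hk, hk0, hPk⟩ := h
  exact ⟨P, k, hP, hk, hk0, by filter_upwards [hPk, hg] with z h1 h2 using h2.trans h1⟩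

/-! ### Half planes -/

theorem sub_one_lt_coe_iff (k : EReal) (x : ℝ) : k - 1 < (x : EReal) ↔ k < ((x + 1 : ℝ) : EReal) := by
  induction k using EReal.rec with
  | bot => exact iff_of_true (EReal.bot_lt_coe x) (EReal.bot_lt_coe _)
  | coe k =>
    rw [← EReal.coe_one, ← EReal.coe_sub, EReal.coe_lt_coe_iff, EReal.coe_lt_coe_iff]
    constructor <;> intro h <;> linarith
  | top =>
    rw [← EReal.coe_one, EReal.top_sub_coe]
    simp

theorem isOpen_halfPlane (k : EReal) : IsOpen {z : ℂ | k < ((z.re : ℝ) : EReal)} :=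
  isOpen_lt continuous_const (continuous_coe_real_ereal.comp Complex.continuous_re)

theorem convex_halfPlane (k : EReal) : Convex ℝ {z : ℂ | k < ((z.re : ℝ) : EReal)} := by
  have h1 : OrdConnected {x : ℝ | k < (x : EReal)} :=
    ⟨fun x hx y _ z hz => lt_of_lt_of_le hx (EReal.coe_le_coe_iff.2 hz.1)⟩
  exact h1.convex.linear_preimage Complex.reLm

/-- A holomorphic function on a half plane that agrees with a meromorphic function farther to the right
agrees with it wherever the latter is analytic. -/
theorem eq_of_meromorphic {k K : EReal} (hK : K < ⊤) {g G : ℂ → ℂ} (hg : MeromorphicOn g univ)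
    (hG : DifferentiableOn ℂ G {z | k < ((z.re : ℝ) : EReal)})
    (h : ∀ z : ℂ, K < ((z.re : ℝ) : EReal) → k < ((z.re : ℝ) : EReal) → G z = g z) {z : ℂ}
    (hz : k < ((z.re : ℝ) : EReal)) (hgz : AnalyticAt ℂ g z) : G z = g z := by
  have hGa : AnalyticOnNhd ℂ G {z | k < ((z.re : ℝ) : EReal)} :=
    hG.analyticOnNhd (isOpen_halfPlane k)
  have hD : MeromorphicOn (G - g) {z | k < ((z.re : ℝ) : EReal)} := fun w hw =>
    (hGa w hw).meromorphicAt.sub (hg w (mem_univ w))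
  have hconn : IsConnected {z : ℂ | k < ((z.re : ℝ) : EReal)} :=
    ⟨⟨z, hz⟩, (convex_halfPlane k).isPreconnected⟩
  -- Far to the right `G = g` on an open set, so `G - g` has infinite order there. On a connected
  -- half plane the order is then infinite everywhere, and continuity at `z` gives equality of
  -- values.
  obtain ⟨x, hx, -⟩ : ∃ x : ℝ, max K k < (x : EReal) ∧ (x : EReal) < ⊤ :=
    EReal.lt_iff_exists_real_btwn.1 (max_lt hK (hz.trans (EReal.coe_lt_top _)))
  have hxK : K < (((x : ℂ).re : ℝ) : EReal) := (le_max_left _ _).trans_lt hx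
  have hxk : k < (((x : ℂ).re : ℝ) : EReal) := (le_max_right _ _).trans_lt hx
  have htop : meromorphicOrderAt (G - g) (x : ℂ) = ⊤ := by
    rw [meromorphicOrderAt_eq_top_iff]
    refine Filter.Eventually.filter_mono nhdsWithin_le_nhds ?_
    filter_upwards [(isOpen_halfPlane K).mem_nhds hxK, (isOpen_halfPlane k).mem_nhds hxk] with w h1 h2
    rw [Pi.sub_apply, h w h1 h2, sub_self]
  have hall : meromorphicOrderAt (G - g) z = ⊤ := by
    by_contra hne
    exact (hD.exists_meromorphicOrderAt_ne_top_iff_forall hconn).1 ⟨⟨z, hz⟩, hne⟩ ⟨x, hxk⟩ htop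
  rw [meromorphicOrderAt_eq_top_iff] at hall
  have h1 : Tendsto (G - g) (𝓝[≠] z) (𝓝 ((G - g) z)) :=
    (((hGa z hz).sub hgz).continuousAt).continuousWithinAt
  have h2 : Tendsto (G - g) (𝓝[≠] z) (𝓝 0) :=
    tendsto_const_nhds.congr' (hall.mono fun w hw => hw.symm)
  exact sub_eq_zero.1 (tendsto_nhds_unique h1 h2)

/-! ### Renormalizability from local extensions -/

section

variable {n : ℕ} {M : Type*} [TopologicalSpace M] [ChartedSpace (EuclideanQuadrant n) M]
  [IsManifold (Q n) ∞ M] [T2Space M] [CompactSpace M]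
  {𝓕 : Set (Set M)} {V : Submodule (Fn n M) (VF n M)} {r : Set M → Fn n M}

theorem rhoPow_zero (σ : (p : M) → (Fin n → TangentSpace (Q n) p) → ℂ) : rhoPow 𝓕 r 0 σ = σ := by
  funext p v
  rw [rhoPow, Complex.cpow_zero, one_mul]

theorem HolomorphicBeyond.mono {k K : EReal} (h : HolomorphicBeyond 𝓕 V r k) (hkK : k ≤ K) :
    HolomorphicBeyond 𝓕 V r K := fun f hf =>
  have h1 : k - 1 ≤ K - 1 := EReal.sub_le_sub hkK le_rfl
  ⟨fun z hz => (h f hf).1 z (h1.trans_lt hz), (h f hf).2.mono fun _ hz => h1.trans_lt hz⟩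

/-- The open half plane of the infimum is the union of the half planes of the admissible abscissas,
and both conditions are local in `z`. So a minimal abscissa exists as soon as any does. -/
theorem holomorphicBeyond_sInf : HolomorphicBeyond 𝓕 V r (sInf {k | HolomorphicBeyond 𝓕 V r k}) := by
  have key : ∀ z : ℂ, sInf {k | HolomorphicBeyond 𝓕 V r k} - 1 < ((z.re : ℝ) : EReal) →
      ∃ k, HolomorphicBeyond 𝓕 V r k ∧ k - 1 < ((z.re : ℝ) : EReal) := by
    intro z hz
    rw [sub_one_lt_coe_iff, sInf_lt_iff] at hz
    obtain ⟨k, hk, hkz⟩ := hz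
    exact ⟨k, hk, (sub_one_lt_coe_iff _ _).2 hkz⟩
  refine fun f hf => ⟨fun z hz => ?_, fun z hz => ?_⟩
  · obtain ⟨k, hk, hkz⟩ := key z hz
    exact (hk f hf).1 z hkz
  · obtain ⟨k, hk, hkz⟩ := key z hz
    exact ((hk f hf).2.differentiableAt
      ((isOpen_halfPlane (k - 1)).mem_nhds hkz)).differentiableWithinAt

/-- The minimal half plane need not be known: it is enough to continue `G(f)` meromorphically from
some half plane. -/
theorem exists_isLeast_holomorphicBeyond {K : EReal} (hK : K < ⊤) (h : HolomorphicBeyond 𝓕 V r K)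
    {Tr : Density 𝓕 V → ℂ} (hg : ∀ f : Density 𝓕 V, ∃ g : ℂ → ℂ, MeromorphicOn g univ ∧
      (∀ z : ℂ, K - 1 < ((z.re : ℝ) : EReal) → g z = densityIntegral (rhoPow 𝓕 r z f.1)) ∧
      IsRegularizedValue g (Tr f)) :
    ∃ k : EReal, k < ⊤ ∧ IsLeast {k' | HolomorphicBeyond 𝓕 V r k'} k ∧
      ∀ f : Density 𝓕 V, ∃ g : ℂ → ℂ, MeromorphicOn g univ ∧
        (∀ z : ℂ, k - 1 < ((z.re : ℝ) : EReal) → g z = densityIntegral (rhoPow 𝓕 r z f.1)) ∧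
        IsRegularizedValue g (Tr f) := by
  classical
  set k := sInf {k | HolomorphicBeyond 𝓕 V r k} with hk
  have hkh : HolomorphicBeyond 𝓕 V r k := holomorphicBeyond_sInf
  refine ⟨k, (sInf_le h).trans_lt hK, ⟨hkh, fun k' hk' => sInf_le hk'⟩, fun f => ?_⟩
  obtain ⟨g, hgm, hgK, hgr⟩ := hg f
  have hK1 : K - 1 < ⊤ := by
    obtain ⟨x, hx, -⟩ := EReal.lt_iff_exists_real_btwn.1 hK
    have : K - 1 < ((x - 1 : ℝ) : EReal) := (sub_one_lt_coe_iff _ _).2 (by rwa [sub_add_cancel])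
    exact this.trans (EReal.coe_lt_top _)
  -- A meromorphic `g` may carry arbitrary values at removable singularities, so it is replaced by
  -- the integral on the larger half plane. The two differ only where `g` is not analytic, hence not
  -- on punctured neighbourhoods.
  let G : ℂ → ℂ := fun z => if k - 1 < ((z.re : ℝ) : EReal) then
    densityIntegral (rhoPow 𝓕 r z f.1) else g z
  have hGg : ∀ z, AnalyticAt ℂ g z → G z = g z := by
    intro z hz
    by_cases hzk : k - 1 < ((z.re : ℝ) : EReal)
    · refine (if_pos hzk).trans ?_
      exact eq_of_meromorphic (G := fun z => densityIntegral (rhoPow 𝓕 r z f.1)) hK1 hgm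
        (hkh f.1 f.2).2 (fun w hw _ => (hgK w hw).symm) hzk hz
    · exact if_neg hzk
  have hev : ∀ z, G =ᶠ[𝓝[≠] z] g := fun z =>
    (hgm z (mem_univ z)).eventually_analyticAt.mono hGg
  exact ⟨G, fun z hz => (hgm z hz).congr (hev z).symm, fun z hz => if_pos hz, hgr.congr (hev 0)⟩

end

/-- On each patch of a partition of unity the family `∫_Y r^z χ_i f` is the family of an extended
density on `M`. Integrability, continuation and regularized values therefore hold patchwise, and the
sum over the patches is finite. -/
theorem IsLieManifoldWithBoundary.isRenormalizable {m : ℕ}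
    {M : Type*} [TopologicalSpace M] [ChartedSpace (EuclideanQuadrant (m + 1)) M]
    [IsManifold (Q (m + 1)) ∞ M] [T2Space M] [CompactSpace M]
    {Y : Type*} [TopologicalSpace Y] [ChartedSpace (EuclideanQuadrant m) Y]
    [IsManifold (Q m) ∞ Y] [T2Space Y] [CompactSpace Y]
    {𝓕 : Set (Set M)} {V : Submodule (Fn (m + 1) M) (VF (m + 1) M)}
    {ι : Y → M} {W : Submodule (Fn m Y) (VF m Y)}
    (hMY : IsLieManifoldWithBoundary 𝓕 V ι W) (hM : IsRenormalizable 𝓕 V) :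
    IsRenormalizable (hyperfaces m Y) W := by
  intro r hr
  choose O hO hyO hext using hMY.exists_extension hr
  obtain ⟨χ, hχ⟩ := SmoothPartitionOfUnity.exists_isSubordinate (Q m) isClosed_univ O hO
    fun y _ => mem_iUnion.2 ⟨y, hyO y⟩
  choose R hR L hflat hL using fun i => hext i (χ i) (hχ i)
  -- The hypothesis is applied once per patch, each time to the defining functions adapted to it;
  -- the resulting functionals and abscissas differ.
  choose T hT k hk hkl hg using fun i => hM (R i) (hR i)
  have hfin : {i | (Function.support (χ i)).Nonempty}.Finite :=
    χ.locallyFinite.finite_nonempty_of_compact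
  set t := hfin.toFinset with ht
  have hsum : ∀ y, ∑ i ∈ t, ((χ i y : ℝ) : ℂ) = 1 := by
    intro y
    rw [← Complex.ofReal_sum, ← finsum_eq_sum_of_support_subset, χ.sum_eq_one (mem_univ y),
      Complex.ofReal_one]
    exact fun i hi => hfin.mem_toFinset.2 ⟨y, hi⟩
  have hdec : ∀ (f : Density (hyperfaces m Y) W) (z : ℂ), rhoPow (hyperfaces m Y) r z f.1 =
      fun y v => ∑ i ∈ t, ((χ i y : ℝ) : ℂ) * rhoPow (hyperfaces m Y) r z f.1 y v := by
    intro f z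
    funext y v
    rw [← Finset.sum_mul, hsum, one_mul]
  have hint : ∀ (f : Density (hyperfaces m Y) W) (z : ℂ),
      (∀ i ∈ t, DensityIntegrable (rhoPow 𝓕 (R i) z (L i f).1)) →
      DensityIntegrable (rhoPow (hyperfaces m Y) r z f.1) ∧
      densityIntegral (rhoPow (hyperfaces m Y) r z f.1) =
        ∑ i ∈ t, densityIntegral (rhoPow 𝓕 (R i) z (L i f).1) := by
    intro f z h
    rw [hdec f z]
    refine ⟨densityIntegrable_sum t fun i hi => (hL i f z (h i hi)).1, ?_⟩
    rw [densityIntegral_sum t fun i hi => (hL i f z (h i hi)).1]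
    exact Finset.sum_congr rfl fun i hi => (hL i f z (h i hi)).2.symm
  -- A common half plane for the finitely many patches. It need not be the minimal one for `Y`.
  have hKi : ∀ i ∈ t, HolomorphicBeyond 𝓕 V (R i) (t.sup k) := fun i hi =>
    (hkl i).1.mono (Finset.le_sup hi)
  have hG : ∀ (f : Density (hyperfaces m Y) W) (z : ℂ), t.sup k - 1 < ((z.re : ℝ) : EReal) →
      DensityIntegrable (rhoPow (hyperfaces m Y) r z f.1) ∧
      densityIntegral (rhoPow (hyperfaces m Y) r z f.1) =
        ∑ i ∈ t, densityIntegral (rhoPow 𝓕 (R i) z (L i f).1) := fun f z hz =>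
    hint f z fun i hi => (hKi i hi (L i f).1 (L i f).2).1 z hz
  refine ⟨∑ i ∈ t, T i ∘ₗ L i, fun f hf => ?_, ?_⟩
  · have h1 : ∀ i, DensityIntegrable (L i f).1 ∧ T i (L i f) = densityIntegral (L i f).1 :=
      fun i => hT i _ (hflat i f hf)
    -- At `z = 0` the weight is `1` (also where the product vanishes, by `0 ^ 0 = 1`), so the
    -- identity for weighted integrals gives the one for `∫_Y f`.
    have h2 := hint f 0 fun i _ => by
      rw [rhoPow_zero]
      exact (h1 i).1
    simp only [rhoPow_zero] at h2
    refine ⟨h2.1, ?_⟩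
    rw [h2.2, LinearMap.sum_apply]
    exact Finset.sum_congr rfl fun i _ => (h1 i).2
  · refine exists_isLeast_holomorphicBeyond (K := t.sup k)
      ((Finset.sup_lt_iff bot_lt_top).2 fun i _ => hk i) (fun f hf => ⟨fun z hz =>
        (hG ⟨f, hf⟩ z hz).1, ?_⟩) fun f => ?_
    · refine DifferentiableOn.congr (f := fun z => ∑ i ∈ t,
        densityIntegral (rhoPow 𝓕 (R i) z (L i ⟨f, hf⟩).1)) ?_ fun z hz => (hG ⟨f, hf⟩ z hz).2
      exact DifferentiableOn.fun_sum fun i hi => (hKi i hi _ (L i ⟨f, hf⟩).2).2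
    · choose g hgm hgk hgr using fun i => hg i (L i f)
      refine ⟨fun z => ∑ i ∈ t, g i z, fun z _ => ?_, fun z hz => ?_, ?_⟩
      · exact MeromorphicAt.fun_sum fun i _ => hgm i z (mem_univ z)
      · rw [(hG f z hz).2]
        exact Finset.sum_congr rfl fun i hi => hgk i z
          ((EReal.sub_le_sub (Finset.le_sup hi) le_rfl).trans_lt hz)
      · rw [LinearMap.sum_apply]
        exact isRegularizedValue_sum t fun i _ => hgr i

end LieMfd

end

theorem mainTheorem10 {m : ℕ}
    {M : Type*} [TopologicalSpace M] [ChartedSpace (EuclideanQuadrant (m + 1)) M]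
    [IsManifold (LieMfd.Q (m + 1)) ∞ M] [T2Space M] [CompactSpace M]
    {Y : Type*} [TopologicalSpace Y] [ChartedSpace (EuclideanQuadrant m) Y]
    [IsManifold (LieMfd.Q m) ∞ Y] [T2Space Y] [CompactSpace Y]
    (𝓕 : Set (Set M)) (V : Submodule (LieMfd.Fn (m + 1) M) (LieMfd.VF (m + 1) M))
    (ι : Y → M) (W : Submodule (LieMfd.Fn m Y) (LieMfd.VF m Y))
    (hMY : LieMfd.IsLieManifoldWithBoundary 𝓕 V ι W)
    (hM : LieMfd.IsRenormalizable 𝓕 V) :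
    LieMfd.IsRenormalizable (LieMfd.hyperfaces m Y) W :=
  hMY.isRenormalizable hM
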